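/- Let $n\ge 3$, let $0\le s\le r\le n$ be integers and $w\in\mathbb C$. Let $h=(h_{ij})$ be a nondegenerate real symmetric bilinear form on $\mathbb R^n$ (of any signature), and let $\tilde h$ be the form on $\mathbb R^{n+2}$ with $\tilde h(x,x)=2x^0x^\infty+h_{ij}x^ix^j$. Let $\mathcal N=\{x\neq 0:\tilde h(x,x)=0\}$ be its null cone with inclusion $\iota:\mathcal N\to\mathbb R^{n+2}$, $\mathcal Q\subset\mathbb P^{n+1}$ the quadric of null lines, $\pi:\mathbb R^{n+2}\setminus\{0\}\to\mathbb P^{n+1}$ the projection (we also write $\pi$ for its restriction $\mathcal N\to\mathcal Q$), $X=x^I\partial_I$ the Euler field, $\delta_\lambda(x)=\lambda x$, and $G=O(\tilde h)/\{\pm I\}$, acting by pullback. A complex-valued covariant tensor $f_{i_1\dots i_rj_1\dots j_s}$ has Young symmetry $(r,s)$ if it is skew in $i_1,\dots,i_r$, skew in $j_1,\dots,j_s$ and, when $s>0$, $f_{[i_1\dots i_rj_1]j_2\dots j_s}=0$. For $\mathcal U\subset\mathcal Q$ open, let $\mathcal E^{r,s}_0(w)(\mathcal U)$ be the space of smooth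 sections over $\mathcal U$ of the bundle of trace-free covariant tensors on $\mathcal Q$ of Young symmetry $(r,s)$ and conformal weight $w$; equivalently, of smooth covariant tensor fields $f$ on $\pi^{-1}(\mathcal U)\subset\mathcal N$ of Young symmetry $(r,s)$ such that $\delta_\lambda^*f=|\lambda|^wf$ for all real $\lambda\ne0$, the contraction of $X$ into every index of $f$ vanishes, and $f$ is trace-free with respect to the nondegenerate form induced by $\tilde h$ on $T_x\mathcal N/\operatorname{span}X$. Let $\mathcal H^{r,s}(w)(\mathcal U)$ be the space of infinite-order jets along $\pi^{-1}(\mathcal U)\subset\mathcal N$ of smooth $\tilde h$-trace-free tensor fields $\tilde f$ of Young symmetry $(r,s)$, defined on $\pi^{-1}(\mathcal V)\subset\mathbb R^{n+2}\setminus\{0\}$ for some open $\mathcal V\subset\mathbb P^{n+1}$ with $\mathcal U\subset\mathcal V$, that satisfy $\delta_\lambda^*\tilde f=|\lambda|^w\tilde f$ for all real $\lambda\neq0$ and, to infinite order along $\pi^{-1}(\mathcal U)\subset\mathcal N$, $$\tilde\Delta\tilde f=0,\qquad \tilde\delta_1\tilde f=0,\qquad X\lrcorner\tilde f=0 .$$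 Here $\tilde\Delta=\tilde h^{IJ}\partial_I\partial_J$ acts componentwise, $(\tilde\delta_1\tilde f)_{I_1\dots I_{r-1}J_1\dots J_s}=-\partial^K\tilde f_{I_1\dots I_{r-1}KJ_1\dots J_s}$ (and $\tilde\delta_1\tilde f=0$ if $r=0$), and $X\lrcorner\tilde f=0$ means that the contraction of $X$ into every index vanishes. Assume: - if $r>s=0$, then $w\ne 2r-n$; - if $s>0$, then $w\ne r+2s-n-1$ and $w\neq 2r+s-n$; - $w+n/2-r-s\notin\mathbb N=\{1,2,3,\dots\}$. Then $\mathcal E^{r,s}_0(w)$ and $\mathcal H^{r,s}(w)$ are sheaves of complex vector spaces on $\mathcal Q$, and restriction $\tilde f\mapsto\iota^*\tilde f$ defines a $G$-equivariant isomorphism of sheaves $\mathcal H^{r,s}(w)\to\mathcal E^{r,s}_0(w)$. That is, for every open $\mathcal U\subset\mathcal Q$, each element of $\mathcal E^{r,s}_0(w)(\mathcal U)$ has a unique lift to an element of $\mathcal H^{r,s}(w)(\mathcal U)$. -/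

import Mathlib

open CategoryTheory TopologicalSpace Opposite
open scoped ContDiff LinearAlgebra.Projectivization Matrix

namespace AmbientLift

noncomputable section

/-! ### Multilinear tensors with two-column Young symmetry -/

/-- Complex-valued covariant tensors of rank `r + s` on a real normed space `M`.  The slots
`Sum.inl _` are the first `r` indices, the slots `Sum.inr _` the last `s` indices. -/
abbrev Tens (r s : ℕ) (M : Type) [NormedAddCommGroup M] [NormedSpace ℝ M] : Type :=
  ContinuousMultilinearMap ℝ (fun _ : Fin r ⊕ Fin s => M) ℂ

/-- The Young symmetry given by a first column of length `r` and a second column of length `s`: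
the tensor is skew in the first `r` and in the last `s` indices, and its skew-symmetrization
over the first `r` indices together with one of the last `s` indices vanishes. -/
structure IsYoung {r s : ℕ} {M : Type} [NormedAddCommGroup M] [NormedSpace ℝ M]
    (T : Tens r s M) : Prop where
  skew_left : ∀ (σ : Equiv.Perm (Fin r)) (v : Fin r ⊕ Fin s → M),
    T (v ∘ Sum.map σ id) = Equiv.Perm.sign σ • T v
  skew_right : ∀ (σ : Equiv.Perm (Fin s)) (v : Fin r ⊕ Fin s → M),
    T (v ∘ Sum.map id σ) = Equiv.Perm.sign σ • T v
  bianchi : ∀ (b : Fin s) (v : Fin r ⊕ Fin s → M),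
    ∑ σ : Equiv.Perm (Fin r ⊕ Fin s) with ∀ c, c ≠ b → σ (Sum.inr c) = Sum.inr c,
      Equiv.Perm.sign σ • T (v ∘ σ) = 0

/-! ### The ambient space, the quadric and the conformal group -/

/-- The index set `0, 1, …, n, ∞` of the ambient coordinates. -/
abbrev Idx (n : ℕ) : Type := Unit ⊕ (Fin n ⊕ Unit)

/-- The ambient space `ℝ ^ (n + 2)`. -/
abbrev Amb (n : ℕ) : Type := Idx n → ℝ

/-- Infinite-order jets at a point (all derivatives at the point) of ambient tensor fields. -/
def Jet (r s n : ℕ) : Type :=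
  (k : ℕ) → ContinuousMultilinearMap ℝ (fun _ : Fin k => Amb n) (Tens r s (Amb n))

instance jetAddCommGroup (r s n : ℕ) : AddCommGroup (Jet r s n) :=
  inferInstanceAs (AddCommGroup
    ((k : ℕ) → ContinuousMultilinearMap ℝ (fun _ : Fin k => Amb n) (Tens r s (Amb n))))

instance jetModule (r s n : ℕ) : Module ℂ (Jet r s n) :=
  inferInstanceAs (Module ℂ
    ((k : ℕ) → ContinuousMultilinearMap ℝ (fun _ : Fin k => Amb n) (Tens r s (Amb n))))

/-- The derivative of order `k` recorded by a jet. -/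
def Jet.coeff {r s n : ℕ} (J : Jet r s n) (k : ℕ) :
    ContinuousMultilinearMap ℝ (fun _ : Fin k => Amb n) (Tens r s (Amb n)) := J k

/-- The infinite-order jet at `x` of an ambient tensor field. -/
def jetAt {r s n : ℕ} (F : Amb n → Tens r s (Amb n)) (x : Amb n) : Jet r s n :=
  fun k => iteratedFDeriv ℝ k F x

theorem Jet.ext {r s n : ℕ} {J K : Jet r s n} (hJK : ∀ k, J.coeff k = K.coeff k) : J = K :=
  funext hJK

/-- The ambient metric `2 x⁰ x^∞ + h_{ij} x^i x^j` as a matrix. -/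
def ambMetric {n : ℕ} (h : Matrix (Fin n) (Fin n) ℝ) : Matrix (Idx n) (Idx n) ℝ
  | Sum.inl _, Sum.inr (Sum.inr _) => 1
  | Sum.inr (Sum.inr _), Sum.inl _ => 1
  | Sum.inr (Sum.inl i), Sum.inr (Sum.inl j) => h i j
  | _, _ => 0

variable {n : ℕ} (h : Matrix (Fin n) (Fin n) ℝ) (r s : ℕ) (w : ℂ)

/-- The ambient metric as a bilinear form. -/
def ambForm : LinearMap.BilinForm ℝ (Amb n) := Matrix.toBilin' (ambMetric h)

/-- The standard basis vector `e_I` of the ambient space. -/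
def e (I : Idx n) : Amb n := Pi.single I 1

/-- Contraction of two covariant arguments with the inverse ambient metric. -/
def ambContract {M : Type} [AddCommGroup M] [Module ℝ M] (β : Amb n → Amb n → M) : M :=
  ∑ I, ∑ J, (ambMetric h)⁻¹ I J • β (e I) (e J)

/-- The quotient topology on the projective space of the ambient space. -/
instance projTopology : TopologicalSpace (ℙ ℝ (Amb n)) :=
  inferInstanceAs (TopologicalSpace (Quotient (projectivizationSetoid ℝ (Amb n))))

/-- The quadric of null lines in the ambient space, with the subspace topology. -/
def Quadric : Type := {p : ℙ ℝ (Amb n) // ∀ x ∈ p.submodule, ambForm h x x = 0}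

instance quadricTopology : TopologicalSpace (Quadric h) :=
  inferInstanceAs (TopologicalSpace
    {p : ℙ ℝ (Amb n) // ∀ x ∈ p.submodule, ambForm h x x = 0})

variable {h} in
/-- The preimage in the null cone (without the origin) of a subset of the quadric. -/
def cone (U : Set (Quadric h)) : Set (Amb n) :=
  {x | ∃ p ∈ U, ∃ hx : x ≠ 0, Projectivization.mk ℝ x hx = p.1}

/-- The preimage in `ℝ ^ (n + 2)` without the origin of a subset of projective space. -/
def ambCone (W : Set (ℙ ℝ (Amb n))) : Set (Amb n) :=
  {x | ∃ hx : x ≠ 0, Projectivization.mk ℝ x hx ∈ W}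

/-- The tangent space of the null cone at a point `x` of the null cone. -/
def tan (x : Amb n) : Submodule ℝ (Amb n) := LinearMap.ker (ambForm h x)

theorem mem_tan {x v : Amb n} : v ∈ tan h x ↔ ambForm h x v = 0 := Iff.rfl

/-- The orthogonal group of the ambient metric. -/
def orthGroup : Subgroup (Amb n ≃L[ℝ] Amb n) where
  carrier := {A | ∀ x y, ambForm h (A x) (A y) = ambForm h x y}
  mul_mem' := fun {A B} hA hB x y => by
    change ambForm h (A (B x)) (A (B y)) = _
    rw [hA, hB]
  one_mem' := fun _ _ => rfl
  inv_mem' := fun {A} hA x y => by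
    have := hA (A.symm x) (A.symm y)
    simp only [ContinuousLinearEquiv.apply_symm_apply] at this
    exact this.symm

variable {h}

theorem form_self_of_mem_cone {U : Set (Quadric h)} {x : Amb n} (hx : x ∈ cone U) :
    ambForm h x x = 0 := by
  obtain ⟨p, -, hx0, hp⟩ := hx
  refine p.2 x ?_
  rw [← hp, Projectivization.submodule_mk]
  exact Submodule.mem_span_singleton_self x

theorem smul_mem_cone {U : Set (Quadric h)} {x : Amb n} (hx : x ∈ cone U) {c : ℝ} (hc : c ≠ 0) :
    c • x ∈ cone U := by
  obtain ⟨p, hpU, hx0, hp⟩ := hx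
  refine ⟨p, hpU, smul_ne_zero hc hx0, ?_⟩
  rw [← hp, Projectivization.mk_eq_mk_iff']
  exact ⟨c, rfl⟩

theorem smul_mem_tan {x v : Amb n} (hv : v ∈ tan h x) (c : ℝ) : c • v ∈ tan h (c • x) := by
  rw [mem_tan] at hv ⊢
  simp [hv]

theorem cone_mono {U V : Set (Quadric h)} (hUV : U ⊆ V) : cone U ⊆ cone V :=
  fun _ ⟨p, hp, hx⟩ => ⟨p, hUV hp, hx⟩

theorem orth_tan (A : orthGroup h) {x v : Amb n} (hv : v ∈ tan h x) :
    (A : Amb n ≃L[ℝ] Amb n) v ∈ tan h ((A : Amb n ≃L[ℝ] Amb n) x) := by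
  rw [mem_tan] at hv ⊢
  rw [A.2 x v, hv]

/-- The action of the orthogonal group on the quadric. -/
def quadAct (A : orthGroup h) (p : Quadric h) : Quadric h :=
  ⟨Projectivization.map (A : Amb n ≃L[ℝ] Amb n).toLinearEquiv.toLinearMap
    (A : Amb n ≃L[ℝ] Amb n).injective p.1, by
    obtain ⟨p, hp⟩ := p
    induction p using Projectivization.ind with
    | h v hv =>
      intro x hx
      rw [Projectivization.map_mk, Projectivization.submodule_mk,
        Submodule.mem_span_singleton] at hx
      obtain ⟨a, rfl⟩ := hx
      have h1 := hp v (by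
        rw [Projectivization.submodule_mk]; exact Submodule.mem_span_singleton_self v)
      have h2 := A.2 v v
      simp only [map_smul, LinearMap.smul_apply]
      have h3 : ambForm h ((A : Amb n ≃L[ℝ] Amb n).toLinearEquiv.toLinearMap v)
        ((A : Amb n ≃L[ℝ] Amb n).toLinearEquiv.toLinearMap v) = 0 := h2.trans h1
      rw [h3]; simp⟩

theorem continuous_quadAct (A : orthGroup h) : Continuous (quadAct A) := by
  have h1 : Continuous (Projectivization.map (A : Amb n ≃L[ℝ] Amb n).toLinearEquiv.toLinearMap
      (A : Amb n ≃L[ℝ] Amb n).injective) := by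
    refine Continuous.quotient_map' ?_ _
    exact Continuous.subtype_mk
      ((A : Amb n ≃L[ℝ] Amb n).continuous.comp continuous_subtype_val) _
  exact Continuous.subtype_mk (h1.comp continuous_subtype_val) _

/-- The preimage of an open subset of the quadric under `A`, i.e. the translate `A⁻¹ · U`. -/
def preim (A : orthGroup h) (U : Opens (Quadric h)) : Opens (Quadric h) :=
  Opens.comap ⟨quadAct A, continuous_quadAct A⟩ U

theorem act_mem_cone (A : orthGroup h) {U : Opens (Quadric h)} {x : Amb n}
    (hx : x ∈ cone (preim A U : Set (Quadric h))) :
    (A : Amb n ≃L[ℝ] Amb n) x ∈ cone (U : Set (Quadric h)) := by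
  obtain ⟨p, hp, hx0, hxp⟩ := hx
  refine ⟨quadAct A p, hp, ?_, ?_⟩
  · simpa using hx0
  · simp only [quadAct, ← hxp]
    rfl

/-! ### Weighted trace-free tensors on the quadric -/

/-- A section over `U` of the bundle of trace-free tensors on the quadric with Young symmetry
`(r, s)` and weight `w`, viewed as a tensor field on the preimage of `U` in the null cone. -/
structure IsQuadSection (U : Set (Quadric h))
    (f : (x : cone U) → Tens r s (tan h (x : Amb n))) : Prop where
  /-- The field is smooth: locally it is the pullback of a smooth ambient tensor field. -/
  smooth : ∀ x : cone U, ∃ (W : Set (Amb n)) (F : Amb n → Tens r s (Amb n)),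
    IsOpen W ∧ (x : Amb n) ∈ W ∧ ContDiffOn ℝ ∞ F W ∧
    ∀ y : cone U, (y : Amb n) ∈ W →
      f y = (F y).compContinuousLinearMap (fun _ => (tan h (y : Amb n)).subtypeL)
  young : ∀ x, IsYoung (f x)
  /-- `δ_c^* f = |c|^w f` for all dilations `δ_c`. -/
  homogeneous : ∀ (c : ℝ) (hc : c ≠ 0) (x : cone U) (v : Fin r ⊕ Fin s → tan h (x : Amb n)),
    f ⟨c • (x : Amb n), smul_mem_cone x.2 hc⟩
      (fun i => ⟨c • (v i : Amb n), smul_mem_tan (v i).2 c⟩) = ((|c| : ℝ) : ℂ) ^ w * f x v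
  /-- The contraction of the Euler field into every index vanishes. -/
  horizontal : ∀ (x : cone U) (v : Fin r ⊕ Fin s → tan h (x : Amb n)) (a : Fin r ⊕ Fin s),
    (v a : Amb n) = x → f x v = 0
  /-- The traces with respect to the conformal metric vanish; they are computed in any `n`
  tangent vectors whose Gram matrix `g` is invertible, i.e. which project to a basis of the
  tangent space of the quadric. -/
  traceFree : ∀ (x : cone U) (b : Fin n → tan h (x : Amb n)) (g : Matrix (Fin n) (Fin n) ℝ),
    (∀ i j, g i j = ambForm h (b i) (b j)) → IsUnit g.det →
    ∀ (a a' : Fin r ⊕ Fin s), a ≠ a' → ∀ v : Fin r ⊕ Fin s → tan h (x : Amb n),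
      ∑ i, ∑ j, g⁻¹ i j • f x (Function.update (Function.update v a (b i)) a' (b j)) = 0

/-! ### Jets along the null cone of ambient tensors -/

/-- The componentwise ambient Laplacian `h^{IJ} ∂_I ∂_J`. -/
def ambLaplacian (h : Matrix (Fin n) (Fin n) ℝ) {r s : ℕ} (F : Amb n → Tens r s (Amb n)) :
    Amb n → Tens r s (Amb n) :=
  fun y => ambContract h (fun u u' => fderiv ℝ (fun z => fderiv ℝ F z u') y u)

/-- The divergence in the slot `a` of an ambient tensor field, evaluated on the vectors `v`
(the entry `v a` is replaced by the contraction and is irrelevant). -/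
def ambDiv (h : Matrix (Fin n) (Fin n) ℝ) {r s : ℕ} (F : Amb n → Tens r s (Amb n))
    (a : Fin r ⊕ Fin s) (v : Fin r ⊕ Fin s → Amb n) : Amb n → ℂ :=
  fun y => - ambContract h (fun u u' => fderiv ℝ F y u (Function.update v a u'))

/-- The contraction of the Euler field `X^I = x^I` into the slot `a`. -/
def eulerContract {r s : ℕ} (F : Amb n → Tens r s (Amb n))
    (a : Fin r ⊕ Fin s) (v : Fin r ⊕ Fin s → Amb n) : Amb n → ℂ :=
  fun y => F y (Function.update v a y)

/-- All derivatives of all orders (including order zero) vanish at `x`. -/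
def VanishesToInfiniteOrder {Y : Type} [NormedAddCommGroup Y] [NormedSpace ℝ Y]
    (g : Amb n → Y) (x : Amb n) : Prop :=
  ∀ k : ℕ, iteratedFDeriv ℝ k g x = 0

/-- A trace-free ambient tensor field of Young symmetry `(r, s)` on the preimage of the set `W`
of lines, homogeneous of degree `w`. -/
structure IsAmbSection (h : Matrix (Fin n) (Fin n) ℝ) (W : Set (ℙ ℝ (Amb n)))
    (F : Amb n → Tens r s (Amb n)) : Prop where
  smooth : ContDiffOn ℝ ∞ F (ambCone W)
  young : ∀ x ∈ ambCone W, IsYoung (F x)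
  /-- `δ_c^* F = |c|^w F` for all dilations `δ_c`. -/
  homogeneous : ∀ c : ℝ, c ≠ 0 → ∀ x ∈ ambCone W, ∀ v : Fin r ⊕ Fin s → Amb n,
    F (c • x) (fun i => c • v i) = ((|c| : ℝ) : ℂ) ^ w * F x v
  traceFree : ∀ x ∈ ambCone W, ∀ a a' : Fin r ⊕ Fin s, a ≠ a' →
    ∀ v : Fin r ⊕ Fin s → Amb n,
      ambContract h (fun u u' => F x (Function.update (Function.update v a u) a' u')) = 0

/-- The three ambient equations `Δ F = 0`, `δ₁ F = 0`, `X ⌟ F = 0`, to infinite order along the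
preimage of `U` in the null cone.  By skew symmetry all divergences in one of the first `r`
slots agree up to sign. -/
structure SolvesToInfiniteOrder {r s : ℕ} (U : Set (Quadric h))
    (F : Amb n → Tens r s (Amb n)) : Prop where
  laplacian : ∀ x ∈ cone U, VanishesToInfiniteOrder (ambLaplacian h F) x
  divergence : ∀ x ∈ cone U, ∀ (a : Fin r) (v : Fin r ⊕ Fin s → Amb n),
    VanishesToInfiniteOrder (ambDiv h F (Sum.inl a) v) x
  euler : ∀ x ∈ cone U, ∀ (a : Fin r ⊕ Fin s) (v : Fin r ⊕ Fin s → Amb n),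
    VanishesToInfiniteOrder (eulerContract F a v) x

/-- An infinite-order jet along the preimage of `U` in the null cone is the family of all
derivatives at its points.  This predicate says that `J` is the jet of a homogeneous trace-free
tensor field of the given Young symmetry, defined over some open set `W` of lines containing `U`, that solves the equations. -/
def IsAmbJet (U : Set (Quadric h))
    (J : cone U → Jet r s n) : Prop :=
  ∃ (W : Set (ℙ ℝ (Amb n))) (F : Amb n → Tens r s (Amb n)),
    IsOpen W ∧ (∀ p ∈ U, p.1 ∈ W) ∧ IsAmbSection r s w h W F ∧ SolvesToInfiniteOrder U F ∧
    ∀ x : cone U, J x = jetAt F x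

/-! ### Linear structure -/

theorem IsYoung.zero {M : Type} [NormedAddCommGroup M] [NormedSpace ℝ M] :
    IsYoung (0 : Tens r s M) where
  skew_left := by simp
  skew_right := by simp
  bianchi := by simp

theorem IsYoung.add {r s : ℕ} {M : Type} [NormedAddCommGroup M] [NormedSpace ℝ M]
    {T T' : Tens r s M} (hT : IsYoung T) (hT' : IsYoung T') : IsYoung (T + T') where
  skew_left σ v := by simp [hT.skew_left, hT'.skew_left]
  skew_right σ v := by simp [hT.skew_right, hT'.skew_right]
  bianchi b v := by
    simp only [add_apply, smul_add, Finset.sum_add_distrib,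
      hT.bianchi, hT'.bianchi, add_zero]

theorem IsYoung.smul {r s : ℕ} {M : Type} [NormedAddCommGroup M] [NormedSpace ℝ M]
    {T : Tens r s M} (hT : IsYoung T) (c : ℂ) : IsYoung (c • T) where
  skew_left σ v := by simp [hT.skew_left, mul_smul_comm]
  skew_right σ v := by simp [hT.skew_right, mul_smul_comm]
  bianchi b v := by
    simp only [smul_apply, smul_comm _ c, ← Finset.smul_sum,
      hT.bianchi, smul_zero]

theorem IsYoung.comp {r s : ℕ} {M N : Type} [NormedAddCommGroup M] [NormedSpace ℝ M]
    [NormedAddCommGroup N] [NormedSpace ℝ N]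
    {T : Tens r s M} (hT : IsYoung T) (L : N →L[ℝ] M) :
    IsYoung (T.compContinuousLinearMap (fun _ => L) : Tens r s N) where
  skew_left σ v := hT.skew_left σ (fun i => L (v i))
  skew_right σ v := hT.skew_right σ (fun i => L (v i))
  bianchi b v := hT.bianchi b (fun i => L (v i))

section QuadSections

variable {r s w}
variable {U : Set (Quadric h)} {f g : (x : cone U) → Tens r s (tan h (x : Amb n))}

theorem IsQuadSection.zero : IsQuadSection r s w U
    (0 : (x : cone U) → Tens r s (tan h (x : Amb n))) where
  smooth x := ⟨Set.univ, 0, isOpen_univ, trivial, contDiffOn_const, fun y _ => by ext v; simp⟩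
  young x := IsYoung.zero r s
  homogeneous := by simp
  horizontal := by simp
  traceFree := by simp

theorem IsQuadSection.add (hf : IsQuadSection r s w U f) (hg : IsQuadSection r s w U g) :
    IsQuadSection r s w U (f + g) where
  smooth x := by
    obtain ⟨W, F, hW, hxW, hF, hfF⟩ := hf.smooth x
    obtain ⟨W', F', hW', hxW', hF', hfF'⟩ := hg.smooth x
    refine ⟨W ∩ W', F + F', hW.inter hW', ⟨hxW, hxW'⟩,
      (hF.mono Set.inter_subset_left).add (hF'.mono Set.inter_subset_right), fun y hy => ?_⟩
    rw [Pi.add_apply, hfF y hy.1, hfF' y hy.2]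
    ext v; simp
  young x := (hf.young x).add (hg.young x)
  homogeneous c hc x v := by
    simp only [Pi.add_apply, add_apply, hf.homogeneous c hc x v, hg.homogeneous c hc x v, mul_add]
  horizontal x v a ha := by
    simp [hf.horizontal x v a ha, hg.horizontal x v a ha]
  traceFree x b g' hg' hu a a' haa v := by
    simp only [Pi.add_apply, add_apply, smul_add,
      Finset.sum_add_distrib, hf.traceFree x b g' hg' hu a a' haa v,
      hg.traceFree x b g' hg' hu a a' haa v, add_zero]

theorem IsQuadSection.smul (hf : IsQuadSection r s w U f) (c : ℂ) :
    IsQuadSection r s w U (c • f) where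
  smooth x := by
    obtain ⟨W, F, hW, hxW, hF, hfF⟩ := hf.smooth x
    refine ⟨W, c • F, hW, hxW, contDiffOn_const.smul hF, fun y hy => ?_⟩
    rw [Pi.smul_apply, hfF y hy]
    ext v; simp
  young x := (hf.young x).smul c
  homogeneous c' hc x v := by
    simp only [Pi.smul_apply, smul_apply, hf.homogeneous c' hc x v, smul_eq_mul]
    ring
  horizontal x v a ha := by
    simp [hf.horizontal x v a ha]
  traceFree x b g' hg' hu a a' haa v := by
    simp only [Pi.smul_apply, smul_apply, smul_comm _ c,
      ← Finset.smul_sum, hf.traceFree x b g' hg' hu a a' haa v, smul_zero]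

theorem IsQuadSection.restrict (hf : IsQuadSection r s w U f) {V : Set (Quadric h)}
    (hVU : V ⊆ U) : IsQuadSection r s w V (fun x : cone V => f ⟨x, cone_mono hVU x.2⟩) where
  smooth x := by
    obtain ⟨W, F, hW, hxW, hF, hfF⟩ := hf.smooth ⟨x, cone_mono hVU x.2⟩
    exact ⟨W, F, hW, hxW, hF, fun y hy => hfF ⟨y, cone_mono hVU y.2⟩ hy⟩
  young x := hf.young _
  homogeneous c hc x v := hf.homogeneous c hc ⟨x, cone_mono hVU x.2⟩ v
  horizontal x := hf.horizontal ⟨x, cone_mono hVU x.2⟩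
  traceFree x := hf.traceFree ⟨x, cone_mono hVU x.2⟩

end QuadSections

/-- The complex vector space of sections over `U`. -/
def quadSections (U : Opens (Quadric h)) :
    Submodule ℂ ((x : cone (U : Set (Quadric h))) → Tens r s (tan h (x : Amb n))) where
  carrier := {f | IsQuadSection r s w (U : Set (Quadric h)) f}
  zero_mem' := IsQuadSection.zero
  add_mem' := IsQuadSection.add
  smul_mem' c _ hf := IsQuadSection.smul hf c

theorem isOpen_ambCone {W : Set (ℙ ℝ (Amb n))} (hW : IsOpen W) : IsOpen (ambCone W) := by
  have h1 : IsOpen {v : {v : Amb n // v ≠ 0} | Projectivization.mk ℝ (v : Amb n) v.2 ∈ W} :=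
    hW.preimage (continuous_quotient_mk' (s := projectivizationSetoid ℝ (Amb n)))
  have h2 : IsOpen {v : Amb n | v ≠ 0} := isOpen_ne
  have h3 := h2.isOpenMap_subtype_val _ h1
  convert h3 using 1
  ext x
  constructor
  · rintro ⟨hx, hxW⟩
    exact ⟨⟨x, hx⟩, hxW, rfl⟩
  · rintro ⟨⟨y, hy⟩, hyW, rfl⟩
    exact ⟨hy, hyW⟩

theorem cone_subset_ambCone {U : Set (Quadric h)} {W : Set (ℙ ℝ (Amb n))}
    (hUW : ∀ p ∈ U, p.1 ∈ W) : cone U ⊆ ambCone W := by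
  rintro x ⟨p, hp, hx, hxp⟩
  exact ⟨hx, hxp ▸ hUW p hp⟩

theorem ambCone_mono {W W' : Set (ℙ ℝ (Amb n))} (hW : W ⊆ W') : ambCone W ⊆ ambCone W' :=
  fun _ ⟨hx, hxW⟩ => ⟨hx, hW hxW⟩

section Contract

variable {M : Type} [AddCommGroup M] [Module ℝ M]

theorem ambContract_add (β β' : Amb n → Amb n → M) :
    ambContract h (fun u u' => β u u' + β' u u') = ambContract h β + ambContract h β' := by
  simp only [ambContract, smul_add, Finset.sum_add_distrib]

theorem ambContract_smul [Module ℂ M] [SMulCommClass ℝ ℂ M] (c : ℂ) (β : Amb n → Amb n → M) :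
    ambContract h (fun u u' => c • β u u') = c • ambContract h β := by
  simp only [ambContract, smul_comm _ c, ← Finset.smul_sum]

theorem ambContract_zero : ambContract h (fun _ _ => (0 : M)) = 0 := by
  simp [ambContract]

end Contract

section Smooth

variable {r s}
variable {F G : Amb n → Tens r s (Amb n)} {x : Amb n}

theorem contDiffAt_dir {Y : Type} [NormedAddCommGroup Y] [NormedSpace ℝ Y] {f : Amb n → Y}
    (hf : ContDiffAt ℝ ∞ f x) (u : Amb n) : ContDiffAt ℝ ∞ (fun y => fderiv ℝ f y u) x :=
  ContDiffAt.clm_apply (hf.fderiv_right (m := ∞) (by simp)) (contDiffAt_const (c := u))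

theorem contDiffAt_laplacian (hF : ContDiffAt ℝ ∞ F x) : ContDiffAt ℝ ∞ (ambLaplacian h F) x := by
  unfold ambLaplacian ambContract
  refine ContDiffAt.sum fun I _ => ?_
  refine ContDiffAt.sum fun J _ => ?_
  exact (contDiffAt_dir (f := fun z => fderiv ℝ F z (e J))
    (contDiffAt_dir hF _) _).const_smul _

theorem contDiffAt_eval (hF : ContDiffAt ℝ ∞ F x) (v : Fin r ⊕ Fin s → Amb n) :
    ContDiffAt ℝ ∞ (fun y => F y v) x :=
  ContDiffAt.continuousLinearMap_comp
    (ContinuousMultilinearMap.apply ℝ (fun _ : Fin r ⊕ Fin s => Amb n) ℂ v) hF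

theorem contDiffAt_div (hF : ContDiffAt ℝ ∞ F x) (a : Fin r ⊕ Fin s) (v : Fin r ⊕ Fin s → Amb n) :
    ContDiffAt ℝ ∞ (ambDiv h F a v) x := by
  refine ContDiffAt.neg ?_
  unfold ambContract
  refine ContDiffAt.sum fun I _ => ?_
  refine ContDiffAt.sum fun J _ => ?_
  exact (contDiffAt_eval (contDiffAt_dir hF _) _).const_smul _

theorem contDiffAt_euler (hF : ContDiffAt ℝ ∞ F x) (a : Fin r ⊕ Fin s)
    (v : Fin r ⊕ Fin s → Amb n) : ContDiffAt ℝ ∞ (eulerContract F a v) x := by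
  have h1 : eulerContract F a v = fun y => ∑ I : Idx n, y I • F y (Function.update v a (e I)) := by
    funext y
    have hy : y = ∑ I : Idx n, y I • (e I : Amb n) := by
      simpa [e, Pi.single_apply] using (pi_eq_sum_univ' y)
    have h2 : eulerContract F a v y = (F y).toMultilinearMap.toLinearMap v a y := rfl
    have h3 : ∀ I, F y (Function.update v a (e I)) =
      (F y).toMultilinearMap.toLinearMap v a (e I) := fun I => rfl
    simp only [h2, h3, ← map_smul, ← map_sum]
    exact congrArg _ hy
  rw [h1]
  refine ContDiffAt.sum fun I _ => ?_
  exact (contDiff_apply ℝ ℝ I).contDiffAt.smul (contDiffAt_eval hF _)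

theorem VanishesToInfiniteOrder.congr {Y : Type} [NormedAddCommGroup Y] [NormedSpace ℝ Y]
    {f g : Amb n → Y} (hf : VanishesToInfiniteOrder f x) (hfg : g =ᶠ[nhds x] f) :
    VanishesToInfiniteOrder g x := fun k => by
  rw [(hfg.iteratedFDeriv (𝕜 := ℝ) k).self_of_nhds, hf k]

theorem VanishesToInfiniteOrder.add {Y : Type} [NormedAddCommGroup Y] [NormedSpace ℝ Y]
    {f g : Amb n → Y} (hf : VanishesToInfiniteOrder f x) (hg : VanishesToInfiniteOrder g x)
    (hf' : ContDiffAt ℝ ∞ f x) (hg' : ContDiffAt ℝ ∞ g x) :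
    VanishesToInfiniteOrder (f + g) x := fun k => by
  rw [iteratedFDeriv_add_apply (hf'.of_le (by exact_mod_cast le_top))
    (hg'.of_le (by exact_mod_cast le_top)), hf k, hg k, add_zero]

theorem VanishesToInfiniteOrder.clm_comp {Y Z : Type} [NormedAddCommGroup Y] [NormedSpace ℝ Y]
    [NormedAddCommGroup Z] [NormedSpace ℝ Z] {f : Amb n → Y} (hf : VanishesToInfiniteOrder f x)
    (hf' : ContDiffAt ℝ ∞ f x) (L : Y →L[ℝ] Z) : VanishesToInfiniteOrder (L ∘ f) x := fun k => by
  rw [L.iteratedFDeriv_comp_left hf' (by exact_mod_cast le_top), hf k]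
  ext v
  simp

theorem VanishesToInfiniteOrder.comp_equiv {Y : Type} [NormedAddCommGroup Y] [NormedSpace ℝ Y]
    {f : Amb n → Y} (A : Amb n ≃L[ℝ] Amb n) (hf : VanishesToInfiniteOrder f (A x)) :
    VanishesToInfiniteOrder (f ∘ A) x := fun k => by
  have := A.iteratedFDerivWithin_comp_right f uniqueDiffOn_univ (x := x) (Set.mem_univ _) k
  simp only [Set.preimage_univ, iteratedFDerivWithin_univ] at this
  rw [this, hf k]
  ext v
  simp

theorem eventually_fderiv_add (hF : ContDiffAt ℝ ∞ F x) (hG : ContDiffAt ℝ ∞ G x) :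
    ∀ᶠ y in nhds x, fderiv ℝ (F + G) y = fderiv ℝ F y + fderiv ℝ G y := by
  have hF' := (hF.of_le (m := 1) (by exact_mod_cast le_top)).eventually (by simp)
  have hG' := (hG.of_le (m := 1) (by exact_mod_cast le_top)).eventually (by simp)
  filter_upwards [hF', hG'] with y h1 h2
  exact fderiv_add (h1.differentiableAt (by simp)) (h2.differentiableAt (by simp))

end Smooth

section Jets

variable {r s w}
variable {U : Set (Quadric h)} {W W' : Set (ℙ ℝ (Amb n))} {F G : Amb n → Tens r s (Amb n)}
variable {J K : cone U → Jet r s n}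

theorem IsAmbSection.contDiffAt (hF : IsAmbSection r s w h W F) (hW : IsOpen W)
    (hUW : ∀ p ∈ U, p.1 ∈ W) {x : Amb n} (hx : x ∈ cone U) : ContDiffAt ℝ ∞ F x :=
  hF.smooth.contDiffAt ((isOpen_ambCone hW).mem_nhds (cone_subset_ambCone hUW hx))

theorem IsAmbSection.mono (hF : IsAmbSection r s w h W F) (hW : W' ⊆ W) :
    IsAmbSection r s w h W' F where
  smooth := hF.smooth.mono (ambCone_mono hW)
  young x hx := hF.young x (ambCone_mono hW hx)
  homogeneous c hc x hx := hF.homogeneous c hc x (ambCone_mono hW hx)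
  traceFree x hx := hF.traceFree x (ambCone_mono hW hx)

theorem IsAmbSection.zero : IsAmbSection r s w h W (0 : Amb n → Tens r s (Amb n)) where
  smooth := contDiffOn_const
  young x _ := IsYoung.zero r s
  homogeneous := by simp
  traceFree := by simp [ambContract]

theorem IsAmbSection.add (hF : IsAmbSection r s w h W F) (hG : IsAmbSection r s w h W G) :
    IsAmbSection r s w h W (F + G) where
  smooth := hF.smooth.add hG.smooth
  young x hx := (hF.young x hx).add (hG.young x hx)
  homogeneous c hc x hx v := by
    simp only [Pi.add_apply, add_apply, hF.homogeneous c hc x hx v, hG.homogeneous c hc x hx v,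
      mul_add]
  traceFree x hx a a' haa v := by
    simp only [Pi.add_apply, add_apply, ambContract_add, hF.traceFree x hx a a' haa v,
      hG.traceFree x hx a a' haa v, add_zero]

theorem IsAmbSection.smul (hF : IsAmbSection r s w h W F) (c : ℂ) :
    IsAmbSection r s w h W (c • F) where
  smooth := contDiffOn_const.smul hF.smooth
  young x hx := (hF.young x hx).smul c
  homogeneous c' hc x hx v := by
    simp only [Pi.smul_apply, smul_apply, hF.homogeneous c' hc x hx v, smul_eq_mul]
    ring
  traceFree x hx a a' haa v := by
    simp only [Pi.smul_apply, smul_apply, ambContract_smul, hF.traceFree x hx a a' haa v,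
      smul_zero]

theorem laplacian_add {x : Amb n} (hF : ContDiffAt ℝ ∞ F x) (hG : ContDiffAt ℝ ∞ G x) :
    ambLaplacian h (F + G) =ᶠ[nhds x] ambLaplacian h F + ambLaplacian h G := by
  have hF' := (hF.of_le (m := 2) ENat.LEInfty.out).eventually (by simp)
  have hG' := (hG.of_le (m := 2) ENat.LEInfty.out).eventually (by simp)
  filter_upwards [hF', hG', (eventually_fderiv_add hF hG).eventually_nhds] with y h1 h2 h3
  simp only [ambLaplacian, Pi.add_apply, ← ambContract_add]
  congr 1
  funext u u'
  have h4 : (fun z => fderiv ℝ (F + G) z u') =ᶠ[nhds y]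
      (fun z => fderiv ℝ F z u') + fun z => fderiv ℝ G z u' := by
    filter_upwards [h3] with z hz
    rw [hz]; rfl
  have h5 : ∀ {H : Amb n → Tens r s (Amb n)}, ContDiffAt ℝ 2 H y →
      DifferentiableAt ℝ (fun z => fderiv ℝ H z u') y := fun hH =>
    ((hH.fderiv_right (m := 1) (by norm_num)).differentiableAt (by simp)).clm_apply
      (differentiableAt_const _)
  rw [h4.fderiv_eq, fderiv_add (h5 h1) (h5 h2)]
  rfl

theorem div_add {x : Amb n} (hF : ContDiffAt ℝ ∞ F x) (hG : ContDiffAt ℝ ∞ G x)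
    (a : Fin r ⊕ Fin s) (v : Fin r ⊕ Fin s → Amb n) :
    ambDiv h (F + G) a v =ᶠ[nhds x] ambDiv h F a v + ambDiv h G a v := by
  filter_upwards [eventually_fderiv_add hF hG] with y hy
  simp only [ambDiv, Pi.add_apply, hy, ← neg_add, ← ambContract_add]
  rfl

theorem SolvesToInfiniteOrder.zero :
    SolvesToInfiniteOrder U (0 : Amb n → Tens r s (Amb n)) := by
  have h0 : ∀ {Y : Type} [NormedAddCommGroup Y] [NormedSpace ℝ Y] {g : Amb n → Y} {x : Amb n},
      g = 0 → VanishesToInfiniteOrder g x := by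
    rintro Y _ _ g x rfl k
    simp
  refine ⟨fun x _ => h0 ?_, fun x _ a v => h0 ?_, fun x _ a v => h0 ?_⟩
  · funext y
    simp [ambLaplacian, ambContract]
  · funext y
    simp [ambDiv, ambContract]
  · funext y
    simp [eulerContract]

theorem SolvesToInfiniteOrder.add (hF : SolvesToInfiniteOrder U F)
    (hG : SolvesToInfiniteOrder U G) (hF' : ∀ x ∈ cone U, ContDiffAt ℝ ∞ F x)
    (hG' : ∀ x ∈ cone U, ContDiffAt ℝ ∞ G x) : SolvesToInfiniteOrder U (F + G) where
  laplacian x hx := ((hF.laplacian x hx).add (hG.laplacian x hx)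
    (contDiffAt_laplacian (hF' x hx)) (contDiffAt_laplacian (hG' x hx))).congr
    (laplacian_add (hF' x hx) (hG' x hx))
  divergence x hx a v := ((hF.divergence x hx a v).add (hG.divergence x hx a v)
    (contDiffAt_div (hF' x hx) _ _) (contDiffAt_div (hG' x hx) _ _)).congr
    (div_add (hF' x hx) (hG' x hx) _ _)
  euler x hx a v := (hF.euler x hx a v).add (hG.euler x hx a v)
    (contDiffAt_euler (hF' x hx) _ _) (contDiffAt_euler (hG' x hx) _ _)

/-- Multiplication by a complex number as a real-linear map. -/
def smulCLM (Y : Type) [NormedAddCommGroup Y] [NormedSpace ℝ Y] [NormedSpace ℂ Y]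
    [SMulCommClass ℝ ℂ Y] (c : ℂ) : Y →L[ℝ] Y where
  toFun y := c • y
  map_add' := smul_add c
  map_smul' a y := (smul_comm a c y).symm
  cont := continuous_const_smul c

theorem SolvesToInfiniteOrder.smul (hF : SolvesToInfiniteOrder U F)
    (hF' : ∀ x ∈ cone U, ContDiffAt ℝ ∞ F x) (c : ℂ) : SolvesToInfiniteOrder U (c • F) where
  laplacian x hx := by
    have h1 := (hF.laplacian x hx).clm_comp (contDiffAt_laplacian (hF' x hx))
      (smulCLM (Tens r s (Amb n)) c)
    refine h1.congr ?_
    have h2 := ((hF' x hx).of_le (m := 2) ENat.LEInfty.out).eventually (by simp)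
    filter_upwards [h2.eventually_nhds] with y hy
    change _ = c • ambLaplacian h F y
    simp only [ambLaplacian, ← ambContract_smul]
    congr 1
    funext u u'
    have h4 : (fun z => fderiv ℝ (c • F) z u') =ᶠ[nhds y] c • fun z => fderiv ℝ F z u' := by
      filter_upwards [hy] with z hz
      rw [fderiv_const_smul (hz.differentiableAt (by simp))]
      rfl
    have h5 : DifferentiableAt ℝ (fun z => fderiv ℝ F z u') y :=
      ((hy.self_of_nhds.fderiv_right (m := 1) (by norm_num)).differentiableAt
        (by simp)).clm_apply (differentiableAt_const _)
    rw [h4.fderiv_eq, fderiv_const_smul h5]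
    rfl
  divergence x hx a v := by
    have h1 := (hF.divergence x hx a v).clm_comp (contDiffAt_div (hF' x hx) _ _) (smulCLM ℂ c)
    refine h1.congr ?_
    have h2 := ((hF' x hx).of_le (m := 1) (by exact_mod_cast le_top)).eventually (by simp)
    filter_upwards [h2] with y hy
    change _ = c • ambDiv h F (Sum.inl a) v y
    simp only [ambDiv, smul_neg, ← ambContract_smul]
    rw [fderiv_const_smul (hy.differentiableAt (by simp))]
    rfl
  euler x hx a v := (hF.euler x hx a v).clm_comp (contDiffAt_euler (hF' x hx) _ _) (smulCLM ℂ c)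

theorem IsAmbJet.zero : IsAmbJet r s w U 0 :=
  ⟨Set.univ, 0, isOpen_univ, fun _ _ => trivial, IsAmbSection.zero, SolvesToInfiniteOrder.zero,
    fun x => Jet.ext fun k => (congrFun (iteratedFDeriv_zero (𝕜 := ℝ) (E := Amb n)
      (F := Tens r s (Amb n)) (n := k)) (x : Amb n)).symm⟩

theorem IsAmbJet.add (hJ : IsAmbJet r s w U J) (hK : IsAmbJet r s w U K) :
    IsAmbJet r s w U (J + K) := by
  obtain ⟨W, F, hW, hUW, hF, hFs, hFJ⟩ := hJ
  obtain ⟨W', G, hW', hUW', hG, hGs, hGK⟩ := hK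
  have hF' := fun x (hx : x ∈ cone U) => hF.contDiffAt hW hUW hx
  have hG' := fun x (hx : x ∈ cone U) => hG.contDiffAt hW' hUW' hx
  refine ⟨W ∩ W', F + G, hW.inter hW', fun p hp => ⟨hUW p hp, hUW' p hp⟩,
    (hF.mono Set.inter_subset_left).add (hG.mono Set.inter_subset_right),
    hFs.add hGs hF' hG', fun x => Jet.ext fun k => ?_⟩
  change (J x).coeff k + (K x).coeff k = _
  rw [hFJ, hGK]
  exact (iteratedFDeriv_add_apply ((hF' x x.2).of_le (by exact_mod_cast le_top))
    ((hG' x x.2).of_le (by exact_mod_cast le_top))).symm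

theorem IsAmbJet.smul (hJ : IsAmbJet r s w U J) (c : ℂ) : IsAmbJet r s w U (c • J) := by
  obtain ⟨W, F, hW, hUW, hF, hFs, hFJ⟩ := hJ
  have hF' := fun x (hx : x ∈ cone U) => hF.contDiffAt hW hUW hx
  refine ⟨W, c • F, hW, hUW, hF.smul c, hFs.smul hF' c, fun x => Jet.ext fun k => ?_⟩
  change c • (J x).coeff k = _
  rw [hFJ]
  exact (((smulCLM (Tens r s (Amb n)) c).iteratedFDeriv_comp_left (hF' x x.2)
    (i := k) (by exact_mod_cast le_top))).symm

theorem IsAmbJet.restrict (hJ : IsAmbJet r s w U J) {V : Set (Quadric h)} (hVU : V ⊆ U) :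
    IsAmbJet r s w V (fun x : cone V => J ⟨x, cone_mono hVU x.2⟩) := by
  obtain ⟨W, F, hW, hUW, hF, hFs, hFJ⟩ := hJ
  exact ⟨W, F, hW, fun p hp => hUW p (hVU hp), hF,
    ⟨fun x hx => hFs.laplacian x (cone_mono hVU hx),
      fun x hx => hFs.divergence x (cone_mono hVU hx),
      fun x hx => hFs.euler x (cone_mono hVU hx)⟩, fun x => hFJ _⟩

end Jets

/-- The complex vector space of infinite-order jets along the preimage of `U` in the null cone
of homogeneous trace-free ambient tensors solving the three equations to infinite order. -/
def ambJets (U : Opens (Quadric h)) :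
    Submodule ℂ (cone (U : Set (Quadric h)) →
      Jet r s n) where
  carrier := {J | IsAmbJet r s w (U : Set (Quadric h)) J}
  zero_mem' := IsAmbJet.zero
  add_mem' := IsAmbJet.add
  smul_mem' c _ hJ := IsAmbJet.smul hJ c

/-! ### Pullback by elements of the orthogonal group -/

/-- The restriction of `A` to a map between tangent spaces of the null cone. -/
def tanMap (A : orthGroup h) (x : Amb n) :
    tan h x →L[ℝ] tan h ((A : Amb n ≃L[ℝ] Amb n) x) :=
  ((A : Amb n ≃L[ℝ] Amb n).toContinuousLinearMap.comp (tan h x).subtypeL).codRestrict _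
    (fun v => orth_tan A v.2)

theorem IsQuadSection.pull (A : orthGroup h) {U : Opens (Quadric h)}
    {f : (x : cone (U : Set (Quadric h))) → Tens r s (tan h (x : Amb n))}
    (hf : IsQuadSection r s w (U : Set (Quadric h)) f) :
    IsQuadSection r s w (preim A U : Set (Quadric h))
      (fun x => (f ⟨(A : Amb n ≃L[ℝ] Amb n) x, act_mem_cone A x.2⟩).compContinuousLinearMap
        (fun _ => tanMap A (x : Amb n))) where
  smooth x := by
    obtain ⟨W, F, hW, hxW, hF, hfF⟩ := hf.smooth ⟨_, act_mem_cone A x.2⟩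
    refine ⟨(A : Amb n ≃L[ℝ] Amb n) ⁻¹' W,
      fun y => ContinuousMultilinearMap.compContinuousLinearMapL
        (fun _ => (A : Amb n ≃L[ℝ] Amb n).toContinuousLinearMap)
        (F ((A : Amb n ≃L[ℝ] Amb n) y)),
      hW.preimage (A : Amb n ≃L[ℝ] Amb n).continuous, hxW, ?_, fun y hy => ?_⟩
    · exact ContDiffOn.continuousLinearMap_comp _
        (hF.comp_continuousLinearMap (A : Amb n ≃L[ℝ] Amb n).toContinuousLinearMap)
    · rw [hfF ⟨_, act_mem_cone A y.2⟩ hy]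
      rfl
  young x := (hf.young _).comp _
  homogeneous c hc x v := by
    have h1 := hf.homogeneous c hc ⟨_, act_mem_cone A x.2⟩ (fun i => tanMap A (x : Amb n) (v i))
    have key : ∀ (y z : Amb n) (hy : y ∈ cone (U : Set (Quadric h)))
        (hz : z ∈ cone (U : Set (Quadric h))) (_ : y = z)
        (v : Fin r ⊕ Fin s → tan h y) (v' : Fin r ⊕ Fin s → tan h z)
        (_ : ∀ i, (v i : Amb n) = v' i), f ⟨y, hy⟩ v = f ⟨z, hz⟩ v' := by
      rintro y _ hy hz rfl v v' hv
      exact congrArg _ (funext fun i => Subtype.ext (hv i))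
    refine (key _ _ _ _ ?_ _ _ ?_).trans h1
    · simp
    · intro i
      exact (A : Amb n ≃L[ℝ] Amb n).map_smul c _
  horizontal x v a ha :=
    hf.horizontal ⟨_, act_mem_cone A x.2⟩ (fun i => tanMap A (x : Amb n) (v i)) a
      (congrArg (A : Amb n ≃L[ℝ] Amb n) ha)
  traceFree x b g hg hu a a' haa v := by
    have h1 := hf.traceFree ⟨_, act_mem_cone A x.2⟩ (fun i => tanMap A (x : Amb n) (b i)) g
      (fun i j => (hg i j).trans (A.2 _ _).symm) hu a a' haa
      (fun i => tanMap A (x : Amb n) (v i))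
    rw [← h1]
    refine Finset.sum_congr rfl fun i _ => Finset.sum_congr rfl fun j _ => ?_
    congr 1
    refine congrArg (fun v => f ⟨_, act_mem_cone A x.2⟩ v) (funext fun k => ?_)
    by_cases hk : k = a'
    · subst hk; simp
    · by_cases hk' : k = a
      · subst hk'; simp [hk]
      · simp [hk, hk']

/-- The pullback of an ambient tensor field. -/
def pullField {r s : ℕ} (A : Amb n ≃L[ℝ] Amb n) (F : Amb n → Tens r s (Amb n)) :
    Amb n → Tens r s (Amb n) :=
  fun y => (F (A y)).compContinuousLinearMap (fun _ => (A : Amb n →L[ℝ] Amb n))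

/-- The pullback of tensors as a continuous linear equivalence. -/
def tensPull (r s : ℕ) (A : Amb n ≃L[ℝ] Amb n) : Tens r s (Amb n) ≃L[ℝ] Tens r s (Amb n) :=
  ContinuousLinearEquiv.continuousMultilinearMapCongrLeft ℂ (fun _ => A)

theorem tensPull_apply {r s : ℕ} (A : Amb n ≃L[ℝ] Amb n) (T : Tens r s (Amb n))
    (v : Fin r ⊕ Fin s → Amb n) : tensPull r s A T v = T (fun i => A (v i)) := rfl

theorem pullField_eq {r s : ℕ} (A : Amb n ≃L[ℝ] Amb n) (F : Amb n → Tens r s (Amb n)) :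
    pullField A F = tensPull r s A ∘ (F ∘ A) := rfl

/-- The pullback of jets induced by the pullback of tensor fields. -/
def Jet.pull {r s : ℕ} (A : Amb n ≃L[ℝ] Amb n) (J : Jet r s n) : Jet r s n :=
  fun k => ((tensPull r s A : Tens r s (Amb n) →L[ℝ] Tens r s (Amb n)).compContinuousMultilinearMap
    (J.coeff k)).compContinuousLinearMap (fun _ => (A : Amb n →L[ℝ] Amb n))

theorem iteratedFDeriv_comp_equiv {Y : Type} [NormedAddCommGroup Y] [NormedSpace ℝ Y]
    (A : Amb n ≃L[ℝ] Amb n) (f : Amb n → Y) (x : Amb n) (k : ℕ) :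
    iteratedFDeriv ℝ k (f ∘ A) x =
      (iteratedFDeriv ℝ k f (A x)).compContinuousLinearMap fun _ => (A : Amb n →L[ℝ] Amb n) := by
  have := A.iteratedFDerivWithin_comp_right f uniqueDiffOn_univ (x := x) (Set.mem_univ _) k
  simpa only [Set.preimage_univ, iteratedFDerivWithin_univ] using this

/-- Taking jets commutes with pullback. -/
theorem jetAt_pullField {r s : ℕ} (A : Amb n ≃L[ℝ] Amb n) (F : Amb n → Tens r s (Amb n))
    (x : Amb n) : jetAt (pullField A F) x = Jet.pull A (jetAt F (A x)) := by
  refine Jet.ext fun k => ?_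
  change iteratedFDeriv ℝ k (pullField A F) x = _
  rw [pullField_eq, ContinuousLinearEquiv.iteratedFDeriv_comp_left, iteratedFDeriv_comp_equiv]
  rfl

theorem fderiv_pullField {r s : ℕ} (A : Amb n ≃L[ℝ] Amb n) (F : Amb n → Tens r s (Amb n))
    (x u : Amb n) :
    fderiv ℝ (pullField A F) x u = tensPull r s A (fderiv ℝ F (A x) (A u)) := by
  rw [pullField_eq, ContinuousLinearEquiv.comp_fderiv, ContinuousLinearEquiv.comp_right_fderiv]
  rfl

theorem ambContract_invariant {M : Type} [AddCommGroup M] [Module ℝ M] (A : orthGroup h)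
    (β : Amb n →ₗ[ℝ] Amb n →ₗ[ℝ] M) :
    ambContract h (fun u u' => β ((A : Amb n ≃L[ℝ] Amb n) u) ((A : Amb n ≃L[ℝ] Amb n) u')) =
      ambContract h (fun u u' => β u u') := by
  set g := ambMetric h with hg
  by_cases hdet : IsUnit g.det
  swap
  · simp [ambContract, ← hg, Matrix.nonsing_inv_apply_not_isUnit g hdet]
  set P : Matrix (Idx n) (Idx n) ℝ := Matrix.of fun K I => (A : Amb n ≃L[ℝ] Amb n) (e I) K with hP
  have hAe : ∀ I, (A : Amb n ≃L[ℝ] Amb n) (e I) = ∑ K, P K I • (e K : Amb n) := fun I => by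
    simpa [e, hP, Pi.single_apply] using pi_eq_sum_univ' ((A : Amb n ≃L[ℝ] Amb n) (e I))
  have hform : ∀ I J, ambForm h (e I) (e J) = g I J := fun I J => by
    simp [ambForm, e, hg]
  have hPg : P.transpose * g * P = g := by
    ext I J
    have h1 := A.2 (e I) (e J)
    rw [hform, hAe, hAe] at h1
    rw [← h1]
    simp only [map_sum, map_smul, LinearMap.sum_apply, LinearMap.smul_apply, hform, smul_eq_mul,
      Matrix.mul_apply, Matrix.transpose_apply, Finset.sum_mul, Finset.mul_sum]
    refine Finset.sum_congr rfl fun K _ => Finset.sum_congr rfl fun L _ => ?_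
    ring
  have hPg' : P * g⁻¹ * P.transpose = g⁻¹ := by
    have h1 : g⁻¹ * P.transpose * (g * P) = 1 := by
      rw [Matrix.mul_assoc, ← Matrix.mul_assoc P.transpose, hPg, Matrix.nonsing_inv_mul _ hdet]
    have h2 : g * P * (g⁻¹ * P.transpose) = 1 := mul_eq_one_comm.mp h1
    calc P * g⁻¹ * P.transpose = g⁻¹ * (g * P * (g⁻¹ * P.transpose)) := by
          simp only [Matrix.mul_assoc]
          rw [← Matrix.mul_assoc g⁻¹ g, Matrix.nonsing_inv_mul _ hdet, Matrix.one_mul]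
      _ = g⁻¹ := by rw [h2, Matrix.mul_one]
  simp only [ambContract, ← hg, hAe, map_sum, map_smul, LinearMap.sum_apply, LinearMap.smul_apply,
    Finset.smul_sum, smul_smul]
  conv_rhs => rw [← hPg']
  simp only [Matrix.mul_apply, Matrix.transpose_apply, Finset.sum_smul, Finset.sum_mul]
  have r3 : ∀ t : Idx n → Idx n → Idx n → M,
      ∑ a, ∑ b, ∑ c, t a b c = ∑ c, ∑ b, ∑ a, t a b c := fun t => by
    calc ∑ a, ∑ b, ∑ c, t a b c = ∑ a, ∑ c, ∑ b, t a b c :=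
          Finset.sum_congr rfl fun a _ => Finset.sum_comm
      _ = ∑ c, ∑ a, ∑ b, t a b c := Finset.sum_comm
      _ = ∑ c, ∑ b, ∑ a, t a b c := Finset.sum_congr rfl fun c _ => Finset.sum_comm
  have r4 : ∀ t : Idx n → Idx n → Idx n → Idx n → M,
      ∑ a, ∑ b, ∑ c, ∑ d, t a b c d = ∑ d, ∑ c, ∑ b, ∑ a, t a b c d := fun t => by
    calc ∑ a, ∑ b, ∑ c, ∑ d, t a b c d = ∑ a, ∑ d, ∑ c, ∑ b, t a b c d :=
          Finset.sum_congr rfl fun a _ => r3 _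
      _ = ∑ d, ∑ a, ∑ c, ∑ b, t a b c d := Finset.sum_comm
      _ = ∑ d, ∑ c, ∑ a, ∑ b, t a b c d := Finset.sum_congr rfl fun d _ => Finset.sum_comm
      _ = ∑ d, ∑ c, ∑ b, ∑ a, t a b c d :=
          Finset.sum_congr rfl fun d _ => Finset.sum_congr rfl fun c _ => Finset.sum_comm
  rw [r4]
  refine Finset.sum_congr rfl fun K _ => Finset.sum_congr rfl fun L _ =>
    Finset.sum_congr rfl fun J _ => Finset.sum_congr rfl fun I _ => ?_
  congr 1
  ring

theorem ambContract_map {M N : Type} [AddCommGroup M] [Module ℝ M] [AddCommGroup N] [Module ℝ N]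
    (L : M →ₗ[ℝ] N) (β : Amb n → Amb n → M) :
    ambContract h (fun u u' => L (β u u')) = L (ambContract h β) := by
  simp only [ambContract, map_sum, map_smul]

section Pull

variable {r s w}
variable {F : Amb n → Tens r s (Amb n)}

theorem laplacian_pullField (A : orthGroup h) {y : Amb n}
    (hF : ContDiffAt ℝ 2 F ((A : Amb n ≃L[ℝ] Amb n) y)) :
    ambLaplacian h (pullField (A : Amb n ≃L[ℝ] Amb n) F) y =
      tensPull r s A (ambLaplacian h F ((A : Amb n ≃L[ℝ] Amb n) y)) := by
  set B : Amb n ≃L[ℝ] Amb n := (A : Amb n ≃L[ℝ] Amb n)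
  have h1 : ∀ u u', fderiv ℝ (fun z => fderiv ℝ (pullField B F) z u') y u =
      tensPull r s B (fderiv ℝ (fun z => fderiv ℝ F z (B u')) (B y) (B u)) := fun u u' => by
    have h2 : (fun z => fderiv ℝ (pullField B F) z u') =
        pullField B (fun z => fderiv ℝ F z (B u')) := by
      funext z
      rw [fderiv_pullField]
      rfl
    rw [h2, fderiv_pullField]
  have hd : DifferentiableAt ℝ (fderiv ℝ F) (B y) :=
    (hF.fderiv_right (m := 1) (by norm_num)).differentiableAt (by simp)
  have h3 : ∀ u u', fderiv ℝ (fun z => fderiv ℝ F z u') (B y) u =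
      fderiv ℝ (fderiv ℝ F) (B y) u u' := fun u u' => by
    rw [fderiv_clm_apply hd (differentiableAt_const _)]
    simp
  simp only [ambLaplacian, h1, h3]
  have h4 := ambContract_invariant A (LinearMap.mk₂ ℝ
    (fun u u' => fderiv ℝ (fderiv ℝ F) (B y) u u') (by simp) (by simp) (by simp) (by simp))
  simp only [LinearMap.mk₂_apply] at h4
  rw [← h4]
  exact ambContract_map (tensPull r s B).toLinearEquiv.toLinearMap _

theorem update_comp {a : Fin r ⊕ Fin s} (B : Amb n ≃L[ℝ] Amb n) (v : Fin r ⊕ Fin s → Amb n)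
    (u : Amb n) : (fun i => B (Function.update v a u i)) =
      Function.update (fun i => B (v i)) a (B u) := by
  funext i
  by_cases hi : i = a
  · subst hi; simp
  · simp [hi]

theorem div_pullField (A : orthGroup h) (a : Fin r ⊕ Fin s) (v : Fin r ⊕ Fin s → Amb n)
    (y : Amb n) :
    ambDiv h (pullField (A : Amb n ≃L[ℝ] Amb n) F) a v y =
      ambDiv h F a (fun i => (A : Amb n ≃L[ℝ] Amb n) (v i)) ((A : Amb n ≃L[ℝ] Amb n) y) := by
  simp only [ambDiv, fderiv_pullField, tensPull_apply, update_comp]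
  congr 1
  exact ambContract_invariant A (LinearMap.mk₂ ℝ
    (fun u u' => fderiv ℝ F ((A : Amb n ≃L[ℝ] Amb n) y) u
      (Function.update (fun i => (A : Amb n ≃L[ℝ] Amb n) (v i)) a u'))
    (by simp) (by simp) (by simp) (by simp))

theorem euler_pullField (B : Amb n ≃L[ℝ] Amb n) (a : Fin r ⊕ Fin s) (v : Fin r ⊕ Fin s → Amb n) :
    eulerContract (pullField B F) a v = eulerContract F a (fun i => B (v i)) ∘ B := by
  funext y
  change F (B y) (fun i => B (Function.update v a y i)) = _
  rw [update_comp]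
  rfl

theorem ambCone_preim (B : Amb n ≃L[ℝ] Amb n) {W : Set (ℙ ℝ (Amb n))} {x : Amb n}
    (hx : x ∈ ambCone (Projectivization.map B.toLinearEquiv.toLinearMap B.injective ⁻¹' W)) :
    B x ∈ ambCone W := by
  obtain ⟨hx0, hxW⟩ := hx
  exact ⟨by simpa using hx0, hxW⟩

theorem IsAmbSection.pull (A : orthGroup h) {W : Set (ℙ ℝ (Amb n))}
    (hF : IsAmbSection r s w h W F) :
    IsAmbSection r s w h (Projectivization.map
      (A : Amb n ≃L[ℝ] Amb n).toLinearEquiv.toLinearMap (A : Amb n ≃L[ℝ] Amb n).injective ⁻¹' W)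
      (pullField (A : Amb n ≃L[ℝ] Amb n) F) where
  smooth := by
    refine ContDiffOn.continuousLinearMap_comp
      (tensPull r s (A : Amb n ≃L[ℝ] Amb n)).toContinuousLinearMap ?_
    exact (hF.smooth.comp_continuousLinearMap
      (A : Amb n ≃L[ℝ] Amb n).toContinuousLinearMap).mono (fun x hx => ambCone_preim _ hx)
  young x hx := (hF.young _ (ambCone_preim _ hx)).comp _
  homogeneous c hc x hx v := by
    have h1 := hF.homogeneous c hc _ (ambCone_preim _ hx)
      (fun i => (A : Amb n ≃L[ℝ] Amb n) (v i))
    simp only [← map_smul] at h1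
    exact h1
  traceFree x hx a a' haa v := by
    have h1 := hF.traceFree _ (ambCone_preim _ hx) a a' haa
      (fun i => (A : Amb n ≃L[ℝ] Amb n) (v i))
    rw [← h1]
    have h2 := ambContract_invariant A (LinearMap.mk₂ ℝ
      (fun u u' => F ((A : Amb n ≃L[ℝ] Amb n) x) (Function.update
        (Function.update (fun i => (A : Amb n ≃L[ℝ] Amb n) (v i)) a u) a' u'))
      (by intro u₁ u₂ u'; simp [Function.update_comm haa])
      (by intro c u u'; simp [Function.update_comm haa]) (by simp) (by simp))
    simp only [LinearMap.mk₂_apply, ← update_comp] at h2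
    exact h2

theorem SolvesToInfiniteOrder.pull (A : orthGroup h) {U : Opens (Quadric h)}
    (hF : SolvesToInfiniteOrder (U : Set (Quadric h)) F)
    (hF' : ∀ x ∈ cone (U : Set (Quadric h)), ContDiffAt ℝ ∞ F x) :
    SolvesToInfiniteOrder (preim A U : Set (Quadric h))
      (pullField (A : Amb n ≃L[ℝ] Amb n) F) where
  laplacian x hx := by
    have hx' := act_mem_cone A hx
    have h1 := ((hF.laplacian _ hx').clm_comp (contDiffAt_laplacian (hF' _ hx'))
      (tensPull r s (A : Amb n ≃L[ℝ] Amb n)).toContinuousLinearMap).comp_equiv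
      (A : Amb n ≃L[ℝ] Amb n)
    refine h1.congr ?_
    have h2 := ((hF' _ hx').of_le (m := 2) ENat.LEInfty.out).eventually (by simp)
    filter_upwards [(A : Amb n ≃L[ℝ] Amb n).continuous.continuousAt.eventually h2] with y hy
    exact laplacian_pullField A hy
  divergence x hx a v := by
    have h1 := (hF.divergence _ (act_mem_cone A hx) a
      (fun i => (A : Amb n ≃L[ℝ] Amb n) (v i))).comp_equiv (A : Amb n ≃L[ℝ] Amb n)
    convert h1 using 1
    funext y
    exact div_pullField A _ _ y
  euler x hx a v := by
    rw [euler_pullField]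
    exact (hF.euler _ (act_mem_cone A hx) a _).comp_equiv (A : Amb n ≃L[ℝ] Amb n)

theorem IsAmbJet.pull (A : orthGroup h) {U : Opens (Quadric h)}
    {J : cone (U : Set (Quadric h)) → Jet r s n}
    (hJ : IsAmbJet r s w (U : Set (Quadric h)) J) :
    IsAmbJet r s w (preim A U : Set (Quadric h))
      (fun x => Jet.pull (A : Amb n ≃L[ℝ] Amb n)
        (J ⟨(A : Amb n ≃L[ℝ] Amb n) x, act_mem_cone A x.2⟩)) := by
  obtain ⟨W, F, hW, hUW, hF, hFs, hFJ⟩ := hJ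
  refine ⟨_, pullField (A : Amb n ≃L[ℝ] Amb n) F,
    hW.preimage (f := Projectivization.map (A : Amb n ≃L[ℝ] Amb n).toLinearEquiv.toLinearMap
      (A : Amb n ≃L[ℝ] Amb n).injective) ?_, fun p hp => hUW (quadAct A p) hp,
    hF.pull A, hFs.pull A (fun x hx => hF.contDiffAt hW hUW hx), fun x => ?_⟩
  · refine Continuous.quotient_map' ?_ _
    exact Continuous.subtype_mk
      ((A : Amb n ≃L[ℝ] Amb n).continuous.comp continuous_subtype_val) _
  · rw [jetAt_pullField]
    exact congrArg _ (hFJ _)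

end Pull

/-- Pullback by `A` of sections of the tensor bundle on the quadric. -/
def quadPull (A : orthGroup h) (U : Opens (Quadric h)) :
    quadSections r s w (h := h) U →ₗ[ℂ] quadSections r s w (h := h) (preim A U) where
  toFun f := ⟨_, IsQuadSection.pull r s w A f.2⟩
  map_add' _ _ := rfl
  map_smul' _ _ := rfl

/-- Pullback by `A` of jets along the null cone. -/
def ambPull (A : orthGroup h) (U : Opens (Quadric h)) :
    ambJets r s w (h := h) U →ₗ[ℂ] ambJets r s w (h := h) (preim A U) where
  toFun J := ⟨_, IsAmbJet.pull A J.2⟩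
  map_add' J K := by
    refine Subtype.ext (funext fun x => Jet.ext fun k => ?_)
    ext m v
    rfl
  map_smul' c J := by
    refine Subtype.ext (funext fun x => Jet.ext fun k => ?_)
    ext m v
    rfl

/-- The restriction of (the zeroth-order term of) a jet of an ambient tensor field at a point `x`
of the null cone to the tangent space of the null cone. -/
def Jet.restrict {r s : ℕ} (J : Jet r s n) (x : Amb n) : Tens r s (tan h x) :=
  (J.coeff 0 0).compContinuousLinearMap (fun _ => (tan h x).subtypeL)

/-- The element `-1` of the orthogonal group. -/
def negOne : orthGroup h :=
  ⟨ContinuousLinearEquiv.neg ℝ, fun x y => by simp⟩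

theorem preim_negOne (U : Opens (Quadric h)) : preim negOne U = U := by
  have h1 : ∀ p : Quadric h, quadAct negOne p = p := by
    rintro ⟨p, hp⟩
    refine Subtype.ext ?_
    induction p using Projectivization.ind with
    | h v hv =>
      simp only [quadAct, Projectivization.map_mk]
      rw [Projectivization.mk_eq_mk_iff']
      exact ⟨-1, by simp [negOne]⟩
  ext p
  change quadAct negOne p ∈ U ↔ p ∈ U
  rw [h1]

/-- The element `-1` acts trivially on sections over the quadric, so the action of the
orthogonal group factors through the conformal group, its quotient by `{1, -1}`. -/
theorem quadPull_negOne (U : Opens (Quadric h)) (f : quadSections r s w (h := h) U) {x : Amb n}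
    (hx : x ∈ cone (preim negOne U : Set (Quadric h))) (hx' : x ∈ cone (U : Set (Quadric h))) :
    (quadPull r s w negOne U f).1 ⟨x, hx⟩ = f.1 ⟨x, hx'⟩ := by
  refine ContinuousMultilinearMap.ext fun v => ?_
  have h1 := f.2.homogeneous (-1) (by norm_num) ⟨x, hx'⟩ v
  simp only [abs_neg, abs_one, Complex.ofReal_one, Complex.one_cpow, one_mul] at h1
  rw [← h1]
  have key : ∀ (y z : Amb n) (hy : y ∈ cone (U : Set (Quadric h)))
      (hz : z ∈ cone (U : Set (Quadric h))) (_ : y = z)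
      (v : Fin r ⊕ Fin s → tan h y) (v' : Fin r ⊕ Fin s → tan h z)
      (_ : ∀ i, (v i : Amb n) = v' i), f.1 ⟨y, hy⟩ v = f.1 ⟨z, hz⟩ v' := by
    rintro y _ hy hz rfl v v' hv
    exact congrArg _ (funext fun i => Subtype.ext (hv i))
  have h2 : (negOne : orthGroup h).1 x = (-1 : ℝ) • x := (neg_one_smul ℝ x).symm
  exact key ((negOne : orthGroup h).1 x) ((-1 : ℝ) • x) (act_mem_cone negOne hx)
    (smul_mem_cone hx' (by norm_num)) h2 (fun i => tanMap negOne x (v i))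
    (fun i => ⟨(-1 : ℝ) • (v i : Amb n), smul_mem_tan (v i).2 (-1)⟩)
    (fun i => (neg_one_smul ℝ (v i : Amb n)).symm)

/-- The element `-1` acts trivially on jets along the null cone. -/
theorem ambPull_negOne (U : Opens (Quadric h)) (J : ambJets r s w (h := h) U) {x : Amb n}
    (hx : x ∈ cone (preim negOne U : Set (Quadric h))) (hx' : x ∈ cone (U : Set (Quadric h))) :
    (ambPull r s w negOne U J).1 ⟨x, hx⟩ = J.1 ⟨x, hx'⟩ := by
  obtain ⟨J, W, F, hW, hUW, hF, hFs, hFJ⟩ := J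
  change Jet.pull _ (J ⟨_, _⟩) = J _
  rw [hFJ, hFJ]
  refine (jetAt_pullField (negOne : orthGroup h).1 F x).symm.trans (Jet.ext fun k => ?_)
  have h1 : pullField (negOne : orthGroup h).1 F =ᶠ[nhds x] F := by
    filter_upwards [(isOpen_ambCone hW).mem_nhds (cone_subset_ambCone hUW hx')] with y hy
    ext v
    have h2 := hF.homogeneous (-1) (by norm_num) y hy v
    simp only [abs_neg, abs_one, Complex.ofReal_one, Complex.one_cpow, one_mul,
      neg_one_smul] at h2
    exact h2
  exact (h1.iteratedFDeriv (𝕜 := ℝ) k).self_of_nhds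

/-! ### The two presheaves on the quadric -/

variable (h)

/-- The presheaf on the quadric of smooth trace-free tensors with Young symmetry `(r, s)` and
weight `w`. -/
def quadPresheaf : TopCat.Presheaf (ModuleCat.{0} ℂ) (TopCat.of (Quadric h)) where
  obj U := ModuleCat.of ℂ (quadSections r s w (h := h) U.unop)
  map i := ModuleCat.ofHom
    { toFun := fun f => ⟨fun x => f.1 ⟨x, cone_mono i.unop.le x.2⟩,
        IsQuadSection.restrict f.2 i.unop.le⟩
      map_add' := fun _ _ => rfl
      map_smul' := fun _ _ => rfl }
  map_id _ := rfl
  map_comp _ _ := rfl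

/-- The presheaf on the quadric of infinite-order jets along the null cone of homogeneous
trace-free ambient tensors solving the three equations to infinite order. -/
def ambPresheaf : TopCat.Presheaf (ModuleCat.{0} ℂ) (TopCat.of (Quadric h)) where
  obj U := ModuleCat.of ℂ (ambJets r s w (h := h) U.unop)
  map i := ModuleCat.ofHom
    { toFun := fun f => ⟨fun x => f.1 ⟨x, cone_mono i.unop.le x.2⟩,
        IsAmbJet.restrict f.2 i.unop.le⟩
      map_add' := fun _ _ => rfl
      map_smul' := fun _ _ => rfl }
  map_id _ := rfl
  map_comp _ _ := rfl

variable {h r s w}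

/-- The linear map on sections over `U` given by a morphism from jets to tensors. -/
def onSections (φ : ambPresheaf h r s w ⟶ quadPresheaf h r s w) (U : Opens (Quadric h)) :
    ambJets r s w (h := h) U →ₗ[ℂ] quadSections r s w (h := h) U :=
  (φ.app (op U)).hom

/-- A morphism from jets to tensors is the restriction map `ι^*` if it sends every jet to the
pullback of its zeroth-order term to the null cone. -/
def IsRestriction (φ : ambPresheaf h r s w ⟶ quadPresheaf h r s w) : Prop :=
  ∀ (U : Opens (Quadric h)) (J : ambJets r s w (h := h) U) (x : cone (U : Set (Quadric h))),
    (onSections φ U J).1 x = (J.1 x).restrict (h := h) (x : Amb n)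

/-- Equivariance: the morphism commutes with the pullback by every element `A` of the orthogonal
group, over every open set.  Since `-1` acts trivially on both sides (see `ambPull_negOne` and
`quadPull_negOne`), this is the same as equivariance for the conformal group `O / {1, -1}`. -/
def IsEquivariant (φ : ambPresheaf h r s w ⟶ quadPresheaf h r s w) : Prop :=
  ∀ (A : orthGroup h) (U : Opens (Quadric h)) (J : ambJets r s w (h := h) U),
    onSections φ (preim A U) (ambPull r s w A U J) = quadPull r s w A U (onSections φ U J)

end

end AmbientLift

/-! Tensor fields with two skew columns are treated as one module over coordinates `x i`,
derivatives `d i` and, for each column, fermionic contractions `c` and multiplications `t`. A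
complex frame turns the ambient form into a sum of squares, so the signature disappears. The
quadratic form Q, the Laplacian, the Euler operator, contraction with X, divergence, multiplication
by the one-form dual to X, the column shifts `S` and the trace are all quadratic in the generators.
Their relations therefore follow from the canonical (anti)commutators (`WeylClifford`). Functions
are taken modulo those flat along the null cone, and `ConeData` lists what is needed of the cone: a
null vector q whose linear form l is invertible, the elements K vanishing on the cone, the
derivations l·∂_i − x_i·∂_q tangent to it, and the fact that only zero has all its derivatives in K.

Put N = n + 2 and let m = w − r − s be the degree of the components. The central fact is
`ConeData.eq_zero_of_lap`: a harmonic element of degree m vanishing on the cone is zero. Indeed u =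
Qg satisfies l·Δu = (2m + N − 4)·∂_q u on the cone, so harmonicity makes all first derivatives
vanish there too, and the argument repeats in degrees m − 1, m − 2, and so on. The excluded values
are 2m + N − 2 = 2k with k ≥ 1, which is the third hypothesis on w. Under the same condition the
series Σ c_k Q^k Δ^k F is a formal harmonic extension (`lap_eq_zero_of_series`), realised by smooth
functions through a Borel lemma in powers of Q (`exists_expansion`).

Existence. An arbitrary homogeneous extension F₀ with X⌟F₀ = 0 is changed along the cone by
multiples of the dual of X, which are invisible to vectors tangent to the cone. The result
`corrected` satisfies X⌟F₁ = QG and div F₁ = 2G with the same G; its coefficients have the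
denominators β = m + N − 2 − r and β + r − s + 1, whose nonvanishing is the rest of the hypotheses.
If F is harmonic and equals F₁ on the cone, then its Young defect, trace, divergence and Euler
contraction are harmonic in turn and vanish on the cone to a sufficient order, hence are zero
(`ConeData.solves`).

Uniqueness. A solution whose pullback to the cone vanishes is, along the cone, a combination of
multiples of the duals of X. The tangential part of the divergence gives linear equations for the
coefficients, with the same two numbers as determinants, so the solution vanishes on the cone and
then identically as a jet (`ConeData.eq_zero_of_pr_mem`).

Both statements are local on the quadric. Uniqueness makes local lifts agree, and fields agreeing to
infinite order along the cone are glued by a partition of unity and then made homogeneous by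
averaging over rays (`exists_glued`). This also gives the sheaf property of the jets. -/

namespace AmbientLift

/-! ### Weyl–Clifford modules -/

section WeylClifford

/-- A module with coordinates `x`, derivatives `d` and two sets of fermionic contraction and
multiplication operators `c`, `t`. -/
structure WeylClifford (κ : Type) [DecidableEq κ] (M : Type) [AddCommGroup M] [Module ℂ M] where
  x : κ → Module.End ℂ M
  d : κ → Module.End ℂ M
  c : Bool → κ → Module.End ℂ M
  t : Bool → κ → Module.End ℂ M
  xx : ∀ i j, x i * x j = x j * x i
  dd : ∀ i j, d i * d j = d j * d i
  dx : ∀ i j, d i * x j = x j * d i + if i = j then 1 else 0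
  cc : ∀ a b i j, c a i * c b j = -(c b j * c a i)
  tt : ∀ a b i j, t a i * t b j = -(t b j * t a i)
  ct : ∀ a b i j, c a i * t b j = -(t b j * c a i) + if a = b ∧ i = j then 1 else 0
  xc : ∀ a i j, x i * c a j = c a j * x i
  xt : ∀ a i j, x i * t a j = t a j * x i
  dc : ∀ a i j, d i * c a j = c a j * d i
  dt : ∀ a i j, d i * t a j = t a j * d i

/-- Moving `w j` leftwards past `u i * v i` costs the signs `η'` and `η`, and each contraction
removes one factor and collapses the sum to the index `j`. With integer signs and constants, one
computation serves bosonic and fermionic generators alike; all commutators of the quadratic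
operators with generators are instances. -/
theorem pair_mul {κ A : Type} [Fintype κ] [DecidableEq κ] [Ring A] (u v w : κ → A)
    (η η' α α' : ℤ)
    (hu : ∀ i j, u i * w j = η • (w j * u i) + α • (if i = j then 1 else 0))
    (hv : ∀ i j, v i * w j = η' • (w j * v i) + α' • (if i = j then 1 else 0)) (j : κ) :
    (∑ i, u i * v i) * w j =
      (η * η') • (w j * ∑ i, u i * v i) + α' • u j + (η' * α) • v j := by
  have key : ∀ i, u i * v i * w j = (η * η') • (w j * (u i * v i)) +
      α' • (if i = j then u i else 0) + (η' * α) • (if i = j then v i else 0) := by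
    intro i
    rw [mul_assoc, hv, mul_add, mul_smul_comm, ← mul_assoc, hu]
    by_cases h : i = j
    · subst h
      simp only [if_true, mul_smul_comm, mul_one, add_mul, smul_add, smul_mul_assoc, one_mul,
        smul_smul, mul_assoc]
      rw [mul_comm η' η]
      abel
    · simp only [h, if_false, smul_zero, add_zero, mul_zero, smul_mul_assoc, smul_smul, mul_assoc]
      rw [mul_comm η' η]
  rw [Finset.sum_mul, Finset.sum_congr rfl fun i _ => key i]
  simp [Finset.sum_add_distrib, Finset.mul_sum, Finset.smul_sum]

namespace WeylClifford

variable {κ : Type} [DecidableEq κ] {M : Type} [AddCommGroup M] [Module ℂ M]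
  (W : WeylClifford κ M)

theorem tc (a b i j) : W.t a i * W.c b j =
    -(W.c b j * W.t a i) + if a = b ∧ i = j then 1 else 0 := by
  rw [W.ct]
  by_cases h : a = b ∧ i = j
  · obtain ⟨rfl, rfl⟩ := h; simp
  · have : ¬ (b = a ∧ j = i) := fun h' => h ⟨h'.1.symm, h'.2.symm⟩
    simp [h, this]

theorem xd (i j) : W.x i * W.d j = W.d j * W.x i + if i = j then -1 else 0 := by
  rw [W.dx]
  by_cases h : i = j
  · subst h; simp
  · simp [h, Ne.symm h]

variable [Fintype κ]

/-- The quadratic form as a multiplication operator. -/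
def quad : Module.End ℂ M := ∑ i, W.x i * W.x i
/-- The Laplacian. -/
def lap : Module.End ℂ M := ∑ i, W.d i * W.d i
/-- The Euler operator. -/
def eul : Module.End ℂ M := ∑ i, W.x i * W.d i
/-- Contraction with the Euler field. -/
def con (a : Bool) : Module.End ℂ M := ∑ i, W.x i * W.c a i
/-- The divergence. -/
def div (a : Bool) : Module.End ℂ M := ∑ i, W.d i * W.c a i
/-- Exterior multiplication by the one-form dual to the Euler field. -/
def eps (a : Bool) : Module.End ℂ M := ∑ i, W.x i * W.t a i
/-- The operators which move an index from column `b` to column `a`. -/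
def S (a b : Bool) : Module.End ℂ M := ∑ i, W.t a i * W.c b i
/-- The trace over an index in each column. -/
def tr : Module.End ℂ M := ∑ i, W.c true i * W.c false i

/-! ### Commutators of the quadratic operators with the generators. -/

section Generators

theorem eul_mul_x (j) : W.eul * W.x j = W.x j * W.eul + W.x j := by
  simpa [eul] using pair_mul W.x W.d W.x 1 1 0 1 (by simp [W.xx]) (by simp [W.dx]) j

theorem eul_mul_d (j) : W.eul * W.d j = W.d j * W.eul - W.d j := by
  have := pair_mul W.x W.d W.d 1 1 (-1) 0 (by simp [W.xd]) (by simp [W.dd]) j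
  simpa [eul, ← sub_eq_add_neg] using this

theorem eul_mul_c (a j) : W.eul * W.c a j = W.c a j * W.eul := by
  simpa [eul] using pair_mul W.x W.d (W.c a) 1 1 0 0 (by simp [W.xc]) (by simp [W.dc]) j

theorem eul_mul_t (a j) : W.eul * W.t a j = W.t a j * W.eul := by
  simpa [eul] using pair_mul W.x W.d (W.t a) 1 1 0 0 (by simp [W.xt]) (by simp [W.dt]) j

theorem lap_mul_x (j) : W.lap * W.x j = W.x j * W.lap + (2 : ℤ) • W.d j := by
  have := pair_mul W.d W.d W.x 1 1 1 1 (by simp [W.dx]) (by simp [W.dx]) j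
  simp only [mul_one, one_smul] at this
  rw [lap, this]; abel

theorem lap_mul_d (j) : W.lap * W.d j = W.d j * W.lap := by
  simpa [lap] using pair_mul W.d W.d W.d 1 1 0 0 (by simp [W.dd]) (by simp [W.dd]) j

theorem lap_mul_c (a j) : W.lap * W.c a j = W.c a j * W.lap := by
  simpa [lap] using pair_mul W.d W.d (W.c a) 1 1 0 0 (by simp [W.dc]) (by simp [W.dc]) j

theorem lap_mul_t (a j) : W.lap * W.t a j = W.t a j * W.lap := by
  simpa [lap] using pair_mul W.d W.d (W.t a) 1 1 0 0 (by simp [W.dt]) (by simp [W.dt]) j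

theorem quad_mul_d (j) : W.quad * W.d j = W.d j * W.quad - (2 : ℤ) • W.x j := by
  have := pair_mul W.x W.x W.d 1 1 (-1) (-1) (by simp [W.xd])
    (by simp [W.xd]) j
  simp only [mul_one, one_smul, one_mul, neg_smul] at this
  rw [quad, this]; abel

theorem con_mul_x (a j) : W.con a * W.x j = W.x j * W.con a := by
  simpa [con] using pair_mul W.x (W.c a) W.x 1 1 0 0 (by simp [W.xx]) (by simp [W.xc]) j

theorem con_mul_d (a j) : W.con a * W.d j = W.d j * W.con a - W.c a j := by
  have := pair_mul W.x (W.c a) W.d 1 1 (-1) 0 (by simp [W.xd]) (by simp [W.dc]) j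
  simpa [con, ← sub_eq_add_neg] using this

theorem con_mul_c (a b j) : W.con a * W.c b j = -(W.c b j * W.con a) := by
  simpa [con] using pair_mul W.x (W.c a) (W.c b) 1 (-1) 0 0 (by simp [W.xc])
    (by intro i j; rw [W.cc]; simp) j

theorem con_mul_t (a b j) : W.con a * W.t b j =
    -(W.t b j * W.con a) + if a = b then W.x j else 0 := by
  have := pair_mul W.x (W.c a) (W.t b) 1 (-1) 0 (if a = b then 1 else 0) (by simp [W.xt])
    (by intro i j; rw [W.ct]; by_cases h : a = b <;> simp [h]) j
  by_cases h : a = b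
  · simpa [con, h] using this
  · simpa [con, h] using this

theorem div_mul_x (a j) : W.div a * W.x j = W.x j * W.div a + W.c a j := by
  simpa [div] using pair_mul W.d (W.c a) W.x 1 1 1 0 (by simp [W.dx]) (by simp [W.xc]) j

theorem div_mul_d (a j) : W.div a * W.d j = W.d j * W.div a := by
  simpa [div] using pair_mul W.d (W.c a) W.d 1 1 0 0 (by simp [W.dd]) (by simp [W.dc]) j

theorem div_mul_c (a b j) : W.div a * W.c b j = -(W.c b j * W.div a) := by
  simpa [div] using pair_mul W.d (W.c a) (W.c b) 1 (-1) 0 0 (by simp [W.dc])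
    (by intro i j; rw [W.cc]; simp) j

theorem div_mul_t (a b j) : W.div a * W.t b j =
    -(W.t b j * W.div a) + if a = b then W.d j else 0 := by
  have := pair_mul W.d (W.c a) (W.t b) 1 (-1) 0 (if a = b then 1 else 0) (by simp [W.dt])
    (by intro i j; rw [W.ct]; by_cases h : a = b <;> simp [h]) j
  by_cases h : a = b
  · simpa [div, h] using this
  · simpa [div, h] using this

theorem S_mul_x (a b j) : W.S a b * W.x j = W.x j * W.S a b := by
  simpa [S] using pair_mul (W.t a) (W.c b) W.x 1 1 0 0 (by simp [W.xt]) (by simp [W.xc]) j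

theorem S_mul_d (a b j) : W.S a b * W.d j = W.d j * W.S a b := by
  simpa [S] using pair_mul (W.t a) (W.c b) W.d 1 1 0 0 (by simp [W.dt]) (by simp [W.dc]) j

theorem S_mul_c (a b e j) : W.S a b * W.c e j =
    W.c e j * W.S a b - if a = e then W.c b j else 0 := by
  have := pair_mul (W.t a) (W.c b) (W.c e) (-1) (-1) (if a = e then 1 else 0) 0
    (by intro i j; rw [W.tc]; by_cases h : a = e <;> simp [h])
    (by intro i j; rw [W.cc]; simp) j
  by_cases h : a = e
  · simpa [S, h, sub_eq_add_neg] using this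
  · simpa [S, h] using this

theorem S_mul_t (a b e j) : W.S a b * W.t e j =
    W.t e j * W.S a b + if b = e then W.t a j else 0 := by
  have := pair_mul (W.t a) (W.c b) (W.t e) (-1) (-1) 0 (if b = e then 1 else 0)
    (by intro i j; rw [W.tt]; simp)
    (by intro i j; rw [W.ct]; by_cases h : b = e <;> simp [h]) j
  by_cases h : b = e
  · simpa [S, h] using this
  · simpa [S, h] using this

theorem tr_mul_x (j) : W.tr * W.x j = W.x j * W.tr := by
  simpa [tr] using pair_mul (W.c true) (W.c false) W.x 1 1 0 0 (by simp [W.xc]) (by simp [W.xc]) j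

theorem tr_mul_d (j) : W.tr * W.d j = W.d j * W.tr := by
  simpa [tr] using pair_mul (W.c true) (W.c false) W.d 1 1 0 0 (by simp [W.dc]) (by simp [W.dc]) j

theorem tr_mul_c (a j) : W.tr * W.c a j = W.c a j * W.tr := by
  simpa [tr] using pair_mul (W.c true) (W.c false) (W.c a) (-1) (-1) 0 0
    (by intro i j; rw [W.cc]; simp) (by intro i j; rw [W.cc]; simp) j

theorem tr_mul_t_true (j) : W.tr * W.t true j = W.t true j * W.tr - W.c false j := by
  have := pair_mul (W.c true) (W.c false) (W.t true) (-1) (-1) 1 0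
    (by intro i j; rw [W.ct]; simp) (by intro i j; rw [W.ct]; simp) j
  simpa [tr, sub_eq_add_neg] using this

theorem tr_mul_t_false (j) : W.tr * W.t false j = W.t false j * W.tr + W.c true j := by
  have := pair_mul (W.c true) (W.c false) (W.t false) (-1) (-1) 0 1
    (by intro i j; rw [W.ct]; simp) (by intro i j; rw [W.ct]; simp) j
  simpa [tr] using this

end Generators

/-! ### Commutators among the quadratic operators. -/

section Quadratic

theorem sum_c_mul_c (a) : ∑ i, W.c a i * W.c a i = 0 := by
  refine Finset.sum_eq_zero fun i _ => ?_
  have h1 := W.cc a a i i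
  have h2 : (2 : ℂ) • (W.c a i * W.c a i) = 0 := by
    rw [two_smul]; nth_rewrite 1 [h1]; simp
  simpa using h2

theorem eul_con (a) : W.eul * W.con a = W.con a * W.eul + W.con a := by
  simp only [con, Finset.mul_sum, Finset.sum_mul, ← Finset.sum_add_distrib]
  refine Finset.sum_congr rfl fun i _ => ?_
  rw [← mul_assoc, eul_mul_x, add_mul, mul_assoc, eul_mul_c, mul_assoc]

theorem eul_div (a) : W.eul * W.div a = W.div a * W.eul - W.div a := by
  simp only [div, Finset.mul_sum, Finset.sum_mul, ← Finset.sum_sub_distrib]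
  refine Finset.sum_congr rfl fun i _ => ?_
  rw [← mul_assoc, eul_mul_d, sub_mul, mul_assoc, eul_mul_c, mul_assoc]

theorem eul_eps (a) : W.eul * W.eps a = W.eps a * W.eul + W.eps a := by
  simp only [eps, Finset.mul_sum, Finset.sum_mul, ← Finset.sum_add_distrib]
  refine Finset.sum_congr rfl fun i _ => ?_
  rw [← mul_assoc, eul_mul_x, add_mul, mul_assoc, eul_mul_t, mul_assoc]

theorem eul_S (a b) : W.eul * W.S a b = W.S a b * W.eul := by
  simp only [S, Finset.mul_sum, Finset.sum_mul]
  refine Finset.sum_congr rfl fun i _ => ?_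
  rw [← mul_assoc, eul_mul_t, mul_assoc, eul_mul_c, mul_assoc]

theorem eul_tr : W.eul * W.tr = W.tr * W.eul := by
  simp only [tr, Finset.mul_sum, Finset.sum_mul]
  refine Finset.sum_congr rfl fun i _ => ?_
  rw [← mul_assoc, eul_mul_c, mul_assoc, eul_mul_c, mul_assoc]

theorem lap_con (a) : W.lap * W.con a = W.con a * W.lap + (2 : ℤ) • W.div a := by
  simp only [con, div, Finset.mul_sum, Finset.sum_mul, Finset.smul_sum, ← Finset.sum_add_distrib]
  refine Finset.sum_congr rfl fun i _ => ?_
  rw [← mul_assoc, lap_mul_x, add_mul, mul_assoc, lap_mul_c, mul_assoc, smul_mul_assoc]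

theorem lap_div (a) : W.lap * W.div a = W.div a * W.lap := by
  simp only [div, Finset.mul_sum, Finset.sum_mul]
  refine Finset.sum_congr rfl fun i _ => ?_
  rw [← mul_assoc, lap_mul_d, mul_assoc, lap_mul_c, mul_assoc]

theorem lap_S (a b) : W.lap * W.S a b = W.S a b * W.lap := by
  simp only [S, Finset.mul_sum, Finset.sum_mul]
  refine Finset.sum_congr rfl fun i _ => ?_
  rw [← mul_assoc, lap_mul_t, mul_assoc, lap_mul_c, mul_assoc]

theorem lap_tr : W.lap * W.tr = W.tr * W.lap := by
  simp only [tr, Finset.mul_sum, Finset.sum_mul]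
  refine Finset.sum_congr rfl fun i _ => ?_
  rw [← mul_assoc, lap_mul_c, mul_assoc, lap_mul_c, mul_assoc]

theorem sum_d_mul_x : ∑ i, W.d i * W.x i = W.eul + (Fintype.card κ : ℂ) • 1 := by
  simp only [eul, W.dx, if_true, Finset.sum_add_distrib]
  congr 1
  rw [Finset.sum_const, Finset.card_univ, Nat.cast_smul_eq_nsmul]

/-- The Laplacian passes each of the two factors of `x i * x i` at the cost of twice a derivative;
reordering one of the two resulting terms produces the dimension. The divisors of the harmonic
series come from this relation. -/
theorem lap_quad : W.lap * W.quad = W.quad * W.lap + (4 : ℂ) • W.eul +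
    (2 * (Fintype.card κ : ℂ)) • 1 := by
  have h1 : W.lap * W.quad = W.quad * W.lap +
      ((2 : ℤ) • ∑ i, W.x i * W.d i + (2 : ℤ) • ∑ i, W.d i * W.x i) := by
    simp only [quad, Finset.mul_sum, Finset.sum_mul, Finset.smul_sum, ← Finset.sum_add_distrib]
    refine Finset.sum_congr rfl fun i _ => ?_
    rw [← mul_assoc, lap_mul_x, add_mul, mul_assoc, lap_mul_x, mul_add, mul_assoc, mul_smul_comm,
      smul_mul_assoc]
    abel
  rw [h1, sum_d_mul_x, ← eul]
  module

/-- The extra term is zero for equal columns and plus or minus the trace for different ones. Hence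
trace-freeness is what makes the divergences of a field with X⌟F = 0 again annihilated by X. -/
theorem con_div (a b) : W.con a * W.div b = -(W.div b * W.con a) - ∑ i, W.c a i * W.c b i := by
  simp only [div, Finset.mul_sum, Finset.sum_mul, ← Finset.sum_neg_distrib,
    ← Finset.sum_sub_distrib]
  refine Finset.sum_congr rfl fun i _ => ?_
  rw [← mul_assoc, con_mul_d, sub_mul, mul_assoc, con_mul_c, mul_neg, mul_assoc]

theorem con_eps (a b) : W.con a * W.eps b = -(W.eps b * W.con a) + if a = b then W.quad else 0 := by
  have : (if a = b then W.quad else 0) = ∑ i, W.x i * (if a = b then W.x i else 0) := by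
    by_cases h : a = b <;> simp [h, quad]
  rw [this]
  simp only [eps, Finset.mul_sum, Finset.sum_mul, ← Finset.sum_neg_distrib,
    ← Finset.sum_add_distrib]
  refine Finset.sum_congr rfl fun i _ => ?_
  rw [← mul_assoc, con_mul_x, mul_assoc, con_mul_t, mul_add, mul_neg, mul_assoc]

theorem div_div (a b) : W.div a * W.div b = -(W.div b * W.div a) := by
  conv_lhs => rw [div.eq_1 W b]
  conv_rhs => rw [div.eq_1 W b]
  simp only [Finset.mul_sum, Finset.sum_mul, ← Finset.sum_neg_distrib]
  refine Finset.sum_congr rfl fun i _ => ?_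
  rw [← mul_assoc, div_mul_d, mul_assoc, div_mul_c, mul_neg, mul_assoc]

theorem eps_eps (a b) : W.eps a * W.eps b = -(W.eps b * W.eps a) := by
  simp only [eps, Finset.mul_sum, Finset.sum_mul, ← Finset.sum_neg_distrib]
  rw [Finset.sum_comm]
  refine Finset.sum_congr rfl fun i _ => Finset.sum_congr rfl fun j _ => ?_
  rw [mul_assoc, ← mul_assoc (W.t a i), ← W.xt, mul_assoc, W.tt, mul_assoc, ← mul_assoc (W.t b j),
    ← W.xt, mul_neg, mul_neg, ← mul_assoc, ← mul_assoc, W.xx, mul_assoc, mul_assoc, mul_assoc]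

theorem eps_sq (a) : W.eps a * W.eps a = 0 := by
  have h1 := W.eps_eps a a
  have h2 : (2 : ℂ) • (W.eps a * W.eps a) = 0 := by
    rw [two_smul]; nth_rewrite 1 [h1]; simp
  simpa using h2

theorem div_sq (a) : W.div a * W.div a = 0 := by
  have h1 := W.div_div a a
  have h2 : (2 : ℂ) • (W.div a * W.div a) = 0 := by
    rw [two_smul]; nth_rewrite 1 [h1]; simp
  simpa using h2

theorem sum_c_mul_t (a b) : ∑ i, W.c a i * W.t b i =
    -W.S b a + if a = b then (Fintype.card κ : ℂ) • 1 else 0 := by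
  by_cases h : a = b
  · simp only [W.ct, h, S, true_and, if_true, Finset.sum_add_distrib, Finset.sum_neg_distrib]
    congr 1
    rw [Finset.sum_const, Finset.card_univ, Nat.cast_smul_eq_nsmul]
  · simp only [W.ct, h, S, false_and, if_false, add_zero, Finset.sum_neg_distrib]

/-- Three sources: the derivative acting on the coordinates gives the Euler operator, the
contraction meeting the exterior factor gives the dimension, and the reordering of `c` and `t` gives
the shift. On a tensor of fixed bidegree and degree the diagonal part is a number, and this is where
the weight conditions on the columns originate. -/
theorem div_eps (a b) : W.div a * W.eps b = -(W.eps b * W.div a) - W.S b a +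
    if a = b then W.eul + (Fintype.card κ : ℂ) • 1 else 0 := by
  have h0 : W.div a * W.eps b = -(W.eps b * W.div a) + (if a = b then W.eul else 0) +
      ∑ i, W.c a i * W.t b i := by
    have : (if a = b then W.eul else 0) = ∑ i, W.x i * (if a = b then W.d i else 0) := by
      by_cases h : a = b <;> simp [h, eul]
    rw [this]
    simp only [eps, Finset.mul_sum, Finset.sum_mul, ← Finset.sum_neg_distrib,
      ← Finset.sum_add_distrib]
    refine Finset.sum_congr rfl fun i _ => ?_
    rw [← mul_assoc, div_mul_x, add_mul, mul_assoc, div_mul_t, mul_add, mul_neg, mul_assoc]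
  rw [h0, sum_c_mul_t]
  by_cases h : a = b
  · simp only [h, if_true]; abel
  · simp only [h, if_false]; abel

theorem S_con (a b e) : W.S a b * W.con e = W.con e * W.S a b - if a = e then W.con b else 0 := by
  have : (if a = e then W.con b else 0) = ∑ i, W.x i * (if a = e then W.c b i else 0) := by
    by_cases h : a = e <;> simp [h, con]
  rw [this]
  simp only [con, Finset.mul_sum, Finset.sum_mul, ← Finset.sum_sub_distrib]
  refine Finset.sum_congr rfl fun i _ => ?_
  rw [← mul_assoc, S_mul_x, mul_assoc, S_mul_c, mul_sub, mul_assoc]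

theorem S_div (a b e) : W.S a b * W.div e = W.div e * W.S a b - if a = e then W.div b else 0 := by
  have : (if a = e then W.div b else 0) = ∑ i, W.d i * (if a = e then W.c b i else 0) := by
    by_cases h : a = e <;> simp [h, div]
  rw [this]
  simp only [div, Finset.mul_sum, Finset.sum_mul, ← Finset.sum_sub_distrib]
  refine Finset.sum_congr rfl fun i _ => ?_
  rw [← mul_assoc, S_mul_d, mul_assoc, S_mul_c, mul_sub, mul_assoc]

theorem S_eps (a b e) : W.S a b * W.eps e = W.eps e * W.S a b + if b = e then W.eps a else 0 := by
  have : (if b = e then W.eps a else 0) = ∑ i, W.x i * (if b = e then W.t a i else 0) := by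
    by_cases h : b = e <;> simp [h, eps]
  rw [this]
  simp only [eps, Finset.mul_sum, Finset.sum_mul, ← Finset.sum_add_distrib]
  refine Finset.sum_congr rfl fun i _ => ?_
  rw [← mul_assoc, S_mul_x, mul_assoc, S_mul_t, mul_add, mul_assoc]

theorem S_S (a b e f) : W.S a b * W.S e f = W.S e f * W.S a b + (if b = e then W.S a f else 0) -
    if a = f then W.S e b else 0 := by
  have h1 : (if b = e then W.S a f else 0) = ∑ i, (if b = e then W.t a i else 0) * W.c f i := by
    by_cases h : b = e <;> simp [h, S]
  have h2 : (if a = f then W.S e b else 0) = ∑ i, W.t e i * (if a = f then W.c b i else 0) := by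
    by_cases h : a = f <;> simp [h, S]
  rw [h1, h2]
  conv_lhs => rw [S.eq_1 W e f]
  conv_rhs => rw [S.eq_1 W e f]
  simp only [Finset.mul_sum, Finset.sum_mul, ← Finset.sum_add_distrib, ← Finset.sum_sub_distrib]
  refine Finset.sum_congr rfl fun i _ => ?_
  rw [← mul_assoc, S_mul_t, add_mul, mul_assoc, S_mul_c, mul_sub, mul_assoc]
  abel

theorem tr_div (a) : W.tr * W.div a = W.div a * W.tr := by
  simp only [div, Finset.mul_sum, Finset.sum_mul]
  refine Finset.sum_congr rfl fun i _ => ?_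
  rw [← mul_assoc, tr_mul_d, mul_assoc, tr_mul_c, mul_assoc]

theorem tr_S (a b) (h : a ≠ b) : W.tr * W.S a b = W.S a b * W.tr := by
  have key : W.tr * W.S a b = W.S a b * W.tr + ∑ i, W.c b i * W.c b i ∨
      W.tr * W.S a b = W.S a b * W.tr - ∑ i, W.c b i * W.c b i := by
    cases a <;> cases b
    · exact absurd rfl h
    · left
      simp only [S, Finset.mul_sum, Finset.sum_mul, ← Finset.sum_add_distrib]
      refine Finset.sum_congr rfl fun i _ => ?_
      rw [← mul_assoc, tr_mul_t_false, add_mul, mul_assoc, tr_mul_c, mul_assoc]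
    · right
      simp only [S, Finset.mul_sum, Finset.sum_mul, ← Finset.sum_sub_distrib]
      refine Finset.sum_congr rfl fun i _ => ?_
      rw [← mul_assoc, tr_mul_t_true, sub_mul, mul_assoc, tr_mul_c, mul_assoc]
    · exact absurd rfl h
  simpa [sum_c_mul_c] using key

theorem tr_eps_true : W.tr * W.eps true = W.eps true * W.tr - W.con false := by
  simp only [eps, con, Finset.mul_sum, Finset.sum_mul, ← Finset.sum_sub_distrib]
  refine Finset.sum_congr rfl fun i _ => ?_
  rw [← mul_assoc, tr_mul_x, mul_assoc, tr_mul_t_true, mul_sub, mul_assoc]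

theorem tr_eps_false : W.tr * W.eps false = W.eps false * W.tr + W.con true := by
  simp only [eps, con, Finset.mul_sum, Finset.sum_mul, ← Finset.sum_add_distrib]
  refine Finset.sum_congr rfl fun i _ => ?_
  rw [← mul_assoc, tr_mul_x, mul_assoc, tr_mul_t_false, mul_add, mul_assoc]

end Quadratic

end WeylClifford

end WeylClifford

end AmbientLift

/-! ### Null cones in Weyl–Clifford modules and uniqueness of harmonic elements. -/

namespace AmbientLift

namespace WeylClifford

variable {κ : Type} [Fintype κ] [DecidableEq κ] {M : Type} [AddCommGroup M] [Module ℂ M]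
  (W : WeylClifford κ M)

/-- Multiplication by the linear form with coefficients `q`. -/
def lin (q : κ → ℂ) : Module.End ℂ M := ∑ i, q i • W.x i
/-- Differentiation in the direction `q`. -/
def dir (q : κ → ℂ) : Module.End ℂ M := ∑ i, q i • W.d i
/-- Contraction with `q`. -/
def conDir (q : κ → ℂ) (a : Bool) : Module.End ℂ M := ∑ i, q i • W.c a i

section Applied

variable (v : M)

theorem eul_con' (a) : W.eul (W.con a v) = W.con a (W.eul v) + W.con a v :=
  congrArg (· v) (W.eul_con a)
theorem eul_div' (a) : W.eul (W.div a v) = W.div a (W.eul v) - W.div a v :=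
  congrArg (· v) (W.eul_div a)
theorem eul_eps' (a) : W.eul (W.eps a v) = W.eps a (W.eul v) + W.eps a v :=
  congrArg (· v) (W.eul_eps a)
theorem eul_S' (a b) : W.eul (W.S a b v) = W.S a b (W.eul v) := congrArg (· v) (W.eul_S a b)
theorem eul_tr' : W.eul (W.tr v) = W.tr (W.eul v) := congrArg (· v) W.eul_tr
theorem eul_d' (i) : W.eul (W.d i v) = W.d i (W.eul v) - W.d i v :=
  congrArg (· v) (W.eul_mul_d i)
theorem lap_con' (a) : W.lap (W.con a v) = W.con a (W.lap v) + (2 : ℤ) • W.div a v :=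
  congrArg (· v) (W.lap_con a)
theorem lap_div' (a) : W.lap (W.div a v) = W.div a (W.lap v) := congrArg (· v) (W.lap_div a)
theorem lap_S' (a b) : W.lap (W.S a b v) = W.S a b (W.lap v) := congrArg (· v) (W.lap_S a b)
theorem lap_tr' : W.lap (W.tr v) = W.tr (W.lap v) := congrArg (· v) W.lap_tr
theorem lap_d' (i) : W.lap (W.d i v) = W.d i (W.lap v) := congrArg (· v) (W.lap_mul_d i)
theorem lap_quad' : W.lap (W.quad v) = W.quad (W.lap v) + (4 : ℂ) • W.eul v +
    (2 * (Fintype.card κ : ℂ)) • v := congrArg (· v) W.lap_quad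
theorem con_eps' (a b) : W.con a (W.eps b v) =
    -(W.eps b (W.con a v)) + if a = b then W.quad v else 0 :=
  (congrArg (· v) (W.con_eps a b)).trans (by by_cases h : a = b <;> simp [h])
theorem con_div_self' (a) : W.con a (W.div a v) = -(W.div a (W.con a v)) :=
  (congrArg (· v) (W.con_div a a)).trans (by simp [W.sum_c_mul_c])
theorem con_div_tf' : W.con true (W.div false v) = -(W.div false (W.con true v)) - W.tr v :=
  congrArg (· v) (W.con_div true false)
theorem con_div_ft' : W.con false (W.div true v) = -(W.div true (W.con false v)) + W.tr v := by
  have h := congrArg (· v) (W.con_div false true)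
  have h2 : ∑ i, W.c false i * W.c true i = -W.tr := by
    simp only [tr, W.cc false true, Finset.sum_neg_distrib]
  rw [h2] at h
  simpa using h
theorem div_sq' (a) : W.div a (W.div a v) = 0 := congrArg (· v) (W.div_sq a)
theorem eps_eps' (a b) : W.eps a (W.eps b v) = -(W.eps b (W.eps a v)) :=
  congrArg (· v) (W.eps_eps a b)
theorem eps_sq' (a) : W.eps a (W.eps a v) = 0 := congrArg (· v) (W.eps_sq a)
theorem div_eps_self' (a) : W.div a (W.eps a v) = -(W.eps a (W.div a v)) - W.S a a v +
    W.eul v + (Fintype.card κ : ℂ) • v :=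
  (congrArg (· v) (W.div_eps a a)).trans (by simp [add_assoc])
theorem div_eps_ne' {a b} (h : a ≠ b) :
    W.div a (W.eps b v) = -(W.eps b (W.div a v)) - W.S b a v :=
  (congrArg (· v) (W.div_eps a b)).trans (by simp [h])
theorem S_con' (a b e) : W.S a b (W.con e v) =
    W.con e (W.S a b v) - if a = e then W.con b v else 0 :=
  (congrArg (· v) (W.S_con a b e)).trans (by by_cases h : a = e <;> simp [h])
theorem S_div' (a b e) : W.S a b (W.div e v) =
    W.div e (W.S a b v) - if a = e then W.div b v else 0 :=
  (congrArg (· v) (W.S_div a b e)).trans (by by_cases h : a = e <;> simp [h])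
theorem S_eps' (a b e) : W.S a b (W.eps e v) =
    W.eps e (W.S a b v) + if b = e then W.eps a v else 0 :=
  (congrArg (· v) (W.S_eps a b e)).trans (by by_cases h : b = e <;> simp [h])
theorem S_S' (a b e f) : W.S a b (W.S e f v) = W.S e f (W.S a b v) +
    (if b = e then W.S a f v else 0) - if a = f then W.S e b v else 0 :=
  (congrArg (· v) (W.S_S a b e f)).trans (by
    by_cases h : b = e <;> by_cases h' : a = f <;> simp [h, h'])
theorem tr_div' (a) : W.tr (W.div a v) = W.div a (W.tr v) := congrArg (· v) (W.tr_div a)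
theorem tr_S' {a b} (h : a ≠ b) : W.tr (W.S a b v) = W.S a b (W.tr v) :=
  congrArg (· v) (W.tr_S a b h)
theorem tr_eps_true' : W.tr (W.eps true v) = W.eps true (W.tr v) - W.con false v :=
  congrArg (· v) W.tr_eps_true
theorem tr_eps_false' : W.tr (W.eps false v) = W.eps false (W.tr v) + W.con true v :=
  congrArg (· v) W.tr_eps_false

end Applied

/-- The data of a null cone: a null vector `q` whose linear form is invertible, the submodule of
elements which vanish on the cone, and the derivations tangent to the cone. -/
structure ConeData where
  q : κ → ℂ
  q_null : ∑ i, q i * q i = 0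
  li : Module.End ℂ M
  K : Submodule ℂ M
  li_lin : li * W.lin q = 1
  lin_li : W.lin q * li = 1
  li_x : ∀ i, li * W.x i = W.x i * li
  li_c : ∀ a i, li * W.c a i = W.c a i * li
  li_t : ∀ a i, li * W.t a i = W.t a i * li
  K_x : ∀ i, ∀ u ∈ K, W.x i u ∈ K
  K_c : ∀ a i, ∀ u ∈ K, W.c a i u ∈ K
  K_t : ∀ a i, ∀ u ∈ K, W.t a i u ∈ K
  K_li : ∀ u ∈ K, li u ∈ K
  K_quad : ∀ u, W.quad u ∈ K
  -- The vector field l·∂_i − x_i·∂_q annihilates the quadratic form, hence is tangent to the cone.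
  K_tan : ∀ i, ∀ u ∈ K, W.lin q (W.d i u) - W.x i (W.dir q u) ∈ K
  -- The algebraic form of the statement that a jet along the cone is determined by the values of
  -- all its derivatives on the cone.
  sep : ∀ S : Set M, (∀ u ∈ S, u ∈ K) → (∀ u ∈ S, ∀ i, W.d i u ∈ S) → ∀ u ∈ S, u = 0

namespace ConeData

variable {W} (D : W.ConeData)

/-- The invertible linear form. -/
def l : Module.End ℂ M := W.lin D.q
/-- The derivative in the null direction. -/
def p : Module.End ℂ M := W.dir D.q

theorem K_sum {A : κ → Module.End ℂ M} {u : M} (h : ∀ i, A i u ∈ D.K) : (∑ i, A i) u ∈ D.K := by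
  rw [LinearMap.sum_apply]
  exact D.K.sum_mem fun i _ => h i

theorem K_l {u : M} (h : u ∈ D.K) : D.l u ∈ D.K :=
  D.K_sum fun i => D.K.smul_mem _ (D.K_x i u h)

theorem K_conDir {u : M} (a : Bool) (h : u ∈ D.K) : W.conDir D.q a u ∈ D.K :=
  D.K_sum fun i => D.K.smul_mem _ (D.K_c a i u h)

theorem K_con {u : M} (a : Bool) (h : u ∈ D.K) : W.con a u ∈ D.K :=
  D.K_sum fun i => D.K_x i _ (D.K_c a i u h)

theorem K_eps {u : M} (a : Bool) (h : u ∈ D.K) : W.eps a u ∈ D.K :=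
  D.K_sum fun i => D.K_x i _ (D.K_t a i u h)

theorem K_S {u : M} (a b : Bool) (h : u ∈ D.K) : W.S a b u ∈ D.K :=
  D.K_sum fun i => D.K_t a i _ (D.K_c b i u h)

theorem K_tr {u : M} (h : u ∈ D.K) : W.tr u ∈ D.K :=
  D.K_sum fun i => D.K_c true i _ (D.K_c false i u h)

theorem li_l (u : M) : D.li (D.l u) = u := congrArg (· u) D.li_lin

theorem l_li (u : M) : D.l (D.li u) = u := congrArg (· u) D.lin_li

theorem mem_of_l_mem {u : M} (h : D.l u ∈ D.K) : u ∈ D.K := by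
  rw [← D.li_l u]
  exact D.K_li _ h

theorem mem_of_smul_mem {u : M} {a : ℂ} (ha : a ≠ 0) (h : a • u ∈ D.K) : u ∈ D.K := by
  have := D.K.smul_mem a⁻¹ h
  rwa [smul_smul, inv_mul_cancel₀ ha, one_smul] at this

/-- Tangential derivatives preserve `K`, and `l * d i` differs from a tangential one only by `x i *
p`. Thus the single transversal derivative `p` decides whether all first derivatives vanish on the
cone. -/
theorem d_mem {u : M} (h : u ∈ D.K) (hp : D.p u ∈ D.K) (i : κ) : W.d i u ∈ D.K := by
  refine D.mem_of_l_mem ?_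
  have := D.K.add_mem (D.K_tan i u h) (D.K_x i _ hp)
  simpa [l, p] using this

theorem d_l (i : κ) : W.d i * D.l = D.l * W.d i + D.q i • 1 := by
  simp only [l, lin, Finset.mul_sum, Finset.sum_mul, mul_smul_comm, smul_mul_assoc, W.dx, smul_add,
    Finset.sum_add_distrib]
  simp

theorem x_l (i : κ) : W.x i * D.l = D.l * W.x i := by
  simp only [l, lin, Finset.mul_sum, Finset.sum_mul, mul_smul_comm, smul_mul_assoc, W.xx i]

theorem p_x (i : κ) : D.p * W.x i = W.x i * D.p + D.q i • 1 := by
  simp only [p, dir, Finset.mul_sum, Finset.sum_mul, mul_smul_comm, smul_mul_assoc, W.dx, smul_add,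
    Finset.sum_add_distrib]
  simp

theorem p_d (i : κ) : D.p * W.d i = W.d i * D.p := by
  simp only [p, dir, Finset.mul_sum, Finset.sum_mul, mul_smul_comm, smul_mul_assoc, W.dd _ i]

theorem p_l : D.p * D.l = D.l * D.p := by
  have : D.p * D.l = D.l * D.p + (∑ i, D.q i * D.q i) • 1 := by
    conv_lhs => rw [l, lin, Finset.mul_sum]
    conv_rhs => rw [l, lin, Finset.sum_mul, Finset.sum_smul, ← Finset.sum_add_distrib]
    refine Finset.sum_congr rfl fun i _ => ?_
    rw [mul_smul_comm, p_x, smul_add, smul_mul_assoc, smul_smul]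
  rw [this, D.q_null]; simp

theorem eul_p (u : M) : W.eul (D.p u) = D.p (W.eul u) - D.p u := by
  simp only [p, dir, LinearMap.sum_apply, map_sum, LinearMap.smul_apply, map_smul, eul_d',
    smul_sub, Finset.sum_sub_distrib]

/-- The sum of the squares of the tangential derivations. -/
theorem sum_tan_sq : ∑ i, (D.l * W.d i - W.x i * D.p) * (D.l * W.d i - W.x i * D.p) =
    D.l * (D.l * W.lap - (2 : ℂ) • (W.eul * D.p) - ((Fintype.card κ : ℂ) - 2) • D.p) +
      W.quad * (D.p * D.p) := by
  have key : ∀ i, (D.l * W.d i - W.x i * D.p) * (D.l * W.d i - W.x i * D.p) =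
      D.l * (D.l * (W.d i * W.d i)) + D.l * (D.q i • W.d i) - D.l * ((W.d i * W.x i) * D.p)
      - D.l * ((W.x i * W.d i) * D.p) + (W.x i * W.x i) * (D.p * D.p) +
        (D.q i • W.x i) * D.p := by
    intro i
    have e1 : W.d i * (D.l * W.d i) = D.l * (W.d i * W.d i) + D.q i • W.d i := by
      rw [← mul_assoc, d_l, add_mul, smul_mul_assoc, one_mul, mul_assoc]
    have e2 : D.p * (D.l * W.d i) = D.l * (W.d i * D.p) := by
      rw [← mul_assoc, p_l, mul_assoc, p_d]
    have e3 : D.p * (W.x i * D.p) = W.x i * (D.p * D.p) + D.q i • D.p := by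
      rw [← mul_assoc, p_x, add_mul, smul_mul_assoc, one_mul, mul_assoc]
    have e4 : W.x i * (D.l * (W.d i * D.p)) = D.l * (W.x i * (W.d i * D.p)) := by
      rw [← mul_assoc, x_l, mul_assoc]
    simp only [sub_mul, mul_sub, mul_assoc, e1, e2, e3, e4, mul_add, smul_mul_assoc, mul_smul_comm]
    abel
  rw [Finset.sum_congr rfl fun i _ => key i]
  simp only [Finset.sum_add_distrib, Finset.sum_sub_distrib, ← Finset.mul_sum, ← Finset.sum_mul,
    W.sum_d_mul_x, ← eul.eq_1, ← quad.eq_1, ← lap.eq_1]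
  change D.l * (D.l * W.lap) + D.l * D.p - D.l * ((W.eul + (Fintype.card κ : ℂ) • 1) * D.p) -
    D.l * (W.eul * D.p) + W.quad * (D.p * D.p) + D.l * D.p = _
  simp only [mul_sub, add_mul, mul_add, mul_smul_comm, smul_mul_assoc, one_mul]
  module

/-- For u = Qg one has ∂_q u = 2lg and Δu = (4(m − 2) + 2N)g on the cone, which explains the
constant. The proof needs no division by Q: the sum of squares of the tangential derivations maps
`K` to itself, and `sum_tan_sq` expresses it through Δ and ∂_q modulo Q. -/
theorem lap_sub_mem {u : M} {m : ℂ} (h : u ∈ D.K) (hm : W.eul u = m • u) :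
    D.l (W.lap u) - (2 * m + Fintype.card κ - 4) • D.p u ∈ D.K := by
  refine D.mem_of_l_mem ?_
  have h1 : (∑ i, (D.l * W.d i - W.x i * D.p) * (D.l * W.d i - W.x i * D.p)) u ∈ D.K :=
    D.K_sum fun i => D.K_tan i _ (D.K_tan i u h)
  rw [sum_tan_sq] at h1
  have h2 := D.K.sub_mem h1 (D.K_quad (D.p (D.p u)))
  convert h2 using 1
  simp only [LinearMap.add_apply, Module.End.mul_apply, add_sub_cancel_right,
    LinearMap.sub_apply, LinearMap.smul_apply, eul_p, hm]
  congr 1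
  simp only [map_smul]
  module

/-- A harmonic element which vanishes on the cone is zero, unless its degree is exceptional. -/
theorem eq_zero_of_lap {u : M} {m : ℂ} (h : u ∈ D.K) (hm : W.eul u = m • u) (hl : W.lap u = 0)
    (hk : ∀ k : ℕ, 1 ≤ k → 2 * m + Fintype.card κ - 2 ≠ 2 * k) : u = 0 := by
  -- Harmonic elements of `K` whose degree is m − j for some j form a set stable under derivatives.
  -- In degree m − j the decisive factor is 2(m − j) + N − 4, which is nonzero by `hk` at k = j + 1.
  refine D.sep {v | v ∈ D.K ∧ W.lap v = 0 ∧ ∃ j : ℕ, W.eul v = (m - j) • v}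
    (fun v hv => hv.1) ?_ u ⟨h, hl, 0, by simpa using hm⟩
  rintro v ⟨h1, h2, j, h3⟩ i
  refine ⟨D.d_mem h1 ?_ i, by rw [lap_d', h2, map_zero], j + 1, ?_⟩
  · have := D.lap_sub_mem h1 h3
    rw [h2, map_zero, zero_sub, ← neg_smul] at this
    refine D.mem_of_smul_mem ?_ this
    intro h0
    have := hk (j + 1) (by omega)
    apply this
    push_cast
    linear_combination -h0
  · rw [eul_d', h3, map_smul]
    push_cast
    module

/-- An element with harmonic derivatives vanishing to second order on the cone is zero. -/
theorem eq_zero_of_lap' {u : M} {m : ℂ} (h : u ∈ D.K) (hp : D.p u ∈ D.K)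
    (hm : W.eul u = (m + 1) • u) (hl : W.lap u = 0)
    (hk : ∀ k : ℕ, 1 ≤ k → 2 * m + Fintype.card κ - 2 ≠ 2 * k) : u = 0 := by
  -- The degree is m + 1, for which the first factor 2m + N − 2 may vanish. Vanishing to second
  -- order replaces that first step, and the derivatives have the permitted degree m.
  have h1 : ∀ i, W.d i u = 0 := fun i => by
    refine D.eq_zero_of_lap (m := m) (D.d_mem h hp i) ?_ (by rw [lap_d', hl, map_zero]) hk
    rw [eul_d', hm, map_smul]
    module
  refine D.sep {v | v = u ∨ v = 0} ?_ ?_ u (Or.inl rfl)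
  · rintro v (rfl | rfl)
    exacts [h, D.K.zero_mem]
  · rintro v (rfl | rfl) i
    exacts [Or.inr (h1 i), Or.inr (map_zero _)]

end ConeData

end WeylClifford

end AmbientLift

/-! ### The correction along the cone and why its harmonic extension solves all equations. -/

namespace AmbientLift

namespace WeylClifford

variable {κ : Type} [Fintype κ] [DecidableEq κ] {M : Type} [AddCommGroup M] [Module ℂ M]
  (W : WeylClifford κ M)

/-- Elements of bidegree `(r, s)` with component degree `m` which are trace-free and satisfy the
Bianchi identity. -/
structure IsIrred (m : ℂ) (r s : ℕ) (F : M) : Prop where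
  eul : W.eul F = m • F
  left : W.S true true F = (r : ℂ) • F
  right : W.S false false F = (s : ℂ) • F
  young : W.S true false F = 0
  tr : W.tr F = 0

/-- The part of the first divergence which satisfies the Bianchi identity. -/
def divYoung (k : ℂ) (F : M) : M := W.div true F + k • W.S false true (W.div false F)

/-- The correction of `F` along the cone by terms containing the dual of the Euler field. -/
def corrected (a b k : ℂ) (F : M) : M :=
  F + a • W.eps true (W.divYoung k F) +
    b • (W.eps false (W.div false F) - k • W.eps true (W.S false true (W.div false F))) -
    (a * b) • W.eps true (W.eps false (W.div true (W.div false F)))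

/-- The quotient by the quadratic form of the Euler contraction of the corrected element. -/
def correctedCon (a b k : ℂ) (F : M) : M :=
  a • W.divYoung k F - (b * k) • W.S false true (W.div false F) -
    (a * b) • W.eps false (W.div true (W.div false F))

theorem S_tf_ft (v : M) : W.S true false (W.S false true v) =
    W.S false true (W.S true false v) + W.S true true v - W.S false false v := by
  simp [W.S_S' v true false false true]

theorem S_tt_ft (v : M) : W.S true true (W.S false true v) =
    W.S false true (W.S true true v) - W.S false true v := by
  simp [W.S_S' v true true false true]

section Corrected

variable {W} {m a b k : ℂ} {r s : ℕ} {F : M} (hF : W.IsIrred m r s F)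

include hF

/-- The shift `S true false` sends `div true F` to `-div false F`, and multiplies `div false F` by r
− (s − 1) when composed with `S false true`. This dictates the value of `k`. -/
theorem IsIrred.S_divYoung (hk : k * ((r : ℂ) - s + 1) = 1) :
    W.S true false (W.divYoung k F) = 0 := by
  simp only [divYoung, map_add, map_sub, map_smul, S_div', S_tf_ft, hF.young, hF.left, hF.right,
    reduceIte, Bool.false_eq_true, Bool.true_eq_false, sub_zero, add_zero, map_zero]
  linear_combination (norm := module) hk • (W.div false F)

/-- The same value of `k` projects the term with `eps false` to the correct Young type; the last
term survives no shift because `eps true` and `div false` square to zero. -/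
theorem IsIrred.young_corrected (hk : k * ((r : ℂ) - s + 1) = 1) :
    W.S true false (W.corrected a b k F) = 0 := by
  simp only [corrected, map_add, map_sub, map_smul, S_eps', hF.S_divYoung hk, hF.young,
    S_div', S_tf_ft, hF.left, hF.right, W.eps_sq', W.div_sq', map_neg,
    reduceIte, Bool.false_eq_true, Bool.true_eq_false, sub_zero, add_zero, map_zero]
  linear_combination (norm := module) (-b * hk) • (W.eps true (W.div false F))

theorem IsIrred.eul_corrected : W.eul (W.corrected a b k F) = m • W.corrected a b k F := by
  simp only [corrected, divYoung, map_add, map_sub, map_smul, eul_eps', eul_S', eul_div', hF.eul]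
  module

theorem IsIrred.con_div (hc : ∀ e, W.con e F = 0) (e f : Bool) : W.con e (W.div f F) = 0 := by
  cases e <;> cases f <;> simp [con_div_self', con_div_ft', con_div_tf', hc, hF.tr]

theorem IsIrred.con_div_div (hc : ∀ e, W.con e F = 0) (e : Bool) :
    W.con e (W.div true (W.div false F)) = 0 := by
  cases e
  · rw [con_div_ft', hF.con_div hc, tr_div', hF.tr]; simp
  · rw [con_div_self', hF.con_div hc]; simp

theorem IsIrred.con_S_div (hc : ∀ e, W.con e F = 0) (e : Bool) :
    W.con e (W.S false true (W.div false F)) = 0 := by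
  have := W.S_con' (W.div false F) false true e
  rw [hF.con_div hc] at this
  cases e
  · simpa [hF.con_div hc] using this.symm
  · simpa using this.symm

theorem IsIrred.con_divYoung (hc : ∀ e, W.con e F = 0) (e : Bool) :
    W.con e (W.divYoung k F) = 0 := by
  simp [divYoung, hF.con_div hc, hF.con_S_div hc]

/-- All divergences of `F` and their shifts are annihilated by contraction with X, so only the
exterior factors respond, each meeting of equal columns giving the quadratic form. -/
theorem IsIrred.con_corrected (hc : ∀ e, W.con e F = 0) :
    W.con true (W.corrected a b k F) = W.quad (W.correctedCon a b k F) := by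
  simp only [corrected, correctedCon, map_add, map_sub, map_smul, con_eps', hc,
    hF.con_divYoung hc, hF.con_S_div hc, hF.con_div hc, hF.con_div_div hc]
  simp
  module

/-- The trace passes an exterior factor at the cost of a contraction in the other column. Only the
term with two such factors leaves a residue, and this residue vanishes on the cone, which is all
that the harmonic extension needs. -/
theorem IsIrred.tr_corrected (hc : ∀ e, W.con e F = 0) :
    W.tr (W.corrected a b k F) = (a * b) • W.quad (W.div true (W.div false F)) := by
  have h1 : W.tr (W.divYoung k F) = 0 := by
    simp [divYoung, tr_div', tr_S', hF.tr]
  simp only [corrected, map_add, map_sub, map_smul, tr_eps_true', tr_eps_false', h1,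
    tr_S' _ _ (show false ≠ true by decide), tr_div', hF.tr,
    con_eps', hF.con_divYoung hc, hF.con_S_div hc, hF.con_div hc, hF.con_div_div hc]
  simp

/-- The factor 2 is essential. Adding Qg to the corrected element changes its Euler contraction by
Q(X⌟g) and, on the cone, its divergence by 2(X⌟g). So when the contraction is QG and the divergence
is 2G, the single condition X⌟g = −G on the cone removes both. The coefficients are chosen to
achieve this: a = −1/β, b = −1/(β + r − s + 1), k = 1/(r − s + 1) with β = m + N − 2 − r. -/
theorem IsIrred.div_corrected
    (hab : ((m + Fintype.card κ - 2 - r) * a = -1 ∧ (W.div false F = 0 ∨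
      (k * ((r : ℂ) - s + 1) = 1 ∧ (m + Fintype.card κ - 2 - r + (r - s + 1)) * b = -1))) ∨
      (W.div true F = 0 ∧ W.div false F = 0)) :
    W.div true (W.corrected a b k F) = (2 : ℂ) • W.correctedCon a b k F := by
  set β : ℂ := m + Fintype.card κ - 2 - r with hβ
  have hT : ∀ v, W.div true (W.S false true v) = W.S false true (W.div true v) := fun v => by
    rw [S_div']; simp
  -- In normal order four kinds of terms remain; their coefficients give the equations for a, b and
  -- k.
  have h1 : W.div true (W.corrected a b k F) - (2 : ℂ) • W.correctedCon a b k F =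
      (1 + β * a) • W.divYoung k F - (k + b + b * k * β) • W.S false true (W.div false F) -
      (b * (1 + a * β)) • W.eps false (W.div true (W.div false F)) +
      (-a * k + b * k - a * b) •
        W.eps true (W.S false true (W.div true (W.div false F))) := by
    simp only [corrected, correctedCon, divYoung, map_add, map_sub, map_smul, div_eps_self',
      div_eps_ne' _ _ (show true ≠ false by decide), div_sq', hT,
      S_eps', S_tt_ft, fun v e => W.S_div' v true true e, eul_eps', eul_S', eul_div', hF.eul,
      hF.left, hβ, map_neg, W.div_sq',
      reduceIte, Bool.false_eq_true, Bool.true_eq_false, sub_zero, add_zero, map_zero]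
    module
  rw [← sub_eq_zero, h1]
  -- The first case occurs without a second column, where only a matters; the last for scalars,
  -- where every correction term is zero.
  rcases hab with ⟨ha, h2 | ⟨hk, hb⟩⟩ | ⟨h2, h3⟩
  · simp only [h2, map_zero, smul_zero]
    linear_combination (norm := module) ha • W.divYoung k F
  · have hβk : k + b + b * k * β = 0 := by
      linear_combination k * hb - b * hk
    have hz : -a * k + b * k - a * b = 0 := by
      linear_combination (b * k) * ha - a * hβk
    rw [hβk, hz, show 1 + β * a = 0 by linear_combination ha,
      show b * (1 + a * β) = 0 by linear_combination b * ha]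
    simp
  · simp [divYoung, h2, h3]

end Corrected

/-- The corrected element, extended harmonically, solves all the equations. -/
theorem ConeData.solves (D : W.ConeData) {m a b k : ℂ} {r s : ℕ} {F₀ F : M}
    (hF₀ : W.IsIrred m r s F₀) (hc : ∀ e, W.con e F₀ = 0)
    (hk : k * ((r : ℂ) - s + 1) = 1)
    (hab : ((m + Fintype.card κ - 2 - r) * a = -1 ∧ (W.div false F₀ = 0 ∨
      (k * ((r : ℂ) - s + 1) = 1 ∧ (m + Fintype.card κ - 2 - r + (r - s + 1)) * b = -1))) ∨
      (W.div true F₀ = 0 ∧ W.div false F₀ = 0))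
    (hm : ∀ j : ℕ, 1 ≤ j → 2 * m + Fintype.card κ - 2 ≠ 2 * j)
    (hF : W.eul F = m • F) (hl : W.lap F = 0) (hK : F - W.corrected a b k F₀ ∈ D.K) :
    W.S true false F = 0 ∧ W.tr F = 0 ∧ W.div true F = 0 ∧ ∀ e, W.con e F = 0 := by
  set F₁ := W.corrected a b k F₀
  set G := W.correctedCon a b k F₀
  have e1 : W.eul F₁ = m • F₁ := hF₀.eul_corrected
  -- The Young defect, and likewise the trace below, commutes with Δ and preserves the degree; both
  -- vanish on the cone because they do so for `F₁`.
  have hy : W.S true false F = 0 := by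
    refine D.eq_zero_of_lap (m := m) ?_ (by rw [eul_S', hF, map_smul])
      (by rw [lap_S', hl, map_zero]) hm
    have := D.K_S true false hK
    rwa [map_sub, hF₀.young_corrected hk, sub_zero] at this
  have ht : W.tr F = 0 := by
    refine D.eq_zero_of_lap (m := m) ?_ (by rw [eul_tr', hF, map_smul])
      (by rw [lap_tr', hl, map_zero]) hm
    have := D.K.add_mem (D.K_tr hK)
      (D.K.smul_mem (a * b) (D.K_quad (W.div true (W.div false F₀))))
    rwa [map_sub, hF₀.tr_corrected hc, sub_add_cancel] at this
  have hG : W.eul G = (m - 1) • G := by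
    simp only [G, correctedCon, divYoung, map_add, map_sub, map_smul, eul_eps', eul_S', eul_div',
      hF₀.eul]
    module
  have hcon : W.con true F₁ = W.quad G := hF₀.con_corrected hc
  have hdiv : W.div true F₁ = (2 : ℂ) • G := hF₀.div_corrected hab
  set E := F - F₁ with hE
  have eE : W.eul E = m • E := by rw [hE, map_sub, hF, e1, smul_sub]
  have hc0 : 2 * m + (Fintype.card κ : ℂ) - 4 ≠ 0 := fun h => by
    refine hm 1 le_rfl ?_
    push_cast
    linear_combination h
  have hpcon : D.p (W.con true E) = W.conDir D.q true E + W.con true (D.p E) := by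
    have h2 : D.p * W.con true = W.conDir D.q true + W.con true * D.p := by
      simp only [p, dir, conDir, Finset.sum_mul, Finset.mul_sum, smul_mul_assoc, mul_smul_comm,
        W.con_mul_d, smul_sub, Finset.sum_sub_distrib]
      abel
    exact congrArg (· E) h2
  -- Writing E = Qg, where ∂_q E = 2lg on the cone, this is X⌟g = −G there. It results from
  -- contracting ΔE = −ΔF₁ with X: on the cone X⌟ΔF₁ = Δ(QG) − 4G = 2(2m + N − 4)G, and X⌟ΔE carries
  -- the same nonzero constant through `lap_sub_mem`.
  have hpE : W.con true (D.p E) + (2 : ℂ) • D.l G ∈ D.K := by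
    have h1 := D.K_con true (D.lap_sub_mem hK eE)
    have hlE : W.lap E = -W.lap F₁ := by rw [hE, map_sub, hl, zero_sub]
    have h3 : W.con true (W.lap F₁) = W.quad (W.lap G) +
        (2 * (2 * m + (Fintype.card κ : ℂ) - 4)) • G := by
      have := W.lap_con' F₁ true
      rw [hcon, hdiv, lap_quad', hG] at this
      linear_combination (norm := module) -this
    have hconl : ∀ v, W.con true (D.l v) = D.l (W.con true v) := fun v => by
      have h2 : W.con true * D.l = D.l * W.con true := by
        simp only [l, lin, Finset.sum_mul, Finset.mul_sum, smul_mul_assoc, mul_smul_comm,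
          W.con_mul_x]
      exact congrArg (· v) h2
    rw [map_sub, hlE, map_neg, map_neg, map_smul, hconl, h3] at h1
    refine D.mem_of_smul_mem hc0 ?_
    have h4 := D.K.neg_mem (D.K.add_mem h1 (D.K_l (D.K_quad (W.lap G))))
    convert h4 using 1
    simp only [map_add, map_smul]
    module
  -- The contraction of the tangential derivatives of E vanishes on the cone, so there l·div E
  -- equals X⌟∂_q E = −2lG, which cancels the divergence 2G of `F₁`. The degree drops to m − 1,
  -- which shifts the excluded index by one.
  have hdF : W.div true F = 0 := by
    refine D.eq_zero_of_lap (m := m - 1) ?_ (by rw [eul_div', hF, map_smul]; module)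
      (by rw [lap_div', hl, map_zero]) ?_
    · have h1 : D.l (W.div true E) - W.con true (D.p E) ∈ D.K := by
        have h2 : (∑ i, W.c true i * (D.l * W.d i - W.x i * D.p)) E ∈ D.K :=
          D.K_sum fun i => D.K_c true i _ (D.K_tan i E hK)
        convert h2 using 1
        have h3 : D.l * W.div true - W.con true * D.p =
            ∑ i, W.c true i * (D.l * W.d i - W.x i * D.p) := by
          have hcl : ∀ i, W.c true i * D.l = D.l * W.c true i := fun i => by
            simp only [l, lin, Finset.sum_mul, Finset.mul_sum, smul_mul_assoc, mul_smul_comm,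
              W.xc]
          simp only [mul_sub, Finset.sum_sub_distrib, ← mul_assoc, hcl, ← W.xc, div, con,
            Finset.mul_sum, Finset.sum_mul, W.dc]
        exact congrArg (· E) h3
      have h2 := D.K.add_mem h1 hpE
      refine D.mem_of_l_mem ?_
      have h3 : W.div true F = W.div true E + (2 : ℂ) • G := by
        rw [hE, map_sub, hdiv]; abel
      rw [h3, map_add, map_smul]
      convert h2 using 1
      abel
    · intro j hj h
      refine hm (j + 1) (by omega) ?_
      push_cast
      linear_combination h
  -- The contraction is harmonic only now that the divergence is zero. It has degree m + 1, so
  -- vanishing on the cone alone would not suffice and its derivative along q is controlled as well.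
  have hct : W.con true F = 0 := by
    have h1 : W.con true F = W.con true E + W.quad G := by rw [hE, map_sub, hcon]; abel
    refine D.eq_zero_of_lap' (m := m) ?_ ?_ (by rw [eul_con', hF, map_smul]; module)
      (by rw [lap_con', hl, map_zero, hdF]; simp) hm
    · rw [h1]
      exact D.K.add_mem (D.K_con true hK) (D.K_quad _)
    · have h2 : D.p (W.quad G) = W.quad (D.p G) + (2 : ℂ) • D.l G := by
        have h3 : D.p * W.quad = W.quad * D.p + (2 : ℂ) • D.l := by
          simp only [p, dir, l, lin, Finset.sum_mul, Finset.mul_sum, smul_mul_assoc,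
            mul_smul_comm, W.quad_mul_d, smul_sub, Finset.sum_sub_distrib, Finset.smul_sum]
          rw [eq_comm, sub_add_eq_add_sub, add_sub_assoc]
          simp only [smul_comm (2 : ℂ), ← Finset.sum_sub_distrib]
          rw [add_eq_left]
          refine Finset.sum_eq_zero fun i _ => ?_
          module
        exact congrArg (· G) h3
      rw [h1, map_add, hpcon, h2]
      have := D.K.add_mem (D.K.add_mem (D.K_conDir true hK) hpE) (D.K_quad (D.p G))
      convert this using 1
      abel
  refine ⟨hy, ht, hdF, fun e => ?_⟩
  -- The contraction in the second column is the commutator of `S true false` with the contraction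
  -- in the first column.
  cases e
  · have := W.S_con' F true false true
    rw [hct, hy] at this
    simpa using this.symm
  · exact hct

end WeylClifford

end AmbientLift

/-! ### Uniqueness: a solution is determined by its restriction to the cone. -/

namespace AmbientLift

namespace WeylClifford

namespace ConeData

variable {κ : Type} [Fintype κ] [DecidableEq κ] {M : Type} [AddCommGroup M] [Module ℂ M]
  {W : WeylClifford κ M} (D : W.ConeData)

/-- Contraction with the transversal vector dual to the Euler field. -/
def kap (a : Bool) : Module.End ℂ M := D.li * W.conDir D.q a

/-- The projection which kills the multiples of the duals of the Euler field. -/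
def pr (v : M) : M := v - W.eps true (D.kap true v) - W.eps false (D.kap false v) -
  W.eps true (W.eps false (D.kap true (D.kap false v)))

/-- The part of the first divergence which is tangent to the cone. -/
def tanDiv : Module.End ℂ M := D.li * (D.l * W.div true - W.con true * D.p)

theorem li_con (a) : D.li * W.con a = W.con a * D.li := by
  simp only [con, Finset.mul_sum, Finset.sum_mul]
  refine Finset.sum_congr rfl fun i _ => ?_
  rw [← mul_assoc, D.li_x, mul_assoc, D.li_c, mul_assoc]

theorem li_eps (a) : D.li * W.eps a = W.eps a * D.li := by
  simp only [eps, Finset.mul_sum, Finset.sum_mul]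
  refine Finset.sum_congr rfl fun i _ => ?_
  rw [← mul_assoc, D.li_x, mul_assoc, D.li_t, mul_assoc]

theorem li_S (a b) : D.li * W.S a b = W.S a b * D.li := by
  simp only [S, Finset.mul_sum, Finset.sum_mul]
  refine Finset.sum_congr rfl fun i _ => ?_
  rw [← mul_assoc, D.li_t, mul_assoc, D.li_c, mul_assoc]

theorem li_conDir (a) : D.li * W.conDir D.q a = W.conDir D.q a * D.li := by
  simp only [conDir, Finset.mul_sum, Finset.sum_mul, mul_smul_comm, smul_mul_assoc, D.li_c]

theorem conDir_conDir (a b) :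
    W.conDir D.q a * W.conDir D.q b = -(W.conDir D.q b * W.conDir D.q a) := by
  simp only [conDir, Finset.mul_sum, Finset.sum_mul, mul_smul_comm, smul_mul_assoc,
    ← Finset.sum_neg_distrib, Finset.smul_sum]
  rw [Finset.sum_comm]
  refine Finset.sum_congr rfl fun i _ => Finset.sum_congr rfl fun j _ => ?_
  rw [W.cc a b]
  module

theorem conDir_eps (a b) : W.conDir D.q a * W.eps b =
    -(W.eps b * W.conDir D.q a) + if a = b then D.l else 0 := by
  have key : ∀ i, W.c a i * W.eps b = -(W.eps b * W.c a i) + if a = b then W.x i else 0 := by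
    intro i
    have : ∀ j, W.c a i * (W.x j * W.t b j) = -(W.x j * W.t b j * W.c a i) +
        if i = j then (if a = b then W.x i else 0) else 0 := by
      intro j
      rw [← mul_assoc, ← W.xc, mul_assoc, W.ct, mul_add, mul_neg, mul_assoc]
      congr 1
      by_cases h : a = b <;> by_cases h' : i = j <;> simp [h, h']
    simp only [eps, Finset.mul_sum, Finset.sum_mul, this, Finset.sum_add_distrib,
      Finset.sum_neg_distrib]
    simp
  have hl : (if a = b then D.l else 0) = ∑ i, D.q i • (if a = b then W.x i else 0) := by
    by_cases h : a = b <;> simp [h, l, lin]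
  rw [hl]
  simp only [conDir, Finset.mul_sum, Finset.sum_mul, mul_smul_comm, smul_mul_assoc, key, smul_add,
    Finset.sum_add_distrib, smul_neg, Finset.sum_neg_distrib]

theorem con_conDir (a b) : W.con a * W.conDir D.q b = -(W.conDir D.q b * W.con a) := by
  simp only [conDir, Finset.mul_sum, Finset.sum_mul, mul_smul_comm, smul_mul_assoc,
    W.con_mul_c, smul_neg, Finset.sum_neg_distrib]

theorem S_conDir (a b e) : W.S a b * W.conDir D.q e =
    W.conDir D.q e * W.S a b - if a = e then W.conDir D.q b else 0 := by
  have : (if a = e then W.conDir D.q b else 0) = ∑ i, D.q i • (if a = e then W.c b i else 0) := by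
    by_cases h : a = e <;> simp [h, conDir]
  rw [this]
  simp only [conDir, Finset.mul_sum, Finset.sum_mul, mul_smul_comm, smul_mul_assoc,
    W.S_mul_c, smul_sub, Finset.sum_sub_distrib]

theorem eul_li : W.eul * D.li = D.li * W.eul - D.li := by
  have h1 : W.eul * D.l = D.l * W.eul + D.l := by
    simp only [l, lin, Finset.mul_sum, Finset.sum_mul, mul_smul_comm, smul_mul_assoc,
      W.eul_mul_x, smul_add, Finset.sum_add_distrib]
  have h2 : D.li * (W.eul * D.l) * D.li = D.li * (D.l * W.eul + D.l) * D.li := by rw [h1]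
  have h3 : D.l * D.li = 1 := D.lin_li
  have h4 : D.li * D.l = 1 := D.li_lin
  have h5 : D.li * W.eul = W.eul * D.li + D.li := by
    calc D.li * W.eul = D.li * (W.eul * D.l) * D.li := by
          rw [mul_assoc, mul_assoc, h3, mul_one]
      _ = D.li * D.l * W.eul * D.li + D.li * D.l * D.li := by
          rw [h2, mul_add, add_mul]; simp only [mul_assoc]
      _ = _ := by rw [h4, one_mul, one_mul]
  rw [h5]; abel

section Applied

variable (v : M)

theorem kap_kap (a b) : D.kap a (D.kap b v) = -(D.kap b (D.kap a v)) := by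
  have : D.kap a * D.kap b = -(D.kap b * D.kap a) := by
    simp only [kap, mul_assoc, ← mul_assoc (W.conDir D.q _) D.li, ← D.li_conDir]
    rw [D.conDir_conDir a b]; simp
  exact congrArg (· v) this

theorem kap_sq (a) : D.kap a (D.kap a v) = 0 := by
  have h1 := D.kap_kap v a a
  have h2 : (2 : ℂ) • D.kap a (D.kap a v) = 0 := by
    rw [two_smul]; nth_rewrite 1 [h1]; simp
  simpa using h2

theorem kap_eps (a b) : D.kap a (W.eps b v) = -(W.eps b (D.kap a v)) + if a = b then v else 0 := by
  have : D.kap a * W.eps b = -(W.eps b * D.kap a) + if a = b then 1 else 0 := by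
    simp only [kap, mul_assoc, D.conDir_eps, mul_add, mul_neg]
    rw [← mul_assoc, D.li_eps, mul_assoc]
    congr 1
    by_cases h : a = b <;> simp [h]
    exact D.li_lin
  refine (congrArg (· v) this).trans ?_
  by_cases h : a = b <;> simp [h]

theorem con_kap (a b) : W.con a (D.kap b v) = -(D.kap b (W.con a v)) := by
  have : W.con a * D.kap b = -(D.kap b * W.con a) := by
    simp only [kap, mul_assoc]
    rw [← mul_assoc, ← D.li_con, mul_assoc, D.con_conDir]; simp
  exact congrArg (· v) this

theorem S_kap (a b e) : W.S a b (D.kap e v) =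
    D.kap e (W.S a b v) - if a = e then D.kap b v else 0 := by
  have : W.S a b * D.kap e = D.kap e * W.S a b - if a = e then D.kap b else 0 := by
    simp only [kap, mul_assoc]
    rw [← mul_assoc, ← D.li_S, mul_assoc, D.S_conDir, mul_sub]
    congr 1
    by_cases h : a = e <;> simp [h]
  refine (congrArg (· v) this).trans ?_
  by_cases h : a = e <;> simp [h]

theorem eul_kap (a) : W.eul (D.kap a v) = D.kap a (W.eul v) - D.kap a v := by
  have : W.eul * D.kap a = D.kap a * W.eul - D.kap a := by
    have h1 : W.eul * W.conDir D.q a = W.conDir D.q a * W.eul := by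
      simp only [conDir, Finset.mul_sum, Finset.sum_mul, mul_smul_comm, smul_mul_assoc,
        W.eul_mul_c]
    simp only [kap]
    rw [← mul_assoc, D.eul_li, sub_mul, mul_assoc, h1, mul_assoc]
  exact congrArg (· v) this

/-- Expanded, `pr` is the product over both columns of `1 - eps a * kap a`. Each such factor kills
`eps a`, since `kap a * eps a = 1 - eps a * kap a` and `eps a` squares to zero. -/
theorem pr_eps (a) : D.pr (W.eps a v) = 0 := by
  cases a
  · simp only [pr, kap_eps, map_add, map_neg, W.eps_sq', reduceIte, Bool.true_eq_false,
      W.eps_eps' _ true false]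
    simp
  · simp only [pr, kap_eps, map_add, map_neg, W.eps_sq', reduceIte, Bool.false_eq_true,
      W.eps_eps' _ true false]
    simp [W.eps_sq']

theorem pr_add (u : M) : D.pr (u + v) = D.pr u + D.pr v := by
  simp only [pr, map_add]; abel

theorem pr_smul (a : ℂ) : D.pr (a • v) = a • D.pr v := by
  simp only [pr, map_smul]; module

theorem S_pr (a b) : W.S a b (D.pr v) = D.pr (W.S a b v) := by
  cases a <;> cases b <;>
  simp only [pr, map_add, map_sub, W.S_eps', S_kap, reduceIte, Bool.true_eq_false, Bool.false_eq_true,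
    sub_zero, add_zero, map_zero, W.eps_sq', D.kap_sq] <;> abel

theorem K_kap {v : M} (a : Bool) (h : v ∈ D.K) : D.kap a v ∈ D.K := D.K_li _ (D.K_conDir a h)

theorem K_pr {v : M} (h : v ∈ D.K) : D.pr v ∈ D.K :=
  D.K.sub_mem (D.K.sub_mem (D.K.sub_mem h (D.K_eps _ (D.K_kap _ h))) (D.K_eps _ (D.K_kap _ h)))
    (D.K_eps _ (D.K_eps _ (D.K_kap _ (D.K_kap _ h))))

/-- Only the derivations l·∂_i − x_i·∂_q enter. Unlike the full divergence, this operator may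
therefore be applied to congruences modulo `K`. -/
theorem K_tanDiv {v : M} (h : v ∈ D.K) : D.tanDiv v ∈ D.K := by
  refine D.K_li _ ?_
  have h2 : (∑ i, W.c true i * (D.l * W.d i - W.x i * D.p)) v ∈ D.K :=
    D.K_sum fun i => D.K_c true i _ (D.K_tan i v h)
  convert h2 using 1
  have h3 : D.l * W.div true - W.con true * D.p =
      ∑ i, W.c true i * (D.l * W.d i - W.x i * D.p) := by
    have hcl : ∀ i, W.c true i * D.l = D.l * W.c true i := fun i => by
      simp only [l, lin, Finset.sum_mul, Finset.mul_sum, smul_mul_assoc, mul_smul_comm,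
        W.xc]
    simp only [mul_sub, Finset.sum_sub_distrib, ← mul_assoc, hcl, ← W.xc, div, con,
      Finset.mul_sum, Finset.sum_mul, W.dc]
  exact congrArg (· v) h3

theorem p_con (a) : D.p (W.con a v) = W.conDir D.q a v + W.con a (D.p v) := by
  have h2 : D.p * W.con a = W.conDir D.q a + W.con a * D.p := by
    simp only [p, dir, conDir, Finset.sum_mul, Finset.mul_sum, smul_mul_assoc, mul_smul_comm,
      W.con_mul_d, smul_sub, Finset.sum_sub_distrib]
    abel
  exact congrArg (· v) h2

/-- Differentiating X⌟F = 0 along q replaces X⌟∂_q F by −q⌟F. For a solution, a differential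
expression along the cone thus becomes the algebraic component of `F` in the direction q. -/
theorem tanDiv_eq {F : M} (hc : W.con true F = 0) (hd : W.div true F = 0) :
    D.tanDiv F = D.kap true F := by
  have h := D.p_con F true
  rw [hc, map_zero] at h
  have h2 : W.con true (D.p F) = -W.conDir D.q true F := by
    rw [eq_neg_iff_add_eq_zero, h]; abel
  simp only [tanDiv, Module.End.mul_apply, LinearMap.sub_apply, hd, h2, map_zero, kap]
  simp

/-- Exterior multiplication by the one-form dual to the null direction. -/
def theta (a : Bool) : Module.End ℂ M := ∑ i, D.q i • W.t a i

theorem p_eps (a) : D.p (W.eps a v) = W.eps a (D.p v) + D.theta a v := by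
  have h2 : D.p * W.eps a = W.eps a * D.p + D.theta a := by
    have : ∀ i, W.d i * W.eps a = W.eps a * W.d i + W.t a i := fun i => by
      have h3 : ∀ j, W.d i * (W.x j * W.t a j) = W.x j * W.t a j * W.d i +
          if i = j then W.t a j else 0 := fun j => by
        rw [← mul_assoc, W.dx, add_mul, mul_assoc, W.dt, mul_assoc]
        by_cases h : i = j <;> simp [h]
      simp only [eps, Finset.mul_sum, Finset.sum_mul, h3, Finset.sum_add_distrib]
      simp
    simp only [p, dir, theta, Finset.sum_mul, Finset.mul_sum, smul_mul_assoc, mul_smul_comm, this,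
      smul_add, Finset.sum_add_distrib]
  exact congrArg (· v) h2

theorem con_theta (a b) : W.con a (D.theta b v) =
    -(D.theta b (W.con a v)) + if a = b then D.l v else 0 := by
  have : W.con a * D.theta b = -(D.theta b * W.con a) + if a = b then D.l else 0 := by
    have hl : (if a = b then D.l else 0) = ∑ i, D.q i • (if a = b then W.x i else 0) := by
      by_cases h : a = b <;> simp [h, l, lin]
    rw [hl]
    simp only [theta, Finset.mul_sum, Finset.sum_mul, mul_smul_comm, smul_mul_assoc,
      W.con_mul_t, smul_add, smul_neg, Finset.sum_add_distrib, Finset.sum_neg_distrib]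
  refine (congrArg (· v) this).trans ?_
  by_cases h : a = b <;> simp [h]

theorem l_eps (a) : D.l (W.eps a v) = W.eps a (D.l v) := by
  have : D.l * W.eps a = W.eps a * D.l := by
    have hx : ∀ i, D.l * W.x i = W.x i * D.l := fun i => (D.x_l i).symm
    have ht : ∀ i, D.l * W.t a i = W.t a i * D.l := fun i => by
      simp only [l, lin, Finset.sum_mul, Finset.mul_sum, smul_mul_assoc, mul_smul_comm, W.xt]
    simp only [eps, Finset.mul_sum, Finset.sum_mul, ← mul_assoc, hx]
    simp only [mul_assoc, ht]
  exact congrArg (· v) this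

/-- The number N − 1 instead of N in the divergence formula: ∂_q also differentiates the dual of X,
and contracting the resulting dual of q with X gives l, which removes one transversal direction. -/
theorem tanDiv_eps_true {v : M} (hc : W.con true v = 0) :
    D.tanDiv (W.eps true v) + W.eps true (D.tanDiv v) -
      (W.eul v + ((Fintype.card κ : ℂ) - 1) • v - W.S true true v) ∈ D.K := by
  refine D.mem_of_l_mem ?_
  have h1 : D.l (D.tanDiv (W.eps true v)) =
      D.l (W.div true (W.eps true v)) - W.con true (D.p (W.eps true v)) := D.l_li _
  have h2 : D.l (W.eps true (D.tanDiv v)) =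
      W.eps true (D.l (W.div true v) - W.con true (D.p v)) := by
    rw [l_eps]
    exact congrArg _ (D.l_li _)
  have h3 : D.l (D.tanDiv (W.eps true v) + W.eps true (D.tanDiv v) -
      (W.eul v + ((Fintype.card κ : ℂ) - 1) • v - W.S true true v)) = -W.quad (D.p v) := by
    rw [map_sub, map_add, h1, h2]
    simp only [div_eps_self', p_eps, map_add, map_sub, con_theta, con_eps', hc, map_smul, l_eps,
      map_neg, map_zero, reduceIte, neg_zero]
    module
  rw [h3]
  exact D.K.neg_mem (D.K_quad _)

theorem tanDiv_eps_false {v : M} (hc : W.con true v = 0) :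
    D.tanDiv (W.eps false v) = -W.eps false (D.tanDiv v) - W.S false true v := by
  have h1 : D.l (D.tanDiv (W.eps false v)) =
      D.l (W.div true (W.eps false v)) - W.con true (D.p (W.eps false v)) := D.l_li _
  have h2 : D.l (W.eps false (D.tanDiv v)) =
      W.eps false (D.l (W.div true v) - W.con true (D.p v)) := by
    rw [l_eps]
    exact congrArg _ (D.l_li _)
  rw [← D.li_l (D.tanDiv (W.eps false v)), ← D.li_l (-W.eps false (D.tanDiv v) - _)]
  congr 1
  rw [h1, map_sub, map_neg, h2]
  simp only [div_eps_ne' _ _ (show true ≠ false by decide), p_eps, map_add, map_sub, con_theta,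
    con_eps', hc, l_eps, map_neg, map_zero, reduceIte, Bool.true_eq_false, neg_zero, add_zero]
  abel

end Applied

/-- A solution of all the equations whose restriction to the cone is zero vanishes. -/
theorem eq_zero_of_pr_mem {m : ℂ} {r s : ℕ} {F : M} (hF : W.IsIrred m r s F)
    (hc : ∀ e, W.con e F = 0) (hd : W.div true F = 0) (hl : W.lap F = 0)
    (hpr : D.pr F ∈ D.K)
    (hm : ∀ j : ℕ, 1 ≤ j → 2 * m + Fintype.card κ - 2 ≠ 2 * j)
    (h : (m + Fintype.card κ - 2 - r ≠ 0 ∧ (D.kap false F = 0 ∨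
      m + Fintype.card κ - 2 - r + (r - s + 1) ≠ 0)) ∨
      (D.kap true F = 0 ∧ D.kap false F = 0)) : F = 0 := by
  -- By harmonic uniqueness it is enough that the components transversal to the cone vanish on it as
  -- well.
  suffices hFK : F ∈ D.K from D.eq_zero_of_lap hFK hF.eul hl hm
  set A := D.kap true F with hA
  set B := D.kap false F with hB
  set C := D.kap true B with hC
  have hFK : ∀ X : M, X ∈ D.K → D.pr F + X ∈ D.K := fun X hX => D.K.add_mem hpr hX
  have hpF : D.pr F = F - W.eps true A - W.eps false B - W.eps true (W.eps false C) := rfl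
  rcases h with ⟨hβ, h2⟩ | ⟨h1, h2⟩
  swap
  · have hC0 : C = 0 := by rw [hC, h2, map_zero]
    rw [hpF, h1, h2, hC0] at hpr
    simpa using hpr
  set β := m + (Fintype.card κ : ℂ) - 2 - r with hβd
  have hcA : W.con true A = 0 := by rw [hA, con_kap, hc]; simp
  have hcB : W.con true B = 0 := by rw [hB, con_kap, hc]; simp
  have hcC : W.con true C = 0 := by rw [hC, con_kap, hcB]; simp
  have hcC' : W.con true (W.eps false C) = 0 := by rw [con_eps', hcC]; simp
  have hT : D.tanDiv F = A := D.tanDiv_eq (hc true) hd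
  have eA : W.eul A + ((Fintype.card κ : ℂ) - 1) • A - W.S true true A = (β + 1) • A := by
    simp only [hA, eul_kap, S_kap, hF.eul, hF.left, map_smul, reduceIte, hβd]
    module
  have eC : W.eul (W.eps false C) + ((Fintype.card κ : ℂ) - 1) • W.eps false C -
      W.S true true (W.eps false C) = (β + 1) • W.eps false C := by
    simp only [hC, hB, eul_kap, eul_eps', W.S_eps', S_kap, hF.eul, hF.left, map_smul, map_sub,
      reduceIte, hβd, Bool.true_eq_false, sub_zero, add_zero]
    module
  have kA : D.tanDiv (W.eps true A) + W.eps true (D.tanDiv A) - (β + 1) • A ∈ D.K := by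
    rw [← eA]; exact D.tanDiv_eps_true hcA
  have kC : D.tanDiv (W.eps true (W.eps false C)) + W.eps true (D.tanDiv (W.eps false C)) -
      (β + 1) • W.eps false C ∈ D.K := by
    rw [← eC]; exact D.tanDiv_eps_true hcC'
  have kB := D.tanDiv_eps_false hcB
  -- Modulo `K`, F = eps_true A + eps_false B + eps_true eps_false C. The tangential divergence of
  -- the left side is A; that of the right side, up to terms killed by `pr`, is (β + 1)A −
  -- S_false,true B.
  have h3 : β • D.pr A - W.S false true (D.pr B) ∈ D.K := by
    have h4 := D.K_tanDiv hpr
    rw [hpF] at h4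
    simp only [map_sub, hT, kB] at h4
    have h5 := D.K_pr (D.K.add_mem (D.K.add_mem h4 kA) kC)
    have h6 : A - D.tanDiv (W.eps true A) - (-W.eps false (D.tanDiv B) - W.S false true B) -
        D.tanDiv (W.eps true (W.eps false C)) +
        (D.tanDiv (W.eps true A) + W.eps true (D.tanDiv A) - (β + 1) • A) +
        (D.tanDiv (W.eps true (W.eps false C)) + W.eps true (D.tanDiv (W.eps false C)) -
          (β + 1) • W.eps false C) =
        (-β) • A + W.S false true B + W.eps true (D.tanDiv A + D.tanDiv (W.eps false C)) +
          W.eps false (D.tanDiv B - (β + 1) • C) := by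
      simp only [map_add, map_sub, map_smul]
      module
    rw [h6] at h5
    simp only [pr_add, pr_smul, pr_eps, add_zero] at h5
    rw [S_pr]
    convert D.K.neg_mem h5 using 1
    module
  have hSA : W.S true false A = -B := by
    rw [hA, S_kap, hF.young]; simp [hB]
  have hSB : W.S true false B = 0 := by
    rw [hB, S_kap, hF.young]; simp
  -- Applying `S true false` decouples the system: it sends A to −B and S_false,true B to (r − s +
  -- 1)B, so the determinant is β + r − s + 1.
  have hprB : D.pr B ∈ D.K := by
    rcases h2 with h2 | h2
    · rw [h2]; simp [pr, D.K.zero_mem]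
    have h4 := D.K_S true false h3
    have nB : W.S true true B = (r : ℂ) • B := by
      rw [hB, S_kap, hF.left]; simp
    have nB' : W.S false false B = ((s : ℂ) - 1) • B := by
      rw [hB, S_kap, hF.right]; simp; module
    rw [map_sub, map_smul, S_pr, hSA, S_tf_ft] at h4
    simp only [S_pr, hSB, nB, nB'] at h4
    have h5 : D.pr (-B) = - D.pr B := by simpa using D.pr_smul B (-1)
    have h6 : D.pr (0 : M) = 0 := by simp [pr]
    simp only [h5, h6, pr_smul, map_zero] at h4
    refine D.mem_of_smul_mem (a := -(β + (r - s + 1))) (neg_ne_zero.mpr h2) ?_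
    convert h4 using 1
    module
  have hprA : D.pr A ∈ D.K := by
    refine D.mem_of_smul_mem hβ ?_
    have := D.K.add_mem h3 (D.K_S false true hprB)
    simpa using this
  have c1 : D.kap true A = 0 := D.kap_sq F true
  have c2 : D.kap false A = -C := D.kap_kap F false true
  have c3 : D.kap true C = 0 := D.kap_sq B true
  have c4 : D.kap false B = 0 := D.kap_sq F false
  have c5 : D.kap false C = 0 := by rw [hC, kap_kap, c4]; simp
  -- Vanishing of the projections of A and B still leaves C: only A = −eps_false C and B = eps_true
  -- C follow on the cone, hence F = −eps_true eps_false C there.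
  have hA2 : A + W.eps false C ∈ D.K := by
    simpa [pr, c1, c2, c3] using hprA
  have hB2 : B - W.eps true C ∈ D.K := by
    simpa [pr, c4, ← hC] using hprB
  have hF2 : F + W.eps true (W.eps false C) ∈ D.K := by
    have := D.K.add_mem (D.K.add_mem hpr (D.K_eps true hA2)) (D.K_eps false hB2)
    rw [hpF] at this
    convert this using 1
    simp only [map_add, map_sub, W.eps_eps' _ false true]
    abel
  -- A second tangential divergence, now of this last expression, compared with A = −eps_false C and
  -- stripped by `kap false` and `pr`, leaves βC.
  have hCK : C ∈ D.K := by
    refine D.mem_of_smul_mem hβ ?_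
    have h4 := D.K_tanDiv hF2
    rw [map_add, hT] at h4
    have h5 := D.K_pr (D.K_kap false (D.K.sub_mem (D.K.sub_mem hA2 h4) (D.K.neg_mem kC)))
    have h6 : A + W.eps false C - (A + D.tanDiv (W.eps true (W.eps false C))) -
        -(D.tanDiv (W.eps true (W.eps false C)) + W.eps true (D.tanDiv (W.eps false C)) -
          (β + 1) • W.eps false C) =
        W.eps true (D.tanDiv (W.eps false C)) + (-β) • W.eps false C := by module
    rw [h6] at h5
    simp only [map_add, map_smul, kap_eps, c5, reduceIte, Bool.false_eq_true, map_zero, neg_zero,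
      add_zero, zero_add, pr_add, pr_smul] at h5
    rw [← map_neg, pr_eps, zero_add] at h5
    have h7 : D.pr C = C := by simp [pr, c3, c5]
    rw [h7] at h5
    simpa using D.K.neg_mem h5
  have := D.K.sub_mem hF2 (D.K_eps true (D.K_eps false hCK))
  simpa using this

end ConeData

end WeylClifford

end AmbientLift

namespace AmbientLift

/-! ### Tensors as functionals on an exterior algebra -/

section Fock

open ExteriorAlgebra

/-- The exterior algebra over two copies of a vector space, one for each column. -/
abbrev Fock (n : ℕ) : Type := ExteriorAlgebra ℝ (Amb n × Amb n)

variable {n : ℕ}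

/-- The inclusion of the ambient space as the first (`true`) or second (`false`) copy. -/
def emb (a : Bool) : Amb n →ₗ[ℝ] Amb n × Amb n :=
  if a then LinearMap.inl ℝ _ _ else LinearMap.inr ℝ _ _

/-- The projection to the first (`true`) or second (`false`) copy. -/
def prj (a : Bool) : Amb n × Amb n →ₗ[ℝ] Amb n :=
  if a then LinearMap.fst ℝ _ _ else LinearMap.snd ℝ _ _

theorem prj_emb (a b : Bool) (u : Amb n) : prj a (emb b u) = if a = b then u else 0 := by
  cases a <;> cases b <;> simp [prj, emb]

/-- The `I`-th coordinate of the copy `a`. -/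
def coordForm (a : Bool) (I : Idx n) : Module.Dual ℝ (Amb n × Amb n) :=
  (LinearMap.proj I : (Idx n → ℝ) →ₗ[ℝ] ℝ) ∘ₗ prj a

/-- Exterior multiplication by a vector in the copy `a`. -/
def wedge (a : Bool) (u : Amb n) : Fock n →ₗ[ℝ] Fock n := LinearMap.mulLeft ℝ (ι ℝ (emb a u))

/-- Contraction with the `I`-th coordinate of the copy `a`. -/
def contr (a : Bool) (I : Idx n) : Fock n →ₗ[ℝ] Fock n :=
  CliffordAlgebra.contractLeft (Q := (0 : QuadraticForm ℝ (Amb n × Amb n))) (coordForm a I)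

theorem wedge_apply (a : Bool) (u : Amb n) (z : Fock n) : wedge a u z = ι ℝ (emb a u) * z := rfl

theorem wedge_wedge (a b : Bool) (u v : Amb n) (z : Fock n) :
    wedge a u (wedge b v z) = -wedge b v (wedge a u z) := by
  simp only [wedge_apply, ← mul_assoc]
  rw [eq_neg_iff_add_eq_zero, ← add_mul, ι_add_mul_swap, zero_mul]

theorem contr_contr (a b : Bool) (I J : Idx n) (z : Fock n) :
    contr a I (contr b J z) = -contr b J (contr a I z) :=
  CliffordAlgebra.contractLeft_comm _ _ _

theorem contr_mul (a : Bool) (I : Idx n) (m : Amb n × Amb n) (z : Fock n) :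
    contr a I (ι ℝ m * z) = prj a m I • z - ι ℝ m * contr a I z :=
  CliffordAlgebra.contractLeft_ι_mul _ _ _

theorem contr_wedge (a b : Bool) (I : Idx n) (u : Amb n) (z : Fock n) :
    contr a I (wedge b u z) = (if a = b then u I else 0) • z - wedge b u (contr a I z) := by
  rw [wedge_apply, contr_mul, prj_emb]
  by_cases h : a = b <;> simp [h, wedge_apply]

/-- The derivation of the exterior algebra which replaces vectors in the copy `a` by the same
vectors in the copy `b`. -/
def shift (a b : Bool) : Fock n →ₗ[ℝ] Fock n := ∑ I, wedge b (e I) ∘ₗ contr a I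

theorem eq_sum_e (u : Amb n) : u = ∑ I, u I • (e I : Amb n) := by
  simpa [e, Pi.single_apply] using pi_eq_sum_univ' u

/-- The derivation rule for `shift`: in each summand the contraction gives the coordinate of m,
while the wedge anticommutes past m and cancels the sign of the contraction. -/
theorem shift_mul (a b : Bool) (m : Amb n × Amb n) (z : Fock n) :
    shift a b (ι ℝ m * z) = ι ℝ (emb b (prj a m)) * z + ι ℝ m * shift a b z := by
  have h1 : ι ℝ (emb b (prj a m)) = ∑ I, prj a m I • ι ℝ (emb b (e I : Amb n)) := by
    conv_lhs => rw [eq_sum_e (prj a m)]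
    simp only [map_sum, map_smul]
  simp only [shift, LinearMap.sum_apply, LinearMap.comp_apply, contr_mul, h1,
    Finset.sum_mul, Finset.mul_sum, smul_mul_assoc, ← Finset.sum_add_distrib]
  refine Finset.sum_congr rfl fun I _ => ?_
  rw [map_sub, map_smul, sub_eq_add_neg]
  congr 1
  simp only [wedge_apply, ← mul_assoc]
  rw [neg_eq_iff_add_eq_zero, ← add_mul, ι_add_mul_swap, zero_mul]

theorem shift_one (a b : Bool) : shift a b (1 : Fock n) = 0 := by
  simp only [shift, LinearMap.sum_apply, LinearMap.comp_apply]
  refine Finset.sum_eq_zero fun I _ => ?_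
  have : contr a I (1 : Fock n) = 0 := CliffordAlgebra.contractLeft_one _ _
  rw [this, map_zero]

theorem shift_ιMulti_mul (a b : Bool) (N : ℕ) (f : Fin N → Amb n × Amb n) (z : Fock n) :
    shift a b (ιMulti ℝ N f * z) =
      (∑ k, ιMulti ℝ N (Function.update f k (emb b (prj a (f k))))) * z +
        ιMulti ℝ N f * shift a b z := by
  induction N with
  | zero => simp
  | succ N ih =>
    rw [ιMulti_succ_apply, mul_assoc, shift_mul, ih, Fin.sum_univ_succ]
    have h1 : ιMulti ℝ (N + 1) (Function.update f 0 (emb b (prj a (f 0)))) =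
        ι ℝ (emb b (prj a (f 0))) * ιMulti ℝ N (Matrix.vecTail f) := by
      rw [ιMulti_succ_apply, Function.update_self]
      congr 2
    have h2 : ∀ k : Fin N, ιMulti ℝ (N + 1) (Function.update f k.succ (emb b (prj a (f k.succ)))) =
        ι ℝ (f 0) * ιMulti ℝ N
          (Function.update (Matrix.vecTail f) k (emb b (prj a (Matrix.vecTail f k)))) := by
      intro k
      rw [ιMulti_succ_apply, Function.update_of_ne (Fin.succ_ne_zero k).symm]
      congr 2
      funext j
      simp only [Matrix.vecTail, Function.comp_apply, Function.update_apply, Fin.succ_inj]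
    rw [h1, Finset.sum_congr rfl fun k _ => h2 k, ← Finset.mul_sum]
    simp only [add_mul, mul_add, mul_assoc]
    abel

/-- The product of `p` vectors in the first copy and `q` vectors in the second copy. -/
def mono (p q : ℕ) (f : Fin p → Amb n) (g : Fin q → Amb n) : Fock n :=
  ιMulti ℝ p (fun i => emb true (f i)) * ιMulti ℝ q (fun j => emb false (g j))

theorem wedge_true_mono (p q : ℕ) (f : Fin p → Amb n) (g : Fin q → Amb n) (u : Amb n) :
    wedge true u (mono p q f g) = mono (p + 1) q (Fin.cons u f) g := by
  rw [mono, mono, wedge_apply, ← mul_assoc, ιMulti_succ_apply]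
  rfl

theorem wedge_false_ιMulti (p : ℕ) (f : Fin p → Amb n) (u : Amb n) (z : Fock n) :
    wedge false u (ιMulti ℝ p (fun i => emb true (f i)) * z) =
      (-1 : ℝ) ^ p • (ιMulti ℝ p (fun i => emb true (f i)) * wedge false u z) := by
  induction p with
  | zero => simp
  | succ p ih =>
    have h1 : ∀ z : Fock n, ιMulti ℝ (p + 1) (fun i => emb true (f i)) * z =
        wedge true (f 0) (ιMulti ℝ p (fun i => emb true (f i.succ)) * z) := fun z => by
      rw [ιMulti_succ_apply, wedge_apply, mul_assoc]; rfl
    rw [h1, h1, wedge_wedge, ih (fun i => f i.succ), map_smul, pow_succ]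
    module

theorem wedge_false_mono (p q : ℕ) (f : Fin p → Amb n) (g : Fin q → Amb n) (u : Amb n) :
    wedge false u (mono p q f g) = (-1 : ℝ) ^ p • mono p (q + 1) f (Fin.cons u g) := by
  rw [mono, wedge_false_ιMulti, mono, ιMulti_succ_apply]
  rfl

/-- Left multiplication by a vector of either copy maps monomials to multiples of monomials, a
vector of the second copy picking up a sign when it passes those of the first. Their span is thus a
left ideal containing 1. -/
theorem mono_induction {P : Fock n → Prop} (hadd : ∀ z η, P z → P η → P (z + η))
    (hsmul : ∀ (c : ℝ) z, P z → P (c • z)) (hmono : ∀ p q f g, P (mono p q f g)) (z : Fock n) :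
    P z := by
  have h0 : P 0 := by simpa using hsmul 0 _ (hmono 0 0 Fin.elim0 Fin.elim0)
  let Sp : Submodule ℝ (Fock n) := Submodule.span ℝ
    {z | ∃ p q f g, z = mono p q f g}
  have hw : ∀ a u, ∀ z ∈ Sp, wedge a u z ∈ Sp := by
    intro a u z hz
    induction hz using Submodule.span_induction with
    | mem x hx =>
      obtain ⟨p, q, f, g, rfl⟩ := hx
      cases a
      · rw [wedge_false_mono]
        exact Sp.smul_mem _ (Submodule.subset_span ⟨_, _, _, _, rfl⟩)
      · rw [wedge_true_mono]
        exact Submodule.subset_span ⟨_, _, _, _, rfl⟩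
    | zero => rw [map_zero]; exact Sp.zero_mem
    | add x y _ _ hx hy => rw [map_add]; exact Sp.add_mem hx hy
    | smul c x _ hx => rw [map_smul]; exact Sp.smul_mem _ hx
  have hι : ∀ m, ∀ z ∈ Sp, ι ℝ m * z ∈ Sp := by
    rintro ⟨u, v⟩ z hz
    have : (u, v) = emb true u + emb false v := by simp [emb]
    rw [this, map_add, add_mul]
    exact Sp.add_mem (hw true u z hz) (hw false v z hz)
  have hall : ∀ x : Fock n, ∀ z ∈ Sp, x * z ∈ Sp := by
    intro x
    induction x using ExteriorAlgebra.induction with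
    | algebraMap r => intro z hz; rw [← Algebra.smul_def]; exact Sp.smul_mem _ hz
    | ι x => exact hι x
    | mul a b ha hb => intro z hz; rw [mul_assoc]; exact ha _ (hb _ hz)
    | add a b ha hb => intro z hz; rw [add_mul]; exact Sp.add_mem (ha _ hz) (hb _ hz)
  have h1 : z ∈ Sp := by
    have : (1 : Fock n) ∈ Sp := Submodule.subset_span ⟨0, 0, Fin.elim0, Fin.elim0, by simp [mono]⟩
    simpa using hall z 1 this
  induction h1 using Submodule.span_induction with
  | mem x hx => obtain ⟨p, q, f, g, rfl⟩ := hx; exact hmono p q f g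
  | zero => exact h0
  | add x y _ _ hx hy => exact hadd _ _ hx hy
  | smul c x _ hx => exact hsmul _ _ hx

theorem shift_true_true_mono (p q : ℕ) (f : Fin p → Amb n) (g : Fin q → Amb n) :
    shift true true (mono p q f g) = (p : ℝ) • mono p q f g := by
  have h1 : shift true true (ιMulti ℝ q (fun j => emb false (g j)) * (1 : Fock n)) = 0 := by
    rw [shift_ιMulti_mul, shift_one]
    simp only [prj_emb, Bool.true_eq_false, if_false, map_zero, mul_one, mul_zero, add_zero]
    exact Finset.sum_eq_zero fun k _ => (ιMulti ℝ q).map_coord_zero k (by simp)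
  rw [mul_one] at h1
  rw [mono, shift_ιMulti_mul, h1]
  simp [prj_emb, Nat.cast_smul_eq_nsmul, mul_assoc]

theorem shift_false_false_mono (p q : ℕ) (f : Fin p → Amb n) (g : Fin q → Amb n) :
    shift false false (mono p q f g) = (q : ℝ) • mono p q f g := by
  have h1 : shift false false (ιMulti ℝ q (fun j => emb false (g j)) * (1 : Fock n)) =
      (q : ℝ) • ιMulti ℝ q (fun j => emb false (g j)) := by
    rw [shift_ιMulti_mul, shift_one]
    simp [prj_emb, Nat.cast_smul_eq_nsmul]
  rw [mul_one] at h1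
  rw [mono, shift_ιMulti_mul, h1]
  simp only [prj_emb, Bool.false_eq_true, if_false, map_zero]
  rw [Finset.sum_eq_zero fun k _ => (ιMulti ℝ p).map_coord_zero k (by simp)]
  simp

theorem shift_true_false_mono_zero (q : ℕ) (f : Fin 0 → Amb n) (g : Fin q → Amb n) :
    shift true false (mono 0 q f g) = 0 := by
  have h1 : shift true false (ιMulti ℝ q (fun j => emb false (g j)) * (1 : Fock n)) = 0 := by
    rw [shift_ιMulti_mul, shift_one]
    simp only [prj_emb, Bool.true_eq_false, if_false, map_zero, mul_one, mul_zero, add_zero]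
    exact Finset.sum_eq_zero fun k _ => (ιMulti ℝ q).map_coord_zero k (by simp)
  rw [mul_one] at h1
  simp [mono, h1]

/-- Moving one vector from the first column to the second, summed over the p + 1 choices, yields the
exchange expression of the Bianchi identity. This is why that identity is expressed by the vanishing
of a functional on the image of `shift true false`. -/
theorem shift_true_false_mono_succ (p q : ℕ) (u : Amb n) (f : Fin p → Amb n) (g : Fin q → Amb n) :
    shift true false (mono (p + 1) q (Fin.cons u f) g) =
      (-1 : ℝ) ^ p • (mono p (q + 1) f (Fin.cons u g) -
        ∑ i, mono p (q + 1) (Function.update f i u) (Fin.cons (f i) g)) := by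
  have h1 : shift true false (ιMulti ℝ q (fun j => emb false (g j)) * (1 : Fock n)) = 0 := by
    rw [shift_ιMulti_mul, shift_one]
    simp only [prj_emb, Bool.true_eq_false, if_false, map_zero, mul_one, mul_zero, add_zero]
    exact Finset.sum_eq_zero fun k _ => (ιMulti ℝ q).map_coord_zero k (by simp)
  rw [mul_one] at h1
  rw [mono, shift_ιMulti_mul, h1, mul_zero, add_zero, Fin.sum_univ_succ, add_mul, smul_sub,
    ← wedge_false_mono, sub_eq_add_neg]
  congr 1
  · rw [ιMulti_succ_apply, Function.update_self, mono, wedge_apply, ← mul_assoc]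
    simp only [prj_emb, reduceIte, Fin.cons_zero]
    congr 2
  · rw [Finset.sum_mul, Finset.smul_sum, ← Finset.sum_neg_distrib]
    refine Finset.sum_congr rfl fun i _ => ?_
    rw [← wedge_false_mono]
    -- The vector moved to the second copy stands in position i + 1; exchanging it with the leading
    -- one accounts for the minus sign of the exchange terms.
    have h2 : Function.update (fun k => emb true ((Fin.cons u f : Fin (p + 1) → Amb n) k)) i.succ
        (emb false (prj true (emb true ((Fin.cons u f : Fin (p + 1) → Amb n) i.succ)))) =
        (Fin.cons (emb false (f i)) (fun k => emb true (Function.update f i u k))) ∘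
          Equiv.swap 0 i.succ := by
      funext k
      refine Fin.cases ?_ (fun j => ?_) k
      · rw [Function.update_of_ne (Fin.succ_ne_zero i).symm]
        simp
      · by_cases hj : j = i
        · subst hj
          simp [prj_emb]
        · have : Equiv.swap (0 : Fin (p + 1)) i.succ j.succ = j.succ :=
            Equiv.swap_apply_of_ne_of_ne (Fin.succ_ne_zero j) (by simpa using hj)
          simp [this, hj]
    rw [h2, AlternatingMap.map_swap _ _ (Fin.succ_ne_zero i).symm, mono, wedge_apply, neg_mul,
      ιMulti_succ_apply, mul_assoc]
    rfl

theorem mono_perm_left (p q : ℕ) (f : Fin p → Amb n) (g : Fin q → Amb n)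
    (σ : Equiv.Perm (Fin p)) :
    mono p q (f ∘ σ) g = Equiv.Perm.sign σ • mono p q f g := by
  have := (ιMulti ℝ p).map_perm (fun i => emb true (f i)) σ
  rw [mono, mono, ← smul_mul_assoc, ← this]
  rfl

theorem mono_perm_right (p q : ℕ) (f : Fin p → Amb n) (g : Fin q → Amb n)
    (σ : Equiv.Perm (Fin q)) :
    mono p q f (g ∘ σ) = Equiv.Perm.sign σ • mono p q f g := by
  have := (ιMulti ℝ q).map_perm (fun i => emb false (g i)) σ
  rw [mono, mono, ← mul_smul_comm, ← this]
  rfl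

end Fock

end AmbientLift

/-! ### Young-symmetric tensors as functionals of fixed bidegree on the exterior algebra. -/

namespace AmbientLift

section Symbol

open ExteriorAlgebra

variable {n r s : ℕ}

theorem lift_ιMulti (A : (Amb n × Amb n) [⋀^Fin r ⊕ Fin s]→ₗ[ℝ] ℂ) (N : ℕ)
    (y : Fin N → Amb n × Amb n) (hN : r + s = N) :
    liftAlternating (R := ℝ) (Pi.single (r + s) (A.domDomCongr finSumFinEquiv))
      (ιMulti ℝ N y) = A (fun x => y (Fin.cast hN (finSumFinEquiv x))) := by
  subst hN
  rw [liftAlternating_apply_ιMulti, Pi.single_eq_same]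
  rfl

theorem append_emb_lt {p q : ℕ} (f : Fin p → Amb n) (g : Fin q → Amb n) (k : Fin (p + q)) :
    (k.val < p → prj false
      (Fin.append (fun i => emb true (f i)) (fun j => emb false (g j)) k) = 0) ∧
    (¬ k.val < p → prj true
      (Fin.append (fun i => emb true (f i)) (fun j => emb false (g j)) k) = 0) := by
  induction k using Fin.addCases with
  | left i => simp [prj_emb]
  | right j => simp [prj_emb]

/-- A two-column tensor on two copies of the ambient space. -/
noncomputable def slotMap (T : Tens r s (Amb n)) :
    MultilinearMap ℝ (fun _ : Fin r ⊕ Fin s => Amb n × Amb n) ℂ :=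
  T.toMultilinearMap.compLinearMap (fun i => prj i.isLeft)

theorem slotMap_eq_zero (T : Tens r s (Amb n)) (v : Fin r ⊕ Fin s → Amb n × Amb n)
    (i : Fin r ⊕ Fin s) (h : prj i.isLeft (v i) = 0) : slotMap T v = 0 := by
  change T.toMultilinearMap (fun i => prj i.isLeft (v i)) = 0
  exact MultilinearMap.map_coord_zero _ i h

/-- Counting the image of the first group. It rules out any bidegree other than (r, s) when a
permutation matches all slots with vectors of the right copy. -/
theorem card_eq_of_split {p q : ℕ} (E : Fin r ⊕ Fin s ≃ Fin (p + q))
    (h1 : ∀ i, (E (Sum.inl i)).val < p) (h2 : ∀ j, ¬ (E (Sum.inr j)).val < p) : p = r := by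
  have h3 : (Finset.univ.filter fun k : Fin (p + q) => k.val < p) =
      Finset.univ.image (fun i : Fin r => E (Sum.inl i)) := by
    ext k
    obtain ⟨x, rfl⟩ := E.surjective k
    rcases x with i | j
    · simp [h1 i]
    · simp [h2 j]
  have h4 := congrArg Finset.card h3
  rw [Fin.card_filter_val_lt, Finset.card_image_of_injective _
    (show Function.Injective fun i => E (Sum.inl i) from E.injective.comp Sum.inl_injective)] at h4
  simpa using h4

/-- A permutation mixing the two groups puts a vector of the wrong copy into some slot and
contributes zero. The remaining r!·s! permutations give equal terms, since their signs cancel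
against the skewness of `T`. -/
theorem alternatization_slotMap {T : Tens r s (Amb n)} (hT : IsYoung T)
    (f : Fin r → Amb n) (g : Fin s → Amb n) :
    MultilinearMap.alternatization (slotMap T)
      (Sum.elim (fun i => emb true (f i)) (fun j => emb false (g j))) =
      ((r.factorial * s.factorial : ℕ) : ℝ) • T (Sum.elim f g) := by
  rw [MultilinearMap.alternatization_apply]
  have h1 := Finset.sum_of_injOn (s := (Finset.univ : Finset (Equiv.Perm (Fin r) × Equiv.Perm (Fin s))))
    (t := (Finset.univ : Finset (Equiv.Perm (Fin r ⊕ Fin s))))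
    (f := fun _ => T (Sum.elim f g))
    (g := fun σ => Equiv.Perm.sign σ • (slotMap T).domDomCongr σ
      (Sum.elim (fun i => emb true (f i)) (fun j => emb false (g j))))
    (Equiv.Perm.sumCongrHom (Fin r) (Fin s)) (Equiv.Perm.sumCongrHom_injective.injOn)
    (fun _ _ => Finset.mem_coe.2 (Finset.mem_univ _)) ?_ ?_
  · rw [← h1]
    simp [Fintype.card_perm, Nat.cast_mul]
  · intro σ _ hσ
    have h2 : ¬ Set.MapsTo σ (Set.range Sum.inl) (Set.range Sum.inl) := by
      intro h
      obtain ⟨x, hx⟩ := Equiv.Perm.mem_sumCongrHom_range_of_perm_mapsTo_inl h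
      exact hσ ⟨x, by simp, hx⟩
    rw [Set.mapsTo_range_iff] at h2
    push Not at h2
    obtain ⟨i, hi⟩ := h2
    have h3 : ∃ j, σ (Sum.inl i) = Sum.inr j := by
      rcases hx : σ (Sum.inl i) with k | j
      · exact absurd ⟨k, hx.symm⟩ hi
      · exact ⟨j, rfl⟩
    obtain ⟨j, hj⟩ := h3
    rw [MultilinearMap.domDomCongr_apply, slotMap_eq_zero T _ (Sum.inl i), smul_zero]
    simp [hj, prj_emb]
  · rintro ⟨σ, τ⟩ -
    have h2 : (slotMap T).domDomCongr (Equiv.Perm.sumCongrHom (Fin r) (Fin s) (σ, τ))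
        (Sum.elim (fun i => emb true (f i)) (fun j => emb false (g j))) =
        T ((Sum.elim f g ∘ Sum.map id τ) ∘ Sum.map σ id) := by
      change T _ = T _
      congr 1
      funext x
      rcases x with i | j <;> simp [prj_emb, Equiv.Perm.sumCongrHom]
    change _ = _ • _
    rw [h2, hT.skew_left, hT.skew_right, smul_smul, smul_smul]
    simp only [Equiv.Perm.sumCongrHom, MonoidHom.coe_mk, OneHom.coe_mk, Equiv.Perm.sign_sumCongr]
    rw [mul_assoc (_ * _), Int.units_mul_self, one_smul]

/-- The functional is the alternatization of `T` on the sum of two copies, placed in total degree r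
+ s and divided by r!·s!. In other bidegrees of the same total degree every permutation has a slot
filled from the wrong copy. -/
theorem exists_functional {T : Tens r s (Amb n)} (hT : IsYoung T) :
    ∃ φ : Fock n →ₗ[ℝ] ℂ, (∀ f g, φ (mono r s f g) = T (Sum.elim f g)) ∧
      ∀ p q f g, ¬ (p = r ∧ q = s) → φ (mono p q f g) = 0 := by
  set A := MultilinearMap.alternatization (slotMap T)
  refine ⟨((r.factorial * s.factorial : ℕ) : ℝ)⁻¹ •
    liftAlternating (R := ℝ) (Pi.single (r + s) (A.domDomCongr finSumFinEquiv)),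
    fun f g => ?_, fun p q f g hpq => ?_⟩
  · rw [LinearMap.smul_apply, mono, ιMulti_mul_ιMulti, lift_ιMulti A _ _ rfl]
    have h1 : (fun x => Fin.append (fun i => emb true (f i)) (fun j => emb false (g j))
        (Fin.cast rfl (finSumFinEquiv x))) =
        Sum.elim (fun i => emb true (f i)) (fun j => emb false (g j)) := by
      funext x
      rcases x with i | j <;> simp
    rw [h1, alternatization_slotMap hT, smul_smul, inv_mul_cancel₀, one_smul]
    exact_mod_cast Nat.mul_ne_zero r.factorial_ne_zero s.factorial_ne_zero
  · rw [LinearMap.smul_apply, mono, ιMulti_mul_ιMulti]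
    by_cases hN : r + s = p + q
    · rw [lift_ιMulti A _ _ hN, MultilinearMap.alternatization_apply, Finset.sum_eq_zero, smul_zero]
      intro σ _
      rw [MultilinearMap.domDomCongr_apply]
      let E : Fin r ⊕ Fin s ≃ Fin (p + q) := σ.trans (finSumFinEquiv.trans (finCongr hN))
      by_cases h1 : ∀ i, (E (Sum.inl i)).val < p
      · by_cases h2 : ∀ j, ¬ (E (Sum.inr j)).val < p
        · exact absurd ⟨card_eq_of_split E h1 h2, by
            have := card_eq_of_split E h1 h2; omega⟩ hpq
        · push Not at h2
          obtain ⟨j, hj⟩ := h2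
          rw [slotMap_eq_zero T _ (Sum.inr j) ((append_emb_lt f g _).1 hj), smul_zero]
      · push Not at h1
        obtain ⟨j, hj⟩ := h1
        rw [slotMap_eq_zero T _ (Sum.inl j) ((append_emb_lt f g _).2 hj.not_gt), smul_zero]
    · rw [liftAlternating_apply_ιMulti, Pi.single_eq_of_ne (Ne.symm hN)]
      simp

open Classical in
/-- The functional on the exterior algebra given by a tensor with Young symmetry. -/
noncomputable def symb (T : Tens r s (Amb n)) : Fock n →ₗ[ℝ] ℂ :=
  if h : IsYoung T then (exists_functional h).choose else 0

theorem symb_mono {T : Tens r s (Amb n)} (hT : IsYoung T) (f g) :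
    symb T (mono r s f g) = T (Sum.elim f g) := by
  rw [symb, dif_pos hT]
  exact (exists_functional hT).choose_spec.1 f g

theorem symb_mono_ne (T : Tens r s (Amb n)) {p q : ℕ} (h : ¬ (p = r ∧ q = s)) (f g) :
    symb T (mono p q f g) = 0 := by
  by_cases hT : IsYoung T
  · rw [symb, dif_pos hT]
    exact (exists_functional hT).choose_spec.2 p q f g h
  · rw [symb, dif_neg hT, LinearMap.zero_apply]

/-- Transfers smoothness, homogeneity and similar linear properties from the components of a field
to its functional on arbitrary elements of the exterior algebra. -/
theorem symb_mem {X : Type} (S : Submodule ℝ (X → ℂ)) {T : X → Tens r s (Amb n)}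
    (hT : ∀ x, IsYoung (T x)) (hS : ∀ v, (fun x => T x v) ∈ S) (z : Fock n) :
    (fun x => symb (T x) z) ∈ S := by
  induction z using mono_induction with
  | hadd z z' h h' => simp only [map_add]; exact S.add_mem h h'
  | hsmul c z h => simp only [map_smul]; exact S.smul_mem c h
  | hmono p q f g =>
    by_cases h : p = r ∧ q = s
    · obtain ⟨rfl, rfl⟩ := h
      simpa only [symb_mono (hT _)] using hS _
    · simp only [symb_mono_ne _ h]; exact S.zero_mem

theorem elim_cons_left {p q : ℕ} (u : Amb n) (f : Fin p → Amb n) (g : Fin q → Amb n) :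
    (Sum.elim (Fin.cons u f : Fin (p + 1) → Amb n) g) =
      Function.update (Sum.elim (Fin.cons 0 f : Fin (p + 1) → Amb n) g) (Sum.inl 0) u := by
  funext x
  rcases x with i | j
  · refine Fin.cases ?_ (fun k => ?_) i <;> simp
  · simp

theorem elim_cons_right {p q : ℕ} (u : Amb n) (f : Fin p → Amb n) (g : Fin q → Amb n) :
    (Sum.elim f (Fin.cons u g : Fin (q + 1) → Amb n)) =
      Function.update (Sum.elim f (Fin.cons 0 g : Fin (q + 1) → Amb n)) (Sum.inr 0) u := by
  funext x
  rcases x with i | j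
  · simp
  · refine Fin.cases ?_ (fun k => ?_) j <;> simp

/-- The vector u may vary with the parameter, so that a contraction running over all basis vectors
can be treated as a single function of the point and the index. -/
theorem symb_wedge_true_mem {X : Type} (S : Submodule ℝ (X → ℂ)) {T : X → Tens r s (Amb n)}
    (hT : ∀ x, IsYoung (T x)) (u : X → Amb n)
    (hS : ∀ (a : Fin r) v, (fun x => T x (Function.update v (Sum.inl a) (u x))) ∈ S) (z : Fock n) :
    (fun x => symb (T x) (wedge true (u x) z)) ∈ S := by
  induction z using mono_induction with
  | hadd z z' h h' => simp only [map_add]; exact S.add_mem h h'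
  | hsmul c z h => simp only [map_smul]; exact S.smul_mem c h
  | hmono p q f g =>
    simp only [wedge_true_mono]
    by_cases h : p + 1 = r ∧ q = s
    · obtain ⟨rfl, rfl⟩ := h
      have := hS 0 (Sum.elim (Fin.cons 0 f : Fin (p + 1) → Amb n) g)
      simp only [← elim_cons_left] at this
      simpa only [symb_mono (hT _)] using this
    · simp only [symb_mono_ne _ h]; exact S.zero_mem

theorem symb_wedge_false_mem {X : Type} (S : Submodule ℝ (X → ℂ)) {T : X → Tens r s (Amb n)}
    (hT : ∀ x, IsYoung (T x)) (u : X → Amb n)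
    (hS : ∀ (a : Fin s) v, (fun x => T x (Function.update v (Sum.inr a) (u x))) ∈ S) (z : Fock n) :
    (fun x => symb (T x) (wedge false (u x) z)) ∈ S := by
  induction z using mono_induction with
  | hadd z z' h h' => simp only [map_add]; exact S.add_mem h h'
  | hsmul c z h => simp only [map_smul]; exact S.smul_mem c h
  | hmono p q f g =>
    simp only [wedge_false_mono, map_smul]
    refine S.smul_mem ((-1 : ℝ) ^ p) ?_
    by_cases h : p = r ∧ q + 1 = s
    · obtain ⟨rfl, rfl⟩ := h
      have := hS 0 (Sum.elim f (Fin.cons 0 g : Fin (q + 1) → Amb n))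
      simp only [← elim_cons_right] at this
      simpa only [symb_mono (hT _)] using this
    · simp only [symb_mono_ne _ h]; exact S.zero_mem

theorem symb_wedge_wedge {X : Type} [Fintype X] {T : Tens r s (Amb n)} (hT : IsYoung T)
    (k : X → ℝ) (u u' : X → Amb n)
    (h : ∀ (a : Fin r) (b : Fin s) v, ∑ x, k x • T (Function.update
      (Function.update v (Sum.inl a) (u x)) (Sum.inr b) (u' x)) = 0) (z : Fock n) :
    ∑ x, k x • symb T (wedge true (u x) (wedge false (u' x) z)) = 0 := by
  induction z using mono_induction with
  | hadd z z' h h' => simp only [map_add, smul_add, Finset.sum_add_distrib, h, h', add_zero]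
  | hsmul c z h => simp only [map_smul, smul_comm _ c, ← Finset.smul_sum, h, smul_zero]
  | hmono p q f g =>
    simp only [wedge_false_mono, map_smul, wedge_true_mono, smul_comm _ ((-1 : ℝ) ^ p),
      ← Finset.smul_sum]
    by_cases h' : p + 1 = r ∧ q + 1 = s
    · obtain ⟨rfl, rfl⟩ := h'
      have h1 : ∀ x, (Sum.elim (Fin.cons (u x) f : Fin (p + 1) → Amb n)
          (Fin.cons (u' x) g : Fin (q + 1) → Amb n)) = Function.update (Function.update
          (Sum.elim (Fin.cons 0 f : Fin (p + 1) → Amb n) (Fin.cons 0 g : Fin (q + 1) → Amb n))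
            (Sum.inl 0) (u x)) (Sum.inr 0) (u' x) := fun x => by
        rw [← elim_cons_left, ← elim_cons_right]
      simp only [symb_mono hT, h1, h, smul_zero]
    · simp only [symb_mono_ne _ h', smul_zero, Finset.sum_const_zero]

/-! ### The Young identity -/

/-- The position exchanged with `inr b`: nothing, or one of the slots of the first group. -/
def exch (b : Fin s) : Option (Fin r) → Fin r ⊕ Fin s := fun o => o.elim (Sum.inr b) Sum.inl

/-- A permutation fixing the second-column slots other than b is uniquely a permutation of the first
r slots followed by the exchange of b with at most one of them. Skewness makes the r! elements of
each coset contribute equally, and a proper exchange has sign −1. -/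
theorem sum_bianchi {T : Tens r s (Amb n)}
    (hT : ∀ (σ : Equiv.Perm (Fin r)) (v : Fin r ⊕ Fin s → Amb n),
      T (v ∘ Sum.map σ id) = Equiv.Perm.sign σ • T v) (b : Fin s) (v : Fin r ⊕ Fin s → Amb n) :
    ∑ σ : Equiv.Perm (Fin r ⊕ Fin s) with ∀ c, c ≠ b → σ (Sum.inr c) = Sum.inr c,
      Equiv.Perm.sign σ • T (v ∘ σ) =
    (r.factorial : ℝ) • (T v - ∑ i : Fin r, T (v ∘ Equiv.swap (Sum.inr b) (Sum.inl i))) := by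
  have h1 := Finset.sum_of_injOn
    (s := (Finset.univ : Finset (Option (Fin r) × Equiv.Perm (Fin r))))
    (t := Finset.univ.filter fun σ : Equiv.Perm (Fin r ⊕ Fin s) =>
      ∀ c, c ≠ b → σ (Sum.inr c) = Sum.inr c)
    (f := fun x => x.1.elim (T v) (fun i => - T (v ∘ Equiv.swap (Sum.inr b) (Sum.inl i))))
    (g := fun σ => Equiv.Perm.sign σ • T (v ∘ σ))
    (fun x => Equiv.swap (Sum.inr b) (exch b x.1) * Equiv.Perm.sumCongr x.2 1) ?_ ?_ ?_ ?_
  · rw [← h1, Fintype.sum_prod_type]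
    simp [Fintype.card_perm, Fintype.sum_option, sub_eq_add_neg, Finset.smul_sum]
  · rintro ⟨o, τ⟩ - ⟨o', τ'⟩ - h
    simp only at h
    have h2 := Equiv.congr_fun h (Sum.inr b)
    simp only [Equiv.Perm.mul_apply, Equiv.Perm.sumCongr_apply, Sum.map_inr, Equiv.Perm.one_apply,
      Equiv.swap_apply_left] at h2
    have h3 : o = o' := by
      rcases o with _ | i <;> rcases o' with _ | i' <;> simp_all [exch]
    subst h3
    have h4 := mul_left_cancel h
    have h5 := Equiv.Perm.sumCongrHom_injective (a₁ := (τ, 1)) (a₂ := (τ', 1)) h4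
    simp_all
  · rintro ⟨o, τ⟩ -
    simp only [Finset.coe_filter, Finset.mem_univ, true_and, Set.mem_ofPred_eq]
    intro c hc
    simp only [Equiv.Perm.mul_apply, Equiv.Perm.sumCongr_apply, Sum.map_inr, Equiv.Perm.one_apply]
    refine Equiv.swap_apply_of_ne_of_ne (by simpa using hc) ?_
    rcases o with _ | i <;> simp_all [exch]
  · intro σ hσ hσ'
    exfalso
    apply hσ'
    simp only [Finset.mem_filter, Finset.mem_univ, true_and] at hσ
    have h2 : ∃ o, σ (Sum.inr b) = exch b o := by
      rcases hx : σ (Sum.inr b) with i | c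
      · exact ⟨some i, rfl⟩
      · by_cases hc : c = b
        · subst hc; exact ⟨none, rfl⟩
        · have h3 := σ.injective ((hσ c hc).trans hx.symm)
          exact absurd (Sum.inr_injective h3) hc
    obtain ⟨o, ho⟩ := h2
    set ρ := Equiv.swap (Sum.inr b) (exch b o) * σ with hρ
    have h3 : ∀ c, ρ (Sum.inr c) = Sum.inr c := by
      intro c
      by_cases hc : c = b
      · subst hc
        simp [hρ, ho]
      · rw [hρ, Equiv.Perm.mul_apply, hσ c hc]
        refine Equiv.swap_apply_of_ne_of_ne (by simpa using hc) ?_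
        rcases o with _ | i <;> simp_all [exch]
    have h4 : Set.MapsTo ρ (Set.range Sum.inl) (Set.range Sum.inl) := by
      rw [Set.mapsTo_range_iff]
      intro i
      rcases hx : ρ (Sum.inl i) with k | c
      · exact ⟨k, rfl⟩
      · have := ρ.injective (hx.trans (h3 c).symm)
        simp at this
    obtain ⟨⟨τ, τ'⟩, hτ⟩ := Equiv.Perm.mem_sumCongrHom_range_of_perm_mapsTo_inl h4
    have h5 : τ' = 1 := by
      ext c
      have := Equiv.congr_fun hτ (Sum.inr c)
      rw [h3] at this
      simp only [Equiv.Perm.sumCongrHom, MonoidHom.coe_mk, OneHom.coe_mk,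
        Equiv.Perm.sumCongr_apply, Sum.map_inr] at this
      rw [Sum.inr_injective this]; rfl
    subst h5
    refine ⟨(o, τ), by simp, ?_⟩
    have h6 : Equiv.Perm.sumCongr τ 1 = ρ := hτ
    simp only [h6, hρ, ← mul_assoc, Equiv.swap_mul_self, one_mul]
  · rintro ⟨o, τ⟩ -
    have h2 : v ∘ (Equiv.swap (Sum.inr b) (exch b o) * Equiv.Perm.sumCongr τ 1 :
        Equiv.Perm (Fin r ⊕ Fin s)) =
        (v ∘ Equiv.swap (Sum.inr b) (exch b o)) ∘ Sum.map τ id := by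
      funext x
      rcases x with x | x <;> rfl
    rw [h2, hT, Equiv.Perm.sign_mul, Equiv.Perm.sign_sumCongr, smul_smul]
    simp only [Equiv.Perm.sign_one, mul_one, mul_assoc, Int.units_mul_self]
    rcases o with _ | i
    · simp [exch]
    · rw [Equiv.Perm.sign_swap (by simp [exch])]
      simp [exch]

theorem bianchi_iff {T : Tens r s (Amb n)}
    (hT : ∀ (σ : Equiv.Perm (Fin r)) (v : Fin r ⊕ Fin s → Amb n),
      T (v ∘ Sum.map σ id) = Equiv.Perm.sign σ • T v) (b : Fin s) (v : Fin r ⊕ Fin s → Amb n) :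
    (∑ σ : Equiv.Perm (Fin r ⊕ Fin s) with ∀ c, c ≠ b → σ (Sum.inr c) = Sum.inr c,
      Equiv.Perm.sign σ • T (v ∘ σ) = 0) ↔
    T v - ∑ i : Fin r, T (v ∘ Equiv.swap (Sum.inr b) (Sum.inl i)) = 0 := by
  rw [sum_bianchi hT]
  simp [r.factorial_ne_zero]

theorem elim_cons_swap {p q : ℕ} (f : Fin p → Amb n) (u : Amb n) (g : Fin q → Amb n) (i : Fin p) :
    Sum.elim f (Fin.cons u g : Fin (q + 1) → Amb n) ∘ Equiv.swap (Sum.inr 0) (Sum.inl i) =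
      Sum.elim (Function.update f i u) (Fin.cons (f i) g : Fin (q + 1) → Amb n) := by
  funext x
  rcases x with k | j
  · by_cases hk : k = i
    · subst hk; simp
    · rw [Function.comp_apply, Equiv.swap_apply_of_ne_of_ne (by simp) (by simpa using hk)]
      simp [hk]
  · refine Fin.cases ?_ (fun k => ?_) j
    · simp
    · rw [Function.comp_apply, Equiv.swap_apply_of_ne_of_ne (by simp [Fin.succ_ne_zero]) (by simp)]
      simp

theorem symb_shift {T : Tens r s (Amb n)} (hT : IsYoung T) (z : Fock n) :
    symb T (shift true false z) = 0 := by
  induction z using mono_induction with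
  | hadd z z' h h' => rw [map_add, map_add, h, h', add_zero]
  | hsmul c z h => rw [map_smul, map_smul, h, smul_zero]
  | hmono p q f g =>
    rcases p with _ | p
    · rw [shift_true_false_mono_zero, map_zero]
    · obtain ⟨u, f, rfl⟩ : ∃ u f', f = (Fin.cons u f' : Fin (p + 1) → Amb n) :=
        ⟨f 0, Fin.tail f, (Fin.cons_self_tail f).symm⟩
      rw [shift_true_false_mono_succ, map_smul, map_sub, map_sum]
      by_cases h : p = r ∧ q + 1 = s
      · obtain ⟨rfl, rfl⟩ := h
        have := (bianchi_iff hT.skew_left 0 (Sum.elim f (Fin.cons u g : Fin (q + 1) → Amb n))).1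
          (hT.bianchi _ _)
        simp only [symb_mono hT, ← elim_cons_swap]
        rw [this, smul_zero]
      · simp [symb_mono_ne _ h]

theorem symb_shift_left (T : Tens r s (Amb n)) (z : Fock n) :
    symb T (shift true true z) = (r : ℝ) • symb T z := by
  induction z using mono_induction with
  | hadd z z' h h' => rw [map_add, map_add, h, h', map_add, smul_add]
  | hsmul c z h => rw [map_smul, map_smul, h, map_smul, smul_comm]
  | hmono p q f g =>
    rw [shift_true_true_mono, map_smul]
    by_cases h : p = r ∧ q = s
    · obtain ⟨rfl, rfl⟩ := h; rfl
    · simp [symb_mono_ne _ h]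

theorem symb_shift_right (T : Tens r s (Amb n)) (z : Fock n) :
    symb T (shift false false z) = (s : ℝ) • symb T z := by
  induction z using mono_induction with
  | hadd z z' h h' => rw [map_add, map_add, h, h', map_add, smul_add]
  | hsmul c z h => rw [map_smul, map_smul, h, map_smul, smul_comm]
  | hmono p q f g =>
    rw [shift_false_false_mono, map_smul]
    by_cases h : p = r ∧ q = s
    · obtain ⟨rfl, rfl⟩ := h; rfl
    · simp [symb_mono_ne _ h]

end Symbol

end AmbientLift

namespace AmbientLift

noncomputable section

/-! ### Components of tensors -/

section Components

open ExteriorAlgebra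

variable {n r s : ℕ}

theorem multilinear_expand {ι E : Type} [Fintype ι] [DecidableEq ι] [AddCommGroup E] [Module ℝ E]
    (f : MultilinearMap ℝ (fun _ : ι => Amb n) E) (v : ι → Amb n) :
    f v = ∑ I : ι → Idx n, (∏ i, v i (I i)) • f (fun i => e (I i)) := by
  conv_lhs => rw [show v = fun i => ∑ J, v i J • (e J : Amb n) from funext fun i => eq_sum_e (v i)]
  rw [MultilinearMap.map_sum]
  exact Finset.sum_congr rfl fun I _ => f.map_smul_univ _ _

/-- A multilinear form on the ambient space is continuous. -/
def toTens (f : MultilinearMap ℝ (fun _ : Fin r ⊕ Fin s => Amb n) ℂ) : Tens r s (Amb n) where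
  toMultilinearMap := f
  cont := by
    have : f.toFun = fun v => ∑ I : Fin r ⊕ Fin s → Idx n,
        (∏ i, v i (I i)) • f (fun i => e (I i)) := funext fun v => multilinear_expand f v
    rw [this]
    fun_prop

/-- The products of coordinate forms. -/
def coordTens (I : Fin r ⊕ Fin s → Idx n) : Tens r s (Amb n) :=
  toTens ((Algebra.linearMap ℝ ℂ).compMultilinearMap
    ((MultilinearMap.mkPiAlgebra ℝ (Fin r ⊕ Fin s) ℝ).compLinearMap
      fun i => (LinearMap.proj (I i) : Amb n →ₗ[ℝ] ℝ)))

theorem coordTens_apply (I : Fin r ⊕ Fin s → Idx n) (v : Fin r ⊕ Fin s → Amb n) :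
    coordTens I v = ((∏ i, v i (I i) : ℝ) : ℂ) := rfl

theorem tens_eq_sum (T : Tens r s (Amb n)) :
    T = ∑ I : Fin r ⊕ Fin s → Idx n, T (fun i => e (I i)) • coordTens I := by
  ext v
  rw [show T v = _ from multilinear_expand T.toMultilinearMap v, sum_apply]
  refine Finset.sum_congr rfl fun I _ => ?_
  rw [smul_apply, coordTens_apply, Complex.real_smul, smul_eq_mul, mul_comm]
  rfl

/-- Multiplication of a fixed tensor by scalars. -/
def smulTens (T : Tens r s (Amb n)) : ℂ →L[ℝ] Tens r s (Amb n) :=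
  ((ContinuousLinearMap.id ℂ ℂ).smulRight T).restrictScalars ℝ

theorem field_eq_sum (F : Amb n → Tens r s (Amb n)) :
    F = ∑ I : Fin r ⊕ Fin s → Idx n,
      smulTens (coordTens I) ∘ (fun x => F x (fun i => e (I i))) := by
  funext x
  rw [Finset.sum_apply]
  exact tens_eq_sum (F x)

theorem contDiffOn_field {F : Amb n → Tens r s (Amb n)} {O : Set (Amb n)}
    (hF : ∀ v, ContDiffOn ℝ ∞ (fun x => F x v) O) : ContDiffOn ℝ ∞ F O := by
  rw [field_eq_sum F]
  have : (∑ I : Fin r ⊕ Fin s → Idx n, smulTens (coordTens I) ∘ (fun x => F x (fun i => e (I i)))) =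
    fun y => ∑ I : Fin r ⊕ Fin s → Idx n, (smulTens (coordTens I) ∘
      (fun x => F x (fun i => e (I i)))) y := by ext; simp
  rw [this]
  exact ContDiffOn.sum fun I _ => (smulTens (coordTens I)).contDiff.comp_contDiffOn (hF _)

theorem contDiffOn_eval {F : Amb n → Tens r s (Amb n)} {O : Set (Amb n)}
    (hF : ContDiffOn ℝ ∞ F O) (v : Fin r ⊕ Fin s → Amb n) :
    ContDiffOn ℝ ∞ (fun x => F x v) O :=
  (ContinuousMultilinearMap.apply ℝ (fun _ : Fin r ⊕ Fin s => Amb n) ℂ v).contDiff.comp_contDiffOn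
    hF

theorem VanishesToInfiniteOrder.zero {Y : Type} [NormedAddCommGroup Y] [NormedSpace ℝ Y]
    (x : Amb n) : VanishesToInfiniteOrder (0 : Amb n → Y) x := fun k => by simp

theorem vanishes_field {F : Amb n → Tens r s (Amb n)} {x : Amb n} (hF : ContDiffAt ℝ ∞ F x)
    (h : ∀ v, VanishesToInfiniteOrder (fun y => F y v) x) : VanishesToInfiniteOrder F x := by
  rw [field_eq_sum F]
  have h1 : ∀ (A : Finset (Fin r ⊕ Fin s → Idx n)), VanishesToInfiniteOrder
      (∑ I ∈ A, smulTens (coordTens I) ∘ (fun x => F x (fun i => e (I i)))) x ∧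
      ContDiffAt ℝ ∞ (∑ I ∈ A, smulTens (coordTens I) ∘ (fun x => F x (fun i => e (I i)))) x := by
    intro A
    induction A using Finset.induction_on with
    | empty => exact ⟨by simpa using VanishesToInfiniteOrder.zero x, contDiffAt_const (c := 0)⟩
    | insert I A hI ih =>
      rw [Finset.sum_insert hI]
      have h2 : ContDiffAt ℝ ∞ (smulTens (coordTens I) ∘ fun x => F x (fun i => e (I i))) x :=
        (smulTens (coordTens I)).contDiff.contDiffAt.comp x (contDiffAt_eval hF _)
      exact ⟨((h _).clm_comp (contDiffAt_eval hF _) _).add ih.1 h2 ih.2, h2.add ih.2⟩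
  exact (h1 _).1

/-- The tensor given by a functional on the exterior algebra. -/
def tensOf (r s : ℕ) (φ : Fock n →ₗ[ℝ] ℂ) : Tens r s (Amb n) :=
  toTens (φ.compMultilinearMap ((LinearMap.mul' ℝ (Fock n)).compMultilinearMap
    (((ιMulti ℝ r).toMultilinearMap.compLinearMap (fun _ => emb true)).domCoprod
      ((ιMulti ℝ s).toMultilinearMap.compLinearMap fun _ => emb false))))

theorem tensOf_apply (φ : Fock n →ₗ[ℝ] ℂ) (v : Fin r ⊕ Fin s → Amb n) :
    tensOf r s φ v = φ (mono r s (v ∘ Sum.inl) (v ∘ Sum.inr)) := rfl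

theorem units_smul_map {A B : Type} [AddCommGroup A] [Module ℝ A] [AddCommGroup B] [Module ℝ B]
    (L : A →ₗ[ℝ] B) (u : ℤˣ) (a : A) : L (u • a) = u • L a := by
  rw [Units.smul_def, Units.smul_def, map_zsmul]

theorem update_eq_cons_swap {p : ℕ} (f : Fin (p + 1) → Amb n) (i : Fin (p + 1)) (u : Amb n) :
    Function.update f i u =
      (Fin.cons u (Fin.tail (f ∘ Equiv.swap 0 i)) : Fin (p + 1) → Amb n) ∘ Equiv.swap 0 i := by
  have h1 : (Fin.cons u (Fin.tail (f ∘ Equiv.swap 0 i)) : Fin (p + 1) → Amb n) =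
      Function.update (f ∘ Equiv.swap 0 i) 0 u := by
    funext k
    refine Fin.cases ?_ (fun j => ?_) k <;> simp [Fin.tail]
  rw [h1]
  funext k
  simp only [Function.comp_apply, Function.update_apply, Equiv.swap_apply_self]
  congr 1
  rw [Equiv.swap_apply_eq_iff, Equiv.swap_apply_left]

/-- Slot i is brought to the front by a transposition, and the rest is independent of u. Slot-wise
contractions of a tensor thereby become exterior multiplications on the exterior algebra. -/
theorem exists_wedge_true (f : Fin r → Amb n) (g : Fin s → Amb n) (i : Fin r) :
    ∃ z, ∀ u, mono r s (Function.update f i u) g = wedge true u z := by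
  rcases r with _ | p
  · exact i.elim0
  refine ⟨Equiv.Perm.sign (Equiv.swap 0 i) • mono p s (Fin.tail (f ∘ Equiv.swap 0 i)) g,
    fun u => ?_⟩
  rw [units_smul_map, wedge_true_mono, update_eq_cons_swap, mono_perm_left]

theorem exists_wedge_false (f : Fin r → Amb n) (g : Fin s → Amb n) (j : Fin s) :
    ∃ z, ∀ u, mono r s f (Function.update g j u) = wedge false u z := by
  rcases s with _ | q
  · exact j.elim0
  refine ⟨Equiv.Perm.sign (Equiv.swap 0 j) • (-1 : ℝ) ^ r •
    mono r q f (Fin.tail (g ∘ Equiv.swap 0 j)), fun u => ?_⟩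
  rw [units_smul_map, map_smul, wedge_false_mono, update_eq_cons_swap, mono_perm_right, smul_smul,
    ← mul_pow]
  simp

theorem exists_wedge_both (f : Fin r → Amb n) (g : Fin s → Amb n) (i : Fin r) (j : Fin s) :
    ∃ z, ∀ u u', mono r s (Function.update f i u) (Function.update g j u') =
      wedge true u (wedge false u' z) := by
  rcases s with _ | q
  · exact j.elim0
  rcases r with _ | p
  · exact i.elim0
  refine ⟨Equiv.Perm.sign (Equiv.swap 0 i) • Equiv.Perm.sign (Equiv.swap 0 j) • (-1 : ℝ) ^ p •
    mono p q (Fin.tail (f ∘ Equiv.swap 0 i)) (Fin.tail (g ∘ Equiv.swap 0 j)), fun u u' => ?_⟩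
  simp only [units_smul_map]
  have hp : ∀ y : Fock n, (-1 : ℝ) ^ p • (-1 : ℝ) ^ p • y = y := fun y => by
    rw [smul_smul, ← mul_pow]
    simp
  rw [map_smul, wedge_false_mono, hp, wedge_true_mono, update_eq_cons_swap, update_eq_cons_swap,
    mono_perm_right, mono_perm_left, smul_comm]

theorem tensOf_update_left (φ : Fock n →ₗ[ℝ] ℂ) (v : Fin r ⊕ Fin s → Amb n) (i : Fin r)
    (u : Amb n) : tensOf r s φ (Function.update v (Sum.inl i) u) =
      φ (mono r s (Function.update (v ∘ Sum.inl) i u) (v ∘ Sum.inr)) := by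
  rw [tensOf_apply, Sum.update_inl_comp_inl, Sum.update_inl_comp_inr]

theorem tensOf_update_right (φ : Fock n →ₗ[ℝ] ℂ) (v : Fin r ⊕ Fin s → Amb n) (j : Fin s)
    (u : Amb n) : tensOf r s φ (Function.update v (Sum.inr j) u) =
      φ (mono r s (v ∘ Sum.inl) (Function.update (v ∘ Sum.inr) j u)) := by
  rw [tensOf_apply, Sum.update_inr_comp_inl, Sum.update_inr_comp_inr]

theorem exists_tensOf_left (v : Fin r ⊕ Fin s → Amb n) (i : Fin r) :
    ∃ z, ∀ (φ : Fock n →ₗ[ℝ] ℂ) u,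
      tensOf r s φ (Function.update v (Sum.inl i) u) = φ (wedge true u z) := by
  obtain ⟨z, hz⟩ := exists_wedge_true (v ∘ Sum.inl) (v ∘ Sum.inr) i
  exact ⟨z, fun φ u => by rw [tensOf_update_left, hz]⟩

theorem exists_tensOf (v : Fin r ⊕ Fin s → Amb n) (a : Fin r ⊕ Fin s) :
    ∃ b z, ∀ (φ : Fock n →ₗ[ℝ] ℂ) u,
      tensOf r s φ (Function.update v a u) = φ (wedge b u z) := by
  rcases a with i | j
  · obtain ⟨z, hz⟩ := exists_tensOf_left v i
    exact ⟨true, z, hz⟩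
  · obtain ⟨z, hz⟩ := exists_wedge_false (v ∘ Sum.inl) (v ∘ Sum.inr) j
    exact ⟨false, z, fun φ u => by rw [tensOf_update_right, hz]⟩

theorem isYoung_tensOf {φ : Fock n →ₗ[ℝ] ℂ} (h : ∀ z, φ (shift true false z) = 0) :
    IsYoung (tensOf r s φ) := by
  have hl : ∀ (σ : Equiv.Perm (Fin r)) (v : Fin r ⊕ Fin s → Amb n),
      tensOf r s φ (v ∘ Sum.map σ id) = Equiv.Perm.sign σ • tensOf r s φ v := fun σ v => by
    rw [tensOf_apply, tensOf_apply, ← units_smul_map, ← mono_perm_left]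
    rfl
  have hr : ∀ (σ : Equiv.Perm (Fin s)) (v : Fin r ⊕ Fin s → Amb n),
      tensOf r s φ (v ∘ Sum.map id σ) = Equiv.Perm.sign σ • tensOf r s φ v := fun σ v => by
    rw [tensOf_apply, tensOf_apply, ← units_smul_map, ← mono_perm_right]
    rfl
  refine ⟨hl, hr, fun b v => (bianchi_iff hl b v).2 ?_⟩
  rcases s with _ | q
  · exact b.elim0
  -- The identity is read off for the first slot of the second column; an arbitrary slot b is
  -- reduced to it by conjugating with the transposition of 0 and b.
  have h0 : ∀ v : Fin r ⊕ Fin (q + 1) → Amb n, tensOf r (q + 1) φ v -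
      ∑ i, tensOf r (q + 1) φ (v ∘ Equiv.swap (Sum.inr 0) (Sum.inl i)) = 0 := by
    intro v
    obtain ⟨f, u, g, rfl⟩ : ∃ f u g, v = Sum.elim f (Fin.cons u g : Fin (q + 1) → Amb n) :=
      ⟨v ∘ Sum.inl, v (Sum.inr 0), Fin.tail (v ∘ Sum.inr), by
        rw [show v (Sum.inr 0) = (v ∘ Sum.inr) 0 from rfl, Fin.cons_self_tail,
          Sum.elim_comp_inl_inr]⟩
    simp only [elim_cons_swap, tensOf_apply, Sum.elim_comp_inl, Sum.elim_comp_inr]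
    have h1 := h (mono (r + 1) q (Fin.cons u f) g)
    rw [shift_true_false_mono_succ, map_smul, map_sub, map_sum] at h1
    exact (smul_eq_zero.1 h1).resolve_left (pow_ne_zero _ (by norm_num))
  have h1 := h0 (v ∘ Sum.map id (Equiv.swap 0 b))
  have h2 : ∀ i : Fin r, (v ∘ Sum.map id (Equiv.swap 0 b)) ∘ Equiv.swap (Sum.inr 0) (Sum.inl i) =
      (v ∘ Equiv.swap (Sum.inr b) (Sum.inl i)) ∘ Sum.map id (Equiv.swap 0 b) := by
    intro i
    funext x
    simp only [Function.comp_apply]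
    congr 1
    rcases x with k | c
    · by_cases hk : k = i
      · subst hk; simp
      · rw [Equiv.swap_apply_of_ne_of_ne (by simp) (by simpa using hk), Sum.map_inl, id_eq,
          Equiv.swap_apply_of_ne_of_ne (by simp) (by simpa using hk)]
    · by_cases hc : c = 0
      · subst hc; simp
      · rw [Equiv.swap_apply_of_ne_of_ne (by simpa using hc) (by simp), Sum.map_inr]
        refine (Equiv.swap_apply_of_ne_of_ne ?_ (by simp)).symm
        simpa [Equiv.swap_apply_eq_iff] using hc
  simp only [h2, hr, ← Finset.smul_sum, ← smul_sub] at h1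
  rwa [smul_eq_zero_iff_eq] at h1

variable {h : Matrix (Fin n) (Fin n) ℝ}

theorem isSymm_ambMetric (hs : h.IsSymm) : (ambMetric h).IsSymm := by
  ext I J
  rcases I with I | I | I <;> rcases J with J | J | J <;> simp [ambMetric, hs.apply]

theorem ambContract_swap (hs : h.IsSymm) {M : Type} [AddCommGroup M] [Module ℝ M]
    (β : Amb n → Amb n → M) : ambContract h (fun u u' => β u' u) = ambContract h β := by
  rw [ambContract, ambContract, Finset.sum_comm]
  have := (isSymm_ambMetric hs).inv
  refine Finset.sum_congr rfl fun I _ => Finset.sum_congr rfl fun J _ => ?_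
  rw [this.apply]

theorem IsYoung.update_swap {M : Type} [NormedAddCommGroup M] [NormedSpace ℝ M] {T : Tens r s M}
    (hT : IsYoung T) (v : Fin r ⊕ Fin s → M) (u u' : M) :
    (∀ a a' : Fin r, a ≠ a' →
      T (Function.update (Function.update v (Sum.inl a) u) (Sum.inl a') u') =
        - T (Function.update (Function.update v (Sum.inl a) u') (Sum.inl a') u)) ∧
    (∀ a a' : Fin s, a ≠ a' →
      T (Function.update (Function.update v (Sum.inr a) u) (Sum.inr a') u') =
        - T (Function.update (Function.update v (Sum.inr a) u') (Sum.inr a') u)) := by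
  constructor
  · intro a a' haa
    have h1 := hT.skew_left (Equiv.swap a a')
      (Function.update (Function.update v (Sum.inl a) u') (Sum.inl a') u)
    rw [Equiv.Perm.sign_swap haa, Units.neg_smul, one_smul] at h1
    rw [← h1]
    congr 1
    funext x
    rcases x with k | c
    · by_cases hk : k = a
      · subst hk; simp [haa]
      · by_cases hk' : k = a'
        · subst hk'; simp [haa]
        · simp [Equiv.swap_apply_of_ne_of_ne hk hk', hk, hk']
    · simp
  · intro a a' haa
    have h1 := hT.skew_right (Equiv.swap a a')
      (Function.update (Function.update v (Sum.inr a) u') (Sum.inr a') u)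
    rw [Equiv.Perm.sign_swap haa, Units.neg_smul, one_smul] at h1
    rw [← h1]
    congr 1
    funext x
    rcases x with c | k
    · simp
    · by_cases hk : k = a
      · subst hk; simp [haa]
      · by_cases hk' : k = a'
        · subst hk'; simp [haa]
        · simp [Equiv.swap_apply_of_ne_of_ne hk hk', hk, hk']

theorem ambContract_eq_zero_of_skew (hs : h.IsSymm) (β : Amb n → Amb n → ℂ)
    (hβ : ∀ u u', β u u' = -β u' u) : ambContract h β = 0 := by
  have h1 := ambContract_swap hs β
  have h2 : ambContract h (fun u u' => β u' u) = - ambContract h β := by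
    simp only [ambContract, ← Finset.sum_neg_distrib, ← smul_neg]
    refine Finset.sum_congr rfl fun I _ => Finset.sum_congr rfl fun J _ => ?_
    rw [hβ]
  rw [h1] at h2
  exact CharZero.eq_neg_self_iff.mp h2

/-- The trace of a tensor over any two slots vanishes if the traces over one slot of each group
vanish. -/
theorem IsYoung.trace_eq_zero (hs : h.IsSymm) {T : Tens r s (Amb n)} (hT : IsYoung T)
    (hmix : ∀ (i : Fin r) (j : Fin s) v, ambContract h (fun u u' =>
      T (Function.update (Function.update v (Sum.inl i) u) (Sum.inr j) u')) = 0)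
    (a a' : Fin r ⊕ Fin s) (haa : a ≠ a') (v : Fin r ⊕ Fin s → Amb n) :
    ambContract h (fun u u' => T (Function.update (Function.update v a u) a' u')) = 0 := by
  rcases a with a | a <;> rcases a' with a' | a'
  · exact ambContract_eq_zero_of_skew hs _ fun u u' =>
      (hT.update_swap v u u').1 a a' (by simpa using haa)
  · exact hmix _ _ _
  · rw [← hmix a' a v, ← ambContract_swap hs]
    simp only [Function.update_comm haa]
  · exact ambContract_eq_zero_of_skew hs _ fun u u' =>
      (hT.update_swap v u u').2 a a' (by simpa using haa)

/-- The contraction of both columns of the exterior algebra with the inverse metric. -/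
def traceOp (h : Matrix (Fin n) (Fin n) ℝ) (z : Fock n) : Fock n :=
  ambContract h (fun u u' => wedge true u (wedge false u' z))

theorem tensOf_trace (hs : h.IsSymm) {φ : Fock n →ₗ[ℝ] ℂ}
    (hY : ∀ z, φ (shift true false z) = 0) (hφ : ∀ z, φ (traceOp h z) = 0)
    (a a' : Fin r ⊕ Fin s) (haa : a ≠ a') (v : Fin r ⊕ Fin s → Amb n) :
    ambContract h (fun u u' =>
      tensOf r s φ (Function.update (Function.update v a u) a' u')) = 0 := by
  refine (isYoung_tensOf hY).trace_eq_zero hs (fun i j v => ?_) a a' haa v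
  obtain ⟨z, hz⟩ := exists_wedge_both (v ∘ Sum.inl) (v ∘ Sum.inr) i j
  have h1 : ∀ u u', tensOf r s φ
      (Function.update (Function.update v (Sum.inl i) u) (Sum.inr j) u') =
      φ (wedge true u (wedge false u' z)) := fun u u' => by
    rw [tensOf_update_right, Sum.update_inl_comp_inl, Sum.update_inl_comp_inr, hz]
  simp only [h1]
  rw [← hφ z, traceOp]
  exact ambContract_map φ _

theorem symb_trace {T : Tens r s (Amb n)} (hT : IsYoung T)
    (hT' : ∀ (i : Fin r) (j : Fin s) v, ambContract h (fun u u' =>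
      T (Function.update (Function.update v (Sum.inl i) u) (Sum.inr j) u')) = 0) (z : Fock n) :
    symb T (traceOp h z) = 0 := by
  rw [traceOp, ← ambContract_map, ambContract, ← Fintype.sum_prod_type']
  refine symb_wedge_wedge hT (fun x : Idx n × Idx n => (ambMetric h)⁻¹ x.1 x.2) (fun x => e x.1)
    (fun x => e x.2) (fun i j v => ?_) z
  rw [Fintype.sum_prod_type, ← hT' i j v]
  rfl

end Components

end

end AmbientLift

namespace AmbientLift

noncomputable section

/-! ### Complex orthonormal frames -/

/-- Diagonalise by the spectral theorem and rescale by complex square roots of the nonzero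
eigenvalues. Over the complex numbers the signature plays no role. -/
theorem exists_frame {κ : Type} [Fintype κ] [DecidableEq κ] {G : Matrix κ κ ℝ} (hs : G.IsSymm)
    (hd : IsUnit G.det) : ∃ P R : Matrix κ κ ℂ, P * R = 1 ∧ R * P = 1 ∧
      P * Pᵀ = (G⁻¹).map Complex.ofRealHom ∧ Rᵀ * R = G.map Complex.ofRealHom := by
  have hH : G.IsHermitian := by
    rw [Matrix.IsHermitian, Matrix.conjTranspose_eq_transpose_of_trivial]; exact hs
  set U : Matrix κ κ ℝ := hH.eigenvectorUnitary.1 with hU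
  have hUU : Uᵀ * U = 1 := by
    have := Matrix.UnitaryGroup.star_mul_self hH.eigenvectorUnitary
    rwa [Matrix.star_eq_conjTranspose, Matrix.conjTranspose_eq_transpose_of_trivial] at this
  have hUU' : U * Uᵀ = 1 := mul_eq_one_comm.mp hUU
  have hG : G = U * Matrix.diagonal hH.eigenvalues * Uᵀ := by
    have := hH.spectral_theorem
    simpa [Unitary.conjStarAlgAut_apply, Matrix.star_eq_conjTranspose,
      Matrix.conjTranspose_eq_transpose_of_trivial] using this
  have hne : ∀ i, hH.eigenvalues i ≠ 0 := by
    have h1 : G.det = ∏ i, hH.eigenvalues i := by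
      conv_lhs => rw [hG]
      rw [Matrix.det_mul_right_comm, hUU', Matrix.one_mul, Matrix.det_diagonal]
    rw [h1, isUnit_iff_ne_zero, Finset.prod_ne_zero_iff] at hd
    exact fun i => hd i (Finset.mem_univ i)
  choose z hz using fun i => IsAlgClosed.exists_pow_nat_eq ((hH.eigenvalues i : ℝ) : ℂ) two_pos
  have hz0 : ∀ i, z i ≠ 0 := fun i h0 => by
    have := hz i
    rw [h0] at this
    simp at this
    exact hne i (by exact_mod_cast this.symm)
  set V := U.map Complex.ofRealHom
  have hVV : Vᵀ * V = 1 := by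
    rw [← Matrix.transpose_map, ← Matrix.map_mul, hUU, Matrix.map_one _ (map_zero _) (map_one _)]
  have hVV' : V * Vᵀ = 1 := mul_eq_one_comm.mp hVV
  have hGC : G.map Complex.ofRealHom = V * Matrix.diagonal (fun i => z i * z i) * Vᵀ := by
    conv_lhs => rw [hG]
    rw [Matrix.map_mul, Matrix.map_mul, Matrix.diagonal_map (map_zero _), Matrix.transpose_map]
    congr 3
    funext i
    rw [← sq, hz i]
    rfl
  have hzz : Matrix.diagonal z * Matrix.diagonal (fun i => (z i)⁻¹) = 1 := by
    rw [Matrix.diagonal_mul_diagonal]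
    simp [hz0]
  have hzz' := mul_eq_one_comm.mp hzz
  have h1 : V * Matrix.diagonal (fun i => (z i)⁻¹) * (Matrix.diagonal z * Vᵀ) = 1 := by
    rw [Matrix.mul_assoc, ← Matrix.mul_assoc _ _ Vᵀ, hzz', Matrix.one_mul, hVV']
  have h4 : (Matrix.diagonal z * Vᵀ)ᵀ * (Matrix.diagonal z * Vᵀ) = G.map Complex.ofRealHom := by
    rw [hGC, Matrix.transpose_mul, Matrix.transpose_transpose, Matrix.diagonal_transpose,
      Matrix.mul_assoc, ← Matrix.mul_assoc _ _ Vᵀ, Matrix.diagonal_mul_diagonal,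
      ← Matrix.mul_assoc]
  refine ⟨V * Matrix.diagonal (fun i => (z i)⁻¹), Matrix.diagonal z * Vᵀ, h1,
    mul_eq_one_comm.mp h1, ?_, h4⟩
  set P := V * Matrix.diagonal (fun i => (z i)⁻¹)
  set R := Matrix.diagonal z * Vᵀ
  have h5 : (G⁻¹).map Complex.ofRealHom * G.map Complex.ofRealHom = 1 := by
    rw [← Matrix.map_mul, Matrix.nonsing_inv_mul _ hd, Matrix.map_one _ (map_zero _) (map_one _)]
  have h6 : G.map Complex.ofRealHom * (P * Pᵀ) = 1 := by
    rw [← h4, Matrix.mul_assoc, ← Matrix.mul_assoc R, mul_eq_one_comm.mp h1, Matrix.one_mul,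
      ← Matrix.transpose_mul, h1, Matrix.transpose_one]
  calc P * Pᵀ = ((G⁻¹).map Complex.ofRealHom * G.map Complex.ofRealHom) * (P * Pᵀ) := by
        rw [h5, Matrix.one_mul]
    _ = _ := by rw [Matrix.mul_assoc, h6, Matrix.mul_one]

/-! ### Linear combinations of generators -/

section Combine

variable {κ B : Type} [Fintype κ] [Ring B] [Algebra ℂ B]

theorem combine_mul [DecidableEq κ] {u v : κ → B} {η : ℤ} {z : B}
    (h : ∀ I J, u I * v J = η • (v J * u I) + if I = J then z else 0) (a b : κ → ℂ) :
    (∑ I, a I • u I) * (∑ J, b J • v J) =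
      η • ((∑ J, b J • v J) * (∑ I, a I • u I)) + (∑ I, a I * b I) • z := by
  have h2 : (∑ J, b J • v J) * (∑ I, a I • u I) = ∑ I, ∑ J, (a I * b J) • (v J * u I) := by
    rw [Finset.sum_mul_sum, Finset.sum_comm]
    refine Finset.sum_congr rfl fun I _ => Finset.sum_congr rfl fun J _ => ?_
    rw [smul_mul_smul_comm, mul_comm]
  rw [h2, Finset.sum_mul_sum, Finset.smul_sum, Finset.sum_smul, ← Finset.sum_add_distrib]
  refine Finset.sum_congr rfl fun I _ => ?_
  have h3 : (a I * b I) • z = ∑ J, (a I * b J) • if I = J then z else 0 := by simp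
  rw [h3, Finset.smul_sum, ← Finset.sum_add_distrib]
  refine Finset.sum_congr rfl fun J _ => ?_
  rw [smul_mul_smul_comm, h, smul_add, smul_comm η]

/-- Rewrites a quadratic operator of the frame in the original coordinates. The matrix `A * Cᵀ`
becomes the identity for operators pairing dual generators, and the metric or its inverse for the
others. -/
theorem sum_combine (u v : κ → B) (A C : Matrix κ κ ℂ) :
    ∑ i, (∑ I, A I i • u I) * (∑ J, C J i • v J) = ∑ I, ∑ J, (A * Cᵀ) I J • (u I * v J) := by
  simp only [Finset.sum_mul_sum, Matrix.mul_apply, Finset.sum_smul, Matrix.transpose_apply]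
  rw [Finset.sum_comm]
  refine Finset.sum_congr rfl fun I _ => ?_
  rw [Finset.sum_comm]
  refine Finset.sum_congr rfl fun J _ => Finset.sum_congr rfl fun i _ => ?_
  rw [smul_mul_smul_comm]

theorem sum_one [DecidableEq κ] (u v : κ → B) :
    ∑ I, ∑ J, (1 : Matrix κ κ ℂ) I J • (u I * v J) = ∑ I, u I * v I := by
  simp [Matrix.one_apply, ite_smul]

end Combine

/-! ### The Weyl–Clifford module of functionals on the exterior algebra -/

section FockModule

variable {n : ℕ} {A : Type} [AddCommGroup A] [Module ℂ A]

/-- Composition with an endomorphism of the values. -/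
def post (L : Module.End ℂ A) : Module.End ℂ (Fock n →ₗ[ℝ] A) where
  toFun φ := L.restrictScalars ℝ ∘ₗ φ
  map_add' _ _ := LinearMap.ext fun _ => L.map_add _ _
  map_smul' _ _ := LinearMap.ext fun _ => L.map_smul _ _

/-- Composition with an endomorphism of the exterior algebra. -/
def pre (A : Type) [AddCommGroup A] [Module ℂ A] (L : Fock n →ₗ[ℝ] Fock n) :
    Module.End ℂ (Fock n →ₗ[ℝ] A) where
  toFun φ := φ ∘ₗ L
  map_add' _ _ := rfl
  map_smul' _ _ := rfl

theorem post_apply (L : Module.End ℂ A) (φ : Fock n →ₗ[ℝ] A) (z) : post L φ z = L (φ z) := rfl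
theorem post_pre (L : Module.End ℂ A) (L' : Fock n →ₗ[ℝ] Fock n) :
    post L * pre A L' = pre A L' * post L := rfl

/-- A module with coordinates and derivatives, over the ambient space. -/
structure WeylModule (n : ℕ) (A : Type) [AddCommGroup A] [Module ℂ A] where
  x : Idx n → Module.End ℂ A
  d : Idx n → Module.End ℂ A
  xx : ∀ i j, x i * x j = x j * x i
  dd : ∀ i j, d i * d j = d j * d i
  dx : ∀ i j, d i * x j = x j * d i + if i = j then 1 else 0

/-- Mutually inverse complex matrices which diagonalize the ambient metric. -/
structure Frame (h : Matrix (Fin n) (Fin n) ℝ) where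
  P : Matrix (Idx n) (Idx n) ℂ
  R : Matrix (Idx n) (Idx n) ℂ
  PR : P * R = 1
  RP : R * P = 1
  PP : P * Pᵀ = ((ambMetric h)⁻¹).map Complex.ofRealHom
  RR : Rᵀ * R = (ambMetric h).map Complex.ofRealHom

variable {h : Matrix (Fin n) (Fin n) ℝ} (V : WeylModule n A) (f : Frame h)

theorem Frame.PtG : f.Pᵀ * (ambMetric h).map Complex.ofRealHom = f.R := by
  rw [← f.RR, ← Matrix.mul_assoc, ← Matrix.transpose_mul, f.RP, Matrix.transpose_one,
    Matrix.one_mul]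

theorem Frame.sum_PR (i j : Idx n) : ∑ I, f.P I i * f.R j I = if i = j then 1 else 0 := by
  have := congrFun (congrFun f.RP j) i
  rw [Matrix.mul_apply, Matrix.one_apply] at this
  simpa only [mul_comm, eq_comm] using this

theorem post_mul (L L' : Module.End ℂ A) : post (n := n) (L * L') = post L * post L' := rfl
theorem post_add (L L' : Module.End ℂ A) : post (n := n) (L + L') = post L + post L' := rfl
theorem post_one : post (n := n) (1 : Module.End ℂ A) = 1 := rfl
theorem post_zero : post (n := n) (0 : Module.End ℂ A) = 0 := rfl

theorem WeylModule.post_dx (i j : Idx n) : post (n := n) (V.d i) * post (V.x j) =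
    (1 : ℤ) • (post (V.x j) * post (V.d i)) + if i = j then 1 else 0 := by
  rw [← post_mul, V.dx, post_add, post_mul, one_smul]
  by_cases hij : i = j <;> simp [hij, post_one, post_zero]

theorem comm_combine {B : Type} [Ring B] [Algebra ℂ B] {u v : Idx n → B}
    (h : ∀ I J, u I * v J = v J * u I) (a b : Idx n → ℂ) :
    (∑ I, a I • u I) * (∑ J, b J • v J) = (∑ J, b J • v J) * (∑ I, a I • u I) := by
  have := combine_mul (u := u) (v := v) (η := 1) (z := 0) (by simpa using h) a b
  simpa using this

theorem anti_combine {B : Type} [Ring B] [Algebra ℂ B] {u v : Idx n → B}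
    (h : ∀ I J, u I * v J = -(v J * u I)) (a b : Idx n → ℂ) :
    (∑ I, a I • u I) * (∑ J, b J • v J) = -((∑ J, b J • v J) * (∑ I, a I • u I)) := by
  have := combine_mul (u := u) (v := v) (η := -1) (z := 0) (by simpa using h) a b
  simpa using this

/-- Operators act on functionals by precomposition, which reverses their order; the anticommutator
is the one of contraction and multiplication on the exterior algebra. A contraction of tensors is
thus dual to a multiplication, and conversely. -/
theorem pre_ct (a b : Bool) (I J : Idx n) :
    pre A (wedge a (e I)) * pre A (contr b J) =
      (-1 : ℤ) • (pre A (contr b J) * pre A (wedge a (e I))) +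
        if I = J then (if a = b then 1 else 0) else 0 := by
  refine LinearMap.ext fun φ => LinearMap.ext fun z => ?_
  have h1 : (pre A (wedge a (e I)) * pre A (contr b J)) φ z = φ (contr b J (wedge a (e I) z)) := rfl
  have h2 : (pre A (contr b J) * pre A (wedge a (e I))) φ z = φ (wedge a (e I) (contr b J z)) := rfl
  rw [h1, contr_wedge, LinearMap.add_apply, LinearMap.smul_apply, LinearMap.add_apply,
    LinearMap.smul_apply, h2, map_sub, map_smul]
  rcases eq_or_ne I J with rfl | hij <;> rcases eq_or_ne a b with rfl | hab
  · simp [e, sub_eq_neg_add]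
  · simp [hab, hab.symm]
  · simp [hij, e, hij.symm]
  · simp [hij, hab.symm]

/-- The Weyl–Clifford module of functionals on the exterior algebra with values in a module of
functions, in an orthonormal frame. -/
def fockWC : WeylClifford (Idx n) (Fock n →ₗ[ℝ] A) where
  x i := ∑ I, f.R i I • post (V.x I)
  d i := ∑ I, f.P I i • post (V.d I)
  c a i := ∑ I, f.P I i • pre A (wedge a (e I))
  t a i := ∑ I, f.R i I • pre A (contr a I)
  xx i j := comm_combine (fun I J => by rw [← post_mul, V.xx, post_mul]) _ _
  dd i j := comm_combine (fun I J => by rw [← post_mul, V.dd, post_mul]) _ _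
  dx i j := by
    rw [combine_mul V.post_dx, one_smul, f.sum_PR]
    by_cases hij : i = j <;> simp [hij]
  cc a b i j := anti_combine (fun I J => by
    refine LinearMap.ext fun φ => LinearMap.ext fun z => ?_
    change φ (wedge b (e J) (wedge a (e I) z)) = -φ (wedge a (e I) (wedge b (e J) z))
    rw [wedge_wedge, map_neg]) _ _
  tt a b i j := anti_combine (fun I J => by
    refine LinearMap.ext fun φ => LinearMap.ext fun z => ?_
    change φ (contr b J (contr a I z)) = -φ (contr a I (contr b J z))
    rw [contr_contr, map_neg]) _ _
  ct a b i j := by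
    rw [combine_mul (pre_ct a b), f.sum_PR]
    by_cases hij : i = j <;> by_cases hab : a = b <;> simp [hij, hab]
  xc a i j := comm_combine (fun _ _ => post_pre _ _) _ _
  xt a i j := comm_combine (fun _ _ => post_pre _ _) _ _
  dc a i j := comm_combine (fun _ _ => post_pre _ _) _ _
  dt a i j := comm_combine (fun _ _ => post_pre _ _) _ _

theorem fockWC_con (a : Bool) (φ : Fock n →ₗ[ℝ] A) (z : Fock n) :
    (fockWC V f).con a φ z = ∑ I, V.x I (φ (wedge a (e I) z)) := by
  have h1 : (fockWC V f).con a = ∑ I, post (V.x I) * pre A (wedge a (e I)) := by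
    have := sum_combine (fun I => post (V.x I)) (fun I => pre A (wedge a (e I))) f.Rᵀ f.P
    rw [← Matrix.transpose_mul, f.PR, Matrix.transpose_one, sum_one] at this
    exact this
  rw [h1, LinearMap.sum_apply, LinearMap.sum_apply]
  rfl

theorem fockWC_S (a b : Bool) (φ : Fock n →ₗ[ℝ] A) (z : Fock n) :
    (fockWC V f).S a b φ z = φ (shift a b z) := by
  have h1 : (fockWC V f).S a b = ∑ I, pre A (contr a I) * pre A (wedge b (e I)) := by
    have := sum_combine (fun I => pre A (contr a I)) (fun I => pre A (wedge b (e I))) f.Rᵀ f.P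
    rw [← Matrix.transpose_mul, f.PR, Matrix.transpose_one, sum_one] at this
    exact this
  rw [h1, LinearMap.sum_apply, LinearMap.sum_apply, shift, LinearMap.sum_apply, map_sum]
  rfl

theorem fockWC_eul (φ : Fock n →ₗ[ℝ] A) (z : Fock n) :
    (fockWC V f).eul φ z = ∑ I, V.x I (V.d I (φ z)) := by
  have h1 : (fockWC V f).eul = ∑ I, post (V.x I) * post (V.d I) := by
    have := sum_combine (fun I => post (n := n) (V.x I)) (fun I => post (V.d I)) f.Rᵀ f.P
    rw [← Matrix.transpose_mul, f.PR, Matrix.transpose_one, sum_one] at this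
    exact this
  rw [h1, LinearMap.sum_apply, LinearMap.sum_apply]
  rfl

theorem fockWC_div (a : Bool) (φ : Fock n →ₗ[ℝ] A) (z : Fock n) :
    (fockWC V f).div a φ z =
      ∑ I, ∑ J, (((ambMetric h)⁻¹ I J : ℝ) : ℂ) • V.d I (φ (wedge a (e J) z)) := by
  have h1 : (fockWC V f).div a = ∑ I, ∑ J, (((ambMetric h)⁻¹ I J : ℝ) : ℂ) •
      (post (V.d I) * pre A (wedge a (e J))) := by
    have := sum_combine (fun I => post (V.d I)) (fun I => pre A (wedge a (e I))) f.P f.P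
    rw [f.PP] at this
    exact this
  rw [h1]
  simp only [LinearMap.sum_apply]
  rfl

theorem fockWC_lap (φ : Fock n →ₗ[ℝ] A) (z : Fock n) :
    (fockWC V f).lap φ z =
      ∑ I, ∑ J, (((ambMetric h)⁻¹ I J : ℝ) : ℂ) • V.d I (V.d J (φ z)) := by
  have h1 : (fockWC V f).lap = ∑ I, ∑ J, (((ambMetric h)⁻¹ I J : ℝ) : ℂ) •
      (post (n := n) (V.d I) * post (V.d J)) := by
    have := sum_combine (fun I => post (n := n) (V.d I)) (fun I => post (V.d I)) f.P f.P
    rw [f.PP] at this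
    exact this
  rw [h1]
  simp only [LinearMap.sum_apply]
  rfl

theorem fockWC_quad (φ : Fock n →ₗ[ℝ] A) (z : Fock n) :
    (fockWC V f).quad φ z =
      ∑ I, ∑ J, ((ambMetric h I J : ℝ) : ℂ) • V.x I (V.x J (φ z)) := by
  have h1 : (fockWC V f).quad = ∑ I, ∑ J, ((ambMetric h I J : ℝ) : ℂ) •
      (post (n := n) (V.x I) * post (V.x J)) := by
    have := sum_combine (fun I => post (n := n) (V.x I)) (fun I => post (V.x I)) f.Rᵀ f.Rᵀ
    rw [Matrix.transpose_transpose, f.RR] at this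
    exact this
  rw [h1]
  simp only [LinearMap.sum_apply]
  rfl

theorem fockWC_eps (a : Bool) (φ : Fock n →ₗ[ℝ] A) (z : Fock n) :
    (fockWC V f).eps a φ z =
      ∑ I, ∑ J, ((ambMetric h I J : ℝ) : ℂ) • V.x I (φ (contr a J z)) := by
  have h1 : (fockWC V f).eps a = ∑ I, ∑ J, ((ambMetric h I J : ℝ) : ℂ) •
      (post (V.x I) * pre A (contr a J)) := by
    have := sum_combine (fun I => post (V.x I)) (fun I => pre A (contr a I)) f.Rᵀ f.Rᵀ
    rw [Matrix.transpose_transpose, f.RR] at this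
    exact this
  rw [h1]
  simp only [LinearMap.sum_apply]
  rfl

/-- The sign records that precomposition reverses the order of the two anticommuting
multiplications. -/
theorem fockWC_tr (φ : Fock n →ₗ[ℝ] A) (z : Fock n) :
    (fockWC V f).tr φ z = -φ (traceOp h z) := by
  have h1 : (fockWC V f).tr = ∑ I, ∑ J, (((ambMetric h)⁻¹ I J : ℝ) : ℂ) •
      (pre A (wedge true (e I)) * pre A (wedge false (e J))) := by
    have := sum_combine (fun I => pre A (wedge true (e I))) (fun I => pre A (wedge false (e I)))
      f.P f.P
    rw [f.PP] at this
    exact this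
  rw [h1, traceOp, ambContract]
  simp only [LinearMap.sum_apply, map_sum, map_smul]
  rw [← Finset.sum_neg_distrib]
  refine Finset.sum_congr rfl fun I _ => ?_
  rw [← Finset.sum_neg_distrib]
  refine Finset.sum_congr rfl fun J _ => ?_
  change (((ambMetric h)⁻¹ I J : ℝ) : ℂ) • φ (wedge false (e J) (wedge true (e I) z)) = _
  rw [wedge_wedge, map_neg, smul_neg, Complex.coe_smul]

end FockModule

end

end AmbientLift

namespace AmbientLift

noncomputable section

/-! ### The null cone in a module of functions -/

section FockCone

variable {n : ℕ} {A : Type} [AddCommGroup A] [Module ℂ A]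

/-- Multiplication by the linear form dual to `q`. -/
def WeylModule.lin (V : WeylModule n A) (h : Matrix (Fin n) (Fin n) ℝ) (q : Amb n) :
    Module.End ℂ A := ∑ J, (((q ᵥ* ambMetric h) J : ℝ) : ℂ) • V.x J

/-- Differentiation in the direction `q`. -/
def WeylModule.dir (V : WeylModule n A) (q : Amb n) : Module.End ℂ A :=
  ∑ I, ((q I : ℝ) : ℂ) • V.d I

/-- The data of a null cone in a module of functions. -/
structure FunctionCone (V : WeylModule n A) (h : Matrix (Fin n) (Fin n) ℝ) where
  q : Amb n
  q_null : ambForm h q q = 0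
  li : Module.End ℂ A
  K : Submodule ℂ A
  li_lin : li * V.lin h q = 1
  lin_li : V.lin h q * li = 1
  li_x : ∀ I, li * V.x I = V.x I * li
  K_x : ∀ I, ∀ u ∈ K, V.x I u ∈ K
  K_li : ∀ u ∈ K, li u ∈ K
  K_quad : ∀ u, ∑ I, ∑ J, ((ambMetric h I J : ℝ) : ℂ) • V.x I (V.x J u) ∈ K
  K_tan : ∀ I, ∀ u ∈ K,
    V.lin h q (V.d I u) - ∑ J, ((ambMetric h I J : ℝ) : ℂ) • V.x J (V.dir q u) ∈ K
  sep : ∀ S : Submodule ℂ A, S ≤ K → (∀ u ∈ S, ∀ I, V.d I u ∈ S) → ∀ u ∈ S, u = 0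

variable {h : Matrix (Fin n) (Fin n) ℝ} (V : WeylModule n A) (f : Frame h)

theorem sum_smul_combine {B κ : Type} [Fintype κ] [AddCommGroup B] [Module ℂ B] (u : κ → B)
    (a : κ → ℂ) (C : Matrix κ κ ℂ) :
    ∑ i, a i • ∑ I, C i I • u I = ∑ I, (a ᵥ* C) I • u I := by
  simp only [Finset.smul_sum, smul_smul, Matrix.vecMul, dotProduct, Finset.sum_smul]
  rw [Finset.sum_comm]

/-- The complex coordinates of a vector in a frame. -/
def Frame.coord (q : Amb n) : Idx n → ℂ := f.R *ᵥ (fun I => ((q I : ℝ) : ℂ))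

theorem Frame.coord_vecMul_R (q : Amb n) :
    f.coord q ᵥ* f.R = fun J => (((q ᵥ* ambMetric h) J : ℝ) : ℂ) := by
  rw [Frame.coord, ← Matrix.vecMul_transpose, Matrix.vecMul_vecMul, f.RR]
  funext J
  simp [Matrix.vecMul, dotProduct]

theorem Frame.coord_vecMul_Pt (q : Amb n) :
    f.coord q ᵥ* f.Pᵀ = fun I => ((q I : ℝ) : ℂ) := by
  rw [Frame.coord, ← Matrix.vecMul_transpose, Matrix.vecMul_vecMul, ← Matrix.transpose_mul, f.PR,
    Matrix.transpose_one, Matrix.vecMul_one]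

theorem ambForm_eq (u v : Amb n) : ambForm h u v = (u ᵥ* ambMetric h) ⬝ᵥ v := by
  rw [ambForm, Matrix.toBilin'_apply', Matrix.dotProduct_mulVec]

theorem fockWC_lin (q : Amb n) : (fockWC V f).lin (f.coord q) = post (V.lin h q) := by
  have h1 : (fockWC V f).lin (f.coord q) = ∑ J, (((q ᵥ* ambMetric h) J : ℝ) : ℂ) • post (V.x J) := by
    have := sum_smul_combine (fun I => post (n := n) (V.x I)) (f.coord q) f.R
    rw [f.coord_vecMul_R] at this
    exact this
  rw [h1]
  refine LinearMap.ext fun φ => LinearMap.ext fun z => ?_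
  simp only [LinearMap.sum_apply, post_apply, WeylModule.lin]
  rfl

theorem fockWC_dir (q : Amb n) : (fockWC V f).dir (f.coord q) = post (V.dir q) := by
  have h1 : (fockWC V f).dir (f.coord q) = ∑ J, ((q J : ℝ) : ℂ) • post (V.d J) := by
    have := sum_smul_combine (fun I => post (n := n) (V.d I)) (f.coord q) f.Pᵀ
    rw [f.coord_vecMul_Pt] at this
    exact this
  rw [h1]
  refine LinearMap.ext fun φ => LinearMap.ext fun z => ?_
  simp only [LinearMap.sum_apply, post_apply, WeylModule.dir]
  rfl

theorem fockWC_conDir (q : Amb n) (a : Bool) :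
    (fockWC V f).conDir (f.coord q) a = pre A (wedge a q) := by
  have h1 : (fockWC V f).conDir (f.coord q) a =
      ∑ J, ((q J : ℝ) : ℂ) • pre A (wedge a (e J)) := by
    have := sum_smul_combine (fun I => pre A (wedge a (e I))) (f.coord q) f.Pᵀ
    rw [f.coord_vecMul_Pt] at this
    exact this
  rw [h1]
  refine LinearMap.ext fun φ => LinearMap.ext fun z => ?_
  simp only [LinearMap.sum_apply]
  change ∑ J, ((q J : ℝ) : ℂ) • φ (wedge a (e J) z) = φ (wedge a q z)
  conv_rhs => rw [eq_sum_e q]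
  simp only [wedge_apply, map_sum, map_smul, Finset.sum_mul, smul_mul_assoc, Complex.coe_smul]

theorem fockWC_d_apply (i : Idx n) (φ : Fock n →ₗ[ℝ] A) (z : Fock n) :
    (fockWC V f).d i φ z = ∑ I, f.P I i • V.d I (φ z) := by
  change (∑ I, f.P I i • post (V.d I)) φ z = _
  simp only [LinearMap.sum_apply]
  rfl

theorem fockWC_x_apply (i : Idx n) (φ : Fock n →ₗ[ℝ] A) (z : Fock n) :
    (fockWC V f).x i φ z = ∑ I, f.R i I • V.x I (φ z) := by
  change (∑ I, f.R i I • post (V.x I)) φ z = _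
  simp only [LinearMap.sum_apply]
  rfl

theorem fockWC_c_apply (a : Bool) (i : Idx n) (φ : Fock n →ₗ[ℝ] A) (z : Fock n) :
    (fockWC V f).c a i φ z = ∑ I, f.P I i • φ (wedge a (e I) z) := by
  change (∑ I, f.P I i • pre A (wedge a (e I))) φ z = _
  simp only [LinearMap.sum_apply]
  rfl

theorem fockWC_t_apply (a : Bool) (i : Idx n) (φ : Fock n →ₗ[ℝ] A) (z : Fock n) :
    (fockWC V f).t a i φ z = ∑ I, f.R i I • φ (contr a I z) := by
  change (∑ I, f.R i I • pre A (contr a I)) φ z = _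
  simp only [LinearMap.sum_apply]
  rfl

/-- The functionals with values in a submodule. -/
def valuesIn (n : ℕ) (K : Submodule ℂ A) : Submodule ℂ (Fock n →ₗ[ℝ] A) where
  carrier := {φ | ∀ z, φ z ∈ K}
  zero_mem' _ := K.zero_mem
  add_mem' h h' z := K.add_mem (h z) (h' z)
  smul_mem' c _ h z := K.smul_mem c (h z)

theorem sum_RP (u : Idx n → A) (J : Idx n) :
    ∑ i, f.R i J • ∑ I, f.P I i • u I = u J := by
  have h1 := sum_smul_combine u (fun i => f.R i J) f.Pᵀ
  have h2 : (fun i => f.R i J) ᵥ* f.Pᵀ = Pi.single J 1 := by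
    have : (f.P * f.R).col J = Pi.single J 1 := by
      rw [f.PR]
      funext I
      simp [Matrix.one_apply, Pi.single_apply]
    rw [← this]
    funext I
    simp [Matrix.vecMul, dotProduct, Matrix.mul_apply, mul_comm]
  rw [h2] at h1
  simpa [Pi.single_apply, ite_smul] using h1

variable {V}

/-- The null cone in the Weyl–Clifford module of functionals on the exterior algebra. -/
def fockCone (C : FunctionCone V h) : (fockWC V f).ConeData where
  q := f.coord C.q
  q_null := by
    have h1 : (f.coord C.q ᵥ* f.R) ⬝ᵥ (fun I => ((C.q I : ℝ) : ℂ)) = 0 := by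
      rw [f.coord_vecMul_R]
      have := C.q_null
      rw [ambForm_eq] at this
      have h2 := congrArg Complex.ofReal this
      simpa [dotProduct] using h2
    rwa [← Matrix.dotProduct_mulVec] at h1
  li := post C.li
  K := valuesIn n C.K
  li_lin := by rw [fockWC_lin, ← post_mul, C.li_lin]; rfl
  lin_li := by rw [fockWC_lin, ← post_mul, C.lin_li]; rfl
  li_x i := by
    refine LinearMap.ext fun φ => LinearMap.ext fun z => ?_
    change C.li ((fockWC V f).x i φ z) = (fockWC V f).x i (post C.li φ) z
    simp only [fockWC_x_apply, map_sum, map_smul, post_apply]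
    refine Finset.sum_congr rfl fun I _ => ?_
    rw [← Module.End.mul_apply, C.li_x, Module.End.mul_apply]
  li_c a i := by
    refine LinearMap.ext fun φ => LinearMap.ext fun z => ?_
    change C.li ((fockWC V f).c a i φ z) = (fockWC V f).c a i (post C.li φ) z
    simp only [fockWC_c_apply, map_sum, map_smul, post_apply]
  li_t a i := by
    refine LinearMap.ext fun φ => LinearMap.ext fun z => ?_
    change C.li ((fockWC V f).t a i φ z) = (fockWC V f).t a i (post C.li φ) z
    simp only [fockWC_t_apply, map_sum, map_smul, post_apply]
  K_x i u hu z := by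
    rw [fockWC_x_apply]
    exact C.K.sum_mem fun I _ => C.K.smul_mem _ (C.K_x I _ (hu z))
  K_c a i u hu z := by
    rw [fockWC_c_apply]
    exact C.K.sum_mem fun I _ => C.K.smul_mem _ (hu _)
  K_t a i u hu z := by
    rw [fockWC_t_apply]
    exact C.K.sum_mem fun I _ => C.K.smul_mem _ (hu _)
  K_li u hu z := C.K_li _ (hu z)
  K_quad u z := by
    rw [fockWC_quad]
    exact C.K_quad _
  K_tan i u hu z := by
    rw [fockWC_lin, fockWC_dir, LinearMap.sub_apply, post_apply, fockWC_d_apply, fockWC_x_apply,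
      post_apply]
    have h1 : ∑ I, f.R i I • V.x I (V.dir C.q (u z)) = ∑ I, f.P I i •
        ∑ J, ((ambMetric h I J : ℝ) : ℂ) • V.x J (V.dir C.q (u z)) := by
      refine Eq.trans ?_ (sum_smul_combine (fun J => V.x J (V.dir C.q (u z))) (fun I => f.P I i)
        ((ambMetric h).map Complex.ofRealHom)).symm
      refine Finset.sum_congr rfl fun J _ => ?_
      conv_lhs => rw [← f.PtG]
      rfl
    rw [h1, map_sum, ← Finset.sum_sub_distrib]
    refine C.K.sum_mem fun I _ => ?_
    rw [map_smul, ← smul_sub]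
    exact C.K.smul_mem _ (C.K_tan I _ (hu z))
  sep S hSK hSd u hu := by
    refine LinearMap.ext fun z => ?_
    -- The span of all values is stable under the coordinate derivatives, because these are
    -- combinations of the frame derivatives under which `S` is stable.
    refine C.sep ((Submodule.span ℂ {a | ∃ φ ∈ S, ∃ z, a = φ z})) ?_ ?_ _
      (Submodule.subset_span ⟨u, hu, z, rfl⟩)
    · rw [Submodule.span_le]
      rintro _ ⟨φ, hφ, z, rfl⟩
      exact hSK φ hφ z
    · intro a ha J
      induction ha using Submodule.span_induction with
      | mem a ha =>
        obtain ⟨φ, hφ, z, rfl⟩ := ha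
        rw [← sum_RP f (fun I => V.d I (φ z)) J]
        refine Submodule.sum_mem _ fun i _ => Submodule.smul_mem _ _ (Submodule.subset_span ?_)
        exact ⟨_, hSd φ hφ i, z, (fockWC_d_apply V f i φ z).symm⟩
      | zero => rw [map_zero]; exact Submodule.zero_mem _
      | add a b _ _ ha hb => rw [map_add]; exact Submodule.add_mem _ ha hb
      | smul c a _ ha => rw [map_smul]; exact Submodule.smul_mem _ _ ha

end FockCone

end

end AmbientLift

namespace AmbientLift

noncomputable section

/-! ### Functions modulo functions vanishing to infinite order along the null cone -/

section Functions

variable {n : ℕ}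

/-- Smooth functions on an open set, extended by zero. -/
def Sm (O : Opens (Amb n)) : Submodule ℂ (Amb n → ℂ) where
  carrier := {g | ContDiffOn ℝ ∞ g O ∧ ∀ x ∉ O, g x = 0}
  zero_mem' := ⟨contDiffOn_const, fun _ _ => rfl⟩
  add_mem' hf hg := ⟨hf.1.add hg.1, fun _ hx => by simp [hf.2 _ hx, hg.2 _ hx]⟩
  smul_mem' c f hf := ⟨contDiffOn_const.smul hf.1, fun _ hx => by simp [hf.2 _ hx]⟩

variable {O : Opens (Amb n)}

theorem Sm.contDiffAt (g : Sm O) {x : Amb n} (hx : x ∈ O) : ContDiffAt ℝ ∞ g.1 x :=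
  g.2.1.contDiffAt (O.isOpen.mem_nhds hx)

theorem Sm.differentiableAt (g : Sm O) {x : Amb n} (hx : x ∈ O) : DifferentiableAt ℝ g.1 x :=
  (Sm.contDiffAt g hx).differentiableAt (by simp)

/-- A function which is smooth on an open set, cut off outside. -/
def Sm.mk (O : Opens (Amb n)) (g : Amb n → ℂ) (hg : ContDiffOn ℝ ∞ g O) : Sm O :=
  ⟨(O : Set (Amb n)).indicator g, hg.congr fun x hx => Set.indicator_of_mem hx g,
    fun x hx => Set.indicator_of_notMem hx g⟩

theorem Sm.mk_apply (g : Amb n → ℂ) (hg : ContDiffOn ℝ ∞ g O) {x : Amb n} (hx : x ∈ O) :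
    (Sm.mk O g hg).1 x = g x := Set.indicator_of_mem hx g

theorem Sm.ext {f g : Sm O} (h : ∀ x ∈ O, f.1 x = g.1 x) : f = g := by
  refine Subtype.ext (funext fun x => ?_)
  by_cases hx : x ∈ O
  · exact h x hx
  · rw [f.2.2 x hx, g.2.2 x hx]

theorem Sm.eventuallyEq_mk (g : Amb n → ℂ) (hg : ContDiffOn ℝ ∞ g O) {x : Amb n} (hx : x ∈ O) :
    g =ᶠ[nhds x] (Sm.mk O g hg).1 := by
  filter_upwards [O.isOpen.mem_nhds hx] with y hy
  exact (Sm.mk_apply g hg hy).symm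

theorem Sm.contDiffOn_deriv (g : Sm O) (u : Amb n) :
    ContDiffOn ℝ ∞ (fun x => fderiv ℝ g.1 x u) O := fun _ hx =>
  (contDiffAt_dir (Sm.contDiffAt g hx) u).contDiffWithinAt

/-- Multiplication by a smooth function. -/
def Sm.mulBy (a : Amb n → ℂ) (ha : ContDiffOn ℝ ∞ a O) : Module.End ℂ (Sm O) where
  toFun g := ⟨a * g.1, ha.mul g.2.1, fun x hx => by simp [g.2.2 x hx]⟩
  map_add' f g := Subtype.ext (mul_add _ _ _)
  map_smul' c g := Subtype.ext (mul_smul_comm _ _ _)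

theorem Sm.mulBy_apply (a : Amb n → ℂ) (ha : ContDiffOn ℝ ∞ a O) (g : Sm O) (x : Amb n) :
    (Sm.mulBy a ha g).1 x = a x * g.1 x := rfl

/-- Differentiation in the direction `u`. -/
def Sm.deriv (O : Opens (Amb n)) (u : Amb n) : Module.End ℂ (Sm O) where
  toFun g := Sm.mk O _ (Sm.contDiffOn_deriv g u)
  map_add' f g := Sm.ext fun x hx => by
    rw [Sm.mk_apply _ _ hx]
    change _ = (Sm.mk O _ _).1 x + (Sm.mk O _ _).1 x
    rw [Sm.mk_apply _ _ hx, Sm.mk_apply _ _ hx]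
    change fderiv ℝ (f.1 + g.1) x u = _
    rw [fderiv_add (Sm.differentiableAt f hx) (Sm.differentiableAt g hx)]
    rfl
  map_smul' c g := Sm.ext fun x hx => by
    rw [Sm.mk_apply _ _ hx]
    change _ = c • (Sm.mk O _ _).1 x
    rw [Sm.mk_apply _ _ hx]
    change fderiv ℝ (c • g.1) x u = _
    rw [fderiv_const_smul (Sm.differentiableAt g hx)]
    rfl

theorem Sm.deriv_apply (u : Amb n) (g : Sm O) {x : Amb n} (hx : x ∈ O) :
    (Sm.deriv O u g).1 x = fderiv ℝ g.1 x u := Sm.mk_apply _ (Sm.contDiffOn_deriv g u) hx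

theorem Sm.eventuallyEq_deriv (u : Amb n) (g : Sm O) {x : Amb n} (hx : x ∈ O) :
    (fun y => fderiv ℝ g.1 y u) =ᶠ[nhds x] (Sm.deriv O u g).1 :=
  Sm.eventuallyEq_mk _ (Sm.contDiffOn_deriv g u) hx

/-- The coordinate `x^I` as a complex-valued function. -/
def coordFun (I : Idx n) : Amb n → ℂ := fun x => ((x I : ℝ) : ℂ)

theorem contDiff_coordFun (I : Idx n) : ContDiff ℝ ∞ (coordFun I) :=
  Complex.ofRealCLM.contDiff.comp (contDiff_apply ℝ ℝ I)

theorem fderiv_coordFun (I : Idx n) (x u : Amb n) : fderiv ℝ (coordFun I) x u = ((u I : ℝ) : ℂ) := by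
  have : coordFun I = (Complex.ofRealCLM.comp (ContinuousLinearMap.proj I :
      Amb n →L[ℝ] ℝ) : Amb n → ℂ) := rfl
  rw [this, ContinuousLinearMap.fderiv]
  rfl

theorem VanishesToInfiniteOrder.fderiv {Y : Type} [NormedAddCommGroup Y] [NormedSpace ℝ Y]
    {g : Amb n → Y} {x : Amb n} (hg : VanishesToInfiniteOrder g x) :
    VanishesToInfiniteOrder (fderiv ℝ g) x := fun k => by
  rw [← norm_eq_zero, norm_iteratedFDeriv_fderiv, hg (k + 1), norm_zero]

theorem VanishesToInfiniteOrder.dir {Y : Type} [NormedAddCommGroup Y] [NormedSpace ℝ Y]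
    {g : Amb n → Y} {x : Amb n} (hg : VanishesToInfiniteOrder g x) (hg' : ContDiffAt ℝ ∞ g x)
    (u : Amb n) : VanishesToInfiniteOrder (fun y => _root_.fderiv ℝ g y u) x :=
  hg.fderiv.clm_comp (hg'.fderiv_right (m := ∞) (by simp)) (ContinuousLinearMap.apply ℝ Y u)

theorem VanishesToInfiniteOrder.eq_zero {Y : Type} [NormedAddCommGroup Y] [NormedSpace ℝ Y]
    {g : Amb n → Y} {x : Amb n} (hg : VanishesToInfiniteOrder g x) : g x = 0 := by
  have := hg 0
  rw [← norm_eq_zero, norm_iteratedFDeriv_zero] at this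
  exact norm_eq_zero.1 this

theorem vanishes_mul (a : Amb n → ℂ) (ha : ContDiffOn ℝ ∞ a O) (g : Amb n → ℂ)
    (hg : ContDiffOn ℝ ∞ g O) {x : Amb n} (hx : x ∈ O) (h : VanishesToInfiniteOrder g x) :
    VanishesToInfiniteOrder (a * g) x := fun k => by
  have h1 := norm_iteratedFDerivWithin_mul_le ha hg O.isOpen.uniqueDiffOn hx (n := k)
    (by exact_mod_cast le_top)
  rw [← norm_le_zero_iff, ← iteratedFDerivWithin_of_isOpen (𝕜 := ℝ) k O.isOpen hx]
  refine h1.trans (le_of_eq (Finset.sum_eq_zero fun i _ => ?_))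
  rw [iteratedFDerivWithin_of_isOpen (𝕜 := ℝ) (f := g) _ O.isOpen hx, h, norm_zero, mul_zero]

variable (h : Matrix (Fin n) (Fin n) ℝ)

/-- The smooth functions on an open set which vanish to infinite order along the null cone. -/
def Flat (O : Opens (Amb n)) : Submodule ℂ (Sm O) where
  carrier := {g | ∀ x ∈ O, ambForm h x x = 0 → VanishesToInfiniteOrder g.1 x}
  zero_mem' x _ _ := VanishesToInfiniteOrder.zero x
  add_mem' {f g} hf hg x hx hq := (hf x hx hq).add (hg x hx hq) (Sm.contDiffAt f hx) (Sm.contDiffAt g hx)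
  smul_mem' c g hg x hx hq := (hg x hx hq).clm_comp (Sm.contDiffAt g hx) (smulCLM ℂ c)

/-- The smooth functions on an open set which vanish on the null cone. -/
def Van (O : Opens (Amb n)) : Submodule ℂ (Sm O) where
  carrier := {g | ∀ x ∈ O, ambForm h x x = 0 → g.1 x = 0}
  zero_mem' x _ _ := rfl
  add_mem' {f g} hf hg x hx hq := by
    change f.1 x + g.1 x = 0
    rw [hf x hx hq, hg x hx hq, add_zero]
  smul_mem' c g hg x hx hq := by
    change c • g.1 x = 0
    rw [hg x hx hq, smul_zero]

theorem flat_le_van : Flat h O ≤ Van h O := fun _ hg x hx hq => (hg x hx hq).eq_zero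

/-- Smooth functions modulo functions which vanish to infinite order along the null cone. -/
def JetMod (O : Opens (Amb n)) : Type := Sm O ⧸ Flat h O

instance (O : Opens (Amb n)) : AddCommGroup (JetMod h O) :=
  inferInstanceAs (AddCommGroup (Sm O ⧸ Flat h O))

instance (O : Opens (Amb n)) : Module ℂ (JetMod h O) :=
  inferInstanceAs (Module ℂ (Sm O ⧸ Flat h O))

/-- The class of a smooth function. -/
def jet (O : Opens (Amb n)) : Sm O →ₗ[ℂ] JetMod h O := (Flat h O).mkQ

variable {h}

theorem jet_eq_zero {g : Sm O} : jet h O g = 0 ↔ g ∈ Flat h O :=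
  Submodule.Quotient.mk_eq_zero _

theorem jet_surjective : Function.Surjective (jet h O) := Submodule.mkQ_surjective _

/-- An operator on jets induced by an operator on functions. -/
def jetMap (L : Module.End ℂ (Sm O)) (hL : ∀ g ∈ Flat h O, L g ∈ Flat h O) :
    Module.End ℂ (JetMod h O) := (Flat h O).mapQ (Flat h O) L hL

theorem end_ext {L L' : Module.End ℂ (JetMod h O)}
    (hL : ∀ g, L (jet h O g) = L' (jet h O g)) : L = L' := by
  refine LinearMap.ext fun a => ?_
  obtain ⟨g, rfl⟩ := jet_surjective a
  exact hL g

/-- Multiplication of jets by a smooth function. -/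
def jetMul (a : Amb n → ℂ) (ha : ContDiffOn ℝ ∞ a O) : Module.End ℂ (JetMod h O) :=
  jetMap (Sm.mulBy a ha) fun g hg x hx hq => vanishes_mul a ha g.1 g.2.1 hx (hg x hx hq)

/-- Differentiation of jets. -/
def jetDeriv (u : Amb n) : Module.End ℂ (JetMod h O) :=
  jetMap (Sm.deriv O u) fun g hg x hx hq =>
    ((hg x hx hq).dir (Sm.contDiffAt g hx) u).congr (Sm.eventuallyEq_deriv u g hx).symm

theorem jetMul_jet (a : Amb n → ℂ) (ha : ContDiffOn ℝ ∞ a O) (g : Sm O) :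
    jetMul a ha (jet h O g) = jet h O (Sm.mulBy a ha g) := rfl

theorem jetDeriv_jet (u : Amb n) (g : Sm O) :
    jetDeriv u (jet h O g) = jet h O (Sm.deriv O u g) := rfl

theorem Sm.deriv_deriv (u v : Amb n) (g : Sm O) :
    Sm.deriv O u (Sm.deriv O v g) = Sm.deriv O v (Sm.deriv O u g) := by
  refine Sm.ext fun x hx => ?_
  have hd : DifferentiableAt ℝ (fderiv ℝ g.1) x :=
    ((Sm.contDiffAt g hx).fderiv_right (m := 1)
      (by rw [one_add_one_eq_two]; exact ENat.LEInfty.out)).differentiableAt (by simp)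
  have key : ∀ u v, (Sm.deriv O u (Sm.deriv O v g)).1 x = fderiv ℝ (fderiv ℝ g.1) x u v := by
    intro u v
    rw [Sm.deriv_apply _ _ hx, ← (Sm.eventuallyEq_deriv v g hx).fderiv_eq,
      fderiv_clm_apply hd (differentiableAt_const _)]
    simp
  rw [key, key]
  have := (Sm.contDiffAt g hx).isSymmSndFDerivAt (by simpa using ENat.LEInfty.out)
  exact this u v

theorem Sm.deriv_mulBy (u : Amb n) (a : Amb n → ℂ) (ha : ContDiff ℝ ∞ a) (g : Sm O) {x : Amb n}
    (hx : x ∈ O) : (Sm.deriv O u (Sm.mulBy a ha.contDiffOn g)).1 x =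
      a x * (Sm.deriv O u g).1 x + fderiv ℝ a x u * g.1 x := by
  rw [Sm.deriv_apply _ _ hx, Sm.deriv_apply _ _ hx]
  change fderiv ℝ (a * g.1) x u = _
  rw [fderiv_mul (ha.differentiable (by simp) x) (Sm.differentiableAt g hx)]
  simp [mul_comm]

theorem Sm.mulBy_mulBy (a b : Amb n → ℂ) (ha : ContDiffOn ℝ ∞ a O) (hb : ContDiffOn ℝ ∞ b O)
    (g : Sm O) : Sm.mulBy a ha (Sm.mulBy b hb g) = Sm.mulBy b hb (Sm.mulBy a ha g) :=
  Subtype.ext (mul_left_comm _ _ _)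

/-- The module of jets with its coordinates and derivatives. -/
def jetWeyl (h : Matrix (Fin n) (Fin n) ℝ) (O : Opens (Amb n)) : WeylModule n (JetMod h O) where
  x I := jetMul (coordFun I) (contDiff_coordFun I).contDiffOn
  d I := jetDeriv (e I)
  xx I J := end_ext fun g => congrArg (jet h O) (Sm.mulBy_mulBy _ _ _ _ g)
  dd I J := end_ext fun g => congrArg (jet h O) (Sm.deriv_deriv _ _ g)
  dx I J := end_ext fun g => by
    rw [Module.End.mul_apply, LinearMap.add_apply, Module.End.mul_apply]
    have h1 : (if I = J then 1 else 0 : Module.End ℂ (JetMod h O)) (jet h O g) =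
        jet h O (if I = J then g else 0) := by
      by_cases hij : I = J <;> simp [hij]
    rw [h1]
    simp only [jetMul_jet, jetDeriv_jet]
    rw [← map_add]
    congr 1
    refine Sm.ext fun x hx => ?_
    rw [Sm.deriv_mulBy _ _ (contDiff_coordFun J) _ hx, fderiv_coordFun]
    change _ = _ + (ite (I = J) g 0).1 x
    by_cases hij : I = J
    · subst hij
      simp [e, Sm.mulBy_apply]
    · have : (e I : Amb n) J = 0 := by simp [e, Ne.symm hij]
      simp [hij, this, Sm.mulBy_apply]

variable (h) in
/-- The jets of functions vanishing on the null cone. -/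
def coneIdeal (O : Opens (Amb n)) : Submodule ℂ (JetMod h O) := (Van h O).map (jet h O)

/-- Flat functions vanish on the cone, so the condition does not depend on the representative of the
jet. -/
theorem jet_mem_coneIdeal {g : Sm O} : jet h O g ∈ coneIdeal h O ↔ g ∈ Van h O := by
  constructor
  · rintro ⟨g', hg', he⟩
    have h1 : g' - g ∈ Flat h O := by
      rw [← jet_eq_zero, map_sub, he, sub_self]
    have := (Van h O).sub_mem hg' (flat_le_van h h1)
    rwa [sub_sub_cancel] at this
  · exact fun hg => ⟨g, hg, rfl⟩

theorem ambForm_comm (hs : h.IsSymm) (u v : Amb n) : ambForm h u v = ambForm h v u := by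
  rw [ambForm_eq, ambForm_eq, ← Matrix.dotProduct_mulVec, dotProduct_comm,
    ← Matrix.vecMul_transpose, (isSymm_ambMetric hs).eq]

/-- A function which vanishes on the null cone has vanishing derivative in tangent directions. -/
theorem fderiv_eq_zero_of_van (hs : h.IsSymm) {g : Sm O} (hg : g ∈ Van h O) {x : Amb n}
    (hx : x ∈ O) (hxx : ambForm h x x = 0) {q : Amb n} (hq : ambForm h q q = 0)
    (hqx : ambForm h q x ≠ 0) {v : Amb n} (hv : ambForm h x v = 0) : fderiv ℝ g.1 x v = 0 := by
  -- The curve x + tv − c(t)q is null exactly for this c, because x and q are null and v is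
  -- orthogonal to x. As c is of order t², the velocity at 0 is v.
  set c : ℝ → ℝ := fun t => t ^ 2 * (ambForm h v v / (2 * (ambForm h q x + t * ambForm h q v)))
  set γ : ℝ → Amb n := fun t => x + t • v - c t • q
  have hne : ∀ᶠ t : ℝ in nhds 0, ambForm h q x + t * ambForm h q v ≠ 0 := by
    have : ContinuousAt (fun t : ℝ => ambForm h q x + t * ambForm h q v) 0 := by fun_prop
    exact this.eventually_ne (by simpa using hqx)
  have hγ0 : γ 0 = x := by simp [γ, c]
  have hc : HasDerivAt c 0 0 := by
    have h1 : HasDerivAt (fun t : ℝ => t ^ 2) 0 0 := by simpa using hasDerivAt_pow 2 (0 : ℝ)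
    have h2 : DifferentiableAt ℝ
        (fun t : ℝ => ambForm h v v / (2 * (ambForm h q x + t * ambForm h q v))) 0 := by
      refine DifferentiableAt.div (differentiableAt_const _) (by fun_prop) ?_
      simpa using hqx
    have h3 := h1.mul h2.hasDerivAt
    simp only [zero_mul, ne_eq, OfNat.ofNat_ne_zero, not_false_eq_true, zero_pow, add_zero] at h3
    exact h3
  have hγ : HasDerivAt γ v 0 := by
    have h1 : HasDerivAt (fun t : ℝ => x + t • v - c t • q) (0 + (1 : ℝ) • v - (0 : ℝ) • q) 0 :=
      ((hasDerivAt_const _ _).add ((hasDerivAt_id _).smul_const v)).sub (hc.smul_const q)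
    simpa using h1
  have hnull : ∀ᶠ t : ℝ in nhds 0, ambForm h (γ t) (γ t) = 0 := by
    filter_upwards [hne] with t ht
    simp only [γ, map_sub, map_add, map_smul, LinearMap.sub_apply, LinearMap.add_apply,
      LinearMap.smul_apply, smul_eq_mul, hq, hxx, hv, ambForm_comm hs v x, ambForm_comm hs x q,
      ambForm_comm hs v q, c]
    field_simp
    ring
  have hO : ∀ᶠ t : ℝ in nhds 0, γ t ∈ O := by
    refine hγ.continuousAt.eventually ?_
    rw [hγ0]
    exact O.isOpen.mem_nhds hx
  have h1 : (g.1 ∘ γ) =ᶠ[nhds 0] fun _ => 0 := by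
    filter_upwards [hnull, hO] with t h1 h2
    exact hg _ h2 h1
  have h2 : HasDerivAt (g.1 ∘ γ) (fderiv ℝ g.1 x v) 0 := by
    have := (Sm.differentiableAt g hx).hasFDerivAt
    rw [← hγ0] at this
    have h3 := this.comp_hasDerivAt 0 hγ
    rwa [hγ0] at h3
  exact h2.unique ((hasDerivAt_const _ _).congr_of_eventuallyEq h1)

theorem sum_jet_apply {ι : Type} (A : Finset ι) (g : ι → Sm O) (x : Amb n) :
    (∑ i ∈ A, g i).1 x = ∑ i ∈ A, (g i).1 x := by
  rw [AddSubmonoidClass.coe_finsetSum, Finset.sum_apply]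

/-- The linear form dual to `q` as a complex-valued function. -/
def linFun (h : Matrix (Fin n) (Fin n) ℝ) (q : Amb n) : Amb n → ℂ :=
  fun x => ((ambForm h q x : ℝ) : ℂ)

theorem contDiff_ambForm (q : Amb n) : ContDiff ℝ ∞ (fun x => ambForm h q x) :=
  (LinearMap.toContinuousLinearMap (ambForm h q)).contDiff

theorem contDiff_linFun (q : Amb n) : ContDiff ℝ ∞ (linFun h q) :=
  Complex.ofRealCLM.contDiff.comp (contDiff_ambForm q)

theorem jetWeyl_lin (q : Amb n) :
    (jetWeyl h O).lin h q = jetMul (linFun h q) (contDiff_linFun q).contDiffOn := by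
  refine end_ext fun g => ?_
  simp only [WeylModule.lin, LinearMap.sum_apply, LinearMap.smul_apply, jetWeyl, jetMul_jet,
    ← (jet h O).map_smul, ← map_sum (jet h O)]
  congr 1
  refine Sm.ext fun x hx => ?_
  rw [sum_jet_apply, Sm.mulBy_apply, linFun, ambForm_eq, dotProduct]
  push_cast
  rw [Finset.sum_mul]
  refine Finset.sum_congr rfl fun J _ => ?_
  change _ * (coordFun J x * g.1 x) = _
  rw [coordFun, mul_assoc]

theorem jetWeyl_dir (q : Amb n) (g : Sm O) :
    (jetWeyl h O).dir q (jet h O g) = jet h O (Sm.deriv O q g) := by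
  simp only [WeylModule.dir, LinearMap.sum_apply, LinearMap.smul_apply, jetWeyl, jetDeriv_jet,
    ← (jet h O).map_smul, ← map_sum (jet h O)]
  congr 1
  refine Sm.ext fun x hx => ?_
  rw [sum_jet_apply, Sm.deriv_apply _ _ hx]
  conv_rhs => rw [eq_sum_e q, map_sum]
  refine Finset.sum_congr rfl fun J _ => ?_
  change _ * (Sm.deriv O (e J) g).1 x = _
  rw [Sm.deriv_apply _ _ hx, map_smul, Complex.real_smul]

theorem coneIdeal_mul {a : Amb n → ℂ} (ha : ContDiffOn ℝ ∞ a O) {u : JetMod h O}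
    (hu : u ∈ coneIdeal h O) : jetMul a ha u ∈ coneIdeal h O := by
  obtain ⟨g, rfl⟩ := jet_surjective u
  rw [jet_mem_coneIdeal] at hu
  rw [jetMul_jet, jet_mem_coneIdeal]
  intro x hx hq
  rw [Sm.mulBy_apply, hu x hx hq, mul_zero]

theorem sum_metric_coord (x : Amb n) (I : Idx n) :
    ∑ J, ((ambMetric h I J : ℝ) : ℂ) * coordFun J x = ((ambForm h (e I) x : ℝ) : ℂ) := by
  rw [ambForm_eq, dotProduct]
  push_cast
  refine Finset.sum_congr rfl fun J _ => ?_
  simp [e, coordFun]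

theorem sum_quad_apply (x : Amb n) (y : ℂ) :
    ∑ I, ∑ J, ((ambMetric h I J : ℝ) : ℂ) * (coordFun I x * (coordFun J x * y)) =
      ((ambForm h x x : ℝ) : ℂ) * y := by
  have h1 : ∀ I, ∑ J, ((ambMetric h I J : ℝ) : ℂ) * (coordFun I x * (coordFun J x * y)) =
      coordFun I x * ((ambForm h (e I) x : ℝ) : ℂ) * y := fun I => by
    rw [← sum_metric_coord, Finset.mul_sum, Finset.sum_mul]
    exact Finset.sum_congr rfl fun J _ => by ring
  rw [Finset.sum_congr rfl fun I _ => h1 I, ← Finset.sum_mul]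
  congr 1
  conv_rhs => rw [show ambForm h x x = ambForm h (∑ I, x I • e I) x by rw [← eq_sum_e]]
  simp [coordFun]

/-- The innermost derivative of an iterated one is expanded in the coordinate directions, and these
stay in `S`; this supplies the separation axiom of the cone. -/
theorem iterated_zero (S : Set (Sm O)) {x : Amb n} (hx : x ∈ O) (h0 : ∀ g ∈ S, g.1 x = 0)
    (hd : ∀ g ∈ S, ∀ I, Sm.deriv O (e I) g ∈ S) (k : ℕ) :
    ∀ g ∈ S, iteratedFDeriv ℝ k g.1 x = 0 := by
  induction k with
  | zero => intro g hg; ext m; simpa using h0 g hg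
  | succ k ih =>
    intro g hg
    ext m
    rw [iteratedFDeriv_succ_apply_right]
    have h1 : ∀ u, iteratedFDeriv ℝ k (fun y => fderiv ℝ g.1 y) x (Fin.init m) u =
        iteratedFDeriv ℝ k (fun y => fderiv ℝ g.1 y u) x (Fin.init m) := fun u => by
      have := (ContinuousLinearMap.apply ℝ ℂ u).iteratedFDeriv_comp_left (i := k)
        ((Sm.contDiffAt g hx).fderiv_right (m := ∞) (by simp)) (by exact_mod_cast le_top)
      have h2 := congrArg (fun T => T (Fin.init m)) this
      exact h2.symm
    conv_lhs => rw [eq_sum_e (m (Fin.last k)), map_sum]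
    refine Finset.sum_eq_zero fun I _ => ?_
    rw [map_smul, h1, ((Sm.eventuallyEq_deriv (e I) g hx).iteratedFDeriv (𝕜 := ℝ) k).self_of_nhds,
      ih _ (hd g hg I)]
    simp

/-- The null cone in the module of jets on an open set where the linear form of a null vector does
not vanish. -/
def jetCone (hs : h.IsSymm) (q : Amb n) (hq : ambForm h q q = 0)
    (hO : ∀ x ∈ O, ambForm h q x ≠ 0) : FunctionCone (jetWeyl h O) h where
  q := q
  q_null := hq
  li := jetMul (fun x => (linFun h q x)⁻¹) ((contDiff_linFun q).contDiffOn.inv fun x hx => by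
    simpa [linFun] using hO x hx)
  K := coneIdeal h O
  li_lin := by
    rw [jetWeyl_lin]
    refine end_ext fun g => congrArg (jet h O) (Sm.ext fun x hx => ?_)
    have : linFun h q x ≠ 0 := by simpa [linFun] using hO x hx
    simp only [Sm.mulBy_apply]
    field_simp
  lin_li := by
    rw [jetWeyl_lin]
    refine end_ext fun g => congrArg (jet h O) (Sm.ext fun x hx => ?_)
    have : linFun h q x ≠ 0 := by simpa [linFun] using hO x hx
    simp only [Sm.mulBy_apply]
    field_simp
  li_x I := end_ext fun g => congrArg (jet h O) (Sm.mulBy_mulBy _ _ _ _ g)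
  K_x I u hu := coneIdeal_mul _ hu
  K_li u hu := coneIdeal_mul _ hu
  K_quad u := by
    obtain ⟨g, rfl⟩ := jet_surjective u
    simp only [jetWeyl, jetMul_jet, ← (jet h O).map_smul, ← map_sum (jet h O)]
    rw [jet_mem_coneIdeal]
    intro x hx hxx
    simp only [sum_jet_apply]
    refine (sum_quad_apply (h := h) x (g.1 x)).trans ?_
    rw [hxx, Complex.ofReal_zero, zero_mul]
  K_tan I u hu := by
    obtain ⟨g, rfl⟩ := jet_surjective u
    rw [jet_mem_coneIdeal] at hu
    rw [jetWeyl_lin, jetWeyl_dir]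
    simp only [jetWeyl, jetMul_jet, jetDeriv_jet, ← (jet h O).map_smul, ← map_sum (jet h O), ← (jet h O).map_sub]
    rw [jet_mem_coneIdeal]
    intro x hx hxx
    have h1 : (∑ J, ((ambMetric h I J : ℝ) : ℂ) • Sm.mulBy (coordFun J)
        (contDiff_coordFun J).contDiffOn (Sm.deriv O q g)).1 x =
        ((ambForm h (e I) x : ℝ) : ℂ) * fderiv ℝ g.1 x q := by
      rw [sum_jet_apply, ← sum_metric_coord, Finset.sum_mul, ← Sm.deriv_apply _ _ hx]
      exact Finset.sum_congr rfl fun J _ => (mul_assoc _ _ _).symm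
    -- The direction ⟨q, x⟩e_I − ⟨e_I, x⟩q is orthogonal to x, hence tangent to the cone at x.
    have h2 := fderiv_eq_zero_of_van hs hu hx hxx hq (hO x hx)
      (v := ambForm h q x • e I - ambForm h (e I) x • q) (by
        simp only [map_sub, map_smul, smul_eq_mul]
        rw [ambForm_comm hs x (e I), ambForm_comm hs x q]
        ring)
    rw [map_sub, map_smul, map_smul, Complex.real_smul, Complex.real_smul] at h2
    change (Sm.mulBy _ _ _).1 x - _ = 0
    rw [h1, Sm.mulBy_apply, Sm.deriv_apply _ _ hx]
    exact h2
  sep S hSK hSd u hu := by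
    obtain ⟨g, rfl⟩ := jet_surjective u
    rw [jet_eq_zero]
    intro x hx hxx k
    refine iterated_zero {g | jet h O g ∈ S} hx (fun g hg => ?_) (fun g hg I => ?_) k g hu
    · exact jet_mem_coneIdeal.1 (hSK hg) x hx hxx
    · exact hSd _ hg I

end Functions

end

end AmbientLift

namespace AmbientLift

noncomputable section

/-! ### Formal harmonic extension -/

section Harmonic

namespace WeylClifford

variable {κ : Type} [Fintype κ] [DecidableEq κ] {M : Type} [AddCommGroup M] [Module ℂ M]
  {W : WeylClifford κ M}

theorem quad_d' (i : κ) (v : M) : W.d i (W.quad v) = W.quad (W.d i v) + (2 : ℂ) • W.x i v := by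
  have h1 : ∀ j, W.d i (W.x j (W.x j v)) =
      W.x j (W.x j (W.d i v)) + (2 : ℂ) • if i = j then W.x j v else 0 := by
    intro j
    have hd : ∀ y, W.d i (W.x j y) = W.x j (W.d i y) + if i = j then y else 0 := fun y => by
      have := congrArg (· y) (W.dx i j)
      simp only [Module.End.mul_apply, LinearMap.add_apply] at this
      rw [this]
      by_cases h : i = j <;> simp [h]
    rw [hd, hd, map_add]
    by_cases h : i = j
    · simp only [h, if_true]
      module
    · simp [h]
  simp only [quad, LinearMap.sum_apply, Module.End.mul_apply, map_sum, h1,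
    Finset.sum_add_distrib, ← Finset.smul_sum, Finset.sum_ite_eq, Finset.mem_univ, if_true]

theorem quad_x' (i : κ) (v : M) : W.x i (W.quad v) = W.quad (W.x i v) := by
  simp only [quad, LinearMap.sum_apply, Module.End.mul_apply, map_sum]
  refine Finset.sum_congr rfl fun j _ => ?_
  have h : ∀ y, W.x i (W.x j y) = W.x j (W.x i y) := fun y => congrArg (· y) (W.xx i j)
  rw [h, h]

/-- A derivative costs one power of the quadratic form. Consequently the elements divisible by all
powers are stable under derivatives. -/
theorem d_quad_pow (i : κ) (K : ℕ) (v : M) :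
    ∃ y, W.d i ((W.quad ^ (K + 1)) v) = (W.quad ^ K) y := by
  induction K generalizing v with
  | zero => exact ⟨_, rfl⟩
  | succ K ih =>
    obtain ⟨y, hy⟩ := ih v
    rw [pow_succ', Module.End.mul_apply, quad_d', hy]
    have h1 : ∀ K : ℕ, ∀ v, W.x i ((W.quad ^ K) v) = (W.quad ^ K) (W.x i v) := by
      intro K
      induction K with
      | zero => intro v; rfl
      | succ K ih => intro v; rw [pow_succ, Module.End.mul_apply, Module.End.mul_apply, ih, quad_x']
    rw [h1]
    refine ⟨y + (2 : ℂ) • W.x i v, ?_⟩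
    rw [map_add, map_smul, pow_succ', Module.End.mul_apply]
    rfl

/-- The coefficients of the formal harmonic extension. -/
def harmCoeff (b : ℂ) : ℕ → ℂ
  | 0 => 1
  | k + 1 => -harmCoeff b k / (2 * (k + 1) * (b - 2 * (k + 1)))

theorem harmCoeff_succ {b : ℂ} (hb : ∀ k : ℕ, 1 ≤ k → b ≠ 2 * k) (k : ℕ) :
    harmCoeff b (k + 1) * (2 * (k + 1) * (b - 2 * (k + 1))) = -harmCoeff b k := by
  have h1 : b - 2 * ((k : ℂ) + 1) ≠ 0 := sub_ne_zero.2 (by exact_mod_cast hb (k + 1) (by omega))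
  have h2 : (k : ℂ) + 1 ≠ 0 := by exact_mod_cast k.succ_ne_zero
  rw [harmCoeff]
  field_simp

/-- `U K` plays the role of the tail Σ c_{K+i} Q^i Δ^{K+i} F of the formal harmonic extension. Since
`U 0` agrees with each partial sum modulo the next power of Q, its Laplacian is divisible by every
power of Q and vanishes by separation. No convergence is used, only the recursion between tails. -/
theorem lap_eq_zero_of_series (D : W.ConeData) {m : ℂ} {F : M}
    (hk : ∀ k : ℕ, 1 ≤ k → 2 * m + Fintype.card κ - 2 ≠ 2 * k) (U : ℕ → M)
    (hU : ∀ K, W.eul (U K) = (m - 2 * K) • U K)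
    (hs : ∀ K, U K = harmCoeff (2 * m + Fintype.card κ - 2) K • (W.lap ^ K) F + W.quad (U (K + 1))) :
    W.lap (U 0) = 0 := by
  set a := harmCoeff (2 * m + Fintype.card κ - 2)
  -- Commuting Δ past Q raised to K + 1 yields the factor 2(K + 1)(2m + N − 2 − 2(K + 1)). The
  -- recursion for the coefficients makes the leading part of that term cancel `a K • lap ^ (K + 1)
  -- F`, leaving one more power of Q.
  have key : ∀ K : ℕ, W.lap (U 0) = (W.quad ^ K) (a K • (W.lap ^ (K + 1)) F +
      W.quad (W.lap (U (K + 1))) +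
      ((2 * (K + 1) * (2 * m + Fintype.card κ - 2 - 2 * (K + 1)) : ℂ)) • U (K + 1)) := by
    intro K
    induction K with
    | zero =>
      conv_lhs => rw [hs 0]
      rw [map_add, lap_quad', hU, map_smul]
      simp only [pow_zero, Nat.cast_zero, Module.End.one_apply, zero_add, pow_one]
      push_cast
      module
    | succ K ih =>
      rw [ih, pow_succ W.quad K, Module.End.mul_apply]
      refine congrArg _ ?_
      have ha := harmCoeff_succ hk K
      have h1 : W.lap (U (K + 1)) = a (K + 1) • (W.lap ^ (K + 2)) F + W.quad (W.lap (U (K + 2))) +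
          (4 * (m - 2 * (K + 2)) + 2 * Fintype.card κ : ℂ) • U (K + 2) := by
        conv_lhs => rw [hs (K + 1)]
        rw [map_add, lap_quad', hU, map_smul, pow_succ' W.lap (K + 1),
          Module.End.mul_apply]
        push_cast
        module
      have h2 : (2 * (K + 1) * (2 * m + Fintype.card κ - 2 - 2 * (K + 1)) : ℂ) • U (K + 1) =
          -(a K • (W.lap ^ (K + 1)) F) +
          (2 * (K + 1) * (2 * m + Fintype.card κ - 2 - 2 * (K + 1)) : ℂ) • W.quad (U (K + 2)) := by
        conv_lhs => rw [hs (K + 1)]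
        rw [smul_add, smul_smul, mul_comm _ (harmCoeff _ _), ha, neg_smul]
      rw [h1, h2]
      simp only [map_add, map_smul]
      push_cast
      module
  refine D.sep {v | ∀ K, ∃ y, v = (W.quad ^ K) y} ?_ ?_ _ fun K => ⟨_, key K⟩
  · intro u hu
    obtain ⟨y, hy⟩ := hu 1
    rw [hy, pow_one]
    exact D.K_quad y
  · intro u hu i K
    obtain ⟨y, rfl⟩ := hu (K + 1)
    exact d_quad_pow i K y

end WeylClifford

end Harmonic

/-! ### Homogeneous functions -/

section Homogeneous

variable {n : ℕ}

/-- The character `|c| ^ w * c ^ (-k)` of the multiplicative group. -/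
def scale (w : ℂ) (k : ℤ) (c : ℝ) : ℂ := Complex.exp (w * (Real.log c : ℝ)) * (c : ℂ) ^ (-k)

/-- `Real.log c` is log |c| for negative c too, so the exponential is the even part |c|^w of the
character and the sign of a dilation enters only through the integral power. For components of a
tensor of rank r + s the relevant k is r + s. -/
theorem scale_eq (w : ℂ) (k : ℤ) {c : ℝ} (hc : c ≠ 0) :
    scale w k c = ((|c| : ℝ) : ℂ) ^ w * (c : ℂ) ^ (-k) := by
  rw [scale, Complex.cpow_def_of_ne_zero (by simpa using hc), ← Complex.ofReal_log (abs_nonneg c),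
    Real.log_abs, mul_comm w]

theorem scale_mul (w : ℂ) (k : ℤ) {c d : ℝ} (hc : c ≠ 0) (hd : d ≠ 0) :
    scale w k (c * d) = scale w k c * scale w k d := by
  rw [scale, scale, scale, Real.log_mul hc hd]
  push_cast
  rw [mul_add, Complex.exp_add, mul_zpow]
  ring

theorem scale_one (w : ℂ) (k : ℤ) : scale w k 1 = 1 := by simp [scale]

theorem scale_add (w : ℂ) (k j : ℤ) {c : ℝ} (hc : c ≠ 0) :
    scale w (k + j) c = scale w k c * (c : ℂ) ^ (-j) := by
  rw [scale, scale, neg_add, zpow_add₀ (by simpa using hc), mul_assoc]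

theorem contDiffAt_zpow {c : ℝ} (hc : c ≠ 0) (k : ℤ) :
    ContDiffAt ℝ ∞ (fun x : ℝ => (x : ℂ) ^ k) c := by
  have h0 : ContDiffAt ℝ ∞ (fun x : ℝ => (x : ℂ)) c := Complex.ofRealCLM.contDiff.contDiffAt
  rcases k with k | k
  · simpa using h0.pow k
  · simp only [zpow_negSucc]
    exact (h0.pow (k + 1)).inv (by simpa using hc)

theorem contDiffAt_scale (w : ℂ) (k : ℤ) {c : ℝ} (hc : c ≠ 0) : ContDiffAt ℝ ∞ (scale w k) c := by
  refine ContDiffAt.mul ?_ (contDiffAt_zpow hc _)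
  refine ContDiffAt.cexp (contDiffAt_const.mul ?_)
  exact Complex.ofRealCLM.contDiff.contDiffAt.comp c (Real.contDiffAt_log.2 hc)

theorem hasDerivAt_scale (w : ℂ) (k : ℤ) : HasDerivAt (scale w k) (w - k) 1 := by
  have h1 : HasDerivAt (fun c : ℝ => Complex.exp (w * (Real.log c : ℝ))) w 1 := by
    have := ((Real.hasDerivAt_log one_ne_zero).ofReal_comp.const_mul w).cexp
    simpa using this
  have h2 : HasDerivAt (fun c : ℝ => (c : ℂ) ^ (-k)) (-k : ℂ) 1 := by
    have := (hasDerivAt_zpow (-k) ((1 : ℝ) : ℂ) (Or.inl (by simp))).comp_ofReal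
    simpa using this
  have := h1.mul h2
  simp only [Real.log_one, Complex.ofReal_zero, mul_zero, Complex.exp_zero, Complex.ofReal_one,
    one_zpow, mul_one, one_mul] at this
  rw [sub_eq_add_neg]
  exact this

/-- An open set which is invariant under nonzero dilations. -/
def IsConic (O : Opens (Amb n)) : Prop := ∀ x ∈ O, ∀ c : ℝ, c ≠ 0 → c • x ∈ O

/-- The functions which are homogeneous with respect to the character `|c| ^ w * c ^ (-k)`. -/
def homFun (O : Opens (Amb n)) (w : ℂ) (k : ℤ) : Submodule ℂ (Sm O) where
  carrier := {g | ∀ x ∈ O, ∀ c : ℝ, c ≠ 0 → g.1 (c • x) = scale w k c * g.1 x}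
  zero_mem' x _ c _ := by simp
  add_mem' {f g} hf hg x hx c hc := by
    change f.1 _ + g.1 _ = _ * (f.1 x + g.1 x)
    rw [hf x hx c hc, hg x hx c hc, mul_add]
  smul_mem' a g hg x hx c hc := by
    change a • g.1 _ = _ * (a • g.1 x)
    rw [hg x hx c hc, mul_smul_comm]

variable {O O' : Opens (Amb n)} {w : ℂ} {k : ℤ} {h : Matrix (Fin n) (Fin n) ℝ}

theorem homFun_coord {g : Sm O} (hg : g ∈ homFun O w k) (I : Idx n) :
    Sm.mulBy (coordFun I) (contDiff_coordFun I).contDiffOn g ∈ homFun O w (k - 1) := by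
  intro x hx c hc
  rw [Sm.mulBy_apply, Sm.mulBy_apply, hg x hx c hc, sub_eq_add_neg, scale_add _ _ _ hc]
  simp only [coordFun, Pi.smul_apply, smul_eq_mul, Complex.ofReal_mul, neg_neg, zpow_one]
  ring

theorem homFun_deriv (hO : IsConic O) {g : Sm O} (hg : g ∈ homFun O w k) (u : Amb n) :
    Sm.deriv O u g ∈ homFun O w (k + 1) := by
  intro x hx c hc
  have hcx := hO x hx c hc
  rw [Sm.deriv_apply _ _ hx, Sm.deriv_apply _ _ hcx, scale_add _ _ _ hc]
  have h1 : (fun y => g.1 (c • y)) =ᶠ[nhds x] fun y => scale w k c * g.1 y := by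
    filter_upwards [O.isOpen.mem_nhds hx] with y hy
    exact hg y hy c hc
  have h2 : HasFDerivAt (fun y => g.1 (c • y))
      ((fderiv ℝ g.1 (c • x)).comp (c • ContinuousLinearMap.id ℝ (Amb n))) x :=
    (Sm.differentiableAt g hcx).hasFDerivAt.comp x ((hasFDerivAt_id x).const_smul c)
  have h3 := (Sm.differentiableAt g hx).hasFDerivAt.const_mul (scale w k c)
  have h4 := congrArg (fun L => L u) ((h3.congr_of_eventuallyEq h1).unique h2)
  simp only [ContinuousLinearMap.comp_apply, smul_apply,
    ContinuousLinearMap.id_apply, map_smul, smul_eq_mul, Complex.real_smul] at h4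
  have hc' : (c : ℂ) ≠ 0 := by simpa using hc
  rw [mul_right_comm, h4, zpow_neg, zpow_one]
  field_simp

/-- Restriction of smooth functions. -/
def Sm.restrict (hO : O' ≤ O) : Sm O →ₗ[ℂ] Sm O' where
  toFun g := Sm.mk O' g.1 (g.2.1.mono hO)
  map_add' f g := Sm.ext fun x hx => by
    change _ = (Sm.mk O' _ _).1 x + (Sm.mk O' _ _).1 x
    rw [Sm.mk_apply _ _ hx, Sm.mk_apply _ _ hx, Sm.mk_apply _ _ hx]
    rfl
  map_smul' c g := Sm.ext fun x hx => by
    change _ = c • (Sm.mk O' _ _).1 x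
    rw [Sm.mk_apply _ _ hx, Sm.mk_apply _ _ hx]
    rfl

theorem Sm.restrict_apply (hO : O' ≤ O) (g : Sm O) {x : Amb n} (hx : x ∈ O') :
    (Sm.restrict hO g).1 x = g.1 x :=
  Sm.mk_apply _ (g.2.1.mono hO) hx

theorem Sm.eventuallyEq_restrict (hO : O' ≤ O) (g : Sm O) {x : Amb n} (hx : x ∈ O') :
    g.1 =ᶠ[nhds x] (Sm.restrict hO g).1 := Sm.eventuallyEq_mk _ (g.2.1.mono hO) hx

/-- The jets on `O'` of homogeneous functions defined on `O`. -/
def homJets (h : Matrix (Fin n) (Fin n) ℝ) (hO : O' ≤ O) (w : ℂ) (k : ℤ) :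
    Submodule ℂ (JetMod h O') := (homFun O w k).map (jet h O' ∘ₗ Sm.restrict hO)

theorem homJets_x (hO : O' ≤ O) {u : JetMod h O'} (hu : u ∈ homJets h hO w k) (I : Idx n) :
    (jetWeyl h O').x I u ∈ homJets h hO w (k - 1) := by
  obtain ⟨g, hg, rfl⟩ := hu
  refine ⟨_, homFun_coord hg I, congrArg (jet h O') (Sm.ext fun x hx => ?_)⟩
  simp only [Sm.mulBy_apply, Sm.restrict_apply hO _ hx]

theorem homJets_d (hO : O' ≤ O) (hc : IsConic O) {u : JetMod h O'} (hu : u ∈ homJets h hO w k)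
    (I : Idx n) : (jetWeyl h O').d I u ∈ homJets h hO w (k + 1) := by
  obtain ⟨g, hg, rfl⟩ := hu
  refine ⟨_, homFun_deriv hc hg (e I), congrArg (jet h O') (Sm.ext fun x hx => ?_)⟩
  rw [Sm.restrict_apply hO _ hx, Sm.deriv_apply _ _ hx, Sm.deriv_apply _ _ (hO hx)]
  have : g.1 =ᶠ[nhds x] (Sm.restrict hO g).1 := Sm.eventuallyEq_restrict hO g hx
  rw [this.fderiv_eq]

theorem homFun_euler {g : Sm O} (hg : g ∈ homFun O w k) {x : Amb n} (hx : x ∈ O) :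
    fderiv ℝ g.1 x x = (w - k) * g.1 x := by
  have h1 : HasDerivAt (fun c : ℝ => g.1 (c • x)) (fderiv ℝ g.1 x x) 1 := by
    have h2 := (Sm.differentiableAt g hx).hasFDerivAt
    have h3 : HasDerivAt (fun c : ℝ => c • x) x 1 := by
      simpa using (hasDerivAt_id (1 : ℝ)).smul_const x
    rw [← one_smul ℝ x] at h2
    have := h2.comp_hasDerivAt 1 h3
    rwa [one_smul] at this
  have h2 := (hasDerivAt_scale w k).mul_const (g.1 x)
  refine h1.unique (h2.congr_of_eventuallyEq ?_)
  filter_upwards [isOpen_ne.mem_nhds (one_ne_zero (α := ℝ))] with c hc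
  exact hg x hx c hc

theorem homJets_euler (hO : O' ≤ O) {u : JetMod h O'} (hu : u ∈ homJets h hO w k) :
    ∑ I, (jetWeyl h O').x I ((jetWeyl h O').d I u) = (w - k) • u := by
  obtain ⟨g, hg, rfl⟩ := hu
  simp only [jetWeyl, LinearMap.comp_apply, jetDeriv_jet, jetMul_jet, ← map_sum (jet h O'),
    ← (jet h O').map_smul]
  congr 1
  refine Sm.ext fun x hx => ?_
  rw [sum_jet_apply]
  change _ = (w - k) * (Sm.restrict hO g).1 x
  rw [Sm.restrict_apply hO _ hx, ← homFun_euler hg (hO hx)]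
  have h2 : fderiv ℝ g.1 x x = ∑ I, x I • fderiv ℝ g.1 x (e I) := by
    conv_lhs => enter [2]; rw [eq_sum_e x]
    simp
  rw [h2]
  refine Finset.sum_congr rfl fun I _ => ?_
  have : g.1 =ᶠ[nhds x] (Sm.restrict hO g).1 := Sm.eventuallyEq_restrict hO g hx
  rw [Sm.mulBy_apply, Sm.deriv_apply _ _ hx, this.fderiv_eq, coordFun, Complex.real_smul]

end Homogeneous

end

end AmbientLift

namespace AmbientLift

noncomputable section

/-! ### A Borel lemma along the zero set of a function -/

section Borel

/-- A smooth bump function on the line. -/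
def lineBump : ContDiffBump (0 : ℝ) := ⟨1, 2, one_pos, one_lt_two⟩

/-- A power times a bump function. -/
def powBump (p : ℕ) (t : ℝ) : ℝ := t ^ p * lineBump t

/-- Displays the cut-off power as ε^p times a fixed function of Q/ε, so that the dependence of
derivatives on ε can be counted. -/
theorem powBump_comp {E : Type} (Q : E → ℝ) (p : ℕ) {ε : ℝ} (hε : 0 < ε) :
    (fun x => Q x ^ p * lineBump (Q x / ε)) =
      (ε ^ p) • (powBump p ∘ (ε⁻¹ • Q)) := by
  funext x
  simp only [Pi.smul_apply, Function.comp_apply, powBump, smul_eq_mul, mul_pow, inv_pow]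
  rw [← mul_assoc, ← mul_assoc, mul_inv_cancel₀ (pow_ne_zero _ hε.ne'), one_mul, div_eq_inv_mul]


variable {E F : Type} [NormedAddCommGroup E] [NormedSpace ℝ E]
  [NormedAddCommGroup F] [NormedSpace ℝ F]

theorem contDiff_powBump (p : ℕ) : ContDiff ℝ ∞ (powBump p) :=
  (contDiff_id.pow p).mul lineBump.contDiff

theorem hasCompactSupport_powBump (p : ℕ) : HasCompactSupport (powBump p) :=
  lineBump.hasCompactSupport.mul_left

theorem exists_bound_iteratedFDeriv {G : E → F} (hG : ContDiff ℝ ∞ G) (hc : HasCompactSupport G)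
    (m : ℕ) : ∃ C, 0 ≤ C ∧ ∀ i ≤ m, ∀ x, ‖iteratedFDeriv ℝ i G x‖ ≤ C := by
  have h1 : ∀ i, ∃ C, ∀ x, ‖iteratedFDeriv ℝ i G x‖ ≤ C := fun i =>
    (hG.continuous_iteratedFDeriv (by exact_mod_cast le_top)).bounded_above_of_compact_support
      (hc.iteratedFDeriv i)
  choose C hC using h1
  have h0 : ∀ i, 0 ≤ C i := fun i => (norm_nonneg _).trans (hC i 0)
  refine ⟨∑ i ∈ Finset.range (m + 1), C i, Finset.sum_nonneg fun i _ => h0 i, fun i hi x =>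
    (hC i x).trans (Finset.single_le_sum (f := C) (fun i _ => h0 i) (by simp; omega))⟩

theorem exists_bound_on {Q : E → ℝ} (hQ : ContDiff ℝ ∞ Q) {S : Set E} (hS : IsCompact S)
    (m : ℕ) : ∃ C, 1 ≤ C ∧ ∀ i ≤ m, ∀ x ∈ S, ‖iteratedFDeriv ℝ i Q x‖ ≤ C := by
  have h1 : ∀ i, ∃ C, ∀ x ∈ S, ‖iteratedFDeriv ℝ i Q x‖ ≤ C := fun i =>
    hS.exists_bound_of_continuousOn
      (hQ.continuous_iteratedFDeriv (by exact_mod_cast le_top)).continuousOn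
  choose C hC using h1
  refine ⟨1 + ∑ i ∈ Finset.range (m + 1), |C i|, by
    linarith [Finset.sum_nonneg (s := Finset.range (m + 1)) fun i _ => abs_nonneg (C i)],
    fun i hi x hx => (hC i x hx).trans ((le_abs_self _).trans ?_)⟩
  have := Finset.single_le_sum (f := fun i => |C i|) (s := Finset.range (m + 1))
    (fun i _ => abs_nonneg _) (a := i) (by simp; omega)
  linarith

theorem contDiff_powBump_comp {Q : E → ℝ} (hQ : ContDiff ℝ ∞ Q) (p : ℕ) {ε : ℝ} (hε : 0 < ε) :
    ContDiff ℝ ∞ (fun x => Q x ^ p * lineBump (Q x / ε)) := by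
  rw [powBump_comp Q p hε]
  exact contDiff_const.smul ((contDiff_powBump p).comp (contDiff_const.smul hQ))

/-- Each derivative costs at most a factor 1/ε, while the prefactor is ε^p with p > m, so at least
one ε is left. Derivatives of Q need only be bounded on the compact support of G, since outside it
all derivatives of G vanish. -/
theorem exists_decay {Q : E → ℝ} (hQ : ContDiff ℝ ∞ Q) {G : E → F} (hG : ContDiff ℝ ∞ G)
    (hc : HasCompactSupport G) {p m : ℕ} (hm : m < p) :
    ∃ C, ∀ ε, 0 < ε → ε ≤ 1 → ∀ x,
      ‖iteratedFDeriv ℝ m (fun x => (Q x ^ p * lineBump (Q x / ε)) • G x) x‖ ≤ C * ε := by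
  obtain ⟨C₁, h1, hC₁⟩ := exists_bound_on hQ hc.isCompact m
  obtain ⟨C₂, h2, hC₂⟩ := exists_bound_iteratedFDeriv (contDiff_powBump p)
    (hasCompactSupport_powBump p) m
  obtain ⟨C₃, h3, hC₃⟩ := exists_bound_iteratedFDeriv hG hc m
  refine ⟨∑ i ∈ Finset.range (m + 1), (m.choose i : ℝ) * (i.factorial * C₂ * C₁ ^ m) * C₃,
    fun ε hε hε1 x => ?_⟩
  rw [Finset.sum_mul]
  refine (norm_iteratedFDeriv_smul_le (contDiff_powBump_comp hQ p hε) hG x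
    (by exact_mod_cast le_top)).trans (Finset.sum_le_sum fun i hi => ?_)
  have him : i ≤ m := by simpa [Nat.lt_succ_iff] using hi
  by_cases hx : x ∈ tsupport G
  · have hp : ‖iteratedFDeriv ℝ i (fun x => Q x ^ p * lineBump (Q x / ε)) x‖ ≤
        i.factorial * C₂ * C₁ ^ m * ε := by
      have hsm : ContDiff ℝ ∞ (ε⁻¹ • Q) := hQ.const_smul ε⁻¹
      rw [powBump_comp Q p hε, iteratedFDeriv_const_smul_apply
        (((contDiff_powBump p).comp hsm).contDiffAt.of_le
          (by exact_mod_cast le_top)), norm_smul,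
        Real.norm_of_nonneg (pow_nonneg hε.le p)]
      have h4 := norm_iteratedFDeriv_comp_le (n := i) (N := ∞) (contDiff_powBump p)
        hsm (by exact_mod_cast le_top) x
        (C := C₂) (D := C₁ / ε) (fun j hj => hC₂ j (hj.trans him) _) (fun j hj hji => ?_)
      · calc ε ^ p * _ ≤ ε ^ p * (i.factorial * C₂ * (C₁ / ε) ^ i) :=
              mul_le_mul_of_nonneg_left h4 (pow_nonneg hε.le p)
          _ = i.factorial * C₂ * C₁ ^ i * ε ^ (p - i) := by
              have : ε ^ p = ε ^ (p - i) * ε ^ i := by rw [← pow_add]; congr 1; omega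
              rw [this, div_pow]
              field_simp
          _ ≤ i.factorial * C₂ * C₁ ^ m * ε := by
              refine mul_le_mul ?_ ?_ (pow_nonneg hε.le _) (by positivity)
              · exact mul_le_mul_of_nonneg_left (pow_le_pow_right₀ h1 him) (by positivity)
              · calc ε ^ (p - i) ≤ ε ^ 1 := pow_le_pow_of_le_one hε.le hε1 (by omega)
                  _ = ε := pow_one ε
      · rw [iteratedFDeriv_const_smul_apply (hQ.contDiffAt.of_le (by exact_mod_cast le_top)),
          norm_smul, Real.norm_of_nonneg (inv_nonneg.2 hε.le)]
        have h5 : 1 ≤ C₁ / ε := by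
          rw [le_div_iff₀ hε]
          linarith
        calc ε⁻¹ * ‖iteratedFDeriv ℝ j Q x‖ ≤ ε⁻¹ * C₁ :=
              mul_le_mul_of_nonneg_left (hC₁ j (hji.trans him) x hx) (inv_nonneg.2 hε.le)
          _ = (C₁ / ε) ^ 1 := by rw [pow_one, div_eq_inv_mul]
          _ ≤ (C₁ / ε) ^ j := pow_le_pow_right₀ h5 hj
    calc _ ≤ (m.choose i : ℝ) * (i.factorial * C₂ * C₁ ^ m * ε) * C₃ := by
          gcongr
          exact hC₃ _ (by omega) x
      _ = _ := by ring
  · have : iteratedFDeriv ℝ (m - i) G x = 0 := by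
      by_contra h
      exact hx (support_iteratedFDeriv_subset (𝕜 := ℝ) (m - i) h)
    rw [this, norm_zero, mul_zero]
    positivity

/-- Smooth functions with prescribed expansions in powers of `Q` near the zero set of `Q`. -/
theorem exists_expansion {Q : E → ℝ} (hQ : ContDiff ℝ ∞ Q) (G : ℕ → E → ℂ)
    (hG : ∀ k, ContDiff ℝ ∞ (G k)) (hc : ∀ k, HasCompactSupport (G k)) :
    ∃ B : ℕ → E → ℂ, (∀ K, ContDiff ℝ ∞ (B K)) ∧
      ∀ K, ∃ δ > 0, ∀ x, |Q x| < δ → B K x = G K x + Q x • B (K + 1) x := by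
  -- The function `G k` occurs in the series `B K` with the power k − K, so one ε must serve all
  -- powers p ≤ k at once.
  have h1 : ∀ k, ∃ ε : ℝ, 0 < ε ∧ ∀ p ≤ k, ∀ m < p, ∀ x,
      ‖iteratedFDeriv ℝ m (fun x => (Q x ^ p * lineBump (Q x / ε)) • G k x) x‖ ≤ (1 / 2) ^ k := by
    intro k
    have h2 : ∀ p, ∀ m, ∃ C, m < p → ∀ ε, 0 < ε → ε ≤ 1 → ∀ x,
        ‖iteratedFDeriv ℝ m (fun x => (Q x ^ p * lineBump (Q x / ε)) • G k x) x‖ ≤ C * ε := by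
      intro p m
      by_cases hm : m < p
      · obtain ⟨C, hC⟩ := exists_decay hQ (hG k) (hc k) hm
        exact ⟨C, fun _ => hC⟩
      · exact ⟨0, fun h => absurd h hm⟩
    choose C hC using h2
    set D := ∑ p ∈ Finset.range (k + 1), ∑ m ∈ Finset.range (k + 1), |C p m|
    have hD0 : 0 ≤ D := Finset.sum_nonneg fun _ _ => Finset.sum_nonneg fun _ _ => abs_nonneg _
    refine ⟨(1 / 2) ^ k / (D + 1), by positivity, fun p hp m hm x => ?_⟩
    have hle : (1 / 2 : ℝ) ^ k / (D + 1) ≤ 1 := by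
      rw [div_le_one (by linarith)]
      calc (1 / 2 : ℝ) ^ k ≤ 1 := pow_le_one₀ (by norm_num) (by norm_num)
        _ ≤ D + 1 := by linarith
    refine (hC p m hm _ (by positivity) hle x).trans ?_
    have h3 : C p m ≤ D := by
      refine (le_abs_self _).trans ?_
      refine (Finset.single_le_sum (f := fun m => |C p m|) (s := Finset.range (k + 1))
        (fun i _ => abs_nonneg _) (a := m) (by simp; omega)).trans ?_
      exact Finset.single_le_sum (f := fun p => ∑ m ∈ Finset.range (k + 1), |C p m|)
        (s := Finset.range (k + 1)) (fun i _ => Finset.sum_nonneg fun _ _ => abs_nonneg _) (a := p)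
        (by simp; omega)
    calc C p m * ((1 / 2) ^ k / (D + 1)) ≤ (D + 1) * ((1 / 2) ^ k / (D + 1)) := by
          gcongr; linarith
      _ = (1 / 2) ^ k := by field_simp
  choose ε hε hb using h1
  -- The scale of the cut-off depends on K + i only. Term i + 1 of the series `B K` is therefore
  -- exactly Q times term i of `B (K + 1)`.
  set f : ℕ → ℕ → E → ℂ := fun K i x => (Q x ^ i * lineBump (Q x / ε (K + i))) • G (K + i) x with hf
  have hfb : ∀ K i m, m < i → ∀ x, ‖iteratedFDeriv ℝ m (f K i) x‖ ≤ (1 / 2) ^ i := by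
    intro K i m hm x
    refine (hb (K + i) i (by omega) m hm x).trans ?_
    exact pow_le_pow_of_le_one (by norm_num) (by norm_num) (by omega)
  have hsum : Summable fun i : ℕ => (1 / 2 : ℝ) ^ i :=
    summable_geometric_of_lt_one (by norm_num) (by norm_num)
  have hfs : ∀ K x, Summable fun i => f K i x := by
    intro K x
    refine (summable_nat_add_iff 1).1 (Summable.of_norm_bounded
      ((summable_nat_add_iff 1).2 hsum) fun i => ?_)
    have := hfb K (i + 1) 0 (by omega) x
    rwa [norm_iteratedFDeriv_zero] at this
  refine ⟨fun K x => ∑' i, f K i x, fun K => ?_, fun K => ⟨ε K, hε K, fun x hx => ?_⟩⟩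
  · refine contDiff_tsum_of_eventually (v := fun _ i => (1 / 2) ^ i) (fun i => ?_)
      (fun _ _ => hsum) fun m _ => ?_
    · exact (contDiff_powBump_comp hQ i (hε _)).smul (hG _)
    · rw [Nat.cofinite_eq_atTop]
      filter_upwards [Filter.eventually_gt_atTop m] with i hi
      exact hfb K i m hi
  · change ∑' i, f K i x = G K x + Q x • ∑' i, f (K + 1) i x
    rw [(hfs K x).tsum_eq_zero_add]
    have h2 : f K 0 x = G K x := by
      -- Only the first term of `B K` is altered by its cut-off in the recursion, and near the zero
      -- set of Q this cut-off equals one.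
      have h3 : lineBump (Q x / ε K) = 1 := by
        refine lineBump.one_of_mem_closedBall ?_
        rw [mem_closedBall_zero_iff, Real.norm_eq_abs, abs_div, abs_of_pos (hε K)]
        exact (div_le_one (hε K)).2 hx.le
      simp [hf, h3]
    rw [h2, ← tsum_const_smul'']
    congr 1
    refine tsum_congr fun i => ?_
    simp only [hf]
    rw [show K + (i + 1) = K + 1 + i by omega, smul_smul, pow_succ']
    congr 1
    ring

end Borel

end

end AmbientLift

namespace AmbientLift

noncomputable section

/-! ### Harmonic extension of homogeneous jets -/

section Extension

variable {n : ℕ} {h : Matrix (Fin n) (Fin n) ℝ} {O O' : Opens (Amb n)} {w : ℂ}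

theorem contDiff_quad : ContDiff ℝ ∞ (fun x : Amb n => ambForm h x x) := by
  simp only [ambForm_eq, dotProduct, Matrix.vecMul]
  fun_prop

/-- The central projection to the hyperplane where the linear form dual to `q` is one. -/
def norml (h : Matrix (Fin n) (Fin n) ℝ) (q x : Amb n) : Amb n := (ambForm h q x)⁻¹ • x

theorem norml_smul (q x : Amb n) {c : ℝ} (hc : c ≠ 0) : norml h q (c • x) = norml h q x := by
  rw [norml, norml, map_smul, smul_smul, smul_eq_mul, mul_inv, mul_right_comm,
    inv_mul_cancel₀ hc, one_mul]

theorem contDiffOn_norml {q : Amb n} (hq : ∀ x ∈ O, ambForm h q x ≠ 0) :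
    ContDiffOn ℝ ∞ (norml h q) O :=
  ((contDiff_ambForm q).contDiffOn.inv fun x hx => hq x hx).smul contDiffOn_id

/-- The part of a conic open set which projects centrally to a ball. -/
def conicBall (h : Matrix (Fin n) (Fin n) ℝ) (O : Opens (Amb n)) (q : Amb n)
    (hq : ∀ x ∈ O, ambForm h q x ≠ 0) (x₀ : Amb n) (ρ : ℝ) : Opens (Amb n) :=
  ⟨O ∩ norml h q ⁻¹' Metric.ball x₀ ρ,
    (contDiffOn_norml (O := O) hq).continuousOn.isOpen_inter_preimage O.isOpen Metric.isOpen_ball⟩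

theorem isConic_conicBall (hO : IsConic O) (q : Amb n) (hq : ∀ x ∈ O, ambForm h q x ≠ 0)
    (x₀ : Amb n) (ρ : ℝ) : IsConic (conicBall h O q hq x₀ ρ) := fun x hx c hc =>
  ⟨hO x hx.1 c hc, by
    change norml h q (c • x) ∈ Metric.ball x₀ ρ
    rw [norml_smul q x hc]
    exact hx.2⟩

theorem contDiff_bump_smul {x₀ : Amb n} (f : ContDiffBump x₀)
    (hf : Metric.closedBall x₀ f.rOut ⊆ (O : Set (Amb n))) (g : Sm O) :
    ContDiff ℝ ∞ (fun y => f y • g.1 y) := by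
  rw [contDiff_iff_contDiffAt]
  intro y
  by_cases hy : y ∈ O
  · exact f.contDiff.contDiffAt.smul (Sm.contDiffAt g hy)
  · have h1 : y ∉ tsupport f := by
      rw [f.tsupport_eq]
      exact fun h => hy (hf h)
    rw [notMem_tsupport_iff_eventuallyEq] at h1
    refine (contDiffAt_const (c := (0 : ℂ))).congr_of_eventuallyEq ?_
    filter_upwards [h1] with z hz
    rw [hz]
    simp

/-- A homogeneous function is determined by its values on the slice where the linear form of q is
one. The Borel lemma is applied to cut-off functions, evaluated on this slice, and the result is
extended back homogeneously. The new open set is the cone over the ball where the bump function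
equals one; it depends only on q and p, not on the functions, so it serves arbitrarily many
sequences. -/
theorem exists_homogeneous_expansion (hO : IsConic O) {q : Amb n}
    (hq : ∀ x ∈ O, ambForm h q x ≠ 0) {p : Amb n} (hp : p ∈ O) :
    ∃ (O' : Opens (Amb n)) (hO' : O' ≤ O), IsConic O' ∧ p ∈ O' ∧
      ∀ (w : ℂ) (k₀ : ℤ) (a : ℕ → JetMod h O'), (∀ k : ℕ, a k ∈ homJets h hO' w (k₀ + 2 * k)) →
        ∃ u : ℕ → JetMod h O', (∀ K : ℕ, u K ∈ homJets h le_rfl w (k₀ + 2 * K)) ∧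
          ∀ K, u K = a K + ∑ I, ∑ J, ((ambMetric h I J : ℝ) : ℂ) •
            (jetWeyl h O').x I ((jetWeyl h O').x J (u (K + 1))) := by
  have hx₀ : norml h q p ∈ O := hO p hp _ (inv_ne_zero (hq p hp))
  obtain ⟨ρ, hρ, hρO⟩ := Metric.isOpen_iff.1 O.isOpen _ hx₀
  set x₀ := norml h q p
  let f : ContDiffBump x₀ := ⟨ρ / 3, ρ / 2, by positivity, by linarith⟩
  have hf : Metric.closedBall x₀ f.rOut ⊆ (O : Set (Amb n)) :=
    (Metric.closedBall_subset_ball (by change ρ / 2 < ρ; linarith)).trans hρO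
  obtain ⟨O', hO', hc, hpO', hball⟩ : ∃ (O' : Opens (Amb n)) (_ : O' ≤ O), IsConic O' ∧ p ∈ O' ∧
      ∀ x ∈ O', f (norml h q x) = 1 :=
    ⟨conicBall h O q hq x₀ f.rIn, fun x hx => hx.1, isConic_conicBall hO q hq _ _,
      ⟨hp, Metric.mem_ball_self f.rIn_pos⟩,
      fun x hx => f.one_of_mem_closedBall (Metric.ball_subset_closedBall hx.2)⟩
  refine ⟨O', hO', hc, hpO', fun w k₀ a ha => ?_⟩
  choose g hg hga using ha
  obtain ⟨B, hB, hBe⟩ := exists_expansion (contDiff_quad (h := h)) (fun k y => f y • (g k).1 y)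
    (fun k => contDiff_bump_smul f hf (g k)) (fun k => f.hasCompactSupport.smul_right)
  have hsm : ∀ K : ℕ, ContDiffOn ℝ ∞
      (fun x => scale w (k₀ + 2 * K) (ambForm h q x) * B K (norml h q x)) O' := fun K => by
    refine ContDiffOn.mul (fun x hx => ?_) ((hB K).comp_contDiffOn
      ((contDiffOn_norml hq).mono hO'))
    exact ((contDiffAt_scale w _ (hq x (hO' hx))).comp x
      (contDiff_ambForm q).contDiffAt).contDiffWithinAt
  refine ⟨fun K => jet h O' (Sm.mk O' _ (hsm K)), fun K => ?_, fun K => ?_⟩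
  · refine ⟨Sm.mk O' _ (hsm K), fun x hx c hc0 => ?_, congrArg (jet h O') (Sm.ext fun x hx =>
      Sm.restrict_apply _ _ hx)⟩
    rw [Sm.mk_apply _ _ hx, Sm.mk_apply _ _ (hc x hx c hc0),
      norml_smul q x hc0, map_smul, smul_eq_mul, scale_mul _ _ hc0 (hq x (hO' hx)), mul_assoc]
  · rw [← hga K]
    simp only [jetWeyl, LinearMap.comp_apply, jetMul_jet, ← map_sum (jet h O'),
      ← (jet h O').map_smul, ← (jet h O').map_add]
    rw [← sub_eq_zero, ← (jet h O').map_sub, jet_eq_zero]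
    intro x hx hxx
    refine (VanishesToInfiniteOrder.zero x).congr ?_
    obtain ⟨δ, hδ, hδe⟩ := hBe K
    have h0 : ContinuousAt (fun y => ambForm h (norml h q y) (norml h q y)) x :=
      (contDiff_quad (h := h)).continuous.continuousAt.comp
        (((contDiffOn_norml hq).contDiffAt (O.isOpen.mem_nhds (hO' hx))).continuousAt)
    have h1 : ∀ᶠ y in nhds x, |ambForm h (norml h q y) (norml h q y)| < δ := by
      refine h0.abs.eventually_lt continuousAt_const ?_
      simp [norml, hxx, hδ]
    filter_upwards [O'.isOpen.mem_nhds hx, h1] with y hy hyd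
    have hyO : y ∈ O := hO' hy
    have hl := hq y hyO
    have hlc : ((ambForm h q y : ℝ) : ℂ) ≠ 0 := by exact_mod_cast hl
    have h2 := hδe _ hyd
    have h3 : f (norml h q y) = 1 := hball y hy
    have h4 : (g K).1 (norml h q y) = scale w (k₀ + 2 * K) (ambForm h q y)⁻¹ * (g K).1 y :=
      hg K y hyO _ (inv_ne_zero hl)
    have h5 : scale w (k₀ + 2 * K) (ambForm h q y) * scale w (k₀ + 2 * K) (ambForm h q y)⁻¹ = 1 := by
      rw [← scale_mul _ _ hl (inv_ne_zero hl), mul_inv_cancel₀ hl, scale_one]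
    -- Raising the index by two contributes l^{−2}, exactly the factor by which Q at the normalised
    -- point differs from Q(y).
    have h6 : scale w (k₀ + 2 * (K + 1 : ℕ)) (ambForm h q y) =
        scale w (k₀ + 2 * K) (ambForm h q y) * (((ambForm h q y : ℝ) : ℂ) ^ 2)⁻¹ := by
      rw [show k₀ + 2 * ((K + 1 : ℕ) : ℤ) = k₀ + 2 * K + 2 by push_cast; ring, scale_add _ _ _ hl,
        zpow_neg]
      rfl
    have h7 : ambForm h (norml h q y) (norml h q y) =
        ((ambForm h q y) ^ 2)⁻¹ * ambForm h y y := by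
      simp only [norml, map_smul, LinearMap.smul_apply, smul_eq_mul]
      rw [pow_two, mul_inv, mul_assoc]
    have h8 : (∑ I, ∑ J, ((ambMetric h I J : ℝ) : ℂ) • (Sm.mulBy (coordFun I)
        (contDiff_coordFun I).contDiffOn (Sm.mulBy (coordFun J) (contDiff_coordFun J).contDiffOn
          (Sm.mk O' _ (hsm (K + 1)))))).1 y = ((ambForm h y y : ℝ) : ℂ) *
        (Sm.mk O' _ (hsm (K + 1))).1 y := by
      rw [← sum_quad_apply, sum_jet_apply]
      refine Finset.sum_congr rfl fun I _ => ?_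
      rw [sum_jet_apply]
      rfl
    rw [h3, h4, h7] at h2
    have h9 : ∀ a b c : Sm O', (a - (b + c)).1 y = a.1 y - (b.1 y + c.1 y) := fun _ _ _ => rfl
    rw [Pi.zero_apply, h9, h8, Sm.mk_apply _ _ hy, Sm.mk_apply _ _ hy, Sm.restrict_apply hO' _ hy, h2, h6]
    simp only [Complex.real_smul, one_smul]
    push_cast
    linear_combination ((g K).1 y) * h5

theorem lap_pow_mem_homJets (f : Frame h) (hO' : O' ≤ O) (hO : IsConic O) {k : ℤ}
    {F : Fock n →ₗ[ℝ] JetMod h O'} (hF : F ∈ valuesIn n (homJets h hO' w k)) (K : ℕ) :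
    ((fockWC (jetWeyl h O') f).lap ^ K) F ∈ valuesIn n (homJets h hO' w (k + 2 * K)) := by
  induction K with
  | zero => simpa using hF
  | succ K ih =>
    intro z
    rw [pow_succ', Module.End.mul_apply, fockWC_lap]
    refine Submodule.sum_mem _ fun I _ => Submodule.sum_mem _ fun J _ => Submodule.smul_mem _ _ ?_
    have := homJets_d hO' hO (homJets_d hO' hO (ih z) J) I
    rwa [show k + 2 * ((K + 1 : ℕ) : ℤ) = k + 2 * K + 1 + 1 by push_cast; ring]

theorem eul_of_mem_homJets (f : Frame h) (hO' : O' ≤ O) {k : ℤ}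
    {F : Fock n →ₗ[ℝ] JetMod h O'} (hF : F ∈ valuesIn n (homJets h hO' w k)) :
    (fockWC (jetWeyl h O') f).eul F = (w - k) • F :=
  LinearMap.ext fun z => by
    rw [fockWC_eul, homJets_euler hO' (hF z)]
    rfl

/-- Harmonic extension: locally, every homogeneous jet differs from a harmonic one by a jet which
vanishes on the null cone. -/
theorem exists_harmonic (f : Frame h) (hs : h.IsSymm) (hO : IsConic O) {q : Amb n}
    (hqq : ambForm h q q = 0) (hq : ∀ x ∈ O, ambForm h q x ≠ 0) {p : Amb n} (hp : p ∈ O) :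
    ∃ (O' : Opens (Amb n)) (hO' : O' ≤ O), IsConic O' ∧ p ∈ O' ∧
      ∀ (w : ℂ) (k₀ : ℤ) (_ : ∀ k : ℕ, 1 ≤ k → w - k₀ + (n : ℂ) / 2 ≠ k)
        (F₁ : Fock n →ₗ[ℝ] JetMod h O'), F₁ ∈ valuesIn n (homJets h hO' w k₀) →
        ∃ F : Fock n →ₗ[ℝ] JetMod h O', F ∈ valuesIn n (homJets h le_rfl w k₀) ∧
          (fockWC (jetWeyl h O') f).lap F = 0 ∧ F - F₁ ∈ valuesIn n (coneIdeal h O') := by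
  obtain ⟨O', hO', hc, hpO, hexp⟩ := exists_homogeneous_expansion hO hq hp
  refine ⟨O', hO', hc, hpO, fun w k₀ hk F₁ hF₁ => ?_⟩
  set W := fockWC (jetWeyl h O') f
  let C := jetCone hs q hqq (fun x hx => hq x (hO' hx))
  let D : W.ConeData := fockCone f C
  -- The expansion is made separately on each basis element of the exterior algebra, all on the same
  -- open set, and extended linearly.
  let b := Module.Free.chooseBasis ℝ (Fock n)
  set c := WeylClifford.harmCoeff (2 * (w - k₀) + Fintype.card (Idx n) - 2)
  have h1 := fun i => hexp w k₀ (fun K => c K • (W.lap ^ K) F₁ (b i)) fun K =>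
    Submodule.smul_mem _ _ (lap_pow_mem_homJets f hO' hO hF₁ K (b i))
  choose u hu hue using h1
  let U : ℕ → (Fock n →ₗ[ℝ] JetMod h O') := fun K => b.constr ℝ (fun i => u i K)
  have hUb : ∀ K i, U K (b i) = u i K := fun K i => b.constr_basis ℝ _ i
  have hUm : ∀ K : ℕ, U K ∈ valuesIn n (homJets h le_rfl w (k₀ + 2 * K)) := by
    intro K z
    have hz := b.mem_span z
    induction hz using Submodule.span_induction with
    | mem z hz =>
      obtain ⟨i, rfl⟩ := hz
      rw [hUb]
      exact hu i K
    | zero => rw [map_zero]; exact Submodule.zero_mem _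
    | add x y _ _ hx hy => rw [map_add]; exact Submodule.add_mem _ hx hy
    | smul a x _ hx =>
      rw [map_smul]
      exact ((homJets h le_rfl w (k₀ + 2 * K)).restrictScalars ℝ).smul_mem a hx
  have hUs : ∀ K, U K = c K • (W.lap ^ K) F₁ + W.quad (U (K + 1)) := by
    intro K
    refine b.ext fun i => ?_
    rw [hUb, hue, LinearMap.add_apply, fockWC_quad, hUb]
    rfl
  have hcard : (Fintype.card (Idx n) : ℂ) = n + 2 := by
    simp [Idx]
    ring
  refine ⟨U 0, by simpa using hUm 0, WeylClifford.lap_eq_zero_of_series D (m := w - k₀) (F := F₁)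
    (fun k hk1 hk2 => hk k hk1 ?_) U (fun K => ?_) hUs, ?_⟩
  · rw [hcard] at hk2
    linear_combination hk2 / 2
  · rw [eul_of_mem_homJets f le_rfl (hUm K)]
    push_cast
    congr 1
    ring
  · have h2 := hUs 0
    have h3 : c 0 = 1 := rfl
    rw [h3, one_smul, pow_zero, Module.End.one_apply] at h2
    rw [h2, add_sub_cancel_left]
    exact D.K_quad _

end Extension

end

end AmbientLift

namespace AmbientLift

noncomputable section

/-! ### The jet of a tensor field as a functional on the exterior algebra -/

section FieldSymbol

variable {n r s : ℕ} {h : Matrix (Fin n) (Fin n) ℝ} {O O' : Opens (Amb n)} {w : ℂ}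
  {F : Amb n → Tens r s (Amb n)}

/-- A homogeneous trace-free tensor field with Young symmetry on an open set. -/
structure AmbField (h : Matrix (Fin n) (Fin n) ℝ) (w : ℂ) (O : Opens (Amb n))
    (F : Amb n → Tens r s (Amb n)) : Prop where
  smooth : ContDiffOn ℝ ∞ F O
  young : ∀ x ∈ O, IsYoung (F x)
  homogeneous : ∀ c : ℝ, c ≠ 0 → ∀ x ∈ O, ∀ v : Fin r ⊕ Fin s → Amb n,
    F (c • x) (fun i => c • v i) = ((|c| : ℝ) : ℂ) ^ w * F x v
  traceFree : ∀ x ∈ O, ∀ a a' : Fin r ⊕ Fin s, a ≠ a' → ∀ v : Fin r ⊕ Fin s → Amb n,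
    ambContract h (fun u u' => F x (Function.update (Function.update v a u) a' u')) = 0

theorem AmbField.restrict (hF : AmbField h w O F) (hO : O' ≤ O) : AmbField h w O' F where
  smooth := hF.smooth.mono hO
  young x hx := hF.young x (hO hx)
  homogeneous c hc x hx := hF.homogeneous c hc x (hO hx)
  traceFree x hx := hF.traceFree x (hO hx)

/-- The tensor field which vanishes outside an open set. -/
def cutoff (O : Opens (Amb n)) (F : Amb n → Tens r s (Amb n)) : Amb n → Tens r s (Amb n) :=
  (O : Set (Amb n)).indicator F

theorem cutoff_of_mem (F : Amb n → Tens r s (Amb n)) {x : Amb n} (hx : x ∈ O) :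
    cutoff O F x = F x := Set.indicator_of_mem hx F

theorem cutoff_of_notMem (F : Amb n → Tens r s (Amb n)) {x : Amb n} (hx : x ∉ O) :
    cutoff O F x = 0 := Set.indicator_of_notMem hx F

theorem AmbField.young_cutoff (hF : AmbField h w O F) (x : Amb n) : IsYoung (cutoff O F x) := by
  by_cases hx : x ∈ O
  · rw [cutoff_of_mem F hx]
    exact hF.young x hx
  · rw [cutoff_of_notMem F hx]
    exact IsYoung.zero r s

/-- The components of a tensor field. -/
def AmbField.comp (hF : AmbField h w O F) (v : Fin r ⊕ Fin s → Amb n) : Sm O :=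
  ⟨fun x => cutoff O F x v, (contDiffOn_eval hF.smooth v).congr fun x hx => by
    rw [cutoff_of_mem F hx], fun x hx => by
      change cutoff O F x v = 0
      rw [cutoff_of_notMem F hx]
      rfl⟩

theorem AmbField.comp_apply (hF : AmbField h w O F) (v : Fin r ⊕ Fin s → Amb n) {x : Amb n}
    (hx : x ∈ O) : (hF.comp v).1 x = F x v := by
  change cutoff O F x v = _
  rw [cutoff_of_mem F hx]

theorem AmbField.eventuallyEq_comp (hF : AmbField h w O F) (v : Fin r ⊕ Fin s → Amb n) {x : Amb n}
    (hx : x ∈ O) : (fun y => F y v) =ᶠ[nhds x] (hF.comp v).1 := by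
  filter_upwards [O.isOpen.mem_nhds hx] with y hy
  exact (hF.comp_apply v hy).symm

/-- The functional on the exterior algebra given by a tensor field. -/
def AmbField.symbol (hF : AmbField h w O F) : Fock n →ₗ[ℝ] Sm O where
  toFun z := ⟨fun x => symb (cutoff O F x) z,
    symb_mem ((Sm O).restrictScalars ℝ) hF.young_cutoff (fun v => (hF.comp v).2) z⟩
  map_add' _ _ := Subtype.ext (funext fun _ => map_add _ _ _)
  map_smul' _ _ := Subtype.ext (funext fun _ => map_smul _ _ _)

theorem AmbField.symbol_apply (hF : AmbField h w O F) (z : Fock n) {x : Amb n}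
    (hx : x ∈ O) : (hF.symbol z).1 x = symb (F x) z := by
  change symb (cutoff O F x) z = _
  rw [cutoff_of_mem F hx]

theorem AmbField.symbol_mono (hF : AmbField h w O F) (v : Fin r ⊕ Fin s → Amb n) :
    hF.symbol (mono r s (v ∘ Sum.inl) (v ∘ Sum.inr)) = hF.comp v := by
  refine Subtype.ext (funext fun x => ?_)
  change symb (cutoff O F x) _ = cutoff O F x v
  rw [symb_mono (hF.young_cutoff x), Sum.elim_comp_inl_inr]

theorem AmbField.symbol_mem (hF : AmbField h w O F) (S : Submodule ℂ (Sm O))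
    (hS : ∀ v, hF.comp v ∈ S) (z : Fock n) : hF.symbol z ∈ S := by
  obtain ⟨g, hg, hgz⟩ := symb_mem ((S.map (Sm O).subtype).restrictScalars ℝ) hF.young_cutoff
    (fun v => ⟨_, hS v, rfl⟩) z
  have : hF.symbol z = g := Subtype.ext hgz.symm
  rwa [this]

/-- Families of smooth functions as functions of two variables. -/
def uncurrySm (O : Opens (Amb n)) : (Idx n → Sm O) →ₗ[ℂ] (Idx n × Amb n → ℂ) where
  toFun g p := (g p.1).1 p.2
  map_add' _ _ := rfl
  map_smul' _ _ := rfl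

/-- Divergence and Euler contraction combine the components in all basis directions. The family over
the index is treated as one function of index and point, and the equation as membership in the
kernel of L, so that the slot-wise statement passes to the exterior algebra. -/
theorem AmbField.symbol_wedge (hF : AmbField h w O F) {B : Type} [AddCommGroup B] [Module ℂ B]
    (L : (Idx n → Sm O) →ₗ[ℂ] B) (b : Bool)
    (hL : ∀ (a : Fin r ⊕ Fin s), a.isLeft = b → ∀ v,
      L (fun I => hF.comp (Function.update v a (e I))) = 0) (z : Fock n) :
    L (fun I => hF.symbol (wedge b (e I) z)) = 0 := by
  set S := ((LinearMap.ker L).map (uncurrySm O)).restrictScalars ℝ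
  have key : (fun p : Idx n × Amb n => symb (cutoff O F p.2) (wedge b (e p.1) z)) ∈ S := by
    cases b
    · exact symb_wedge_false_mem (X := Idx n × Amb n) S (fun p => hF.young_cutoff p.2)
        (fun p => e p.1) (fun a v => ⟨_, hL (Sum.inr a) rfl v, rfl⟩) z
    · exact symb_wedge_true_mem (X := Idx n × Amb n) S (fun p => hF.young_cutoff p.2)
        (fun p => e p.1) (fun a v => ⟨_, hL (Sum.inl a) rfl v, rfl⟩) z
  obtain ⟨g, hg, hgz⟩ := key
  have : (fun I => hF.symbol (wedge b (e I) z)) = g :=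
    funext fun I => Subtype.ext (funext fun x => (congrFun hgz (I, x)).symm)
  rw [this]
  exact hg

theorem AmbField.comp_mem_homFun (hF : AmbField h w O F) (hO : IsConic O)
    (v : Fin r ⊕ Fin s → Amb n) : hF.comp v ∈ homFun O w (r + s) := by
  intro x hx c hc
  rw [hF.comp_apply v hx, hF.comp_apply v (hO x hx c hc), scale_eq _ _ hc]
  have h1 := hF.homogeneous c hc x hx v
  have h2 : F (c • x) (fun i => c • v i) = (c : ℂ) ^ ((r : ℤ) + s) * F (c • x) v := by
    rw [ContinuousMultilinearMap.map_smul_univ, Finset.prod_const, Complex.real_smul]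
    push_cast
    congr 1
    rw [← zpow_natCast]
    simp
  have h3 : (c : ℂ) ^ (-((r : ℤ) + s)) * (c : ℂ) ^ ((r : ℤ) + s) = 1 := by
    rw [zpow_neg, inv_mul_cancel₀ (zpow_ne_zero _ (by exact_mod_cast hc))]
  rw [h2] at h1
  linear_combination (c : ℂ) ^ (-((r : ℤ) + s)) * h1 - F (c • x) v * h3

theorem AmbField.symbol_mem_homFun (hF : AmbField h w O F) (hO : IsConic O) (z : Fock n) :
    hF.symbol z ∈ homFun O w (r + s) := hF.symbol_mem _ (hF.comp_mem_homFun hO) z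

theorem AmbField.symbol_shift (hF : AmbField h w O F) (z : Fock n) :
    hF.symbol (shift true false z) = 0 :=
  Subtype.ext (funext fun x => symb_shift (hF.young_cutoff x) z)

theorem AmbField.symbol_shift_left (hF : AmbField h w O F) (z : Fock n) :
    hF.symbol (shift true true z) = (r : ℂ) • hF.symbol z :=
  Subtype.ext (funext fun x => (symb_shift_left (cutoff O F x) z).trans (by
    rw [Complex.real_smul, Complex.ofReal_natCast]; rfl))

theorem AmbField.symbol_shift_right (hF : AmbField h w O F) (z : Fock n) :
    hF.symbol (shift false false z) = (s : ℂ) • hF.symbol z :=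
  Subtype.ext (funext fun x => (symb_shift_right (cutoff O F x) z).trans (by
    rw [Complex.real_smul, Complex.ofReal_natCast]; rfl))

theorem AmbField.symbol_trace (hF : AmbField h w O F) (z : Fock n) :
    hF.symbol (traceOp h z) = 0 := by
  refine Sm.ext fun x hx => ?_
  rw [hF.symbol_apply _ hx]
  exact symb_trace (hF.young x hx) (fun i j v => hF.traceFree x hx _ _ (by simp) v) z

/-- The functional with values in jets on a smaller open set. -/
def toJets (h : Matrix (Fin n) (Fin n) ℝ) (hO : O' ≤ O) (Ψ : Fock n →ₗ[ℝ] Sm O) :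
    Fock n →ₗ[ℝ] JetMod h O' := (jet h O' ∘ₗ Sm.restrict hO).restrictScalars ℝ ∘ₗ Ψ

theorem toJets_apply (hO : O' ≤ O) (Ψ : Fock n →ₗ[ℝ] Sm O) (z : Fock n) :
    toJets h hO Ψ z = jet h O' (Sm.restrict hO (Ψ z)) := rfl

theorem toJets_mem_homJets (hO : O' ≤ O) {Ψ : Fock n →ₗ[ℝ] Sm O} {k : ℤ}
    (hΨ : ∀ z, Ψ z ∈ homFun O w k) : toJets h hO Ψ ∈ valuesIn n (homJets h hO w k) :=
  fun z => ⟨Ψ z, hΨ z, rfl⟩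

theorem AmbField.isIrred (hF : AmbField h w O F) (hO : IsConic O) (hO' : O' ≤ O) (f : Frame h) :
    (fockWC (jetWeyl h O') f).IsIrred (w - (r + s)) r s (toJets h hO' hF.symbol) where
  eul := by
    rw [eul_of_mem_homJets f hO' (toJets_mem_homJets hO' (hF.symbol_mem_homFun hO))]
    push_cast
    rfl
  left := LinearMap.ext fun z => by
    rw [fockWC_S, toJets_apply, hF.symbol_shift_left, map_smul, map_smul]
    rfl
  right := LinearMap.ext fun z => by
    rw [fockWC_S, toJets_apply, hF.symbol_shift_right, map_smul, map_smul]
    rfl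
  young := LinearMap.ext fun z => by
    rw [fockWC_S, toJets_apply, hF.symbol_shift, map_zero, map_zero]
    rfl
  tr := LinearMap.ext fun z => by
    rw [fockWC_tr, toJets_apply, hF.symbol_trace, map_zero, map_zero, neg_zero]
    rfl

theorem AmbField.symbol_wedge_eq_zero (hF : AmbField h w O F) (b : Bool)
    (hb : ∀ a : Fin r ⊕ Fin s, a.isLeft ≠ b) (u : Amb n) (z : Fock n) :
    hF.symbol (wedge b u z) = 0 := by
  refine Subtype.ext (funext fun x => ?_)
  change symb (cutoff O F x) (wedge b u z) = 0
  have key : (fun _ : Unit => symb (cutoff O F x) (wedge b u z)) ∈ (⊥ : Submodule ℝ (Unit → ℂ)) := by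
    cases b
    · exact symb_wedge_false_mem _ (fun _ => hF.young_cutoff x) (fun _ => u)
        (fun a v => absurd rfl (hb (Sum.inr a))) z
    · exact symb_wedge_true_mem _ (fun _ => hF.young_cutoff x) (fun _ => u)
        (fun a v => absurd rfl (hb (Sum.inl a))) z
  exact congrFun ((Submodule.mem_bot ℝ).1 key) ()

theorem AmbField.sum_comp_apply (hF : AmbField h w O F) (a : Fin r ⊕ Fin s)
    (v : Fin r ⊕ Fin s → Amb n) {x : Amb n} (hx : x ∈ O) :
    ∑ I, coordFun I x * (hF.comp (Function.update v a (e I))).1 x = F x (Function.update v a x) := by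
  have h1 : F x (Function.update v a x) = (F x).toMultilinearMap.toLinearMap v a x := rfl
  have h2 : (F x).toMultilinearMap.toLinearMap v a x =
      ∑ I, x I • (F x).toMultilinearMap.toLinearMap v a (e I) := by
    conv_lhs => enter [2]; rw [eq_sum_e x]
    rw [map_sum]
    exact Finset.sum_congr rfl fun I _ => map_smul _ _ _
  rw [h1, h2]
  refine Finset.sum_congr rfl fun I _ => ?_
  rw [hF.comp_apply _ hx, Complex.real_smul]
  rfl

/-- The Euler contraction of a family of functions. -/
def conSm (O : Opens (Amb n)) : (Idx n → Sm O) →ₗ[ℂ] Sm O :=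
  ∑ I, Sm.mulBy (coordFun I) (contDiff_coordFun I).contDiffOn ∘ₗ LinearMap.proj I

theorem conSm_apply (g : Idx n → Sm O) (x : Amb n) :
    (conSm O g).1 x = ∑ I, coordFun I x * (g I).1 x := by
  rw [conSm, LinearMap.sum_apply, sum_jet_apply]
  rfl

/-- The divergence of a family of functions. -/
def divSm (h : Matrix (Fin n) (Fin n) ℝ) (O : Opens (Amb n)) : (Idx n → Sm O) →ₗ[ℂ] Sm O :=
  ∑ I, ∑ J, (((ambMetric h)⁻¹ I J : ℝ) : ℂ) • (Sm.deriv O (e I) ∘ₗ LinearMap.proj J)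

/-- The Laplacian of a function. -/
def lapSm (h : Matrix (Fin n) (Fin n) ℝ) (O : Opens (Amb n)) : Sm O →ₗ[ℂ] Sm O :=
  ∑ I, ∑ J, (((ambMetric h)⁻¹ I J : ℝ) : ℂ) • (Sm.deriv O (e I) ∘ₗ Sm.deriv O (e J))

theorem divSm_apply (g : Idx n → Sm O) {x : Amb n} (hx : x ∈ O) :
    (divSm h O g).1 x = ambContract h (fun u u' => ∑ J, u' J • fderiv ℝ (g J).1 x u) := by
  have h1 : ∀ J u, ∑ J', (e J : Amb n) J' • fderiv ℝ (g J').1 x u = fderiv ℝ (g J).1 x u := by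
    intro J u
    simp [e, Pi.single_apply]
  simp only [divSm, LinearMap.sum_apply, sum_jet_apply, ambContract, h1]
  refine Finset.sum_congr rfl fun I _ => Finset.sum_congr rfl fun J _ => ?_
  rw [Complex.real_smul, ← Sm.deriv_apply (e I) (g J) hx]
  rfl

theorem fockWC_con_toJets (f : Frame h) (Ψ : Fock n →ₗ[ℝ] Sm O) (b : Bool) (z : Fock n) :
    (fockWC (jetWeyl h O) f).con b (toJets h le_rfl Ψ) z =
      jet h O (conSm O fun I => Ψ (wedge b (e I) z)) := by
  rw [fockWC_con, conSm, LinearMap.sum_apply, map_sum]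
  refine Finset.sum_congr rfl fun I _ => ?_
  rw [toJets_apply]
  exact congrArg (jet h O) (Sm.ext fun x hx => by
    rw [Sm.mulBy_apply, Sm.restrict_apply _ _ hx]; rfl)

theorem Sm.restrict_rfl (g : Sm O) : Sm.restrict le_rfl g = g :=
  Sm.ext fun _ hx => Sm.restrict_apply _ _ hx

theorem fockWC_div_toJets (f : Frame h) (Ψ : Fock n →ₗ[ℝ] Sm O) (b : Bool) (z : Fock n) :
    (fockWC (jetWeyl h O) f).div b (toJets h le_rfl Ψ) z =
      jet h O (divSm h O fun I => Ψ (wedge b (e I) z)) := by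
  simp only [fockWC_div, divSm, LinearMap.sum_apply, map_sum]
  refine Finset.sum_congr rfl fun I _ => Finset.sum_congr rfl fun J _ => ?_
  rw [toJets_apply, Sm.restrict_rfl]
  rfl

theorem fockWC_lap_toJets (f : Frame h) (Ψ : Fock n →ₗ[ℝ] Sm O) (z : Fock n) :
    (fockWC (jetWeyl h O) f).lap (toJets h le_rfl Ψ) z = jet h O (lapSm h O (Ψ z)) := by
  simp only [fockWC_lap, lapSm, LinearMap.sum_apply, map_sum]
  refine Finset.sum_congr rfl fun I _ => Finset.sum_congr rfl fun J _ => ?_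
  rw [toJets_apply, Sm.restrict_rfl]
  rfl

end FieldSymbol

end

end AmbientLift

namespace AmbientLift

noncomputable section

/-! ### Evaluation on the null cone -/

section Evaluation

open ExteriorAlgebra

variable {n r s : ℕ} {h : Matrix (Fin n) (Fin n) ℝ} {O : Opens (Amb n)}

/-- Contraction with the linear form dual to `x` in the copy `a`. -/
def contrDual (h : Matrix (Fin n) (Fin n) ℝ) (a : Bool) (x : Amb n) : Fock n →ₗ[ℝ] Fock n :=
  CliffordAlgebra.contractLeft (Q := (0 : QuadraticForm ℝ (Amb n × Amb n))) (ambForm h x ∘ₗ prj a)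

theorem contrDual_eq (a : Bool) (x : Amb n) (z : Fock n) :
    contrDual h a x z = ∑ I, ∑ J, (x I * ambMetric h I J) • contr a J z := by
  have h1 : ambForm h x ∘ₗ prj a = ∑ I, ∑ J, (x I * ambMetric h I J) • coordForm a J := by
    refine LinearMap.ext fun m => ?_
    rw [LinearMap.comp_apply, ambForm_eq, Finset.sum_comm]
    simp only [LinearMap.sum_apply, LinearMap.smul_apply, dotProduct, Matrix.vecMul, smul_eq_mul,
      Finset.sum_mul]
    rfl
  rw [contrDual, h1]
  simp only [map_sum, map_smul, LinearMap.sum_apply, LinearMap.smul_apply]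
  rfl

theorem contrDual_mul (a : Bool) (x : Amb n) (m : Amb n × Amb n) (z : Fock n) :
    contrDual h a x (ι ℝ m * z) = ambForm h x (prj a m) • z - ι ℝ m * contrDual h a x z :=
  CliffordAlgebra.contractLeft_ι_mul _ _ _

theorem contrDual_ιMulti_mul (a : Bool) (x : Amb n) (p : ℕ) (y : Fin p → Amb n × Amb n)
    (hy : ∀ i, ambForm h x (prj a (y i)) = 0) (z : Fock n) :
    contrDual h a x (ιMulti ℝ p y * z) = (-1 : ℝ) ^ p • (ιMulti ℝ p y * contrDual h a x z) := by
  induction p with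
  | zero => simp
  | succ p ih =>
    rw [ιMulti_succ_apply, mul_assoc, contrDual_mul, hy, ih (Matrix.vecTail y) fun i => hy _, zero_smul, zero_sub,
      mul_smul_comm, pow_succ, mul_neg_one, neg_smul, mul_assoc]

/-- Contraction with the form ⟨x, ·⟩ is an antiderivation, and every factor is orthogonal to x. -/
theorem contrDual_mono (a : Bool) (x : Amb n) (p q : ℕ) (f : Fin p → Amb n) (g : Fin q → Amb n)
    (hf : ∀ i, ambForm h x (f i) = 0) (hg : ∀ i, ambForm h x (g i) = 0) :
    contrDual h a x (mono p q f g) = 0 := by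
  have h0 : contrDual h a x (1 : Fock n) = 0 := CliffordAlgebra.contractLeft_one _ _
  rw [mono, contrDual_ιMulti_mul, ← mul_one (ιMulti ℝ q _), contrDual_ιMulti_mul, h0, mul_zero,
    smul_zero, mul_zero, smul_zero]
  · intro i; rw [prj_emb]; split_ifs <;> simp [hg]
  · intro i; rw [prj_emb]; split_ifs <;> simp [hf]

/-- The projection along `q` to the tangent space of the cone in the copy `a`. -/
def copyProj (h : Matrix (Fin n) (Fin n) ℝ) (a : Bool) (x q : Amb n) :
    Amb n × Amb n →ₗ[ℝ] Amb n × Amb n :=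
  LinearMap.id - (ambForm h q x)⁻¹ • (ambForm h x ∘ₗ prj a).smulRight (emb a q)

theorem copyProj_apply (a : Bool) (x q : Amb n) (m : Amb n × Amb n) :
    copyProj h a x q m = m - (ambForm h q x)⁻¹ • ambForm h x (prj a m) • emb a q := rfl

/-- Both sides obey the same rule under left multiplication by a vector, the terms with two factors
q vanishing. The operator removing one dual of X becomes an algebra homomorphism, so its effect on
monomials is evident. -/
theorem wedge_contrDual (a : Bool) (x q : Amb n) (z : Fock n) :
    z - (ambForm h q x)⁻¹ • wedge a q (contrDual h a x z) =
      ExteriorAlgebra.map (copyProj h a x q) z := by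
  have h0 : contrDual h a x (1 : Fock n) = 0 := CliffordAlgebra.contractLeft_one _ _
  induction z using CliffordAlgebra.left_induction with
  | algebraMap c =>
    have h2 : (algebraMap ℝ (CliffordAlgebra (0 : QuadraticForm ℝ (Amb n × Amb n))) c) =
        c • (1 : Fock n) := Algebra.algebraMap_eq_smul_one c
    rw [h2, map_smul, h0, map_smul (ExteriorAlgebra.map _), map_one (ExteriorAlgebra.map _)]
    simp
  | add z z' hz hz' => rw [map_add, map_add, map_add, ← hz, ← hz', smul_add]; abel
  | ι_mul z m hz =>
    change ι ℝ m * z - _ • wedge a q (contrDual h a x (ι ℝ m * z)) =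
      ExteriorAlgebra.map (copyProj h a x q) (ι ℝ m * z)
    rw [map_mul (ExteriorAlgebra.map _), ← hz, map_apply_ι, contrDual_mul, copyProj_apply]
    simp only [wedge_apply, map_sub, map_smul, mul_sub, sub_mul, smul_mul_assoc, mul_smul_comm]
    have h1 : ι ℝ (emb a q) * (ι ℝ m * contrDual h a x z) =
        -(ι ℝ m * (ι ℝ (emb a q) * contrDual h a x z)) := by
      rw [← mul_assoc, ← mul_assoc, eq_neg_iff_add_eq_zero, ← add_mul, ι_add_mul_swap, zero_mul]
    have h2 : ι ℝ (emb a q) * (ι ℝ (emb a q) * contrDual h a x z) = 0 := by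
      rw [← mul_assoc, ι_sq_zero, zero_mul]
    rw [h1, h2]
    simp only [smul_zero, sub_zero, sub_neg_eq_add, smul_add]
    abel

theorem map_mono (M : Amb n × Amb n →ₗ[ℝ] Amb n × Amb n) (P : Amb n → Amb n)
    (hM : ∀ b u, M (emb b u) = emb b (P u)) (p q : ℕ) (f : Fin p → Amb n) (g : Fin q → Amb n) :
    ExteriorAlgebra.map M (mono p q f g) = mono p q (P ∘ f) (P ∘ g) := by
  rw [mono, map_mul, map_apply_ιMulti, map_apply_ιMulti, mono]
  congr 2
  · funext i; exact hM _ _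
  · funext i; exact hM _ _

/-- The projection along `q` to the tangent space of the cone. -/
def tanProj (h : Matrix (Fin n) (Fin n) ℝ) (x q u : Amb n) : Amb n :=
  u - (ambForm h q x)⁻¹ • ambForm h x u • q

theorem ambForm_tanProj (hs : h.IsSymm) {x q : Amb n} (hq : ambForm h q x ≠ 0) (u : Amb n) :
    ambForm h x (tanProj h x q u) = 0 := by
  rw [tanProj, map_sub, map_smul, map_smul, ambForm_comm hs x q, smul_eq_mul, smul_eq_mul,
    mul_comm (ambForm h x u), ← mul_assoc, inv_mul_cancel₀ hq, one_mul, sub_self]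

/-- The two projections together replace every vector, in either copy, by its projection along q to
the hyperplane orthogonal to x. -/
theorem symb_map_copyProj (hs : h.IsSymm) {x q : Amb n} (hq : ambForm h q x ≠ 0)
    {T : Tens r s (Amb n)} (hT : IsYoung T) (h0 : ∀ v, (∀ i, ambForm h x (v i) = 0) → T v = 0)
    (z : Fock n) : symb T (ExteriorAlgebra.map (copyProj h false x q)
      (ExteriorAlgebra.map (copyProj h true x q) z)) = 0 := by
  have h1 : ∀ b u, (copyProj h false x q ∘ₗ copyProj h true x q) (emb b u) =
      emb b (tanProj h x q u) := by
    intro b u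
    rw [LinearMap.comp_apply, copyProj_apply true, prj_emb]
    cases b
    · simp [copyProj_apply, prj_emb, tanProj]
    · simp [copyProj_apply, prj_emb, tanProj]
  have h2 : ∀ z, ExteriorAlgebra.map (copyProj h false x q)
      (ExteriorAlgebra.map (copyProj h true x q) z) =
      ExteriorAlgebra.map (copyProj h false x q ∘ₗ copyProj h true x q) z := fun z => by
    rw [← AlgHom.comp_apply, map_comp_map]
  rw [h2]
  induction z using mono_induction with
  | hadd z z' hz hz' => rw [map_add, map_add, hz, hz', add_zero]
  | hsmul c z hz => rw [map_smul, map_smul, hz, smul_zero]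
  | hmono p q' f g =>
    rw [map_mono _ _ h1]
    by_cases hpq : p = r ∧ q' = s
    · obtain ⟨rfl, rfl⟩ := hpq
      rw [symb_mono hT]
      refine h0 _ fun i => ?_
      rcases i with i | i <;> exact ambForm_tanProj hs hq _
    · exact symb_mono_ne T hpq _ _

/-- The value of a jet at a point of the null cone. -/
def jetEval {x : Amb n} (hx : x ∈ O) (hxx : ambForm h x x = 0) : JetMod h O →ₗ[ℂ] ℂ :=
  (Flat h O).liftQ ((LinearMap.proj x : (Amb n → ℂ) →ₗ[ℂ] ℂ) ∘ₗ (Sm O).subtype)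
    fun _ hg => (hg x hx hxx).eq_zero

variable {x : Amb n} (hx : x ∈ O) (hxx : ambForm h x x = 0)

theorem jetEval_jet (g : Sm O) : jetEval hx hxx (jet h O g) = g.1 x := rfl

theorem mem_coneIdeal {u : JetMod h O} :
    u ∈ coneIdeal h O ↔ ∀ x, ∀ (hx : x ∈ O) (hxx : ambForm h x x = 0), jetEval hx hxx u = 0 := by
  obtain ⟨g, rfl⟩ := jet_surjective u
  exact jet_mem_coneIdeal

theorem jetEval_x (I : Idx n) (u : JetMod h O) :
    jetEval hx hxx ((jetWeyl h O).x I u) = coordFun I x * jetEval hx hxx u := by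
  obtain ⟨g, rfl⟩ := jet_surjective u
  rfl

theorem jetEval_li (hs : h.IsSymm) (q : Amb n) (hq : ambForm h q q = 0)
    (hO : ∀ x ∈ O, ambForm h q x ≠ 0) (u : JetMod h O) :
    jetEval hx hxx ((jetCone hs q hq hO).li u) =
      (((ambForm h q x)⁻¹ : ℝ) : ℂ) * jetEval hx hxx u := by
  obtain ⟨g, rfl⟩ := jet_surjective u
  rw [Complex.ofReal_inv]
  rfl

theorem jetEval_eps (f : Frame h) (a : Bool) (φ : Fock n →ₗ[ℝ] JetMod h O) (z : Fock n) :
    jetEval hx hxx ((fockWC (jetWeyl h O) f).eps a φ z) =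
      jetEval hx hxx (φ (contrDual h a x z)) := by
  rw [fockWC_eps, contrDual_eq]
  simp only [map_sum]
  refine Finset.sum_congr rfl fun I _ => Finset.sum_congr rfl fun J _ => ?_
  rw [map_smul, jetEval_x, map_smul, mul_smul, ← Complex.coe_smul, ← Complex.coe_smul, map_smul,
    map_smul, smul_comm]
  rfl

theorem jetEval_kap (f : Frame h) (hs : h.IsSymm) (q : Amb n) (hq : ambForm h q q = 0)
    (hO : ∀ x ∈ O, ambForm h q x ≠ 0) (a : Bool) (φ : Fock n →ₗ[ℝ] JetMod h O) (z : Fock n) :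
    jetEval hx hxx ((fockCone f (jetCone hs q hq hO)).kap a φ z) =
      jetEval hx hxx (φ ((ambForm h q x)⁻¹ • wedge a q z)) := by
  have h1 : (fockCone f (jetCone hs q hq hO)).kap a φ z =
      (jetCone hs q hq hO).li (φ (wedge a q z)) := by
    change (post (jetCone hs q hq hO).li ((fockWC (jetWeyl h O) f).conDir (f.coord q) a φ)) z = _
    rw [fockWC_conDir]
    rfl
  rw [h1, jetEval_li, map_smul, ← Complex.coe_smul, map_smul]
  rfl

/-- At a point of the cone, `pr` is pullback along the projection to the tangent space of the cone.
This translates vanishing of the restriction of a tensor into the algebraic hypothesis of the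
uniqueness argument. -/
theorem jetEval_pr (f : Frame h) (hs : h.IsSymm) (q : Amb n) (hq : ambForm h q q = 0)
    (hO : ∀ x ∈ O, ambForm h q x ≠ 0) (φ : Fock n →ₗ[ℝ] JetMod h O) (z : Fock n) :
    jetEval hx hxx ((fockCone f (jetCone hs q hq hO)).pr φ z) =
      jetEval hx hxx (φ (ExteriorAlgebra.map (copyProj h false x q)
        (ExteriorAlgebra.map (copyProj h true x q) z))) := by
  have h1 : contrDual h false x (wedge true q (contrDual h true x z)) =
      -wedge true q (contrDual h false x (contrDual h true x z)) := by
    rw [wedge_apply, contrDual_mul, prj_emb]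
    simp [wedge_apply]
  simp only [WeylClifford.ConeData.pr, LinearMap.sub_apply, map_sub, jetEval_eps, jetEval_kap]
  rw [← wedge_contrDual, ← wedge_contrDual]
  simp only [map_sub, map_smul, h1, map_neg, smul_neg, smul_sub]
  abel

/-- Every correction term carries an exterior factor dual to X, which vanishes on vectors tangent to
the cone. -/
theorem jetEval_corrected (f : Frame h) (a b k : ℂ) (φ : Fock n →ₗ[ℝ] JetMod h O) {p q : ℕ}
    {u : Fin p → Amb n} {v : Fin q → Amb n} (hu : ∀ i, ambForm h x (u i) = 0)
    (hv : ∀ i, ambForm h x (v i) = 0) :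
    jetEval hx hxx ((fockWC (jetWeyl h O) f).corrected a b k φ (mono p q u v)) =
      jetEval hx hxx (φ (mono p q u v)) := by
  simp only [WeylClifford.corrected, LinearMap.sub_apply, LinearMap.add_apply,
    LinearMap.smul_apply, map_sub, map_add, map_smul, jetEval_eps, contrDual_mono _ _ _ _ _ _ hu hv,
    map_zero, smul_zero, sub_zero, add_zero]

end Evaluation

end

end AmbientLift

namespace AmbientLift

noncomputable section

/-! ### Local existence and uniqueness of ambient lifts -/

section Local

variable {n r s : ℕ} {h : Matrix (Fin n) (Fin n) ℝ} {O O' : Opens (Amb n)} {w : ℂ}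
  {F F₀ : Amb n → Tens r s (Amb n)}

/-- The ambient equations to infinite order along the part of the null cone in an open set. -/
structure SolvesOn (h : Matrix (Fin n) (Fin n) ℝ) (O : Opens (Amb n))
    (F : Amb n → Tens r s (Amb n)) : Prop where
  laplacian : ∀ x ∈ O, ambForm h x x = 0 → VanishesToInfiniteOrder (ambLaplacian h F) x
  divergence : ∀ x ∈ O, ambForm h x x = 0 → ∀ (a : Fin r) (v : Fin r ⊕ Fin s → Amb n),
    VanishesToInfiniteOrder (ambDiv h F (Sum.inl a) v) x
  euler : ∀ x ∈ O, ambForm h x x = 0 → ∀ (a : Fin r ⊕ Fin s) (v : Fin r ⊕ Fin s → Amb n),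
    VanishesToInfiniteOrder (eulerContract F a v) x

theorem VanishesToInfiniteOrder.neg {Y : Type} [NormedAddCommGroup Y] [NormedSpace ℝ Y]
    {g : Amb n → Y} {x : Amb n} (hg : VanishesToInfiniteOrder g x) :
    VanishesToInfiniteOrder (fun y => -g y) x := fun k => by
  change iteratedFDeriv ℝ k (-g) x = 0
  rw [iteratedFDeriv_neg_apply, hg k, neg_zero]

theorem fderiv_eval {G : Amb n → Tens r s (Amb n)} {y : Amb n} (hG : DifferentiableAt ℝ G y)
    (v : Fin r ⊕ Fin s → Amb n) (u : Amb n) :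
    fderiv ℝ (fun z => G z v) y u = fderiv ℝ G y u v := by
  have := ((ContinuousMultilinearMap.apply ℝ (fun _ : Fin r ⊕ Fin s => Amb n) ℂ v).hasFDerivAt.comp
    y hG.hasFDerivAt).fderiv
  exact congrArg (fun L => L u) this

theorem sum_update (T : Tens r s (Amb n)) (a : Fin r ⊕ Fin s) (v : Fin r ⊕ Fin s → Amb n)
    (u : Amb n) : ∑ J, u J • T (Function.update v a (e J)) = T (Function.update v a u) := by
  have h1 : ∀ u, T (Function.update v a u) = T.toMultilinearMap.toLinearMap v a u := fun _ => rfl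
  simp only [h1]
  conv_rhs => rw [eq_sum_e u, map_sum]
  exact Finset.sum_congr rfl fun I _ => (map_smul _ _ _).symm

theorem AmbField.contDiffAt (hF : AmbField h w O F) {x : Amb n} (hx : x ∈ O) :
    ContDiffAt ℝ ∞ F x := hF.smooth.contDiffAt (O.isOpen.mem_nhds hx)

theorem AmbField.fderiv_comp (hF : AmbField h w O F) {x : Amb n} (hx : x ∈ O)
    (v : Fin r ⊕ Fin s → Amb n) (u : Amb n) :
    fderiv ℝ (hF.comp v).1 x u = fderiv ℝ F x u v := by
  rw [← (hF.eventuallyEq_comp v hx).fderiv_eq,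
    fderiv_eval ((hF.contDiffAt hx).differentiableAt (by simp))]

theorem AmbField.lapSm_comp (hF : AmbField h w O F) {x : Amb n} (hx : x ∈ O)
    (v : Fin r ⊕ Fin s → Amb n) :
    (lapSm h O (hF.comp v)).1 =ᶠ[nhds x] fun y => ambLaplacian h F y v := by
  filter_upwards [O.isOpen.mem_nhds hx] with y hy
  simp only [lapSm, LinearMap.sum_apply, sum_jet_apply, ambLaplacian, ambContract,
    sum_apply]
  refine Finset.sum_congr rfl fun I _ => Finset.sum_congr rfl fun J _ => ?_
  have h1 : (Sm.deriv O (e J) (hF.comp v)).1 =ᶠ[nhds y] fun z => fderiv ℝ F z (e J) v := by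
    filter_upwards [O.isOpen.mem_nhds hy] with z hz
    rw [Sm.deriv_apply _ _ hz, hF.fderiv_comp hz]
  have h2 : fderiv ℝ (Sm.deriv O (e J) (hF.comp v)).1 y (e I) =
      fderiv ℝ (fun z => fderiv ℝ F z (e J)) y (e I) v := by
    rw [h1.fderiv_eq, fderiv_eval]
    exact (contDiffAt_dir (hF.contDiffAt hy) (e J)).differentiableAt (by simp)
  change _ = (ambMetric h)⁻¹ I J • (fderiv ℝ (fun z => fderiv ℝ F z (e J)) y (e I) v)
  rw [← h2, Complex.real_smul, ← Sm.deriv_apply _ _ hy]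
  rfl

theorem AmbField.divSm_comp (hF : AmbField h w O F) {x : Amb n} (hx : x ∈ O)
    (a : Fin r ⊕ Fin s) (v : Fin r ⊕ Fin s → Amb n) :
    (divSm h O fun J => hF.comp (Function.update v a (e J))).1 =ᶠ[nhds x]
      fun y => -ambDiv h F a v y := by
  filter_upwards [O.isOpen.mem_nhds hx] with y hy
  rw [divSm_apply _ hy, ambDiv, neg_neg]
  congr 1
  funext u u'
  simp only [hF.fderiv_comp hy]
  exact sum_update _ a v u'

theorem AmbField.conSm_comp (hF : AmbField h w O F) {x : Amb n} (hx : x ∈ O)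
    (a : Fin r ⊕ Fin s) (v : Fin r ⊕ Fin s → Amb n) :
    (conSm O fun J => hF.comp (Function.update v a (e J))).1 =ᶠ[nhds x] eulerContract F a v := by
  filter_upwards [O.isOpen.mem_nhds hx] with y hy
  rw [conSm_apply, hF.sum_comp_apply _ _ hy]
  rfl

/-- The conditions on the weight. -/
structure Admissible (n r s : ℕ) (w : ℂ) : Prop where
  le : s ≤ r
  left : 0 < r → s = 0 → w ≠ 2 * (r : ℂ) - n
  right : 0 < s → w ≠ (r : ℂ) + 2 * s - n - 1 ∧ w ≠ 2 * (r : ℂ) + s - n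
  harm : ∀ k : ℕ, 1 ≤ k → w + (n : ℂ) / 2 - r - s ≠ k

theorem card_idx : (Fintype.card (Idx n) : ℂ) = n + 2 := by
  simp [Idx]
  ring

namespace Admissible

variable (hA : Admissible n r s w)
include hA

/-- With m = w − r − s and N = n + 2, the number 2m + N − 2 equals 2(w + n/2 − r − s). -/
theorem series (k : ℕ) (hk : 1 ≤ k) :
    2 * (w - (r + s)) + Fintype.card (Idx n) - 2 ≠ 2 * k := by
  rw [card_idx]
  intro h1
  exact hA.harm k hk (by linear_combination h1 / 2)

/-- This is β = w − 2r − s + n; for s = 0 its nonvanishing is the condition on forms. -/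
theorem first (hr : 0 < r) : w - (r + s) + Fintype.card (Idx n) - 2 - r ≠ 0 := by
  rw [card_idx]
  intro h1
  rcases Nat.eq_zero_or_pos s with rfl | hs
  · exact hA.left hr rfl (by push_cast at h1; linear_combination h1)
  · exact (hA.right hs).2 (by linear_combination h1)

/-- This is β + r − s + 1 = w − r − 2s + n + 1, needed only when there is a second column. -/
theorem second (hs : 0 < s) :
    w - (r + s) + Fintype.card (Idx n) - 2 - r + (r - s + 1) ≠ 0 := by
  rw [card_idx]
  intro h1
  exact (hA.right hs).1 (by linear_combination h1)

theorem gap : (r : ℂ) - s + 1 ≠ 0 := by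
  have h1 : ((r - s : ℕ) : ℂ) + 1 ≠ 0 := Nat.cast_add_one_ne_zero _
  rwa [Nat.cast_sub hA.le] at h1

end Admissible

theorem AmbField.toJets_wedge_eq_zero (hF : AmbField h w O F) (hO : O' ≤ O) (b : Bool)
    (hb : ∀ a : Fin r ⊕ Fin s, a.isLeft ≠ b) (u : Amb n) (z : Fock n) :
    toJets h hO hF.symbol (wedge b u z) = 0 := by
  rw [toJets_apply, hF.symbol_wedge_eq_zero b hb, map_zero, map_zero]

theorem AmbField.div_eq_zero (hF : AmbField h w O F) (hO : O' ≤ O) (f : Frame h) (b : Bool)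
    (hb : ∀ a : Fin r ⊕ Fin s, a.isLeft ≠ b) :
    (fockWC (jetWeyl h O') f).div b (toJets h hO hF.symbol) = 0 :=
  LinearMap.ext fun z => by
    simp only [fockWC_div, hF.toJets_wedge_eq_zero hO b hb, map_zero, smul_zero,
      Finset.sum_const_zero, LinearMap.zero_apply]

theorem AmbField.kap_eq_zero (hF : AmbField h w O F) (f : Frame h) (C : FunctionCone (jetWeyl h O) h)
    (b : Bool) (hb : ∀ a : Fin r ⊕ Fin s, a.isLeft ≠ b) :
    (fockCone f C).kap b (toJets h le_rfl hF.symbol) = 0 := by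
  change post C.li ((fockWC (jetWeyl h O) f).conDir (f.coord C.q) b (toJets h le_rfl hF.symbol)) = 0
  rw [fockWC_conDir]
  refine LinearMap.ext fun z => ?_
  change C.li (toJets h le_rfl hF.symbol (wedge b C.q z)) = 0
  rw [hF.toJets_wedge_eq_zero le_rfl b hb, map_zero]

theorem isLeft_ne_true (hr : r = 0) (hs : s = 0) (a : Fin r ⊕ Fin s) : a.isLeft ≠ true := by
  subst hr hs
  rcases a with a | a <;> exact a.elim0

theorem isLeft_ne_false (hs : s = 0) (a : Fin r ⊕ Fin s) : a.isLeft ≠ false := by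
  subst hs
  rcases a with a | a
  · simp
  · exact a.elim0

theorem AmbField.con_eq_zero (hF : AmbField h w O F) (f : Frame h)
    (hE : ∀ x ∈ O, ambForm h x x = 0 → ∀ (a : Fin r ⊕ Fin s) (v : Fin r ⊕ Fin s → Amb n),
      VanishesToInfiniteOrder (eulerContract F a v) x) (b : Bool) :
    (fockWC (jetWeyl h O) f).con b (toJets h le_rfl hF.symbol) = 0 := by
  refine LinearMap.ext fun z => ?_
  rw [fockWC_con_toJets]
  refine hF.symbol_wedge (jet h O ∘ₗ conSm O) b (fun a _ v => ?_) z
  rw [LinearMap.comp_apply, jet_eq_zero]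
  exact fun x hx hxx => (hE x hx hxx a v).congr (hF.conSm_comp hx a v)

/-- Uniqueness of solutions of the ambient equations. -/
theorem AmbField.vanishes (hF : AmbField h w O F) (hs : h.IsSymm) (f : Frame h)
    (hA : Admissible n r s w) (hO : IsConic O) {q : Amb n} (hqq : ambForm h q q = 0)
    (hq : ∀ x ∈ O, ambForm h q x ≠ 0) (hS : SolvesOn h O F)
    (h0 : ∀ x ∈ O, ambForm h x x = 0 → ∀ v, (∀ i, ambForm h x (v i) = 0) → F x v = 0)
    {x : Amb n} (hx : x ∈ O) (hxx : ambForm h x x = 0) : VanishesToInfiniteOrder F x := by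
  set Φ := toJets h le_rfl hF.symbol
  let D := fockCone f (jetCone hs q hqq hq)
  have hd : (fockWC (jetWeyl h O) f).div true Φ = 0 := by
    refine LinearMap.ext fun z => ?_
    rw [fockWC_div_toJets]
    refine hF.symbol_wedge (jet h O ∘ₗ divSm h O) true (fun a ha v => ?_) z
    rw [LinearMap.comp_apply, jet_eq_zero]
    intro x hx hxx
    rcases a with a | a
    · exact (hS.divergence x hx hxx a v).neg.congr (hF.divSm_comp hx _ v)
    · simp at ha
  have hl : (fockWC (jetWeyl h O) f).lap Φ = 0 := by
    refine LinearMap.ext fun z => ?_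
    rw [fockWC_lap_toJets]
    refine hF.symbol_mem (LinearMap.ker (jet h O ∘ₗ lapSm h O)) (fun v => ?_) z
    rw [LinearMap.mem_ker, LinearMap.comp_apply, jet_eq_zero]
    intro x hx hxx
    exact ((hS.laplacian x hx hxx).clm_comp (contDiffAt_laplacian (hF.contDiffAt hx))
      (ContinuousMultilinearMap.apply ℝ (fun _ : Fin r ⊕ Fin s => Amb n) ℂ v)).congr
      (hF.lapSm_comp hx v)
  -- The vanishing of `F` on tangent vectors along the cone, in the form required by the algebra.
  have hpr : D.pr Φ ∈ D.K := by
    intro z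
    refine mem_coneIdeal.2 fun x hx hxx => ?_
    rw [jetEval_pr]
    change (Sm.restrict le_rfl (hF.symbol _)).1 x = 0
    rw [Sm.restrict_apply _ _ hx, hF.symbol_apply _ hx]
    exact symb_map_copyProj hs (hq x hx) (hF.young x hx) (h0 x hx hxx) z
  have key : Φ = 0 := by
    refine D.eq_zero_of_pr_mem (hF.isIrred hO le_rfl f) (hF.con_eq_zero f hS.euler) hd hl hpr
      hA.series ?_
    -- An empty column admits no contraction, so the weight condition belonging to it is not
    -- required.
    rcases Nat.eq_zero_or_pos r with hr | hr
    · have hs0 : s = 0 := by have := hA.le; omega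
      exact Or.inr ⟨hF.kap_eq_zero f _ true (isLeft_ne_true hr hs0),
        hF.kap_eq_zero f _ false (isLeft_ne_false hs0)⟩
    · refine Or.inl ⟨hA.first hr, ?_⟩
      rcases Nat.eq_zero_or_pos s with hs0 | hs0
      · exact Or.inl (hF.kap_eq_zero f _ false (isLeft_ne_false hs0))
      · exact Or.inr (hA.second hs0)
  refine vanishes_field (hF.contDiffAt hx) fun v => ?_
  have h1 : Φ (mono r s (v ∘ Sum.inl) (v ∘ Sum.inr)) = 0 := by rw [key]; rfl
  rw [toJets_apply, hF.symbol_mono, Sm.restrict_rfl, jet_eq_zero] at h1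
  exact (h1 x hx hxx).congr (hF.eventuallyEq_comp v hx)

/-! #### Tensor fields from functionals -/

/-- The value at a point of a functional with values in functions. -/
def evalAt (Ψ : Fock n →ₗ[ℝ] Sm O) (x : Amb n) : Fock n →ₗ[ℝ] ℂ where
  toFun z := (Ψ z).1 x
  map_add' z z' := by rw [map_add]; rfl
  map_smul' c z := by rw [map_smul]; rfl

/-- The tensor field given by a functional with values in functions. -/
def fieldOf (r s : ℕ) (Ψ : Fock n →ₗ[ℝ] Sm O) : Amb n → Tens r s (Amb n) :=
  fun x => tensOf r s (evalAt Ψ x)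

theorem fieldOf_apply (Ψ : Fock n →ₗ[ℝ] Sm O) (x : Amb n) (v : Fin r ⊕ Fin s → Amb n) :
    fieldOf r s Ψ x v = (Ψ (mono r s (v ∘ Sum.inl) (v ∘ Sum.inr))).1 x := rfl

theorem ambField_fieldOf (hs : h.IsSymm) {Ψ : Fock n →ₗ[ℝ] Sm O}
    (hΨ : ∀ z, Ψ z ∈ homFun O w (r + s)) (hY : ∀ z, Ψ (shift true false z) = 0)
    (hT : ∀ z, Ψ (traceOp h z) = 0) : AmbField h w O (fieldOf r s Ψ) where
  smooth := contDiffOn_field fun v => (Ψ _).2.1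
  young x _ := isYoung_tensOf fun z => by
    change (Ψ _).1 x = 0
    rw [hY]
    rfl
  homogeneous c hc x hx v := by
    rw [ContinuousMultilinearMap.map_smul_univ, Finset.prod_const, fieldOf_apply, fieldOf_apply,
      hΨ _ x hx c hc, scale_eq _ _ hc, Complex.real_smul]
    have h3 : (c : ℂ) ^ (-((r : ℤ) + s)) * (c : ℂ) ^ ((r : ℤ) + s) = 1 := by
      rw [zpow_neg, inv_mul_cancel₀ (zpow_ne_zero _ (by exact_mod_cast hc))]
    have h4 : ((c ^ (Finset.univ : Finset (Fin r ⊕ Fin s)).card : ℝ) : ℂ) =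
        (c : ℂ) ^ ((r : ℤ) + s) := by
      push_cast
      rw [← zpow_natCast]
      simp
    rw [h4]
    linear_combination ((|c| : ℝ) : ℂ) ^ w * (Ψ (mono r s (v ∘ Sum.inl) (v ∘ Sum.inr))).1 x * h3
  traceFree x _ a a' haa v := tensOf_trace hs
    (fun z => by change (Ψ _).1 x = 0; rw [hY]; rfl)
    (fun z => by change (Ψ _).1 x = 0; rw [hT]; rfl) a a' haa v

theorem exists_comp_fieldOf (Ψ : Fock n →ₗ[ℝ] Sm O) (hF : AmbField h w O (fieldOf r s Ψ))
    (v : Fin r ⊕ Fin s → Amb n) (a : Fin r ⊕ Fin s) :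
    ∃ b z, (∀ i, a = Sum.inl i → b = true) ∧
      ∀ u, hF.comp (Function.update v a u) = Ψ (wedge b u z) := by
  rcases a with i | j
  · obtain ⟨z, hz⟩ := exists_tensOf_left v i
    refine ⟨true, z, fun _ _ => rfl, fun u => Sm.ext fun x hx => ?_⟩
    rw [hF.comp_apply _ hx]
    exact hz (evalAt Ψ x) u
  · obtain ⟨b, z, hz⟩ := exists_tensOf (r := r) v (Sum.inr j)
    refine ⟨b, z, fun i hi => by simp at hi, fun u => Sm.ext fun x hx => ?_⟩
    rw [hF.comp_apply _ hx]
    exact hz (evalAt Ψ x) u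

theorem comp_fieldOf (Ψ : Fock n →ₗ[ℝ] Sm O) (hF : AmbField h w O (fieldOf r s Ψ))
    (v : Fin r ⊕ Fin s → Amb n) :
    hF.comp v = Ψ (mono r s (v ∘ Sum.inl) (v ∘ Sum.inr)) :=
  Sm.ext fun x hx => by rw [hF.comp_apply _ hx]; rfl

theorem solvesOn_fieldOf (f : Frame h) (Ψ : Fock n →ₗ[ℝ] Sm O)
    (hF : AmbField h w O (fieldOf r s Ψ))
    (hl : (fockWC (jetWeyl h O) f).lap (toJets h le_rfl Ψ) = 0)
    (hd : (fockWC (jetWeyl h O) f).div true (toJets h le_rfl Ψ) = 0)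
    (hc : ∀ b, (fockWC (jetWeyl h O) f).con b (toJets h le_rfl Ψ) = 0) :
    SolvesOn h O (fieldOf r s Ψ) where
  laplacian x hx hxx := by
    refine vanishes_field (contDiffAt_laplacian (hF.contDiffAt hx)) fun v => ?_
    have h1 := congrArg (fun φ => φ (mono r s (v ∘ Sum.inl) (v ∘ Sum.inr))) hl
    simp only [fockWC_lap_toJets, LinearMap.zero_apply, jet_eq_zero, ← comp_fieldOf Ψ hF] at h1
    exact (h1 x hx hxx).congr (hF.lapSm_comp hx v).symm
  divergence x hx hxx a v := by
    obtain ⟨b, z, hb, hz⟩ := exists_comp_fieldOf Ψ hF v (Sum.inl a)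
    obtain rfl := hb a rfl
    have h1 := congrArg (fun φ => φ z) hd
    simp only [fockWC_div_toJets, LinearMap.zero_apply, jet_eq_zero, ← hz] at h1
    have h2 := ((h1 x hx hxx).congr (hF.divSm_comp hx _ v).symm).neg
    simpa using h2
  euler x hx hxx a v := by
    obtain ⟨b, z, -, hz⟩ := exists_comp_fieldOf Ψ hF v a
    have h1 := congrArg (fun φ => φ z) (hc b)
    simp only [fockWC_con_toJets, LinearMap.zero_apply, jet_eq_zero, ← hz] at h1
    exact (h1 x hx hxx).congr (hF.conSm_comp hx _ v).symm

/-- Homogeneous jets lift linearly to homogeneous functions. -/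
theorem exists_lift {k : ℤ} (φ : Fock n →ₗ[ℝ] JetMod h O)
    (hφ : φ ∈ valuesIn n (homJets h le_rfl w k)) :
    ∃ Ψ : Fock n →ₗ[ℝ] Sm O, (∀ z, Ψ z ∈ homFun O w k) ∧ toJets h le_rfl Ψ = φ ∧
      ∀ z, φ z = 0 → Ψ z = 0 := by
  let L : homFun O w k →ₗ[ℝ] JetMod h O :=
    ((jet h O ∘ₗ Sm.restrict le_rfl) ∘ₗ (homFun O w k).subtype).restrictScalars ℝ
  -- A linear section sends zero to zero. The Young and trace relations, which for jets hold only
  -- modulo flat functions, therefore hold exactly for the lifted functions.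
  obtain ⟨σ, hσ⟩ := L.rangeRestrict.exists_rightInverse_of_surjective L.range_rangeRestrict
  have hr : ∀ z, φ z ∈ LinearMap.range L := fun z => by
    obtain ⟨g, hg, hgz⟩ := hφ z
    exact ⟨⟨g, hg⟩, hgz⟩
  refine ⟨(homFun O w k).subtype.restrictScalars ℝ ∘ₗ σ ∘ₗ φ.codRestrict _ hr,
    fun z => (σ _).2, LinearMap.ext fun z => ?_, fun z hz => ?_⟩
  · have h1 := congrArg Subtype.val (LinearMap.congr_fun hσ (φ.codRestrict _ hr z))
    exact h1
  · have h1 : φ.codRestrict _ hr z = 0 := Subtype.ext hz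
    rw [LinearMap.comp_apply, LinearMap.comp_apply, h1, map_zero, map_zero]

/-! #### Stability of homogeneity under the correction -/

theorem eps_mem_homJets (f : Frame h) (hO : O' ≤ O) {k : ℤ} {φ : Fock n →ₗ[ℝ] JetMod h O'}
    (hφ : φ ∈ valuesIn n (homJets h hO w (k + 1))) (b : Bool) :
    (fockWC (jetWeyl h O') f).eps b φ ∈ valuesIn n (homJets h hO w k) := fun z => by
  rw [fockWC_eps]
  refine Submodule.sum_mem _ fun I _ => Submodule.sum_mem _ fun J _ => Submodule.smul_mem _ _ ?_
  have := homJets_x hO (hφ (contr b J z)) I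
  rwa [add_sub_cancel_right] at this

theorem div_mem_homJets (f : Frame h) (hO : O' ≤ O) (hc : IsConic O) {k : ℤ}
    {φ : Fock n →ₗ[ℝ] JetMod h O'} (hφ : φ ∈ valuesIn n (homJets h hO w k)) (b : Bool) :
    (fockWC (jetWeyl h O') f).div b φ ∈ valuesIn n (homJets h hO w (k + 1)) := fun z => by
  rw [fockWC_div]
  exact Submodule.sum_mem _ fun I _ => Submodule.sum_mem _ fun J _ =>
    Submodule.smul_mem _ _ (homJets_d hO hc (hφ _) I)

theorem shift_mem_homJets (f : Frame h) (hO : O' ≤ O) {k : ℤ}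
    {φ : Fock n →ₗ[ℝ] JetMod h O'} (hφ : φ ∈ valuesIn n (homJets h hO w k)) (a b : Bool) :
    (fockWC (jetWeyl h O') f).S a b φ ∈ valuesIn n (homJets h hO w k) := fun z => by
  rw [fockWC_S]
  exact hφ _

theorem corrected_mem_homJets (f : Frame h) (hO : O' ≤ O) (hc : IsConic O) {k : ℤ}
    {φ : Fock n →ₗ[ℝ] JetMod h O'} (hφ : φ ∈ valuesIn n (homJets h hO w k)) (a b c : ℂ) :
    (fockWC (jetWeyl h O') f).corrected a b c φ ∈ valuesIn n (homJets h hO w k) := by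
  have hd := fun b => div_mem_homJets f hO hc hφ b
  have hdd := div_mem_homJets f hO hc (hd false) true
  have hS := shift_mem_homJets f hO (hd false) false true
  have h1 := eps_mem_homJets f hO (Submodule.add_mem _ (hd true) (Submodule.smul_mem _ c hS)) true
  have h2 := eps_mem_homJets f hO (hd false) false
  have h3 := eps_mem_homJets f hO hS true
  have h4 := eps_mem_homJets f hO (eps_mem_homJets f hO hdd false) true
  unfold WeylClifford.corrected WeylClifford.divYoung
  exact Submodule.sub_mem _ (Submodule.add_mem _ (Submodule.add_mem _ hφ (Submodule.smul_mem _ a h1))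
    (Submodule.smul_mem _ b (Submodule.sub_mem _ h2 (Submodule.smul_mem _ c h3))))
    (Submodule.smul_mem _ (a * b) h4)

theorem WeylClifford.ConeData.exists_coeffs {κ M : Type} [Fintype κ] [DecidableEq κ]
    [AddCommGroup M] [Module ℂ M] {W : WeylClifford κ M} (D : W.ConeData) {m : ℂ} {Φ : M}
    (hΦ : W.IsIrred m r s Φ) (hc : ∀ b, W.con b Φ = 0) (hk : (r : ℂ) - s + 1 ≠ 0)
    (h : (m + Fintype.card κ - 2 - r ≠ 0 ∧ (W.div false Φ = 0 ∨
      m + Fintype.card κ - 2 - r + (r - s + 1) ≠ 0)) ∨ (W.div true Φ = 0 ∧ W.div false Φ = 0))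
    (hm : ∀ j : ℕ, 1 ≤ j → 2 * m + Fintype.card κ - 2 ≠ 2 * j) :
    ∃ a b k : ℂ, ∀ F, W.eul F = m • F → W.lap F = 0 → F - W.corrected a b k Φ ∈ D.K →
      W.S true false F = 0 ∧ W.tr F = 0 ∧ W.div true F = 0 ∧ ∀ e, W.con e F = 0 := by
  -- If a denominator happens to be zero, its inverse is zero by convention; this occurs only where
  -- the corresponding divergence of Φ vanishes and the coefficient is irrelevant.
  refine ⟨-(m + Fintype.card κ - 2 - r)⁻¹, -(m + Fintype.card κ - 2 - r + (r - s + 1))⁻¹,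
    ((r : ℂ) - s + 1)⁻¹, fun F hF hl hK =>
      D.solves W hΦ hc (inv_mul_cancel₀ hk) (h.imp_left fun h => ⟨?_, h.2.imp_right fun h =>
        ⟨inv_mul_cancel₀ hk, ?_⟩⟩) hm hF hl hK⟩
  · rw [mul_neg, mul_inv_cancel₀ h.1]
  · rw [mul_neg, mul_inv_cancel₀ h]

theorem AmbField.toJets_restrict (hF₀ : AmbField h w O F₀) (hO' : O' ≤ O) :
    toJets h hO' hF₀.symbol = toJets h le_rfl (hF₀.restrict hO').symbol :=
  LinearMap.ext fun z => congrArg (jet h O') (Sm.ext fun x hx => by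
    rw [Sm.restrict_apply _ _ hx, Sm.restrict_apply _ _ hx, hF₀.symbol_apply _ (hO' hx),
      (hF₀.restrict hO').symbol_apply _ hx])

theorem AmbField.div_alternative (hF₀ : AmbField h w O F₀) (f : Frame h)
    (hA : Admissible n r s w) (hO' : O' ≤ O) :
    (w - (r + s) + Fintype.card (Idx n) - 2 - r ≠ 0 ∧
      ((fockWC (jetWeyl h O') f).div false (toJets h hO' hF₀.symbol) = 0 ∨
        w - (r + s) + Fintype.card (Idx n) - 2 - r + (r - s + 1) ≠ 0)) ∨
      ((fockWC (jetWeyl h O') f).div true (toJets h hO' hF₀.symbol) = 0 ∧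
        (fockWC (jetWeyl h O') f).div false (toJets h hO' hF₀.symbol) = 0) := by
  rcases Nat.eq_zero_or_pos r with hr | hr
  · have h1 : s = 0 := by have := hA.le; omega
    exact Or.inr ⟨hF₀.div_eq_zero hO' f true (isLeft_ne_true hr h1),
      hF₀.div_eq_zero hO' f false (isLeft_ne_false h1)⟩
  · refine Or.inl ⟨hA.first hr, ?_⟩
    rcases Nat.eq_zero_or_pos s with h1 | h1
    · exact Or.inl (hF₀.div_eq_zero hO' f false (isLeft_ne_false h1))
    · exact Or.inr (hA.second h1)

theorem exists_field_of_jets (hs : h.IsSymm) (f : Frame h) (φ : Fock n →ₗ[ℝ] JetMod h O)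
    (hφ : φ ∈ valuesIn n (homJets h le_rfl w ((r : ℤ) + s)))
    (hl : (fockWC (jetWeyl h O) f).lap φ = 0) (hY : (fockWC (jetWeyl h O) f).S true false φ = 0)
    (hT : (fockWC (jetWeyl h O) f).tr φ = 0) (hd : (fockWC (jetWeyl h O) f).div true φ = 0)
    (hc : ∀ b, (fockWC (jetWeyl h O) f).con b φ = 0) :
    ∃ F : Amb n → Tens r s (Amb n), AmbField h w O F ∧ SolvesOn h O F ∧
      ∀ x (hx : x ∈ O) (hxx : ambForm h x x = 0) v,
        F x v = jetEval hx hxx (φ (mono r s (v ∘ Sum.inl) (v ∘ Sum.inr))) := by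
  obtain ⟨Ψ, hΨm, rfl, hΨ0⟩ := exists_lift φ hφ
  have hΨY : ∀ z, Ψ (shift true false z) = 0 := fun z => hΨ0 _ (by
    rw [← fockWC_S (jetWeyl h O) f, hY]
    rfl)
  have hΨT : ∀ z, Ψ (traceOp h z) = 0 := fun z => hΨ0 _ (by
    rw [← neg_eq_zero, ← fockWC_tr (jetWeyl h O) f, hT]
    rfl)
  have hF := ambField_fieldOf hs hΨm hΨY hΨT
  refine ⟨fieldOf r s Ψ, hF, solvesOn_fieldOf f Ψ hF hl hd hc, fun x hx hxx v => ?_⟩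
  rw [toJets_apply, Sm.restrict_rfl]
  rfl

/-- Local existence of solutions of the ambient equations. -/
theorem AmbField.exists_solution (hF₀ : AmbField h w O F₀) (hs : h.IsSymm) (f : Frame h)
    (hA : Admissible n r s w) (hO : IsConic O) {q : Amb n} (hqq : ambForm h q q = 0)
    (hq : ∀ x ∈ O, ambForm h q x ≠ 0)
    (hE : ∀ x ∈ O, ∀ (a : Fin r ⊕ Fin s) (v : Fin r ⊕ Fin s → Amb n),
      F₀ x (Function.update v a x) = 0) {p : Amb n} (hp : p ∈ O) :
    ∃ (O' : Opens (Amb n)) (_ : O' ≤ O), IsConic O' ∧ p ∈ O' ∧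
      ∃ F : Amb n → Tens r s (Amb n), AmbField h w O' F ∧ SolvesOn h O' F ∧
        ∀ x ∈ O', ambForm h x x = 0 → ∀ v, (∀ i, ambForm h x (v i) = 0) → F x v = F₀ x v := by
  obtain ⟨O', hO', hc, hpO, hex⟩ := exists_harmonic f hs hO hqq hq hp
  refine ⟨O', hO', hc, hpO, ?_⟩
  have hq' : ∀ x ∈ O', ambForm h q x ≠ 0 := fun x hx => hq x (hO' hx)
  have hirr := hF₀.isIrred hO hO' f
  have hcon : ∀ b, (fockWC (jetWeyl h O') f).con b (toJets h hO' hF₀.symbol) = 0 := fun b => by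
    rw [hF₀.toJets_restrict hO']
    refine (hF₀.restrict hO').con_eq_zero f (fun x hx _ a v => ?_) b
    refine (VanishesToInfiniteOrder.zero x).congr ?_
    filter_upwards [O'.isOpen.mem_nhds hx] with y hy
    exact hE y (hO' hy) a v
  obtain ⟨a, b, k, habk⟩ := (fockCone f (jetCone hs q hqq hq')).exists_coeffs hirr hcon hA.gap
    (hF₀.div_alternative f hA hO') hA.series
  have hΦm := toJets_mem_homJets (h := h) hO' (hF₀.symbol_mem_homFun hO)
  -- The harmonic extension is taken of the corrected functional, not of the given extension itself.
  obtain ⟨φ, hφm, hφl, hφK⟩ := hex w (r + s) (fun j hj hj' => hA.harm j hj (by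
    push_cast at hj'; linear_combination hj')) _ (corrected_mem_homJets f hO' hO hΦm a b k)
  have heul : (fockWC (jetWeyl h O') f).eul φ = (w - (r + s)) • φ := by
    rw [eul_of_mem_homJets f le_rfl hφm]
    push_cast
    rfl
  obtain ⟨hY, hT, hd, hc0⟩ := habk φ heul hφl hφK
  obtain ⟨F, hF, hFS, hFe⟩ := exists_field_of_jets hs f φ hφm hφl hY hT hd hc0
  refine ⟨F, hF, hFS, fun x hx hxx v hv => ?_⟩
  -- On the cone the solution agrees with the corrected functional, which agrees with the original
  -- one on tangent vectors.
  have h1 := mem_coneIdeal.1 (hφK (mono r s (v ∘ Sum.inl) (v ∘ Sum.inr))) x hx hxx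
  have h2 := jetEval_corrected hx hxx f a b k (toJets h hO' hF₀.symbol) (u := v ∘ Sum.inl)
    (v := v ∘ Sum.inr) (fun i => hv _) (fun i => hv _)
  rw [LinearMap.sub_apply, map_sub, h2, ← hFe x hx hxx v] at h1
  rw [sub_eq_zero.1 h1, toJets_apply, jetEval_jet, Sm.restrict_apply _ _ hx, hF₀.symbol_mono,
    hF₀.comp_apply _ (hO' hx)]

end Local

end

end AmbientLift

namespace AmbientLift

noncomputable section

/-! ### Null frames -/

section NullFrames

variable {n r s : ℕ} {h : Matrix (Fin n) (Fin n) ℝ}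

theorem ambMetric_mul_inv {g : Matrix (Fin n) (Fin n) ℝ} (hg : IsUnit g.det) :
    ambMetric g * ambMetric g⁻¹ = 1 := by
  have h1 := Matrix.mul_nonsing_inv g hg
  ext I J
  rw [Matrix.mul_apply]
  simp only [Fintype.sum_sum_type, Finset.univ_unique, Finset.sum_singleton]
  rcases I with I | I | I <;> rcases J with J | J | J <;>
    simp [ambMetric, Matrix.one_apply]
  rw [← Matrix.mul_apply, h1, Matrix.one_apply]

theorem isUnit_det_ambMetric {g : Matrix (Fin n) (Fin n) ℝ} (hg : IsUnit g.det) :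
    IsUnit (ambMetric g).det :=
  Matrix.isUnit_det_of_right_inverse (ambMetric_mul_inv hg)

theorem inv_ambMetric {g : Matrix (Fin n) (Fin n) ℝ} (hg : IsUnit g.det) :
    (ambMetric g)⁻¹ = ambMetric g⁻¹ := Matrix.inv_eq_right_inv (ambMetric_mul_inv hg)

theorem nonempty_frame (hs : h.IsSymm) (hdet : IsUnit h.det) : Nonempty (Frame h) := by
  obtain ⟨P, R, h1, h2, h3, h4⟩ :=
    exists_frame (isSymm_ambMetric hs) (isUnit_det_ambMetric hdet)
  exact ⟨⟨P, R, h1, h2, h3, h4⟩⟩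

theorem ambForm_nondegenerate (hdet : IsUnit h.det) {u : Amb n}
    (hu : ∀ v, ambForm h u v = 0) : u = 0 := by
  have h1 : u ᵥ* ambMetric h = 0 := by
    funext I
    have := hu (e I)
    rw [ambForm_eq] at this
    simpa [e] using this
  have h2 := congrArg (fun v => v ᵥ* (ambMetric h)⁻¹) h1
  simpa [Matrix.vecMul_vecMul, Matrix.mul_nonsing_inv _ (isUnit_det_ambMetric hdet)] using h2

/-- Nondegeneracy gives a vector pairing to one with y; subtracting a multiple of y makes it null
without changing that pairing. -/
theorem exists_null_dual (hs : h.IsSymm) (hdet : IsUnit h.det) {y : Amb n} (hy : y ≠ 0)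
    (hyy : ambForm h y y = 0) : ∃ q, ambForm h q q = 0 ∧ ambForm h q y = 1 := by
  obtain ⟨v, hv⟩ : ∃ v, ambForm h y v ≠ 0 := by
    by_contra! hc
    exact hy (ambForm_nondegenerate hdet hc)
  set u := (ambForm h y v)⁻¹ • v
  have hu : ambForm h y u = 1 := by
    rw [map_smul, smul_eq_mul, inv_mul_cancel₀ hv]
  have hu' : ambForm h u y = 1 := by rw [ambForm_comm hs, hu]
  refine ⟨u - (ambForm h u u / 2) • y, ?_, ?_⟩
  · simp only [map_sub, map_smul, LinearMap.sub_apply, LinearMap.smul_apply, hu, hu', hyy,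
      smul_eq_mul]
    ring
  · simp [hu', hyy]

/-- The vectors y and q span a hyperbolic plane, whose orthogonal complement has dimension n. A
degenerate vector of the complement would be orthogonal to the plane as well, hence to everything.
-/
theorem exists_orth_basis (hs : h.IsSymm) (hdet : IsUnit h.det) {y q : Amb n}
    (hyy : ambForm h y y = 0) (hqq : ambForm h q q = 0) (hqy : ambForm h q y = 1) :
    ∃ b : Fin n → Amb n, (∀ i, ambForm h y (b i) = 0) ∧ (∀ i, ambForm h q (b i) = 0) ∧
      IsUnit (Matrix.of fun i j => ambForm h (b i) (b j)).det := by
  have hyq : ambForm h y q = 1 := by rw [ambForm_comm hs, hqy]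
  let L : Amb n →ₗ[ℝ] ℝ × ℝ := (ambForm h y).prod (ambForm h q)
  have hL : Function.Surjective L := fun c => ⟨c.1 • q + c.2 • y, by
    ext <;> simp [L, hyy, hqq, hqy, hyq]⟩
  have h1 : Module.finrank ℝ (LinearMap.ker L) = n := by
    have h2 := L.finrank_range_add_finrank_ker
    rw [LinearMap.range_eq_top.2 hL, finrank_top] at h2
    simp [Idx] at h2
    omega
  let b := Module.finBasisOfFinrankEq ℝ (LinearMap.ker L) h1
  have hb : ∀ i, ambForm h y (b i) = 0 ∧ ambForm h q (b i) = 0 := fun i =>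
    Prod.ext_iff.1 (b i).2
  refine ⟨fun i => b i, fun i => (hb i).1, fun i => (hb i).2, ?_⟩
  rw [isUnit_iff_ne_zero]
  intro hd
  obtain ⟨c, hc0, hc⟩ := Matrix.exists_vecMul_eq_zero_iff.2 hd
  set u : Amb n := ∑ i, c i • (b i : Amb n)
  have hub : ∀ j, ambForm h u (b j) = 0 := fun j => by
    have := congrFun hc j
    simpa [u, Matrix.vecMul, dotProduct] using this
  have huy : ambForm h u y = 0 := by
    rw [ambForm_comm hs]
    simp [u, (hb _).1]
  have huq : ambForm h u q = 0 := by
    rw [ambForm_comm hs]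
    simp [u, (hb _).2]
  have hu0 : u = 0 := by
    refine ambForm_nondegenerate hdet fun v => ?_
    set v' := v - ambForm h q v • y - ambForm h y v • q with hv'
    have hv : v' ∈ LinearMap.ker L := by
      rw [LinearMap.mem_ker]
      ext <;> simp [L, v', hyy, hqq, hqy, hyq]
    have h3 : ambForm h u v' = 0 := by
      have h4 := b.sum_repr ⟨v', hv⟩
      have h5 := congrArg Subtype.val h4
      rw [AddSubmonoidClass.coe_finsetSum] at h5
      change _ = v' at h5
      rw [← h5, map_sum]
      refine Finset.sum_eq_zero fun i _ => ?_
      change ambForm h u (_ • (b i : Amb n)) = 0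
      rw [map_smul, hub, smul_zero]
    rw [hv', map_sub, map_sub, map_smul, map_smul, huy, huq] at h3
    simpa using h3
  have h6 : ∑ i, c i • b i = 0 := Subtype.ext (by
    rw [AddSubmonoidClass.coe_finsetSum]; exact hu0)
  exact hc0 (funext fun i => Fintype.linearIndependent_iff.1 b.linearIndependent c h6 i)

/-- The frame consisting of two null vectors and `n` further vectors. -/
def nullFrame (y q : Amb n) (b : Fin n → Amb n) : Idx n → Amb n
  | Sum.inl _ => y
  | Sum.inr (Sum.inl i) => b i
  | Sum.inr (Sum.inr _) => q

/-- The inverse metric is frame independent: if P holds the frame vectors as columns and G is their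
Gram matrix, then P·G⁻¹·Pᵀ is the inverse of the ambient metric. -/
theorem ambContract_eq_of_frame {M : Type} [AddCommGroup M] [Module ℝ M]
    (β : Amb n →ₗ[ℝ] Amb n →ₗ[ℝ] M) (B : Idx n → Amb n) {G : Matrix (Idx n) (Idx n) ℝ}
    (hB : ∀ I J, ambForm h (B I) (B J) = G I J) (hG : IsUnit G.det) :
    ambContract h (fun u u' => β u u') = ∑ I, ∑ J, G⁻¹ I J • β (B I) (B J) := by
  set g := ambMetric h with hg
  set P : Matrix (Idx n) (Idx n) ℝ := fun K I => B I K
  have hBe : ∀ I, B I = ∑ K, P K I • (e K : Amb n) := fun I => eq_sum_e (B I)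
  have hPg : P.transpose * g * P = G := by
    ext I J
    rw [← hB I J, ambForm_eq]
    rfl
  have hP : IsUnit P.det := by
    rw [← hPg, Matrix.det_mul] at hG
    exact isUnit_of_mul_isUnit_right hG
  have hgd : IsUnit g.det := by
    rw [← hPg, Matrix.det_mul, Matrix.det_mul] at hG
    exact isUnit_of_mul_isUnit_right (isUnit_of_mul_isUnit_left hG)
  have hPt : IsUnit P.transpose.det := by rwa [Matrix.det_transpose]
  have hPg' : P * G⁻¹ * P.transpose = g⁻¹ := by
    rw [← hPg, Matrix.mul_inv_rev, Matrix.mul_inv_rev, ← Matrix.mul_assoc,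
      Matrix.mul_nonsing_inv _ hP, Matrix.one_mul, Matrix.mul_assoc,
      Matrix.nonsing_inv_mul _ hPt, Matrix.mul_one]
  have h1 : ∀ I J, β (B I) (B J) = ∑ K, ∑ L, (P K I * P L J) • β (e K) (e L) := by
    intro I J
    rw [hBe I, hBe J]
    simp only [map_sum, map_smul, LinearMap.sum_apply, LinearMap.smul_apply, Finset.smul_sum,
      smul_smul]
    rw [Finset.sum_comm]
    refine Finset.sum_congr rfl fun K _ => Finset.sum_congr rfl fun L _ => ?_
    rw [mul_comm]
  have h2 : ∀ K L, (g⁻¹ K L) • β (e K) (e L) =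
      ∑ I, ∑ J, (G⁻¹ I J * (P K I * P L J)) • β (e K) (e L) := by
    intro K L
    rw [← hPg', Matrix.mul_apply, Finset.sum_smul, Finset.sum_comm]
    refine Finset.sum_congr rfl fun J _ => ?_
    rw [Matrix.mul_apply, Finset.sum_mul, Finset.sum_smul]
    refine Finset.sum_congr rfl fun I _ => ?_
    rw [Matrix.transpose_apply]
    congr 1
    ring
  simp only [ambContract, ← hg, h1, h2, Finset.smul_sum, smul_smul]
  have r4 : ∀ t : Idx n → Idx n → Idx n → Idx n → M,
      ∑ K, ∑ L, ∑ I, ∑ J, t K L I J = ∑ I, ∑ J, ∑ K, ∑ L, t K L I J := fun t => by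
    calc ∑ K, ∑ L, ∑ I, ∑ J, t K L I J = ∑ K, ∑ I, ∑ L, ∑ J, t K L I J :=
          Finset.sum_congr rfl fun K _ => Finset.sum_comm
      _ = ∑ I, ∑ K, ∑ L, ∑ J, t K L I J := Finset.sum_comm
      _ = ∑ I, ∑ K, ∑ J, ∑ L, t K L I J :=
          Finset.sum_congr rfl fun I _ => Finset.sum_congr rfl fun K _ => Finset.sum_comm
      _ = ∑ I, ∑ J, ∑ K, ∑ L, t K L I J := Finset.sum_congr rfl fun I _ => Finset.sum_comm
  exact r4 _

/-- A contraction with the inverse metric in which the direction of a null vector does not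
contribute. -/
theorem ambContract_eq_orth {M : Type} [AddCommGroup M] [Module ℝ M] (hs : h.IsSymm)
    (β : Amb n →ₗ[ℝ] Amb n →ₗ[ℝ] M) {y q : Amb n} {b : Fin n → Amb n}
    {g : Matrix (Fin n) (Fin n) ℝ}
    (hyy : ambForm h y y = 0) (hqq : ambForm h q q = 0) (hqy : ambForm h q y = 1)
    (hyb : ∀ i, ambForm h y (b i) = 0) (hqb : ∀ i, ambForm h q (b i) = 0)
    (hg : ∀ i j, g i j = ambForm h (b i) (b j)) (hgd : IsUnit g.det)
    (hβ : ∀ u, β y u = 0) (hβ' : ∀ u, β u y = 0) :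
    ambContract h (fun u u' => β u u') = ∑ i, ∑ j, g⁻¹ i j • β (b i) (b j) := by
  have hG : ∀ I J, ambForm h (nullFrame y q b I) (nullFrame y q b J) = ambMetric g I J := by
    intro I J
    rcases I with I | I | I <;> rcases J with J | J | J <;>
      simp [nullFrame, ambMetric, hyy, hqq, hqy, hyb, hqb, hg, ambForm_comm hs y q,
        ambForm_comm hs (b _) y, ambForm_comm hs (b _) q]
  rw [ambContract_eq_of_frame β (nullFrame y q b) hG (isUnit_det_ambMetric hgd), inv_ambMetric hgd]
  simp [Fintype.sum_sum_type, ambMetric, nullFrame, hβ, hβ']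

/-- A tensor as a bilinear function of two of its arguments. -/
def slots (T : Tens r s (Amb n)) (a a' : Fin r ⊕ Fin s) (haa : a ≠ a')
    (v : Fin r ⊕ Fin s → Amb n) : Amb n →ₗ[ℝ] Amb n →ₗ[ℝ] ℂ :=
  LinearMap.mk₂ ℝ (fun u u' => T (Function.update (Function.update v a u) a' u'))
    (by intro u₁ u₂ u'; simp [Function.update_comm haa])
    (by intro c u u'; simp [Function.update_comm haa]) (by simp) (by simp)

theorem slots_apply (T : Tens r s (Amb n)) (a a' : Fin r ⊕ Fin s) (haa : a ≠ a')
    (v : Fin r ⊕ Fin s → Amb n) (u u' : Amb n) :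
    slots T a a' haa v u u' = T (Function.update (Function.update v a u) a' u') := rfl

end NullFrames

end

end AmbientLift

namespace AmbientLift

noncomputable section

/-! ### Local extension of sections over the quadric to homogeneous ambient tensors -/

section Extension

variable {n r s : ℕ} {h : Matrix (Fin n) (Fin n) ℝ} {w : ℂ}

theorem Opens.exists_ambCone (U : Opens (Quadric h)) : ∃ W : Set (ℙ ℝ (Amb n)), IsOpen W ∧
    (∀ p ∈ U, p.1 ∈ W) ∧
    ∀ x, x ∈ cone (U : Set (Quadric h)) ↔ x ∈ ambCone W ∧ ambForm h x x = 0 := by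
  obtain ⟨W, hW, hWU⟩ := (isOpen_induced_iff (f := fun p : Quadric h => p.1)).1 U.isOpen
  have hU : ∀ p : Quadric h, p ∈ U ↔ p.1 ∈ W := fun p => by
    change p ∈ (U : Set (Quadric h)) ↔ _
    rw [← hWU]
    rfl
  refine ⟨W, hW, fun p hp => (hU p).1 hp, fun x => ⟨fun hx => ⟨?_, form_self_of_mem_cone hx⟩, ?_⟩⟩
  · exact cone_subset_ambCone (fun p hp => (hU p).1 hp) hx
  · rintro ⟨⟨hx0, hxW⟩, hxx⟩
    refine ⟨⟨Projectivization.mk ℝ x hx0, fun z hz => ?_⟩, (hU _).2 hxW, hx0, rfl⟩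
    rw [Projectivization.submodule_mk, Submodule.mem_span_singleton] at hz
    obtain ⟨a, rfl⟩ := hz
    simp [hxx]

/-- The null representative, along `q`, of a line which is not orthogonal to the null vector
`q`. -/
def nullProj (h : Matrix (Fin n) (Fin n) ℝ) (q x : Amb n) : Amb n :=
  norml h q x - (ambForm h (norml h q x) (norml h q x) / 2) • q

theorem nullProj_smul (q x : Amb n) {c : ℝ} (hc : c ≠ 0) :
    nullProj h q (c • x) = nullProj h q x := by
  rw [nullProj, nullProj, norml_smul q x hc]

theorem form_norml {q x : Amb n} (hx : ambForm h q x ≠ 0) : ambForm h q (norml h q x) = 1 := by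
  rw [norml, map_smul, smul_eq_mul, inv_mul_cancel₀ hx]

theorem form_nullProj {q x : Amb n} (hqq : ambForm h q q = 0) (hx : ambForm h q x ≠ 0) :
    ambForm h q (nullProj h q x) = 1 := by
  rw [nullProj, map_sub, map_smul, form_norml hx, hqq]
  simp

theorem form_nullProj_self (hs : h.IsSymm) {q x : Amb n} (hqq : ambForm h q q = 0)
    (hx : ambForm h q x ≠ 0) : ambForm h (nullProj h q x) (nullProj h q x) = 0 := by
  have h1 : ambForm h (norml h q x) q = 1 := by rw [ambForm_comm hs, form_norml hx]
  simp only [nullProj, map_sub, map_smul, LinearMap.sub_apply, LinearMap.smul_apply, smul_eq_mul,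
    form_norml hx, h1, hqq]
  ring

theorem nullProj_of_null {q x : Amb n} (hxx : ambForm h x x = 0) :
    nullProj h q x = (ambForm h q x)⁻¹ • x := by
  simp [nullProj, norml, hxx]

/-- The projection along `q` to the vectors orthogonal to `y`. -/
def orthProj (h : Matrix (Fin n) (Fin n) ℝ) (q y : Amb n) : Amb n →L[ℝ] Amb n :=
  ContinuousLinearMap.id ℝ (Amb n) - (ambForm h y).toContinuousLinearMap.smulRight q

theorem orthProj_apply (q y v : Amb n) : orthProj h q y v = v - ambForm h y v • q := rfl

theorem orthProj_mem (hs : h.IsSymm) {q y : Amb n} (hqy : ambForm h q y = 1) (v : Amb n) :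
    orthProj h q y v ∈ tan h y := by
  rw [mem_tan, orthProj_apply, map_sub, map_smul, ambForm_comm hs y q, hqy]
  simp

theorem orthProj_of_mem {q y v : Amb n} (hv : ambForm h y v = 0) : orthProj h q y v = v := by
  rw [orthProj_apply, hv, zero_smul, sub_zero]

/-- A vector x and its null representative differ, after scaling, by a multiple of q, which the
projection kills. Hence the extended field satisfies X⌟F = 0 off the cone too. -/
theorem orthProj_nullProj (hs : h.IsSymm) {q x : Amb n} (hqq : ambForm h q q = 0)
    (hx : ambForm h q x ≠ 0) : orthProj h q (nullProj h q x) x = ambForm h q x • nullProj h q x := by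
  have h1 : x = ambForm h q x • norml h q x := by
    rw [norml, smul_smul, mul_inv_cancel₀ hx, one_smul]
  have h2 : norml h q x =
      nullProj h q x + (ambForm h (norml h q x) (norml h q x) / 2) • q := by
    rw [nullProj, sub_add_cancel]
  have h3 : ambForm h (nullProj h q x) q = 1 := by rw [ambForm_comm hs, form_nullProj hqq hx]
  have h4 : orthProj h q (nullProj h q x) (norml h q x) = nullProj h q x := by
    rw [orthProj_apply]
    conv_lhs => rw [h2]
    rw [map_add, map_smul, form_nullProj_self hs hqq hx, h3]
    simp
  calc _ = orthProj h q (nullProj h q x) (ambForm h q x • norml h q x) := by rw [← h1]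
    _ = _ := by rw [map_smul, h4]

theorem contDiffOn_nullProj {O : Set (Amb n)} {q : Amb n} (hq : ∀ x ∈ O, ambForm h q x ≠ 0) :
    ContDiffOn ℝ ∞ (nullProj h q) O := by
  have h1 : ContDiffOn ℝ ∞ (norml h q) O :=
    ContDiffOn.smul (f := fun x => (ambForm h q x)⁻¹) (g := id)
      ((contDiff_ambForm q).contDiffOn.inv hq) contDiffOn_id
  have h2 : ContDiffOn ℝ ∞ (fun x => ambForm h (norml h q x) (norml h q x) / 2) O :=
    (contDiff_quad.comp_contDiffOn h1).div_const 2
  exact h1.sub (h2.smul contDiffOn_const)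

variable {U : Opens (Quadric h)} {f : (x : cone (U : Set (Quadric h))) → Tens r s (tan h (x : Amb n))}

/-- The extension of a tensor field along the null cone, transversally constant along `q`. -/
def extend (h : Matrix (Fin n) (Fin n) ℝ) (w : ℂ) (q : Amb n) (F : Amb n → Tens r s (Amb n)) :
    Amb n → Tens r s (Amb n) := fun x =>
  scale w (r + s) (ambForm h q x) •
    (F (nullProj h q x)).compContinuousLinearMap (fun _ => orthProj h q (nullProj h q x))

theorem extend_apply (q : Amb n) (F : Amb n → Tens r s (Amb n)) (x : Amb n)
    (v : Fin r ⊕ Fin s → Amb n) : extend h w q F x v = scale w (r + s) (ambForm h q x) *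
      F (nullProj h q x) (fun i => orthProj h q (nullProj h q x) (v i)) := rfl

theorem contDiffOn_extend (hs : h.IsSymm) {O W : Set (Amb n)} {q : Amb n}
    (hq : ∀ x ∈ O, ambForm h q x ≠ 0)
    {F : Amb n → Tens r s (Amb n)} (hF : ContDiffOn ℝ ∞ F W)
    (hOW : ∀ x ∈ O, nullProj h q x ∈ W) : ContDiffOn ℝ ∞ (extend h w q F) O := by
  have hy := contDiffOn_nullProj hq
  refine contDiffOn_field fun v => ?_
  simp only [extend_apply]
  refine ContDiffOn.mul (fun x hx =>
    ((contDiffAt_scale w _ (hq x hx)).comp x (contDiff_ambForm q).contDiffAt).contDiffWithinAt) ?_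
  have h1 : ∀ x, F (nullProj h q x) (fun i => orthProj h q (nullProj h q x) (v i)) =
      ∑ I : Fin r ⊕ Fin s → Idx n, (∏ i, orthProj h q (nullProj h q x) (v i) (I i)) •
        F (nullProj h q x) (fun i => e (I i)) := fun x =>
    multilinear_expand (F (nullProj h q x)).toMultilinearMap _
  simp only [h1]
  refine ContDiffOn.sum fun I _ => ContDiffOn.fun_smul (contDiffOn_prod fun i _ => ?_) ?_
  · have h2 : ContDiffOn ℝ ∞ (fun x => orthProj h q (nullProj h q x) (v i)) O := by
      simp only [orthProj_apply, ambForm_comm hs _ (v i)]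
      exact contDiffOn_const.sub (((contDiff_ambForm (v i)).comp_contDiffOn hy).smul
        contDiffOn_const)
    exact (contDiff_apply ℝ ℝ (I i)).comp_contDiffOn h2
  · exact (contDiffOn_eval hF _).comp hy hOW

theorem scale_mul_map_smul {M : Type} [NormedAddCommGroup M] [NormedSpace ℝ M] (T : Tens r s M)
    {c : ℝ} (hc : c ≠ 0) (v : Fin r ⊕ Fin s → M) :
    scale w (r + s) c * T (fun i => c • v i) = ((|c| : ℝ) : ℂ) ^ w * T v := by
  rw [ContinuousMultilinearMap.map_smul_univ, Finset.prod_const, Complex.real_smul, scale_eq _ _ hc]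
  have h3 : (c : ℂ) ^ (-((r : ℤ) + s)) * (c : ℂ) ^ ((r : ℤ) + s) = 1 := by
    rw [zpow_neg, inv_mul_cancel₀ (zpow_ne_zero _ (by exact_mod_cast hc))]
  have h4 : (c : ℂ) ^ ((r : ℤ) + s) = (c : ℂ) ^ (r + s) := by
    rw [← zpow_natCast]; push_cast; rfl
  rw [h4] at h3
  simp only [Finset.card_univ, Fintype.card_sum, Fintype.card_fin, Complex.ofReal_pow]
  linear_combination (((|c| : ℝ) : ℂ) ^ w * T v) * h3

theorem extend_homogeneous {q : Amb n} {F : Amb n → Tens r s (Amb n)} {c : ℝ} (hc : c ≠ 0)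
    {x : Amb n} (hx : ambForm h q x ≠ 0) (v : Fin r ⊕ Fin s → Amb n) :
    extend h w q F (c • x) (fun i => c • v i) = ((|c| : ℝ) : ℂ) ^ w * extend h w q F x v := by
  rw [← scale_mul_map_smul _ hc, extend_apply, extend_apply, nullProj_smul q x hc, map_smul,
    smul_eq_mul, scale_mul _ _ hc hx, mul_assoc]

theorem IsQuadSection.horizontal_smul (hf : IsQuadSection r s w (U : Set (Quadric h)) f)
    (x : cone (U : Set (Quadric h))) (v : Fin r ⊕ Fin s → tan h (x : Amb n)) (a : Fin r ⊕ Fin s)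
    (c : ℝ) (ha : (v a : Amb n) = c • (x : Amb n)) : f x v = 0 := by
  have hx : (x : Amb n) ∈ tan h (x : Amb n) := form_self_of_mem_cone x.2
  have h1 : v = Function.update v a (c • ⟨x, hx⟩) := by
    rw [Function.eq_update_iff]
    exact ⟨Subtype.ext ha, fun _ _ => rfl⟩
  rw [h1, ContinuousMultilinearMap.map_update_smul,
    hf.horizontal x _ a (by rw [Function.update_self]), smul_zero]

theorem IsQuadSection.eq_of_eq_smul (hf : IsQuadSection r s w (U : Set (Quadric h)) f)
    {x y : Amb n} (hx : x ∈ cone (U : Set (Quadric h))) (hy : y ∈ cone (U : Set (Quadric h)))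
    {c : ℝ} (hc : c ≠ 0) (hxy : x = c • y) (v : Fin r ⊕ Fin s → tan h x)
    (v' : Fin r ⊕ Fin s → tan h y) (hv : ∀ i, (v i : Amb n) = v' i) :
    f ⟨x, hx⟩ v = scale w (r + s) c * f ⟨y, hy⟩ v' := by
  subst hxy
  have h1 := hf.homogeneous c hc ⟨y, hy⟩ v'
  have h2 : (fun i => (⟨c • (v' i : Amb n), smul_mem_tan (v' i).2 c⟩ : tan h (c • y))) =
      fun i => c • v i := funext fun i => Subtype.ext (by simp [hv])
  rw [h2] at h1
  have hc' : ((|c| : ℝ) : ℂ) ^ w ≠ 0 := by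
    rw [Complex.cpow_ne_zero_iff]
    exact Or.inl (by simpa using hc)
  refine mul_left_cancel₀ hc' ?_
  rw [← scale_mul_map_smul _ hc, h1]
  ring

/-- At x the extension is the value of f at a null vector y determined by the line of x, pulled back
along the projection parallel to q. Young symmetry and homogeneity are inherited. In a frame y, q, b
with b orthogonal to both, the ambient trace reduces to the trace over b because f annihilates y, so
trace-freeness on the quadric suffices. -/
theorem IsQuadSection.ambField_extend (hf : IsQuadSection r s w (U : Set (Quadric h)) f)
    (hs : h.IsSymm) (hdet : IsUnit h.det) {q : Amb n} (hqq : ambForm h q q = 0)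
    {O : Opens (Amb n)} {W : Set (Amb n)} (hq : ∀ x ∈ O, ambForm h q x ≠ 0)
    {F : Amb n → Tens r s (Amb n)} (hF : ContDiffOn ℝ ∞ F W)
    (hOW : ∀ x ∈ O, nullProj h q x ∈ W)
    (hOU : ∀ x ∈ O, nullProj h q x ∈ cone (U : Set (Quadric h)))
    (hfF : ∀ y : cone (U : Set (Quadric h)), (y : Amb n) ∈ W →
      f y = (F y).compContinuousLinearMap (fun _ => (tan h (y : Amb n)).subtypeL)) :
    AmbField h w O (extend h w q F) ∧
    (∀ x ∈ O, ∀ a v, extend h w q F x (Function.update v a x) = 0) ∧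
    ∀ x ∈ O, ∀ (hx : x ∈ cone (U : Set (Quadric h))) (v : Fin r ⊕ Fin s → tan h x),
      extend h w q F x (fun i => (v i : Amb n)) = f ⟨x, hx⟩ v := by
  have hqy : ∀ x ∈ O, ambForm h q (nullProj h q x) = 1 := fun x hx => form_nullProj hqq (hq x hx)
  have key : ∀ x (hx : x ∈ O) (v : Fin r ⊕ Fin s → Amb n), extend h w q F x v =
      scale w (r + s) (ambForm h q x) * f ⟨nullProj h q x, hOU x hx⟩
        (fun i => ⟨orthProj h q (nullProj h q x) (v i), orthProj_mem hs (hqy x hx) _⟩) := by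
    intro x hx v
    rw [extend_apply, hfF ⟨nullProj h q x, hOU x hx⟩ (hOW x hx)]
    rfl
  refine ⟨⟨contDiffOn_extend hs hq hF hOW, fun x hx => ?_,
    fun c hc x hx v => extend_homogeneous hc (hq x hx) v, fun x hx a a' haa v => ?_⟩, ?_, ?_⟩
  · have h1 := ((hf.young ⟨nullProj h q x, hOU x hx⟩).comp
      ((orthProj h q (nullProj h q x)).codRestrict _ fun v =>
        orthProj_mem hs (hqy x hx) v)).smul (scale w (r + s) (ambForm h q x))
    convert h1 using 1
    exact ContinuousMultilinearMap.ext fun v => key x hx v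
  · set y := nullProj h q x with hy
    have hyy : ambForm h y y = 0 := form_nullProj_self hs hqq (hq x hx)
    have hy1 := hqy x hx
    rw [← hy] at hy1
    obtain ⟨b, hyb, hqb, hb⟩ := exists_orth_basis hs hdet hyy hqq hy1
    have h0 : ∀ (v : Fin r ⊕ Fin s → Amb n) a, v a = y → extend h w q F x v = 0 := by
      intro v a hva
      rw [key x hx, hf.horizontal ⟨nullProj h q x, hOU x hx⟩ _ a
        ((congrArg (orthProj h q y) hva).trans (orthProj_of_mem hyy)), mul_zero]
    have h1 := ambContract_eq_orth hs (slots (extend h w q F x) a a' haa v) hyy hqq hy1 hyb hqb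
      (fun i j => rfl) hb (fun u => h0 _ a (by simp [Function.update_of_ne haa]))
      (fun u => h0 _ a' (by simp))
    simp only [slots_apply] at h1
    rw [h1]
    have h2 := hf.traceFree ⟨y, hOU x hx⟩ (fun i => ⟨b i, hyb i⟩) _ (fun i j => rfl) hb a a' haa
      (fun i => ⟨orthProj h q y (v i), orthProj_mem hs hy1 _⟩)
    have h3 := congrArg (fun t => scale w (r + s) (ambForm h q x) * t) h2
    simp only [mul_zero, Finset.mul_sum, mul_smul_comm] at h3
    rw [← h3]
    refine Finset.sum_congr rfl fun i _ => Finset.sum_congr rfl fun j _ => ?_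
    rw [key x hx]
    congr 3
    funext k
    refine Subtype.ext ?_
    change orthProj h q y _ = _
    by_cases hk' : k = a'
    · subst hk'
      simp [orthProj_of_mem (hyb j)]
    · by_cases hk : k = a
      · subst hk
        simp [Function.update_of_ne haa, orthProj_of_mem (hyb i)]
      · simp [hk, hk']
  · intro x hx a v
    rw [key x hx, hf.horizontal_smul _ _ a (ambForm h q x), mul_zero]
    simp [orthProj_nullProj hs hqq (hq x hx)]
  · intro x hx hxU v
    have hxx := form_self_of_mem_cone hxU
    have hxy : x = ambForm h q x • nullProj h q x := by
      rw [nullProj_of_null hxx, smul_smul, mul_inv_cancel₀ (hq x hx), one_smul]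
    rw [key x hx, hf.eq_of_eq_smul hxU (hOU x hx) (hq x hx) hxy v]
    intro i
    change _ = orthProj h q _ _
    rw [orthProj_of_mem]
    rw [nullProj_of_null hxx, map_smul, LinearMap.smul_apply, (v i).2, smul_zero]

/-- Every section over the quadric extends locally to a homogeneous ambient tensor field. -/
theorem IsQuadSection.exists_ambField (hf : IsQuadSection r s w (U : Set (Quadric h)) f)
    (hs : h.IsSymm) (hdet : IsUnit h.det) {q p : Amb n} (hqq : ambForm h q q = 0)
    (hp : p ∈ cone (U : Set (Quadric h))) (hqp : ambForm h q p ≠ 0) :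
    ∃ O : Opens (Amb n), IsConic O ∧ p ∈ O ∧ (∀ x ∈ O, ambForm h q x ≠ 0) ∧
      (∀ x ∈ O, ambForm h x x = 0 → x ∈ cone (U : Set (Quadric h))) ∧
      ∃ F : Amb n → Tens r s (Amb n), AmbField h w O F ∧
        (∀ x ∈ O, ∀ a v, F x (Function.update v a x) = 0) ∧
        ∀ x ∈ O, ∀ (hx : x ∈ cone (U : Set (Quadric h))) (v : Fin r ⊕ Fin s → tan h x),
          F x (fun i => (v i : Amb n)) = f ⟨x, hx⟩ v := by
  obtain ⟨W', hW', -, hUW'⟩ := Opens.exists_ambCone U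
  have hp' : nullProj h q p ∈ cone (U : Set (Quadric h)) := by
    rw [nullProj_of_null (form_self_of_mem_cone hp)]
    exact smul_mem_cone hp (inv_ne_zero hqp)
  obtain ⟨W, F, hW, hpW, hF, hfF⟩ := hf.smooth ⟨_, hp'⟩
  have hℓ : IsOpen {x | ambForm h q x ≠ 0} := (contDiff_ambForm q).continuous.isOpen_preimage _
    isOpen_ne
  have hO := (contDiffOn_nullProj (h := h) (q := q) (O := {x | ambForm h q x ≠ 0})
    fun x hx => hx).continuousOn.isOpen_inter_preimage hℓ (hW.inter (isOpen_ambCone hW'))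
  let O : Opens (Amb n) := ⟨_, hO⟩
  have hq : ∀ x ∈ O, ambForm h q x ≠ 0 := fun x hx => hx.1
  have hOU : ∀ x ∈ O, nullProj h q x ∈ cone (U : Set (Quadric h)) := fun x hx =>
    (hUW' _).2 ⟨hx.2.2, form_nullProj_self hs hqq hx.1⟩
  have hOc : IsConic O := fun x hx c hc => by
    refine ⟨?_, ?_⟩
    · have := mul_ne_zero hc hx.1
      rwa [← smul_eq_mul, ← map_smul] at this
    · change nullProj h q (c • x) ∈ W ∩ ambCone W'
      rw [nullProj_smul q x hc]
      exact hx.2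
  have hpO : p ∈ O := ⟨hqp, hpW, ((hUW' _).1 hp').1⟩
  refine ⟨O, hOc, hpO, hq, fun x hx hxx => ?_,
    extend h w q F, hf.ambField_extend hs hdet hqq hq hF (fun x hx => hx.2.1) hOU hfF⟩
  have h1 := hOU x hx
  rw [nullProj_of_null hxx] at h1
  have h2 := smul_mem_cone h1 (hq x hx)
  rwa [smul_smul, mul_inv_cancel₀ (hq x hx), one_smul] at h2

end Extension

end

end AmbientLift

namespace AmbientLift

noncomputable section

/-! ### Jets of ambient tensors and their restriction to the null cone -/

section Restriction

variable {n r s : ℕ} {h : Matrix (Fin n) (Fin n) ℝ} {w : ℂ} {O O' : Opens (Amb n)}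
  {F F' : Amb n → Tens r s (Amb n)} {U : Opens (Quadric h)}

theorem IsConic.inf (hO : IsConic O) (hO' : IsConic O') : IsConic (O ⊓ O') :=
  fun x hx c hc => ⟨hO x hx.1 c hc, hO' x hx.2 c hc⟩

theorem isConic_ambCone {W : Set (ℙ ℝ (Amb n))} (hW : IsOpen W) :
    IsConic ⟨ambCone W, isOpen_ambCone hW⟩ := by
  rintro x ⟨hx, hxW⟩ c hc
  refine ⟨smul_ne_zero hc hx, ?_⟩
  have : Projectivization.mk ℝ (c • x) (smul_ne_zero hc hx) = Projectivization.mk ℝ x hx :=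
    (Projectivization.mk_eq_mk_iff' ℝ _ _ _ _).2 ⟨c, rfl⟩
  rwa [this]

theorem IsConic.exists_ambCone (hO : IsConic O) (h0 : (0 : Amb n) ∉ O) :
    ∃ W : Set (ℙ ℝ (Amb n)), IsOpen W ∧ ambCone W = O := by
  have key : ∀ x (hx : x ≠ 0), (Projectivization.mk ℝ x hx ∈
      {p : ℙ ℝ (Amb n) | ∃ y ∈ O, ∃ hy : y ≠ 0, Projectivization.mk ℝ y hy = p}) ↔ x ∈ O := by
    refine fun x hx => ⟨?_, fun hxO => ⟨x, hxO, hx, rfl⟩⟩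
    rintro ⟨y, hyO, hy, hxy⟩
    obtain ⟨c, rfl⟩ := (Projectivization.mk_eq_mk_iff' ℝ _ _ _ _).1 hxy
    have hc : c ≠ 0 := by
      rintro rfl
      simp at hy
    have := hO _ hyO _ (inv_ne_zero hc)
    rwa [smul_smul, inv_mul_cancel₀ hc, one_smul] at this
  refine ⟨{p | ∃ y ∈ O, ∃ hy : y ≠ 0, Projectivization.mk ℝ y hy = p}, ?_, ?_⟩
  · refine isOpen_coinduced.2 ?_
    have : IsOpen {v : {v : Amb n // v ≠ 0} | (v : Amb n) ∈ O} :=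
      O.isOpen.preimage continuous_subtype_val
    convert this using 1
    ext v
    exact key v.1 v.2
  · ext x
    refine ⟨fun ⟨hx, hxW⟩ => (key x hx).1 hxW, fun hx => ?_⟩
    have hx0 : x ≠ 0 := fun hx0 => h0 (hx0 ▸ hx)
    exact ⟨hx0, (key x hx0).2 hx⟩

theorem SolvesOn.restrict (hF : SolvesOn h O F) (hO : O' ≤ O) : SolvesOn h O' F where
  laplacian x hx := hF.laplacian x (hO hx)
  divergence x hx := hF.divergence x (hO hx)
  euler x hx := hF.euler x (hO hx)

/-- Replaces open sets of lines by conic open sets of vectors, shrunk so that their null vectors are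
exactly the cone over `U`. All equations then refer to null vectors of one open set. -/
theorem isAmbJet_iff {J : cone (U : Set (Quadric h)) → Jet r s n} :
    IsAmbJet r s w (U : Set (Quadric h)) J ↔ ∃ O : Opens (Amb n), IsConic O ∧ (0 : Amb n) ∉ O ∧
      (∀ x, x ∈ cone (U : Set (Quadric h)) ↔ x ∈ O ∧ ambForm h x x = 0) ∧
      ∃ F : Amb n → Tens r s (Amb n), AmbField h w O F ∧ SolvesOn h O F ∧
        ∀ x : cone (U : Set (Quadric h)), J x = jetAt F x := by
  obtain ⟨W', hW', hUW', hU⟩ := Opens.exists_ambCone U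
  constructor
  · rintro ⟨W, F, hW, hUW, hF, hS, hJ⟩
    have hU' : ∀ x ∈ ambCone (W ∩ W'), ambForm h x x = 0 → x ∈ cone (U : Set (Quadric h)) :=
      fun x hx hxx => (hU x).2 ⟨ambCone_mono Set.inter_subset_right hx, hxx⟩
    have hF' := hF.mono (W' := W ∩ W') Set.inter_subset_left
    refine ⟨⟨_, isOpen_ambCone (hW.inter hW')⟩, isConic_ambCone (hW.inter hW'),
      fun ⟨h0, _⟩ => h0 rfl, fun x => ⟨fun hx => ⟨?_, form_self_of_mem_cone hx⟩, fun hx =>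
        hU' x hx.1 hx.2⟩, F, ⟨hF'.smooth, hF'.young, hF'.homogeneous, hF'.traceFree⟩,
      ⟨fun x hx hxx => hS.laplacian x (hU' x hx hxx), fun x hx hxx => hS.divergence x (hU' x hx hxx),
        fun x hx hxx => hS.euler x (hU' x hx hxx)⟩, hJ⟩
    obtain ⟨hx0, h1⟩ := cone_subset_ambCone hUW hx
    obtain ⟨_, h2⟩ := cone_subset_ambCone hUW' hx
    exact ⟨hx0, h1, h2⟩
  · rintro ⟨O, hO, h0, hUO, F, hF, hS, hJ⟩
    obtain ⟨W, hW, hWO⟩ := hO.exists_ambCone h0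
    refine ⟨W, F, hW, fun p hp => ?_, ?_, ?_, hJ⟩
    · obtain ⟨p, hpp⟩ := p
      induction p using Projectivization.ind with
      | h x hx =>
        have h1 : x ∈ cone (U : Set (Quadric h)) := ⟨_, hp, hx, rfl⟩
        have h2 : x ∈ ambCone W := by
          rw [hWO]
          exact ((hUO x).1 h1).1
        exact h2.2
    · exact ⟨by rw [hWO]; exact hF.smooth, by rw [hWO]; exact hF.young,
        by rw [hWO]; exact hF.homogeneous, by rw [hWO]; exact hF.traceFree⟩
    · exact ⟨fun x hx => hS.laplacian x ((hUO x).1 hx).1 ((hUO x).1 hx).2,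
        fun x hx => hS.divergence x ((hUO x).1 hx).1 ((hUO x).1 hx).2,
        fun x hx => hS.euler x ((hUO x).1 hx).1 ((hUO x).1 hx).2⟩

theorem jetAt_restrict_apply (F : Amb n → Tens r s (Amb n)) (x : Amb n)
    (v : Fin r ⊕ Fin s → tan h x) :
    (jetAt F x).restrict (h := h) x v = F x (fun i => (v i : Amb n)) := rfl

theorem SolvesOn.euler_eq_zero (hS : SolvesOn h O F) {x : Amb n} (hx : x ∈ O)
    (hxx : ambForm h x x = 0) {v : Fin r ⊕ Fin s → Amb n} {a : Fin r ⊕ Fin s} (ha : v a = x) :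
    F x v = 0 := by
  have h1 := (hS.euler x hx hxx a v).eq_zero
  have h2 : Function.update v a x = v := by rw [← ha, Function.update_eq_self]
  rw [← h2]
  exact h1

/-- The vectors b need not be orthogonal to the chosen null vector q. Subtracting multiples of x
makes them so and changes neither their Gram matrix nor the values of `F`, since X⌟F = 0 on the
cone. -/
theorem AmbField.traceFree_cone (hF : AmbField h w O F) (hs : h.IsSymm) (hdet : IsUnit h.det)
    (hS : SolvesOn h O F) {x : Amb n} (hx : x ∈ O) (hx0 : x ≠ 0) (hxx : ambForm h x x = 0)
    {b : Fin n → Amb n} (hb : ∀ i, ambForm h x (b i) = 0) {g : Matrix (Fin n) (Fin n) ℝ}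
    (hg : ∀ i j, g i j = ambForm h (b i) (b j)) (hgd : IsUnit g.det) {a a' : Fin r ⊕ Fin s}
    (haa : a ≠ a') (v : Fin r ⊕ Fin s → Amb n) :
    ∑ i, ∑ j, g⁻¹ i j • F x (Function.update (Function.update v a (b i)) a' (b j)) = 0 := by
  obtain ⟨q, hqq, hqx⟩ := exists_null_dual hs hdet hx0 hxx
  set β := slots (F x) a a' haa v with hβ
  have hβx : ∀ u, β x u = 0 := fun u =>
    hS.euler_eq_zero hx hxx (a := a) (by simp [Function.update_of_ne haa])
  have hβx' : ∀ u, β u x = 0 := fun u => hS.euler_eq_zero hx hxx (a := a') (by simp)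
  have h1 := ambContract_eq_orth hs β (b := fun i => b i - ambForm h q (b i) • x) hxx hqq hqx
    (by simp [hb, hxx]) (by simp [hqx]) (g := g)
    (fun i j => by simp [hg, hb, hxx, ambForm_comm hs _ x]) hgd hβx hβx'
  simp only [map_sub, map_smul, LinearMap.sub_apply, LinearMap.smul_apply, hβx, hβx', smul_zero,
    sub_zero] at h1
  exact h1.symm.trans (hF.traceFree x hx a a' haa v)

theorem IsAmbJet.isQuadSection (hs : h.IsSymm) (hdet : IsUnit h.det)
    {J : cone (U : Set (Quadric h)) → Jet r s n} (hJ : IsAmbJet r s w (U : Set (Quadric h)) J) :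
    IsQuadSection r s w (U : Set (Quadric h)) (fun x => (J x).restrict (h := h) (x : Amb n)) := by
  obtain ⟨O, hO, h0, hUO, F, hF, hS, hJ⟩ := isAmbJet_iff.1 hJ
  have hO' : ∀ x : cone (U : Set (Quadric h)), (x : Amb n) ∈ O := fun x => ((hUO x).1 x.2).1
  have hQ : ∀ x : cone (U : Set (Quadric h)), ambForm h (x : Amb n) x = 0 :=
    fun x => ((hUO x).1 x.2).2
  simp only [hJ]
  refine ⟨fun x => ⟨O, F, O.isOpen, hO' x, hF.smooth, fun y _ => rfl⟩, fun x =>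
    (hF.young x (hO' x)).comp _, fun c hc x v => hF.homogeneous c hc x (hO' x) _,
    fun x v a ha => ?_, fun x b g hg hgd a a' haa v => ?_⟩
  · rw [jetAt_restrict_apply]
    exact hS.euler_eq_zero (hO' x) (hQ x) ha
  · rw [← hF.traceFree_cone hs hdet hS (hO' x) (fun h2 => h0 (h2 ▸ hO' x)) (hQ x)
      (b := fun i => b i) (fun i => (b i).2) hg hgd haa (fun i => v i)]
    refine Finset.sum_congr rfl fun i _ => Finset.sum_congr rfl fun j _ => ?_
    rw [jetAt_restrict_apply]
    congr 2
    funext k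
    by_cases hk' : k = a'
    · subst hk'
      simp
    · by_cases hk : k = a
      · subst hk
        simp [Function.update_of_ne haa]
      · simp [hk, hk']

/-- The part of an open set on which a linear form does not vanish. -/
def awayFrom (h : Matrix (Fin n) (Fin n) ℝ) (q : Amb n) : Opens (Amb n) :=
  ⟨{x | ambForm h q x ≠ 0}, (contDiff_ambForm q).continuous.isOpen_preimage _ isOpen_ne⟩

theorem isConic_awayFrom (q : Amb n) : IsConic (awayFrom h q) := fun x hx c hc => by
  have := mul_ne_zero hc hx
  rwa [← smul_eq_mul, ← map_smul] at this

theorem AmbField.vanishes_cone (hF : AmbField h w O F) (hs : h.IsSymm) (hdet : IsUnit h.det)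
    (hA : Admissible n r s w) (hO : IsConic O) (hS : SolvesOn h O F)
    (h0 : ∀ x ∈ O, ambForm h x x = 0 → ∀ v, (∀ i, ambForm h x (v i) = 0) → F x v = 0)
    {x : Amb n} (hx : x ∈ O) (hx0 : x ≠ 0) (hxx : ambForm h x x = 0) :
    VanishesToInfiniteOrder F x := by
  obtain ⟨q, hqq, hqx⟩ := exists_null_dual hs hdet hx0 hxx
  obtain ⟨f⟩ := nonempty_frame hs hdet
  have hO' : O ⊓ awayFrom h q ≤ O := inf_le_left
  exact (hF.restrict hO').vanishes hs f hA (hO.inf (isConic_awayFrom q)) hqq (fun y hy => hy.2)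
    (hS.restrict hO') (fun y hy => h0 y hy.1) (x := x)
    ⟨hx, by change ambForm h q x ≠ 0; rw [hqx]; exact one_ne_zero⟩ hxx

theorem IsAmbJet.eq_zero (hs : h.IsSymm) (hdet : IsUnit h.det) (hA : Admissible n r s w)
    {J : cone (U : Set (Quadric h)) → Jet r s n} (hJ : IsAmbJet r s w (U : Set (Quadric h)) J)
    (h0 : ∀ x, (J x).restrict (h := h) (x : Amb n) = 0) : J = 0 := by
  obtain ⟨O, hO, hO0, hUO, F, hF, hS, hJ⟩ := isAmbJet_iff.1 hJ
  funext x
  refine Jet.ext fun k => ?_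
  rw [hJ]
  have hx := (hUO x).1 x.2
  refine hF.vanishes_cone hs hdet hA hO hS (fun y hy hyy v hv => ?_) hx.1
    (fun h2 => hO0 (h2 ▸ hx.1)) hx.2 k
  have h1 := h0 ⟨y, (hUO y).2 ⟨hy, hyy⟩⟩
  rw [hJ] at h1
  exact congrArg (fun T => T (fun i => (⟨v i, hv i⟩ : tan h y))) h1

end Restriction

end

end AmbientLift

namespace AmbientLift

noncomputable section

/-! ### Gluing of ambient tensor fields -/

section Gluing

/-- A smooth partition of unity on the union regarded as a manifold. The finite set A is valid on a
neighbourhood of x, so sums may be differentiated term by term there. -/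
theorem exists_partition {n : ℕ} {ι : Type} (O : ι → Opens (Amb n)) :
    ∃ χ : ι → Amb n → ℂ, (∀ i, ContDiffOn ℝ ∞ (χ i) (⨆ i, O i : Opens (Amb n))) ∧
      ∀ x ∈ (⨆ i, O i : Opens (Amb n)), ∃ A : Finset ι, (∀ i ∈ A, x ∈ O i) ∧
        ∀ᶠ y in nhds x, (∀ i, i ∉ A → χ i y = 0) ∧ ∑ i ∈ A, χ i y = 1 := by
  classical
  set M : Opens (Amb n) := ⨆ i, O i
  have : LocallyCompactSpace M := M.isOpen.locallyCompactSpace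
  obtain ⟨f, hf⟩ := SmoothPartitionOfUnity.exists_isSubordinate (M := M)
    (modelWithCornersSelf ℝ (Amb n)) isClosed_univ (fun i => {x : M | (x : Amb n) ∈ O i})
    (fun i => (O i).isOpen.preimage continuous_subtype_val) (fun x _ => by
      obtain ⟨i, hi⟩ := Opens.mem_iSup.1 x.2
      exact Set.mem_iUnion.2 ⟨i, hi⟩)
  let χ : ι → Amb n → ℝ := fun i x => if hx : x ∈ M then f i ⟨x, hx⟩ else 0
  have hχ : ∀ i (x : M), χ i x = f i x := fun i x => dif_pos x.2
  refine ⟨fun i x => (χ i x : ℂ), fun i x hx => ?_, fun x hx => ?_⟩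
  · have h1 : ContMDiffAt (modelWithCornersSelf ℝ (Amb n)) (modelWithCornersSelf ℝ ℝ) ∞ (χ i) x := by
      refine (contMDiffAt_subtype_iff (U := M) (x := ⟨x, hx⟩)).1 ?_
      exact ((f i).contMDiff ⟨x, hx⟩).congr_of_eventuallyEq (Filter.Eventually.of_forall (hχ i))
    exact (Complex.ofRealCLM.contDiff.contDiffAt.comp x h1.contDiffAt).contDiffWithinAt
  · refine ⟨f.fintsupport ⟨x, hx⟩, fun i hi => hf i ((f.mem_fintsupport_iff _ i).1 hi), ?_⟩
    have h1 := f.eventually_finsupport_subset ⟨x, hx⟩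
    rw [nhds_subtype_eq_comap, Filter.eventually_comap] at h1
    filter_upwards [h1, M.isOpen.mem_nhds hx] with y hy hyM
    have h2 := hy ⟨y, hyM⟩ rfl
    refine ⟨fun i hi => ?_, ?_⟩
    · have h3 : f i ⟨y, hyM⟩ = 0 := by
        by_contra hc
        exact hi (h2 ((f.mem_finsupport _).2 hc))
      rw [hχ i ⟨y, hyM⟩, h3, Complex.ofReal_zero]
    · have h3 := f.sum_finsupport' ⟨y, hyM⟩ (Set.mem_univ _) h2
      rw [← Complex.ofReal_sum, ← Complex.ofReal_one, ← h3]
      exact congrArg _ (Finset.sum_congr rfl fun i _ => hχ i ⟨y, hyM⟩)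

/-! ### Infinite-order vanishing under composition, products and finite sums. -/

section Vanishing

variable {n : ℕ} {Y : Type} [NormedAddCommGroup Y] [NormedSpace ℝ Y] {x : Amb n}

theorem VanishesToInfiniteOrder.comp {g : Amb n → Y} {φ : Amb n → Amb n}
    (hg : VanishesToInfiniteOrder g (φ x)) (hg' : ContDiffAt ℝ ∞ g (φ x))
    (hφ : ContDiffAt ℝ ∞ φ x) : VanishesToInfiniteOrder (g ∘ φ) x := fun k => by
  rw [iteratedFDeriv_comp hg' hφ (by exact_mod_cast le_top)]
  refine Finset.sum_eq_zero fun c _ => ?_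
  ext v
  change iteratedFDeriv ℝ c.length g (φ x) _ = 0
  rw [hg]
  rfl

theorem VanishesToInfiniteOrder.smul [NormedSpace ℂ Y] [IsScalarTower ℝ ℂ Y] {O : Opens (Amb n)}
    {a : Amb n → ℂ} {g : Amb n → Y} (hg : VanishesToInfiniteOrder g x)
    (ha : ContDiffOn ℝ ∞ a O) (hg' : ContDiffOn ℝ ∞ g O) (hx : x ∈ O) :
    VanishesToInfiniteOrder (fun y => a y • g y) x := fun k => by
  have h1 := norm_iteratedFDerivWithin_smul_le ha hg' O.isOpen.uniqueDiffOn hx (n := k)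
    (by exact_mod_cast le_top)
  rw [← norm_le_zero_iff, ← iteratedFDerivWithin_of_isOpen (𝕜 := ℝ) k O.isOpen hx]
  refine h1.trans (le_of_eq (Finset.sum_eq_zero fun i _ => ?_))
  rw [iteratedFDerivWithin_of_isOpen (𝕜 := ℝ) (f := g) _ O.isOpen hx, hg, norm_zero, mul_zero]

theorem VanishesToInfiniteOrder.sum {ι : Type} (A : Finset ι) {g : ι → Amb n → Y}
    (hg : ∀ i ∈ A, VanishesToInfiniteOrder (g i) x) (hg' : ∀ i ∈ A, ContDiffAt ℝ ∞ (g i) x) :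
    VanishesToInfiniteOrder (∑ i ∈ A, g i) x := by
  classical
  have key : VanishesToInfiniteOrder (∑ i ∈ A, g i) x ∧ ContDiffAt ℝ ∞ (∑ i ∈ A, g i) x := by
    induction A using Finset.induction_on with
    | empty => exact ⟨VanishesToInfiniteOrder.zero x, contDiffAt_const⟩
    | insert i A hi ih =>
      rw [Finset.sum_insert hi]
      have h1 := ih (fun j hj => hg j (Finset.mem_insert_of_mem hj))
        (fun j hj => hg' j (Finset.mem_insert_of_mem hj))
      have h2 := hg' i (Finset.mem_insert_self i A)
      exact ⟨(hg i (Finset.mem_insert_self i A)).add h1.1 h2 h1.2, h2.add h1.2⟩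
  exact key.1

end Vanishing

/-! ### Averaging a function over opposite points to make it homogeneous. -/

section Homogenize

variable {n : ℕ} {Y : Type} [NormedAddCommGroup Y] [NormedSpace ℝ Y] [NormedSpace ℂ Y]
  [IsScalarTower ℝ ℂ Y] {w : ℂ} {k : ℤ} {O : Opens (Amb n)} {x : Amb n}

/-- The Euclidean norm. -/
def eucl (x : Amb n) : ℝ := √(∑ I, x I ^ 2)

theorem sum_sq_pos (hx : x ≠ 0) : 0 < ∑ I, x I ^ 2 := by
  obtain ⟨I, hI⟩ := Function.ne_iff.1 hx
  exact Finset.sum_pos' (fun _ _ => sq_nonneg _)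
    ⟨I, Finset.mem_univ _, lt_of_le_of_ne (sq_nonneg _) (Ne.symm (pow_ne_zero 2 hI))⟩

theorem eucl_pos (hx : x ≠ 0) : 0 < eucl x := Real.sqrt_pos.2 (sum_sq_pos hx)

theorem eucl_smul (c : ℝ) (x : Amb n) : eucl (c • x) = |c| * eucl x := by
  simp only [eucl, Pi.smul_apply, smul_eq_mul, mul_pow, ← Finset.mul_sum]
  rw [Real.sqrt_mul (sq_nonneg c), Real.sqrt_sq_eq_abs]

theorem contDiffAt_eucl (hx : x ≠ 0) : ContDiffAt ℝ ∞ (eucl (n := n)) x := by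
  refine ContDiffAt.sqrt ?_ (sum_sq_pos hx).ne'
  exact ContDiffAt.sum fun I _ => (contDiff_apply ℝ ℝ I).contDiffAt.pow 2

/-- A function rescaled by a factor depending on the point. -/
def rescale (w : ℂ) (k : ℤ) (c : Amb n → ℝ) (G : Amb n → Y) (x : Amb n) : Y :=
  scale w k (c x) • G ((c x)⁻¹ • x)

theorem contDiffOn_rescale_arg {c : Amb n → ℝ} (hc : ContDiffOn ℝ ∞ c O)
    (hc0 : ∀ x ∈ O, c x ≠ 0) : ContDiffOn ℝ ∞ (fun x : Amb n => (c x)⁻¹ • x) O :=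
  (hc.inv hc0).smul contDiffOn_id

theorem contDiffOn_rescale_comp (hO : IsConic O) {c : Amb n → ℝ} (hc : ContDiffOn ℝ ∞ c O)
    (hc0 : ∀ x ∈ O, c x ≠ 0) {G : Amb n → Y} (hG : ContDiffOn ℝ ∞ G O) :
    ContDiffOn ℝ ∞ (G ∘ fun x : Amb n => (c x)⁻¹ • x) O :=
  hG.comp (contDiffOn_rescale_arg hc hc0) fun x hx => hO x hx _ (inv_ne_zero (hc0 x hx))

theorem contDiffOn_scale_comp (w : ℂ) (k : ℤ) {c : Amb n → ℝ} (hc : ContDiffOn ℝ ∞ c O)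
    (hc0 : ∀ x ∈ O, c x ≠ 0) : ContDiffOn ℝ ∞ (fun x => scale w k (c x)) O := fun x hx =>
  (contDiffAt_scale w k (hc0 x hx)).comp_contDiffWithinAt x (hc x hx)

theorem contDiffOn_rescale (hO : IsConic O) {c : Amb n → ℝ} (hc : ContDiffOn ℝ ∞ c O)
    (hc0 : ∀ x ∈ O, c x ≠ 0) {G : Amb n → Y} (hG : ContDiffOn ℝ ∞ G O) :
    ContDiffOn ℝ ∞ (rescale w k c G) O :=
  (contDiffOn_scale_comp w k hc hc0).smul (contDiffOn_rescale_comp hO hc hc0 hG)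

theorem vanishes_rescale (hO : IsConic O) {c : Amb n → ℝ} (hc : ContDiffOn ℝ ∞ c O)
    (hc0 : ∀ x ∈ O, c x ≠ 0) {G : Amb n → Y} (hG : ContDiffOn ℝ ∞ G O) (hx : x ∈ O)
    (hv : VanishesToInfiniteOrder G ((c x)⁻¹ • x)) :
    VanishesToInfiniteOrder (rescale w k c G) x := by
  have hx' := hO x hx _ (inv_ne_zero (hc0 x hx))
  have h1 : VanishesToInfiniteOrder (G ∘ fun x : Amb n => (c x)⁻¹ • x) x :=
    VanishesToInfiniteOrder.comp hv (hG.contDiffAt (O.isOpen.mem_nhds hx'))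
      ((contDiffOn_rescale_arg hc hc0).contDiffAt (O.isOpen.mem_nhds hx))
  exact h1.smul (contDiffOn_scale_comp w k hc hc0) (contDiffOn_rescale_comp hO hc hc0 hG) hx

/-- The homogeneous function which agrees with the average of `G` over opposite points of the
unit sphere. -/
def homogenize (w : ℂ) (k : ℤ) (G : Amb n → Y) (x : Amb n) : Y :=
  (1 / 2 : ℂ) • (rescale w k eucl G x + rescale w k (fun x => -eucl x) G x)

/-- A positive dilation preserves each of the two terms and a negative one interchanges them. The
average over opposite points is therefore needed for homogeneity under all nonzero dilations. -/
theorem homogenize_smul (G : Amb n → Y) {c : ℝ} (hc : c ≠ 0) (hx : x ≠ 0) :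
    homogenize w k G (c • x) = scale w k c • homogenize w k G x := by
  have h0 := (eucl_pos hx).ne'
  have key : ∀ d : ℝ, d ≠ 0 → scale w k (c * d) • G ((c * d)⁻¹ • c • x) =
      scale w k c • (scale w k d • G (d⁻¹ • x)) := fun d hd => by
    rw [scale_mul w k hc hd, smul_smul, smul_smul, mul_inv, mul_right_comm, inv_mul_cancel₀ hc,
      one_mul]
  have h1 := key _ h0
  have h2 := key _ (neg_ne_zero.2 h0)
  simp only [homogenize, rescale, eucl_smul]
  rw [smul_comm (scale w k c) (1 / 2 : ℂ), smul_add (scale w k c), ← h1, ← h2]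
  rcases abs_choice c with hc' | hc'
  · rw [hc', mul_neg]
  · rw [hc', add_comm, neg_mul, neg_neg, mul_neg]

theorem contDiffOn_homogenize (hO : IsConic O) (h0 : (0 : Amb n) ∉ O) {G : Amb n → Y}
    (hG : ContDiffOn ℝ ∞ G O) : ContDiffOn ℝ ∞ (homogenize w k G) O := by
  have hx0 : ∀ x ∈ O, x ≠ 0 := fun x hx h1 => h0 (h1 ▸ hx)
  have h1 : ContDiffOn ℝ ∞ (eucl (n := n)) O := fun x hx =>
    (contDiffAt_eucl (hx0 x hx)).contDiffWithinAt
  exact contDiffOn_const.smul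
    ((contDiffOn_rescale hO h1 (fun x hx => (eucl_pos (hx0 x hx)).ne') hG).add
      (contDiffOn_rescale hO h1.neg (fun x hx => neg_ne_zero.2 (eucl_pos (hx0 x hx)).ne') hG))

theorem vanishes_homogenize (hO : IsConic O) (h0 : (0 : Amb n) ∉ O) {G : Amb n → Y}
    (hG : ContDiffOn ℝ ∞ G O) (hx : x ∈ O)
    (hv : ∀ c : ℝ, c ≠ 0 → VanishesToInfiniteOrder G (c • x)) :
    VanishesToInfiniteOrder (homogenize w k G) x := by
  have hx0 : ∀ x ∈ O, x ≠ 0 := fun x hx h1 => h0 (h1 ▸ hx)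
  have h1 : ContDiffOn ℝ ∞ (eucl (n := n)) O := fun x hx =>
    (contDiffAt_eucl (hx0 x hx)).contDiffWithinAt
  have h2 : ∀ x ∈ O, eucl x ≠ 0 := fun x hx => (eucl_pos (hx0 x hx)).ne'
  have h3 : ∀ x ∈ O, -eucl x ≠ 0 := fun x hx => neg_ne_zero.2 (h2 x hx)
  have h4 := contDiffOn_rescale (w := w) (k := k) hO h1 h2 hG
  have h5 := contDiffOn_rescale (w := w) (k := k) hO h1.neg h3 hG
  refine VanishesToInfiniteOrder.smul (O := O) ?_ contDiffOn_const (h4.add h5) hx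
  exact (vanishes_rescale hO h1 h2 hG hx (hv _ (inv_ne_zero (h2 x hx)))).add
    (vanishes_rescale hO h1.neg h3 hG hx (hv _ (inv_ne_zero (h3 x hx))))
    (h4.contDiffAt (O.isOpen.mem_nhds hx)) (h5.contDiffAt (O.isOpen.mem_nhds hx))

theorem homogenize_of_homogeneous {G : Amb n → Y} (hx : x ≠ 0)
    (hG : ∀ c : ℝ, c ≠ 0 → G (c • x) = scale w k c • G x) : homogenize w k G x = G x := by
  have h0 := (eucl_pos hx).ne'
  have key : ∀ d : ℝ, d ≠ 0 → scale w k d • G (d⁻¹ • x) = G x := fun d hd => by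
    rw [hG _ (inv_ne_zero hd), smul_smul, ← scale_mul w k hd (inv_ne_zero hd),
      mul_inv_cancel₀ hd, scale_one, one_smul]
  simp only [homogenize, rescale]
  rw [key _ h0, key _ (neg_ne_zero.2 h0), ← two_smul ℂ, smul_smul]
  norm_num

theorem homogenize_sub (G G' : Amb n → Y) :
    homogenize w k (fun y => G y - G' y) x = homogenize w k G x - homogenize w k G' x := by
  simp only [homogenize, rescale, smul_sub, smul_add]
  abel

theorem homogenize_mem (S : Submodule ℂ Y) (hO : IsConic O) {G : Amb n → Y}
    (hG : ∀ x ∈ O, G x ∈ S) (hx : x ∈ O) (hx0 : x ≠ 0) : homogenize w k G x ∈ S := by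
  have h0 := (eucl_pos hx0).ne'
  exact S.smul_mem _ (S.add_mem (S.smul_mem _ (hG _ (hO x hx _ (inv_ne_zero h0))))
    (S.smul_mem _ (hG _ (hO x hx _ (inv_ne_zero (neg_ne_zero.2 h0))))))

end Homogenize

end Gluing

end

end AmbientLift

namespace AmbientLift

noncomputable section

/-! ### Gluing homogeneous tensor fields with equal jets along the cone. -/

section GluingFields

variable {n r s : ℕ} {h : Matrix (Fin n) (Fin n) ℝ} {w : ℂ} {ι : Type}

/-- The trace-free tensors with Young symmetry. -/
def traceFreeYoung (h : Matrix (Fin n) (Fin n) ℝ) (r s : ℕ) : Submodule ℂ (Tens r s (Amb n)) where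
  carrier := {T | IsYoung T ∧ ∀ a a' : Fin r ⊕ Fin s, a ≠ a' → ∀ v : Fin r ⊕ Fin s → Amb n,
    ambContract h (fun u u' => T (Function.update (Function.update v a u) a' u')) = 0}
  zero_mem' := ⟨IsYoung.zero r s, fun _ _ _ _ => ambContract_zero⟩
  add_mem' hT hT' := ⟨hT.1.add hT'.1, fun a a' haa v => by
    simp only [add_apply, ambContract_add, hT.2 a a' haa v, hT'.2 a a' haa v, add_zero]⟩
  smul_mem' c T hT := ⟨hT.1.smul c, fun a a' haa v => by
    simp only [smul_apply, ambContract_smul, hT.2 a a' haa v, smul_zero]⟩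

theorem AmbField.map_smul_eq {O : Opens (Amb n)} {F : Amb n → Tens r s (Amb n)}
    (hF : AmbField h w O F) {x : Amb n} (hx : x ∈ O) {c : ℝ} (hc : c ≠ 0) :
    F (c • x) = scale w (r + s) c • F x := by
  refine ContinuousMultilinearMap.ext fun v => ?_
  have h1 := hF.homogeneous c hc x hx v
  have hc' : ((|c| : ℝ) : ℂ) ^ w ≠ 0 := by
    rw [Complex.cpow_ne_zero_iff]
    exact Or.inl (by simpa using hc)
  refine mul_left_cancel₀ hc' ?_
  rw [← scale_mul_map_smul _ hc, h1, smul_apply, smul_eq_mul]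
  ring

variable {O : ι → Opens (Amb n)} {F : ι → Amb n → Tens r s (Amb n)}

/-- Homogeneous tensor fields which agree to infinite order along the null cone can be glued to
one tensor field with the same jets along the null cone. -/
theorem exists_glued (hO : ∀ i, IsConic (O i)) (h0 : ∀ i, (0 : Amb n) ∉ O i)
    (hF : ∀ i, AmbField h w (O i) (F i))
    (hFF : ∀ i j, ∀ x ∈ O i, x ∈ O j → ambForm h x x = 0 →
      VanishesToInfiniteOrder (fun y => F i y - F j y) x) :
    ∃ G : Amb n → Tens r s (Amb n), AmbField h w (⨆ i, O i) G ∧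
      ∀ i, ∀ x ∈ O i, ambForm h x x = 0 → VanishesToInfiniteOrder (fun y => G y - F i y) x := by
  classical
  set M : Opens (Amb n) := ⨆ i, O i with hM
  have hOM : ∀ i, O i ≤ M := fun i => le_iSup O i
  obtain ⟨χ, hχ, hpart⟩ := exists_partition O
  have hMc : IsConic M := fun x hx c hc => by
    obtain ⟨i, hi⟩ := Opens.mem_iSup.1 hx
    exact hOM i (hO i x hi c hc)
  have hM0 : (0 : Amb n) ∉ M := fun h1 => by
    obtain ⟨i, hi⟩ := Opens.mem_iSup.1 h1
    exact h0 i hi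
  -- The partition functions are not homogeneous. This sum has the right pointwise symmetry and the
  -- right jets along the cone, and homogeneity is restored afterwards.
  set G : Amb n → Tens r s (Amb n) := fun y => ∑ᶠ i, χ i y • F i y
  have hG : ∀ y (A : Finset ι), (∀ i, i ∉ A → χ i y = 0) → G y = ∑ i ∈ A, χ i y • F i y :=
    fun y A hA => finsum_eq_sum_of_support_subset _ fun i hi => by
      by_contra hc
      exact hi (by
        change χ i y • F i y = 0
        rw [hA i fun h1 => hc (Finset.mem_coe.2 h1)]
        exact zero_smul ℂ (F i y))
  have hχF : ∀ i, ContDiffOn ℝ ∞ (fun y => χ i y • F i y) (O i) := fun i =>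
    ((hχ i).mono (hOM i)).smul (hF i).smooth
  have hGs : ContDiffOn ℝ ∞ G M := fun x hx => by
    obtain ⟨A, hA, hev⟩ := hpart x hx
    have h1 : ContDiffAt ℝ ∞ (fun y => ∑ i ∈ A, χ i y • F i y) x := ContDiffAt.sum fun i hi =>
      (hχF i).contDiffAt ((O i).isOpen.mem_nhds (hA i hi))
    exact (h1.congr_of_eventuallyEq (hev.mono fun y hy => hG y A hy.1)).contDiffWithinAt
  have hGm : ∀ x ∈ M, G x ∈ traceFreeYoung h r s := fun x hx => by
    obtain ⟨A, hA, hev⟩ := hpart x hx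
    rw [hG x A hev.self_of_nhds.1]
    exact Submodule.sum_mem _ fun i hi => Submodule.smul_mem _ _
      ⟨(hF i).young x (hA i hi), (hF i).traceFree x (hA i hi)⟩
  have hGv : ∀ j, ∀ x ∈ O j, ambForm h x x = 0 →
      VanishesToInfiniteOrder (fun y => G y - F j y) x := fun j x hx hxx => by
    obtain ⟨A, hA, hev⟩ := hpart x (hOM j hx)
    have h1 : ∀ i ∈ A, VanishesToInfiniteOrder (fun y => χ i y • (F i y - F j y)) x ∧
        ContDiffAt ℝ ∞ (fun y => χ i y • (F i y - F j y)) x := fun i hi => by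
      have h2 : ContDiffOn ℝ ∞ (fun y => F i y - F j y) (O i ⊓ O j : Opens (Amb n)) :=
        ((hF i).smooth.mono inf_le_left).sub ((hF j).smooth.mono inf_le_right)
      have h3 : ContDiffOn ℝ ∞ (χ i) (O i ⊓ O j : Opens (Amb n)) :=
        (hχ i).mono (inf_le_left.trans (hOM i))
      have hx' : x ∈ O i ⊓ O j := ⟨hA i hi, hx⟩
      exact ⟨(hFF i j x (hA i hi) hx hxx).smul h3 h2 hx',
        (h3.smul h2).contDiffAt ((O i ⊓ O j).isOpen.mem_nhds hx')⟩
    refine (VanishesToInfiniteOrder.sum A (fun i hi => (h1 i hi).1)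
      (fun i hi => (h1 i hi).2)).congr (hev.mono fun y hy => ?_)
    simp only [Finset.sum_apply, smul_sub, Finset.sum_sub_distrib, ← Finset.sum_smul, hy.2,
      one_smul, hG y A hy.1]
  refine ⟨homogenize w (r + s) G, ⟨contDiffOn_homogenize hMc hM0 hGs, fun x hx => ?_,
    fun c hc x hx v => ?_, fun x hx => ?_⟩, fun j x hx hxx => ?_⟩
  · exact (homogenize_mem _ hMc hGm hx fun h1 => hM0 (h1 ▸ hx)).1
  · rw [homogenize_smul G hc (fun h1 => hM0 (h1 ▸ hx)), smul_apply, smul_eq_mul,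
      scale_mul_map_smul _ hc]
  · exact (homogenize_mem _ hMc hGm hx fun h1 => hM0 (h1 ▸ hx)).2
  · have h1 : ContDiffOn ℝ ∞ (fun y => G y - F j y) (O j) :=
      (hGs.mono (hOM j)).sub (hF j).smooth
    -- Homogenization is linear and fixes the homogeneous field `F j`. The new difference is thus
    -- the homogenization of the old one, and it stays flat because the cone is invariant under
    -- dilations.
    have h2 := vanishes_homogenize (w := w) (k := r + s) (hO j) (h0 j) h1 hx fun c hc =>
      hGv j _ (hO j x hx c hc) (by simp [hxx])
    refine h2.congr ?_
    filter_upwards [(O j).isOpen.mem_nhds hx] with y hy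
    rw [homogenize_sub, homogenize_of_homogeneous (G := F j) (fun h1 => h0 j (h1 ▸ hy))
      fun c hc => (hF j).map_smul_eq hy hc]

end GluingFields

end

end AmbientLift

namespace AmbientLift

noncomputable section

/-! ### Locality of ambient jets and global lifts -/

section Global

variable {n r s : ℕ} {h : Matrix (Fin n) (Fin n) ℝ} {w : ℂ} {O : Opens (Amb n)}
  {F G : Amb n → Tens r s (Amb n)} {U V : Opens (Quadric h)} {x : Amb n}

theorem vanishes_ambContract {Y : Type} [NormedAddCommGroup Y] [NormedSpace ℝ Y]
    {β : Amb n → Amb n → Amb n → Y} (hβ : ∀ u u', VanishesToInfiniteOrder (β u u') x)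
    (hβ' : ∀ u u', ContDiffAt ℝ ∞ (β u u') x) :
    VanishesToInfiniteOrder (fun y => ambContract h (fun u u' => β u u' y)) x := by
  have h1 : ∀ p : Idx n × Idx n, VanishesToInfiniteOrder
      (fun y => (ambMetric h)⁻¹ p.1 p.2 • β (e p.1) (e p.2) y) x := fun p =>
    (hβ (e p.1) (e p.2)).clm_comp (hβ' _ _) ((ambMetric h)⁻¹ p.1 p.2 • ContinuousLinearMap.id ℝ Y)
  refine (VanishesToInfiniteOrder.sum Finset.univ (fun p _ => h1 p)
    (fun p _ => (hβ' _ _).const_smul _)).congr (Filter.Eventually.of_forall fun y => ?_)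
  simp only [ambContract, Finset.sum_apply, Fintype.sum_prod_type]

theorem solves_of_vanishes (hF : ContDiffOn ℝ ∞ F O) (hUO : cone (U : Set (Quadric h)) ⊆ O)
    (hv : ∀ x ∈ cone (U : Set (Quadric h)), VanishesToInfiniteOrder F x) :
    SolvesToInfiniteOrder (U : Set (Quadric h)) F where
  laplacian x hx := by
    have hc := hF.contDiffAt (O.isOpen.mem_nhds (hUO hx))
    exact vanishes_ambContract (β := fun u u' y => fderiv ℝ (fun z => fderiv ℝ F z u') y u)
      (fun u u' => ((hv x hx).dir hc u').dir (contDiffAt_dir hc u') u)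
      (fun u u' => contDiffAt_dir (contDiffAt_dir hc u') u)
  divergence x hx a v := by
    have hc := hF.contDiffAt (O.isOpen.mem_nhds (hUO hx))
    refine VanishesToInfiniteOrder.neg (vanishes_ambContract
      (β := fun u u' y => fderiv ℝ F y u (Function.update v (Sum.inl a) u'))
      (fun u u' => ?_) fun u u' => contDiffAt_eval (contDiffAt_dir hc u) _)
    exact ((hv x hx).dir hc u).clm_comp (contDiffAt_dir hc u)
      (ContinuousMultilinearMap.apply ℝ (fun _ : Fin r ⊕ Fin s => Amb n) ℂ _)
  euler x hx a v := by
    have hc := hF.contDiffAt (O.isOpen.mem_nhds (hUO hx))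
    have h1 : ∀ I, VanishesToInfiniteOrder
        (fun y => coordFun I y • F y (Function.update v a (e I))) x := fun I =>
      VanishesToInfiniteOrder.smul (O := O) ((hv x hx).clm_comp hc
        (ContinuousMultilinearMap.apply ℝ (fun _ : Fin r ⊕ Fin s => Amb n) ℂ _))
        (contDiff_coordFun I).contDiffOn (contDiffOn_eval hF _) (hUO hx)
    refine (VanishesToInfiniteOrder.sum Finset.univ (fun I _ => h1 I) (fun I _ =>
      (contDiff_coordFun I).contDiffAt.smul (contDiffAt_eval hc _))).congr
      (Filter.Eventually.of_forall fun y => ?_)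
    rw [Finset.sum_apply]
    exact (sum_update (F y) a v y).symm.trans
      (Finset.sum_congr rfl fun I _ => Complex.real_smul)

theorem jetAt_eq_iff (hF : ContDiffAt ℝ ∞ F x) (hG : ContDiffAt ℝ ∞ G x) :
    jetAt F x = jetAt G x ↔ VanishesToInfiniteOrder (fun y => F y - G y) x := by
  have h1 : ∀ k : ℕ, iteratedFDeriv ℝ k (fun y => F y - G y) x =
      iteratedFDeriv ℝ k F x - iteratedFDeriv ℝ k G x := fun k =>
    iteratedFDeriv_sub_apply (hF.of_le (by exact_mod_cast le_top))
      (hG.of_le (by exact_mod_cast le_top))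
  refine ⟨fun h2 k => ?_, fun h2 => Jet.ext fun k => ?_⟩
  · rw [h1, sub_eq_zero]
    exact congrFun h2 k
  · have := h2 k
    rw [h1, sub_eq_zero] at this
    exact this

theorem IsConic.exists_quad (hO : IsConic O) (h0 : (0 : Amb n) ∉ O) :
    ∃ V : Opens (Quadric h), ∀ x, x ∈ cone (V : Set (Quadric h)) ↔ x ∈ O ∧ ambForm h x x = 0 := by
  obtain ⟨W, hW, hWO⟩ := hO.exists_ambCone h0
  refine ⟨⟨(fun p : Quadric h => p.1) ⁻¹' W, hW.preimage continuous_subtype_val⟩, fun x => ?_⟩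
  constructor
  · intro hx
    refine ⟨?_, form_self_of_mem_cone hx⟩
    obtain ⟨p, hp, hx0, hxp⟩ := hx
    change x ∈ (O : Set (Amb n))
    rw [← hWO]
    exact ⟨hx0, hxp ▸ hp⟩
  · rintro ⟨hx, hxx⟩
    change x ∈ (O : Set (Amb n)) at hx
    rw [← hWO] at hx
    obtain ⟨hx0, hxW⟩ := hx
    refine ⟨⟨Projectivization.mk ℝ x hx0, fun z hz => ?_⟩, hxW, hx0, rfl⟩
    rw [Projectivization.submodule_mk, Submodule.mem_span_singleton] at hz
    obtain ⟨a, rfl⟩ := hz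
    simp [hxx]

theorem le_of_cone_subset (hVU : cone (V : Set (Quadric h)) ⊆ cone (U : Set (Quadric h))) :
    V ≤ U := by
  rintro ⟨p, hp⟩ hpV
  induction p using Projectivization.ind with
  | h x hx =>
    obtain ⟨p', hp', _, hxp⟩ := hVU (a := x) ⟨_, hpV, hx, rfl⟩
    have : (⟨Projectivization.mk ℝ x hx, hp⟩ : Quadric h) = p' := Subtype.ext hxp
    exact this ▸ hp'

theorem mem_cone_inf (hx : x ∈ cone (U : Set (Quadric h))) (hx' : x ∈ cone (V : Set (Quadric h))) :
    x ∈ cone ((U ⊓ V : Opens (Quadric h)) : Set (Quadric h)) := by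
  obtain ⟨p, hp, hx0, hxp⟩ := hx
  obtain ⟨p', hp', _, hxp'⟩ := hx'
  have : p = p' := Subtype.ext (hxp.symm.trans hxp')
  exact ⟨p, ⟨hp, this ▸ hp'⟩, hx0, hxp⟩

theorem IsAmbJet.ext_restrict (hs : h.IsSymm) (hdet : IsUnit h.det) (hA : Admissible n r s w)
    {J K : cone (U : Set (Quadric h)) → Jet r s n} (hJ : IsAmbJet r s w (U : Set (Quadric h)) J)
    (hK : IsAmbJet r s w (U : Set (Quadric h)) K)
    (hJK : ∀ x, (J x).restrict (h := h) (x : Amb n) = (K x).restrict (h := h) (x : Amb n)) :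
    J = K := by
  have h1 : J + (-1 : ℂ) • K = 0 := IsAmbJet.eq_zero hs hdet hA (hJ.add (hK.smul (-1))) fun x => by
    refine ContinuousMultilinearMap.ext fun v => ?_
    have h2 := congrArg (fun T => T v) (hJK x)
    change (J x).coeff 0 0 _ + (-1 : ℂ) • (K x).coeff 0 0 _ = 0
    change (J x).coeff 0 0 _ = (K x).coeff 0 0 _ at h2
    rw [neg_one_smul, h2, add_neg_cancel]
  rwa [neg_one_smul, ← sub_eq_add_neg, sub_eq_zero] at h1

/-- Being the jet of a solution is a local property. -/
theorem isAmbJet_of_local {J : cone (U : Set (Quadric h)) → Jet r s n}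
    (hJ : ∀ x : cone (U : Set (Quadric h)), ∃ (V : Opens (Quadric h)) (hVU : V ≤ U),
      (x : Amb n) ∈ cone (V : Set (Quadric h)) ∧
      IsAmbJet r s w (V : Set (Quadric h)) (fun y => J ⟨y, cone_mono hVU y.2⟩)) :
    IsAmbJet r s w (U : Set (Quadric h)) J := by
  choose V hVU hxV hJV using hJ
  choose O hO h0 hVO F hF hS hJF using fun x => isAmbJet_iff.1 (hJV x)
  have hJF' : ∀ i, ∀ x ∈ O i, ∀ hxx : ambForm h x x = 0, ∀ hxU, J ⟨x, hxU⟩ = jetAt (F i) x :=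
    fun i x hx hxx hxU => hJF i ⟨x, (hVO i x).2 ⟨hx, hxx⟩⟩
  have hU : ∀ i, ∀ x ∈ O i, ambForm h x x = 0 → x ∈ cone (U : Set (Quadric h)) :=
    fun i x hx hxx => cone_mono (hVU i) ((hVO i x).2 ⟨hx, hxx⟩)
  -- Representatives of the same jet may differ off the cone; on overlaps their difference is flat,
  -- which is what the gluing requires.
  obtain ⟨G, hG, hGF⟩ := exists_glued hO h0 hF fun i j x hi hj hxx =>
    (jetAt_eq_iff ((hF i).contDiffAt hi) ((hF j).contDiffAt hj)).1
      ((hJF' i x hi hxx (hU i x hi hxx)).symm.trans (hJF' j x hj hxx (hU i x hi hxx)))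
  have hOM : ∀ i, O i ≤ ⨆ i, O i := fun i => le_iSup O i
  -- Near each piece G is the local solution plus a field flat along the cone, and a flat field
  -- satisfies the equations to infinite order.
  have hGS : ∀ i, SolvesToInfiniteOrder (V i : Set (Quadric h)) G := fun i => by
    have hsub : cone (V i : Set (Quadric h)) ⊆ O i := fun x hx => ((hVO i x).1 hx).1
    have hd : ContDiffOn ℝ ∞ (fun y => G y - F i y) (O i) :=
      (hG.smooth.mono (hOM i)).sub (hF i).smooth
    have h1 : SolvesToInfiniteOrder (V i : Set (Quadric h)) (F i + fun y => G y - F i y) :=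
      SolvesToInfiniteOrder.add
        ⟨fun x hx => (hS i).laplacian x (hsub hx) (form_self_of_mem_cone hx),
          fun x hx => (hS i).divergence x (hsub hx) (form_self_of_mem_cone hx),
          fun x hx => (hS i).euler x (hsub hx) (form_self_of_mem_cone hx)⟩
        (solves_of_vanishes hd hsub fun x hx => hGF i x (hsub hx) (form_self_of_mem_cone hx))
        (fun x hx => (hF i).contDiffAt (hsub hx))
        (fun x hx => hd.contDiffAt ((O i).isOpen.mem_nhds (hsub hx)))
    have h2 : (F i + fun y => G y - F i y) = G := funext fun y => add_sub_cancel _ _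
    rwa [h2] at h1
  refine isAmbJet_iff.2 ⟨⨆ i, O i, fun x hx c hc => ?_, fun h1 => ?_, fun x => ⟨fun hx =>
    ⟨hOM ⟨x, hx⟩ ((hVO _ x).1 (hxV ⟨x, hx⟩)).1, form_self_of_mem_cone hx⟩, fun hx => ?_⟩, G, hG,
    ⟨fun x hx hxx => ?_, fun x hx hxx => ?_, fun x hx hxx => ?_⟩, fun x => ?_⟩
  · obtain ⟨i, hi⟩ := Opens.mem_iSup.1 hx
    exact hOM i (hO i x hi c hc)
  · obtain ⟨i, hi⟩ := Opens.mem_iSup.1 h1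
    exact h0 i hi
  · obtain ⟨i, hi⟩ := Opens.mem_iSup.1 hx.1
    exact hU i x hi hx.2
  · obtain ⟨i, hi⟩ := Opens.mem_iSup.1 hx
    exact (hGS i).laplacian x ((hVO i x).2 ⟨hi, hxx⟩)
  · obtain ⟨i, hi⟩ := Opens.mem_iSup.1 hx
    exact (hGS i).divergence x ((hVO i x).2 ⟨hi, hxx⟩)
  · obtain ⟨i, hi⟩ := Opens.mem_iSup.1 hx
    exact (hGS i).euler x ((hVO i x).2 ⟨hi, hxx⟩)
  · have hx := (hVO x x).1 (hxV x)
    rw [hJF' x x hx.1 hx.2 x.2]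
    exact ((jetAt_eq_iff (hG.contDiffAt (hOM x hx.1)) ((hF x).contDiffAt hx.1)).2
      (hGF x x hx.1 hx.2)).symm

variable {f : (x : cone (U : Set (Quadric h))) → Tens r s (tan h (x : Amb n))}

/-- Around a null vector p, a null q with ⟨q, p⟩ = 1 provides both the transversal extension of f
and the invertible linear form of the algebraic solution. The solution lives on a conic
neighbourhood of p, whose null lines form the required open set. -/
theorem IsQuadSection.exists_local_lift (hf : IsQuadSection r s w (U : Set (Quadric h)) f)
    (hs : h.IsSymm) (hdet : IsUnit h.det) (hA : Admissible n r s w)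
    (p : cone (U : Set (Quadric h))) :
    ∃ (V : Opens (Quadric h)) (hVU : V ≤ U), (p : Amb n) ∈ cone (V : Set (Quadric h)) ∧
      ∃ K : cone (V : Set (Quadric h)) → Jet r s n, IsAmbJet r s w (V : Set (Quadric h)) K ∧
        ∀ x, (K x).restrict (h := h) (x : Amb n) = f ⟨x, cone_mono hVU x.2⟩ := by
  obtain ⟨p, hp⟩ := p
  have hpp := form_self_of_mem_cone hp
  have hp0 : p ≠ 0 := by
    obtain ⟨_, _, h1, _⟩ := hp
    exact h1
  obtain ⟨q, hqq, hqp⟩ := exists_null_dual hs hdet hp0 hpp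
  obtain ⟨fr⟩ := nonempty_frame hs hdet
  obtain ⟨O, hO, hpO, hq, hOU, F₀, hF₀, hE, hFf⟩ :=
    hf.exists_ambField hs hdet hqq hp (by rw [hqp]; exact one_ne_zero)
  obtain ⟨O', hO'O, hO', hpO', F, hF, hS, hFF₀⟩ :=
    hF₀.exists_solution hs fr hA hO hqq hq hE hpO
  have h0 : (0 : Amb n) ∉ O' := fun h1 => hq 0 (hO'O h1) (map_zero _)
  obtain ⟨V, hV⟩ := hO'.exists_quad (h := h) h0
  have hVU : V ≤ U := le_of_cone_subset fun x hx =>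
    hOU x (hO'O ((hV x).1 hx).1) ((hV x).1 hx).2
  refine ⟨V, hVU, (hV p).2 ⟨hpO', hpp⟩, fun x => jetAt F x,
    isAmbJet_iff.2 ⟨O', hO', h0, hV, F, hF, hS, fun _ => rfl⟩, fun x => ?_⟩
  have hx := (hV x).1 x.2
  refine ContinuousMultilinearMap.ext fun v => ?_
  rw [jetAt_restrict_apply, hFF₀ x hx.1 hx.2 _ (fun i => (v i).2),
    hFf x (hO'O hx.1) (cone_mono hVU x.2)]

/-- Every section over the quadric lifts to the jet of a solution of the ambient equations. -/
theorem IsQuadSection.exists_lift (hf : IsQuadSection r s w (U : Set (Quadric h)) f)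
    (hs : h.IsSymm) (hdet : IsUnit h.det) (hA : Admissible n r s w) :
    ∃ J : cone (U : Set (Quadric h)) → Jet r s n, IsAmbJet r s w (U : Set (Quadric h)) J ∧
      ∀ x, (J x).restrict (h := h) (x : Amb n) = f x := by
  choose V hVU hxV K hK hKf using hf.exists_local_lift hs hdet hA
  -- Local lifts need no choice on overlaps: both restrict to f, so uniqueness identifies their
  -- jets.
  have hKK : ∀ i j x (hi : x ∈ cone (V i : Set (Quadric h)))
      (hj : x ∈ cone (V j : Set (Quadric h))), K i ⟨x, hi⟩ = K j ⟨x, hj⟩ := fun i j x hi hj => by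
    have h1 : V i ⊓ V j ≤ V i := inf_le_left
    have h2 : V i ⊓ V j ≤ V j := inf_le_right
    have h3 := mem_cone_inf hi hj
    exact congrFun (IsAmbJet.ext_restrict hs hdet hA ((hK i).restrict h1) ((hK j).restrict h2)
      fun y => (hKf i ⟨y, cone_mono h1 y.2⟩).trans
        (hKf j ⟨y, cone_mono h2 y.2⟩).symm) ⟨x, h3⟩
  refine ⟨fun x => K x ⟨x, hxV x⟩, isAmbJet_of_local fun i => ⟨V i, hVU i, hxV i, ?_⟩,
    fun x => hKf x _⟩
  convert hK i using 1
  exact funext fun y => hKK _ _ _ _ _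

end Global

end

end AmbientLift

namespace AmbientLift

noncomputable section

/-! ### The sheaf property and the isomorphism -/

section Sheaves

variable {n r s : ℕ} {h : Matrix (Fin n) (Fin n) ℝ} {w : ℂ}

theorem isQuadSection_of_local {U : Opens (Quadric h)}
    {f : (x : cone (U : Set (Quadric h))) → Tens r s (tan h (x : Amb n))}
    (hf : ∀ x : cone (U : Set (Quadric h)), ∃ (V : Opens (Quadric h)) (hVU : V ≤ U),
      (x : Amb n) ∈ cone (V : Set (Quadric h)) ∧
      IsQuadSection r s w (V : Set (Quadric h)) (fun y => f ⟨y, cone_mono hVU y.2⟩)) :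
    IsQuadSection r s w (U : Set (Quadric h)) f where
  smooth x := by
    obtain ⟨V, hVU, hx, hV⟩ := hf x
    obtain ⟨W, F, hW, hxW, hF, hfF⟩ := hV.smooth ⟨x, hx⟩
    obtain ⟨W', hW', -, hVW'⟩ := Opens.exists_ambCone V
    exact ⟨W ∩ ambCone W', F, hW.inter (isOpen_ambCone hW'), ⟨hxW, ((hVW' _).1 hx).1⟩,
      hF.mono Set.inter_subset_left, fun y hy =>
        hfF ⟨y, (hVW' _).2 ⟨hy.2, form_self_of_mem_cone y.2⟩⟩ hy.1⟩
  young x := by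
    obtain ⟨V, hVU, hx, hV⟩ := hf x
    exact hV.young ⟨x, hx⟩
  homogeneous c hc x v := by
    obtain ⟨V, hVU, hx, hV⟩ := hf x
    exact hV.homogeneous c hc ⟨x, hx⟩ v
  horizontal x := by
    obtain ⟨V, hVU, hx, hV⟩ := hf x
    exact hV.horizontal ⟨x, hx⟩
  traceFree x := by
    obtain ⟨V, hVU, hx, hV⟩ := hf x
    exact hV.traceFree ⟨x, hx⟩

theorem mem_cone_iSup {ι : Type} {U : ι → Opens (Quadric h)} {x : Amb n}
    (hx : x ∈ cone ((⨆ i, U i : Opens (Quadric h)) : Set (Quadric h))) :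
    ∃ i, x ∈ cone (U i : Set (Quadric h)) := by
  obtain ⟨p, hp, hx⟩ := hx
  obtain ⟨i, hi⟩ := Opens.mem_iSup.1 hp
  exact ⟨i, p, hi, hx⟩

theorem exists_glued_values {E : Amb n → Type} {ι : Type} {U : ι → Opens (Quadric h)}
    (σ : ∀ i, (x : cone (U i : Set (Quadric h))) → E x)
    (hσ : ∀ i j x (hi : x ∈ cone (U i : Set (Quadric h))) (hj : x ∈ cone (U j : Set (Quadric h))),
      σ i ⟨x, hi⟩ = σ j ⟨x, hj⟩) :
    ∃ τ : (x : cone ((⨆ i, U i : Opens (Quadric h)) : Set (Quadric h))) → E x,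
      ∀ i x (hi : x ∈ cone (U i : Set (Quadric h))) hx, τ ⟨x, hx⟩ = σ i ⟨x, hi⟩ :=
  ⟨fun x => σ _ ⟨x, (mem_cone_iSup x.2).choose_spec⟩, fun _ _ _ _ => hσ _ _ _ _ _⟩

theorem exists_glued_quadSections {ι : Type} {U : ι → Opens (Quadric h)} (σ : ∀ i, quadSections r s w (h := h) (U i))
    (hσ : ∀ i j x (hi : x ∈ cone (U i : Set (Quadric h))) (hj : x ∈ cone (U j : Set (Quadric h))),
      (σ i).1 ⟨x, hi⟩ = (σ j).1 ⟨x, hj⟩) :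
    ∃ τ : quadSections r s w (h := h) (⨆ i, U i),
      ∀ i x (hi : x ∈ cone (U i : Set (Quadric h))) hx, τ.1 ⟨x, hx⟩ = (σ i).1 ⟨x, hi⟩ := by
  obtain ⟨τ, hτ⟩ := exists_glued_values (E := fun x => Tens r s (tan h x)) (fun i => (σ i).1) hσ
  refine ⟨⟨τ, isQuadSection_of_local fun x => ?_⟩, hτ⟩
  obtain ⟨i, hi⟩ := mem_cone_iSup x.2
  refine ⟨U i, le_iSup U i, hi, ?_⟩
  have h1 := (σ i).2
  have h2 : (σ i).1 = fun y : cone (U i : Set (Quadric h)) => τ ⟨y, cone_mono (le_iSup U i) y.2⟩ :=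
    funext fun y : cone (U i : Set (Quadric h)) => (hτ i y y.2 _).symm
  rwa [h2] at h1

theorem quadPresheaf_isSheaf : (quadPresheaf h r s w).IsSheaf := by
  rw [TopCat.Presheaf.isSheaf_iff_isSheafUniqueGluing]
  intro ι U σ hσ
  obtain ⟨τ, hτ⟩ := exists_glued_quadSections (h := h) (U := U) σ fun i j x hi hj =>
    congrArg (fun t : quadSections r s w (h := h) (U i ⊓ U j) => t.1 ⟨x, mem_cone_inf hi hj⟩) (hσ i j)
  refine ⟨τ, fun i => Subtype.ext (funext fun y : cone (U i : Set (Quadric h)) =>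
    hτ i y y.2 _), fun t ht => Subtype.ext (funext fun x => ?_)⟩
  obtain ⟨i, hi⟩ := mem_cone_iSup x.2
  exact (congrArg (fun t : quadSections r s w (h := h) (U i) => t.1 ⟨x, hi⟩) (ht i)).trans
    (hτ i x hi x.2).symm

theorem exists_glued_ambJets {ι : Type} {U : ι → Opens (Quadric h)} (σ : ∀ i, ambJets r s w (h := h) (U i))
    (hσ : ∀ i j x (hi : x ∈ cone (U i : Set (Quadric h))) (hj : x ∈ cone (U j : Set (Quadric h))),
      (σ i).1 ⟨x, hi⟩ = (σ j).1 ⟨x, hj⟩) :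
    ∃ τ : ambJets r s w (h := h) (⨆ i, U i),
      ∀ i x (hi : x ∈ cone (U i : Set (Quadric h))) hx, τ.1 ⟨x, hx⟩ = (σ i).1 ⟨x, hi⟩ := by
  obtain ⟨τ, hτ⟩ := exists_glued_values (E := fun _ => Jet r s n) (fun i => (σ i).1) hσ
  refine ⟨⟨τ, isAmbJet_of_local fun x => ?_⟩, hτ⟩
  obtain ⟨i, hi⟩ := mem_cone_iSup x.2
  refine ⟨U i, le_iSup U i, hi, ?_⟩
  have h1 := (σ i).2
  have h2 : (σ i).1 = fun y : cone (U i : Set (Quadric h)) => τ ⟨y, cone_mono (le_iSup U i) y.2⟩ :=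
    funext fun y : cone (U i : Set (Quadric h)) => (hτ i y y.2 _).symm
  rwa [h2] at h1

theorem ambPresheaf_isSheaf : (ambPresheaf h r s w).IsSheaf := by
  rw [TopCat.Presheaf.isSheaf_iff_isSheafUniqueGluing]
  intro ι U σ hσ
  obtain ⟨τ, hτ⟩ := exists_glued_ambJets (h := h) (U := U) σ fun i j x hi hj =>
    congrArg (fun t : ambJets r s w (h := h) (U i ⊓ U j) => t.1 ⟨x, mem_cone_inf hi hj⟩) (hσ i j)
  refine ⟨τ, fun i => Subtype.ext (funext fun y : cone (U i : Set (Quadric h)) =>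
    hτ i y y.2 _), fun t ht => Subtype.ext (funext fun x => ?_)⟩
  obtain ⟨i, hi⟩ := mem_cone_iSup x.2
  exact (congrArg (fun t : ambJets r s w (h := h) (U i) => t.1 ⟨x, hi⟩) (ht i)).trans
    (hτ i x hi x.2).symm

/-- The restriction of jets to the null cone. -/
def restrictJets (hs : h.IsSymm) (hdet : IsUnit h.det) (U : Opens (Quadric h)) :
    ambJets r s w (h := h) U →ₗ[ℂ] quadSections r s w (h := h) U where
  toFun J := ⟨fun x => (J.1 x).restrict (h := h) (x : Amb n), J.2.isQuadSection hs hdet⟩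
  map_add' _ _ := rfl
  map_smul' _ _ := rfl

theorem restrictJets_bijective (hs : h.IsSymm) (hdet : IsUnit h.det) (hA : Admissible n r s w)
    (U : Opens (Quadric h)) :
    Function.Bijective (restrictJets (r := r) (s := s) (w := w) hs hdet U) := by
  refine ⟨fun J K hJK => Subtype.ext (J.2.ext_restrict hs hdet hA K.2 fun x => ?_), fun f => ?_⟩
  · exact congrArg (fun t : quadSections r s w (h := h) U => t.1 x) hJK
  · obtain ⟨J, hJ, hJf⟩ := f.2.exists_lift hs hdet hA
    exact ⟨⟨J, hJ⟩, Subtype.ext (funext hJf)⟩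

/-- The restriction of jets to the null cone as an isomorphism of presheaves. -/
def restrictIso (hs : h.IsSymm) (hdet : IsUnit h.det) (hA : Admissible n r s w) :
    ambPresheaf h r s w ≅ quadPresheaf h r s w :=
  NatIso.ofComponents (fun U => LinearEquiv.toModuleIso
    (LinearEquiv.ofBijective (restrictJets hs hdet U.unop)
      (restrictJets_bijective hs hdet hA U.unop))) fun _ => rfl

theorem restrictIso_isRestriction (hs : h.IsSymm) (hdet : IsUnit h.det)
    (hA : Admissible n r s w) : IsRestriction (restrictIso hs hdet hA).hom :=
  fun _ _ _ => rfl

theorem restrictIso_isEquivariant (hs : h.IsSymm) (hdet : IsUnit h.det)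
    (hA : Admissible n r s w) : IsEquivariant (restrictIso hs hdet hA).hom := by
  intro A U J
  refine Subtype.ext (funext fun x => ContinuousMultilinearMap.ext fun v => ?_)
  set K := (J.1 ⟨_, act_mem_cone A x.2⟩).coeff 0
  -- The coefficient of order zero takes an empty tuple of directions, so transforming this tuple by
  -- A has no effect and only the tensor arguments are pulled back.
  have h0 : (fun i => (A : Amb n ≃L[ℝ] Amb n) ((0 : Fin 0 → Amb n) i)) = 0 := Subsingleton.elim _ _
  exact congrArg (fun t => K t (fun i => (A : Amb n ≃L[ℝ] Amb n) (v i))) h0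

end Sheaves

end

end AmbientLift

theorem theorem2p1 (n r s : ℕ) (w : ℂ) (h : Matrix (Fin n) (Fin n) ℝ)
    (hsymm : h.IsSymm) (hdet : IsUnit h.det)
    (hn : 3 ≤ n) (hsr : s ≤ r) (hrn : r ≤ n)
    (hw₁ : 0 < r → s = 0 → w ≠ 2 * (r : ℂ) - n)
    (hw₂ : 0 < s → w ≠ (r : ℂ) + 2 * s - n - 1 ∧ w ≠ 2 * (r : ℂ) + s - n)
    (hw₃ : ∀ k : ℕ, 1 ≤ k → w + (n : ℂ) / 2 - r - s ≠ k) :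
    (AmbientLift.quadPresheaf h r s w).IsSheaf ∧
    (AmbientLift.ambPresheaf h r s w).IsSheaf ∧
    ∃ Φ : AmbientLift.ambPresheaf h r s w ≅ AmbientLift.quadPresheaf h r s w,
      AmbientLift.IsRestriction Φ.hom ∧ AmbientLift.IsEquivariant Φ.hom := by
  exact ⟨AmbientLift.quadPresheaf_isSheaf, AmbientLift.ambPresheaf_isSheaf,
    AmbientLift.restrictIso hsymm hdet ⟨hsr, hw₁, hw₂, hw₃⟩,
    AmbientLift.restrictIso_isRestriction hsymm hdet _,
    AmbientLift.restrictIso_isEquivariant hsymm hdet _⟩
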